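/- **Problem.** Maintain an $n\times n$ Boolean matrix $X$ ($n\ge 1$), initially $0$, equivalently a directed graph on $\{1,\dots,n\}$ with adjacency matrix $X$, under an arbitrary sequence of the operations - $\mathrm{Init}^*(Y)$: $X\leftarrow Y$; - $\mathrm{Set}^*(i,\Delta)$ ($i$-centered insertion): set to $1$ every entry of the $i$-th row and of the $i$-th column of $X$ at which the Boolean matrix $\Delta$ is $1$; - $\mathrm{Reset}^*(\Delta)$ (deletion), where $\Delta\subseteq X$ is given by the list of the positions of its ones: set these entries of $X$ to $0$; - $\mathrm{Lookup}^*(x,y)$: return $X^*[x,y]$, where $X^*$ is the Kleene closure of $X$; that is, return $1$ if there is a directed path (possibly of length $0$) from $x$ to $y$, and $0$ otherwise. The model is a deterministic unit-cost RAM with zero-initialized memory; on a sequence of $k$ operations its words have $O(\log(n+k))$ bits. Space is measured in words, not counting the (read-only) arguments of the current operation. **Theorem.** Let $\omega$ be a real number such that the product, over the integers, of two $n\times n$ Boolean matrices can be computed on this RAM in $O(n^\omega)$ time and $O(n^2)$ space with words of $O(\log n)$ bits. Then there is a deterministic data structure (a fixed program for each of the four operations, the same for all $n$) that answers every $\mathrm{Lookup}^*$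 correctly, uses $O(n^2)$ space, and has the following time bounds on every sequence of operations: 1. every $\mathrm{Init}^*$ takes $O(n^\omega)$ time in the worst case; 2. every $\mathrm{Lookup}^*$ takes $O(1)$ time in the worst case; 3. the cost of every $\mathrm{Reset}^*$ with $\Delta\ne 0$ can be charged entirely to earlier $\mathrm{Init}^*$ and $\mathrm{Set}^*$ operations (a $\mathrm{Reset}^*$ with $\Delta=0$ takes $O(1)$ time beyond such charges), in such a way that the total charged to each $\mathrm{Init}^*$ is $O(n^3)$ and 4. $\mathrm{Set}^*$ takes $O(n^2)$ amortized time, charges included: the total cost of all $\mathrm{Set}^*$ operations of the sequence, plus everything charged to them, is $O(n^2)$ times their number. The constants depend only on $\omega$ and the multiplication algorithm. Consequently, if the first operation of the sequence is an $\mathrm{Init}^*$, there is no other $\mathrm{Init}^*$, and the sequence contains $u\ge\kappa n$ updates ($\mathrm{Set}^*$ and $\mathrm{Reset}^*$ operations) for a constant $\kappa>0$, then the total time of these updates is $O\big((1+1/\kappa)\,n^2u\big)$, that is, $O(n^2)$ amortized per update, with $O(1)$ time per query, on general directed graphs. -/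

import Mathlib

namespace DynClosure

/-! ## The machine: a deterministic word RAM, programmed in a structured language -/

/-- Arithmetic instructions; `sub` is truncated, `div` rounds down and `x div 0 = 0`. -/
inductive ArithOp
  | add | sub | mul | div

def ArithOp.eval : ArithOp → ℕ → ℕ → ℕ
  | .add, x, y => x + y
  | .sub, x, y => x - y
  | .mul, x, y => x * y
  | .div, x, y => x / y

/-- Programs. Registers are named by natural numbers (a program mentions finitely many of them).
* `const r c`:      `reg r ← c`
* `arith op r a b`: `reg r ← op (reg a) (reg b)`
* `input r a`:      `reg r ← inp[reg a]`, where `inp` is the read-only argument array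
* `load r a`:       `reg r ← mem[reg a]`
* `store a b`:      `mem[reg a] ← reg b`
* `seq`, `ite` (test `reg r ≠ 0`) and `loop` (while `reg r ≠ 0`). -/
inductive Cmd
  | const (r c : ℕ)
  | arith (op : ArithOp) (r a b : ℕ)
  | input (r a : ℕ)
  | load (r a : ℕ)
  | store (a b : ℕ)
  | seq (c₁ c₂ : Cmd)
  | ite (r : ℕ) (c₁ c₂ : Cmd)
  | loop (r : ℕ) (c : Cmd)

structure State where
  reg : ℕ → ℕ
  mem : ℕ → ℕ

/-- All registers and all memory cells hold zero. -/
def State.zero : State := ⟨fun _ => 0, fun _ => 0⟩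

def State.setReg (s : State) (r v : ℕ) : State := ⟨Function.update s.reg r v, s.mem⟩

def State.setMem (s : State) (a v : ℕ) : State := ⟨s.reg, Function.update s.mem a v⟩

/-- `Exec W S inp c s s' t`: on the argument array `inp`, the program `c` takes the state `s` to
the state `s'` and halts after exactly `t` unit-cost steps, while every value it writes into a
register or a cell is smaller than `W` (the word size is `log₂ W` bits) and every memory address
it uses is smaller than `S` (the memory has `S` cells). A program that tries to exceed
these limits gets stuck. -/
inductive Exec (W S : ℕ) (inp : ℕ → ℕ) : Cmd → State → State → ℕ → Prop
  | const {r c s} : c < W → Exec W S inp (.const r c) s (s.setReg r c) 1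
  | arith {op r a b s} : op.eval (s.reg a) (s.reg b) < W →
      Exec W S inp (.arith op r a b) s (s.setReg r (op.eval (s.reg a) (s.reg b))) 1
  | input {r a s} : inp (s.reg a) < W →
      Exec W S inp (.input r a) s (s.setReg r (inp (s.reg a))) 1
  | load {r a s} : s.reg a < S →
      Exec W S inp (.load r a) s (s.setReg r (s.mem (s.reg a))) 1
  | store {a b s} : s.reg a < S →
      Exec W S inp (.store a b) s (s.setMem (s.reg a) (s.reg b)) 1
  | seq {c₁ c₂ s s₁ s₂ t₁ t₂} : Exec W S inp c₁ s s₁ t₁ → Exec W S inp c₂ s₁ s₂ t₂ →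
      Exec W S inp (.seq c₁ c₂) s s₂ (t₁ + t₂)
  | iteTrue {r c₁ c₂ s s' t} : s.reg r ≠ 0 → Exec W S inp c₁ s s' t →
      Exec W S inp (.ite r c₁ c₂) s s' (t + 1)
  | iteFalse {r c₁ c₂ s s' t} : s.reg r = 0 → Exec W S inp c₂ s s' t →
      Exec W S inp (.ite r c₁ c₂) s s' (t + 1)
  | loopDone {r c s} : s.reg r = 0 → Exec W S inp (.loop r c) s s 1
  | loopStep {r c s s₁ s₂ t₁ t₂} : s.reg r ≠ 0 → Exec W S inp c s s₁ t₁ →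
      Exec W S inp (.loop r c) s₁ s₂ t₂ → Exec W S inp (.loop r c) s s₂ (t₁ + t₂ + 1)

/-! ## Boolean matrices and the exponent of matrix multiplication -/

abbrev BoolMat (n : ℕ) := Matrix (Fin n) (Fin n) Bool

/-- `X*[x,y] = 1`: in the digraph with adjacency matrix `X` there is a directed path, possibly of
length `0`, from `x` to `y`. -/
def KleeneClosure {n : ℕ} (X : BoolMat n) (x y : Fin n) : Prop :=
  Relation.ReflTransGen (fun u v => X u v = true) x y

/-- The argument array that holds the list `l` (and zeros after it). -/
def arr (l : List ℕ) : ℕ → ℕ := fun k => l.getD k 0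

/-- The entries of a matrix in row-major order. -/
def entries {n : ℕ} (X : BoolMat n) : List ℕ :=
  List.ofFn fun p : Fin (n * n) => (X p.divNat p.modNat).toNat

/-- The product of two Boolean matrices can be computed in the ring of integers (so entry `(x,y)`
of the result is the number of `z` with `A[x,z] = B[z,y] = 1`) by a fixed deterministic RAM
program in `O(n^ω)` time, with words of `O(log n)` bits and `O(n²)` cells of memory. -/
def MatMulExponent (ω : ℝ) : Prop :=
  ∃ (c : Cmd) (C d : ℕ), ∀ n : ℕ, 1 ≤ n → ∀ A B : BoolMat n, ∃ (s : State) (t : ℕ),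
    Exec ((n + 2) ^ d) (C * n ^ 2) (arr (n :: (entries A ++ entries B))) c State.zero s t ∧
    (t : ℝ) ≤ C * (n : ℝ) ^ ω ∧
    ∀ x y : Fin n, s.mem (x * n + y) = ∑ z : Fin n, (A x z).toNat * (B z y).toNat

/-! ## The fully dynamic Boolean matrix closure problem -/

/-- The operations `Init*`, `Set*`, `Reset*` and `Lookup*` on an `n × n` Boolean matrix. The update
matrix of a `Reset*` is given by the list of the positions of its ones. -/
inductive Op (n : ℕ)
  | init (Y : BoolMat n)
  | set (i : Fin n) (Δ : BoolMat n)
  | reset (D : List (Fin n × Fin n))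
  | lookup (x y : Fin n)

variable {n : ℕ}

def Op.IsInit : Op n → Prop
  | .init _ => True
  | _ => False

def Op.IsSet : Op n → Prop
  | .set _ _ => True
  | _ => False

def Op.IsReset : Op n → Prop
  | .reset _ => True
  | _ => False

/-- The effect of an operation on the matrix. -/
def Op.apply (X : BoolMat n) : Op n → BoolMat n
  | .init Y => Y
  | .set i Δ => fun x y => X x y || (decide (x = i ∨ y = i) && Δ x y)
  | .reset D => fun x y => X x y && !decide ((x, y) ∈ D)
  | .lookup _ _ => X

/-- The value of the matrix after the operations `l`; at time `0` it is the zero matrix. -/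
def matAfter (l : List (Op n)) : BoolMat n := l.foldl Op.apply (fun _ _ => false)

/-- A `Reset*` may be applied to `X` if its update matrix is contained in `X` (and the list of the
ones has no repetitions); all other operations are always admissible. -/
def Op.Admissible (X : BoolMat n) : Op n → Prop
  | .reset D => D.Nodup ∧ ∀ p ∈ D, X p.1 p.2 = true
  | _ => True

def ValidSeq (σ : List (Op n)) : Prop :=
  ∀ j : Fin σ.length, (σ.get j).Admissible (matAfter (σ.take j))

/-- The arguments of an operation, as the machine sees them. -/
def Op.args : Op n → List ℕ
  | .init Y => n :: entries Y
  | .set i Δ => n :: (i : ℕ) :: entries Δ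
  | .reset D => n :: D.length :: D.flatMap fun p => [(p.1 : ℕ), (p.2 : ℕ)]
  | .lookup x y => [n, (x : ℕ), (y : ℕ)]

/-! ## Data structures and their runs -/

/-- A deterministic data structure: one program per kind of operation, the same for all `n`. -/
structure ClosureDS where
  initProg : Cmd
  setProg : Cmd
  resetProg : Cmd
  lookupProg : Cmd

def ClosureDS.prog (P : ClosureDS) : Op n → Cmd
  | .init _ => P.initProg
  | .set _ _ => P.setProg
  | .reset _ => P.resetProg
  | .lookup _ _ => P.lookupProg

/-- `st` and `cost` are the states and the step counts of the run of `P` on `σ` with words smaller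
than `W` and `S` memory cells: the run starts with everything zero, the `j`-th
operation takes `st j` to `st (j+1)` in `cost j` steps. -/
def ClosureDS.IsRun (P : ClosureDS) (W S : ℕ) (σ : List (Op n)) (st : ℕ → State)
    (cost : Fin σ.length → ℕ) : Prop :=
  st 0 = State.zero ∧
  ∀ j : Fin σ.length,
    Exec W S (arr (σ.get j).args) (P.prog (σ.get j)) (st j) (st (j + 1)) (cost j)

/-- Every `Lookup*(x,y)` leaves the current value of `X*[x,y]`, as a bit, in register `0`. -/
def AnswersCorrect (σ : List (Op n)) (st : ℕ → State) : Prop :=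
  ∀ (j : Fin σ.length) (x y : Fin n), σ.get j = .lookup x y →
    (KleeneClosure (matAfter (σ.take j)) x y → (st (j + 1)).reg 0 = 1) ∧
    (¬ KleeneClosure (matAfter (σ.take j)) x y → (st (j + 1)).reg 0 = 0)

open Classical in
/-- The time bounds for one run; `charge r j` is the part of the cost of the `r`-th operation, a
`Reset*`, that is charged to the earlier `j`-th operation, an `Init*` or a `Set*`.
* The actual cost of an `Init*` is at most `C n^ω`, and at most `C n³` is charged to it.
* The total actual cost of the `Set*` operations together with all that is charged to them is
  at most `C n²` per `Set*`.
* The cost of a `Reset*` is covered by its charges, except that a `Reset*` with zero update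
  matrix, which may have no predecessor, is allowed constant time.
* A `Lookup*` takes constant time. -/
def TimeBounds (σ : List (Op n)) (cost : Fin σ.length → ℕ)
    (charge : Fin σ.length → Fin σ.length → ℕ) (C : ℕ) (ω : ℝ) : Prop :=
  (∀ r j, charge r j ≠ 0 →
    j < r ∧ (σ.get r).IsReset ∧ ((σ.get j).IsInit ∨ (σ.get j).IsSet)) ∧
  (∀ j, (σ.get j).IsInit →
    (cost j : ℝ) ≤ C * (n : ℝ) ^ ω ∧ ∑ r, charge r j ≤ C * n ^ 3) ∧
  (∑ j with (σ.get j).IsSet, (cost j + ∑ r, charge r j) ≤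
    C * n ^ 2 * (Finset.univ.filter fun j => (σ.get j).IsSet).card) ∧
  (∀ r D, σ.get r = .reset D →
    cost r ≤ ∑ j, charge r j + if D = [] then C else 0) ∧
  (∀ j x y, σ.get j = .lookup x y → cost j ≤ C)

/-- The first operation is an `Init*` and no other operation is. -/
def OnlyInitialInit (σ : List (Op n)) : Prop :=
  0 < σ.length ∧ ∀ j : Fin σ.length, (σ.get j).IsInit ↔ (j : ℕ) = 0

open Classical in
/-- The indices of the insertions and deletions of `σ`. -/
noncomputable def updates (σ : List (Op n)) : Finset (Fin σ.length) :=
  Finset.univ.filter fun j => (σ.get j).IsSet ∨ (σ.get j).IsReset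

end DynClosure

open DynClosure

/-!
# Fully dynamic closure of Boolean matrices

*Nodes.* The edges of the graph are distributed over nodes. A node has a vertex as its centre and
covers edges into and out of the centre; the nodes are linearly ordered by age. Every vertex is the
centre of a base node, whose edges are those of the matrix from which the counters were built, and
of a top node, whose edges are those around the vertex at the last insertion there. For a node `k`
the data structure records which vertices reach its centre, and which ones are reached from it, by
paths in the edges of `k` and of older nodes. Such a path leads from `x` through older nodes to the
far end `z` of an edge of `k`; so `x` reaches the centre of `k` if and only if `x = z`, or `x`
reaches the centre of an older node `j` from whose centre `z` is reached. A vertex reaches another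
one if and only if it reaches the centre of some node which reaches the other, as one sees by
cutting a path at the centre of its youngest node (`Core.through_trans`, `Core.closure_iff`).

*Counters.* Each of these facts is stored with the number of its witnesses (`cnt`, `Core`). A fact
refers only to facts about older nodes and to facts about its own node of a lower kind, so a fact
without witnesses is false and there is no circular support. A deletion removes edge facts and passes
on the loss of witnesses by means of a work list (`Core.proc`, `tot_cascade`). The removal of a fact
takes `O(n)` time and happens only once, so the number of present facts, times `n`, is a potential
that pays for the deletions. An insertion around `i` empties the top node of `i` and builds it anew
as the youngest node (`Full.renew`, `Core.add`). Older nodes do not refer to it, hence this takes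
`O(n²)` time, and it creates `O(n)` facts, which raise the potential by `O(n²)`.

*Initialization.* Building the base nodes takes cubic time, which is allowed as a charge to an
`Init*`, but not as its cost. Therefore `Init*` only computes the closure, by a recursion on blocks
with the given multiplication program (`closed_union`, `reach_block`), in time `O(n^ω)` because
`2 ≤ ω` (`two_le_of_exponent`, `recTime_le`). Until the next nonempty deletion the graph only grows,
and it is enough to add one node per insertion without exact counters (`Lazy`, `Lazy.add`). That
deletion then builds all counters from the matrix and charges this to the `Init*` (`tot_rebuild`).

*Charges.* The invariant `Inv` has a potential `b` for the base nodes and a potential `t` for the top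
nodes. A deletion charges the decrease of `b` to the last `Init*` and the decrease of `t` to the last
`Set*` (`chargeTo`). Only an `Init*` can raise `b`, and only a `Set*` can raise `t`; so the charges
telescope (`sum_charge_init_le`, `sum_set_le`, `le_sum_charge`).

*Machine.* Programs are composed of compiled expressions and structured commands, with rules for
total correctness and time (`Tot`). The multiplication program, which is given in machine code, is
run as a subroutine by a translation of its registers, arguments and memory (`Sim.exec`, `tot_call`).
-/

namespace DynClosure

/-! ### Expressions and total correctness on the machine -/

/-- A machine as seen by one operation: word bound, number of cells and argument array. -/
structure Mach where
  W : ℕ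
  S : ℕ
  inp : ℕ → ℕ

/-- All registers and cells hold values below the word bound. -/
def WF (W : ℕ) (s : State) : Prop := (∀ r, s.reg r < W) ∧ ∀ a, s.mem a < W

/-- Agreement of two states on the memory and on the registers below `100`. The registers from `100`
on are scratch space of compiled expressions and of the translated multiplication program. -/
def Agree (s s' : State) : Prop := s.mem = s'.mem ∧ ∀ r < 100, s.reg r = s'.reg r

@[simp] theorem State.setReg_mem (s : State) (r v : ℕ) : (s.setReg r v).mem = s.mem := rfl
@[simp] theorem State.setMem_reg (s : State) (r v : ℕ) : (s.setMem r v).reg = s.reg := rfl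
@[simp] theorem State.setReg_reg (s : State) (r v r' : ℕ) :
    (s.setReg r v).reg r' = if r' = r then v else s.reg r' := by
  simp [State.setReg, Function.update_apply]
@[simp] theorem State.setMem_mem (s : State) (a v a' : ℕ) :
    (s.setMem a v).mem a' = if a' = a then v else s.mem a' := by
  simp [State.setMem, Function.update_apply]

theorem Exec.wf {W S inp c s s' t} (h : Exec W S inp c s s' t) (hs : WF W s) : WF W s' := by
  have hr : ∀ {s : State} {r v}, WF W s → v < W → WF W (s.setReg r v) := by
    intro s r v h hv
    refine ⟨fun r' => ?_, h.2⟩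
    rw [State.setReg_reg]; split_ifs
    exacts [hv, h.1 _]
  induction h with
  | const h => exact hr hs h
  | arith h => exact hr hs h
  | input h => exact hr hs h
  | load h => exact hr hs (hs.2 _)
  | store h =>
    refine ⟨hs.1, fun a => ?_⟩
    rw [State.setMem_mem]; split_ifs
    exacts [hs.1 _, hs.2 _]
  | seq _ _ ih1 ih2 => exact ih2 (ih1 hs)
  | iteTrue _ _ ih => exact ih hs
  | iteFalse _ _ ih => exact ih hs
  | loopDone _ => exact hs
  | loopStep _ _ _ ih1 ih2 => exact ih2 (ih1 hs)

/-- Expressions over the registers, the memory (`ld`) and the argument array (`inp`). -/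
inductive Ex
  | c (k : ℕ)
  | v (r : ℕ)
  | op (o : ArithOp) (a b : Ex)
  | ld (a : Ex)
  | inp (a : Ex)

instance : Add Ex := ⟨.op .add⟩
instance : Sub Ex := ⟨.op .sub⟩
instance : Mul Ex := ⟨.op .mul⟩
instance : Div Ex := ⟨.op .div⟩

namespace Ex

/-- The value of an expression in the state `s`. -/
def eval (M : Mach) (s : State) : Ex → ℕ
  | .c k => k
  | .v r => s.reg r
  | .op o a b => o.eval (a.eval M s) (b.eval M s)
  | .ld a => s.mem (a.eval M s)
  | .inp a => M.inp (a.eval M s)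

/-- The evaluation respects the limits of the machine. Differences, quotients, registers and cells
need no condition: they are bounded by values that exist already. -/
def Ok (M : Mach) (s : State) : Ex → Prop
  | .c k => k < M.W
  | .v r => r < 100
  | .op .add a b => a.Ok M s ∧ b.Ok M s ∧ a.eval M s + b.eval M s < M.W
  | .op .mul a b => a.Ok M s ∧ b.Ok M s ∧ a.eval M s * b.eval M s < M.W
  | .op .sub a b => a.Ok M s ∧ b.Ok M s
  | .op .div a b => a.Ok M s ∧ b.Ok M s
  | .ld a => a.Ok M s ∧ a.eval M s < M.S
  | .inp a => a.Ok M s ∧ M.inp (a.eval M s) < M.W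

/-- Code that evaluates an expression into register `t`, with the registers above `t` as scratch
space. -/
def comp (t : ℕ) : Ex → Cmd
  | .c k => .const t k
  | .v r => .seq (.const t 0) (.arith .add t r t)
  | .op o a b => .seq (a.comp t) (.seq (b.comp (t + 1)) (.arith o t t (t + 1)))
  | .ld a => .seq (a.comp t) (.load t t)
  | .inp a => .seq (a.comp t) (.input t t)

/-- The number of instructions of the code of an expression. -/
def cost : Ex → ℕ
  | .c _ => 1
  | .v _ => 2
  | .op _ a b => a.cost + (b.cost + 1)
  | .ld a => a.cost + 1
  | .inp a => a.cost + 1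

variable {M : Mach} {s : State}

@[simp] theorem eval_c (k : ℕ) : (c k).eval M s = k := rfl
@[simp] theorem eval_v (r : ℕ) : (v r).eval M s = s.reg r := rfl
@[simp] theorem eval_add (a b : Ex) : (a + b).eval M s = a.eval M s + b.eval M s := rfl
@[simp] theorem eval_sub (a b : Ex) : (a - b).eval M s = a.eval M s - b.eval M s := rfl
@[simp] theorem eval_mul (a b : Ex) : (a * b).eval M s = a.eval M s * b.eval M s := rfl
@[simp] theorem eval_div (a b : Ex) : (a / b).eval M s = a.eval M s / b.eval M s := rfl
@[simp] theorem eval_ld (a : Ex) : (ld a).eval M s = s.mem (a.eval M s) := rfl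
@[simp] theorem eval_inp (a : Ex) : (inp a).eval M s = M.inp (a.eval M s) := rfl
@[simp] theorem ok_c (k : ℕ) : (c k).Ok M s ↔ k < M.W := Iff.rfl
@[simp] theorem ok_v (r : ℕ) : (v r).Ok M s ↔ r < 100 := Iff.rfl
@[simp] theorem ok_add (a b : Ex) :
    (a + b).Ok M s ↔ a.Ok M s ∧ b.Ok M s ∧ a.eval M s + b.eval M s < M.W := Iff.rfl
@[simp] theorem ok_mul (a b : Ex) :
    (a * b).Ok M s ↔ a.Ok M s ∧ b.Ok M s ∧ a.eval M s * b.eval M s < M.W := Iff.rfl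
@[simp] theorem ok_sub (a b : Ex) : (a - b).Ok M s ↔ a.Ok M s ∧ b.Ok M s := Iff.rfl
@[simp] theorem ok_div (a b : Ex) : (a / b).Ok M s ↔ a.Ok M s ∧ b.Ok M s := Iff.rfl
@[simp] theorem ok_ld (a : Ex) : (ld a).Ok M s ↔ a.Ok M s ∧ a.eval M s < M.S := Iff.rfl
@[simp] theorem ok_inp (a : Ex) :
    (inp a).Ok M s ↔ a.Ok M s ∧ M.inp (a.eval M s) < M.W := Iff.rfl
@[simp] theorem cost_c (k : ℕ) : (c k).cost = 1 := rfl
@[simp] theorem cost_v (r : ℕ) : (v r).cost = 2 := rfl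
@[simp] theorem cost_add (a b : Ex) : (a + b).cost = a.cost + (b.cost + 1) := rfl
@[simp] theorem cost_sub (a b : Ex) : (a - b).cost = a.cost + (b.cost + 1) := rfl
@[simp] theorem cost_mul (a b : Ex) : (a * b).cost = a.cost + (b.cost + 1) := rfl
@[simp] theorem cost_div (a b : Ex) : (a / b).cost = a.cost + (b.cost + 1) := rfl
@[simp] theorem cost_ld (a : Ex) : (ld a).cost = a.cost + 1 := rfl
@[simp] theorem cost_inp (a : Ex) : (inp a).cost = a.cost + 1 := rfl

theorem comp_exec (e : Ex) : ∀ {s1 : State} {t : ℕ}, WF M.W s1 → Agree s1 s → e.Ok M s → 100 ≤ t →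
    ∃ s2, Exec M.W M.S M.inp (e.comp t) s1 s2 e.cost ∧ s2.reg t = e.eval M s ∧
      s2.mem = s1.mem ∧ ∀ r < t, s2.reg r = s1.reg r := by
  induction e with
  | c k =>
    intro s1 t _ _ hk _
    exact ⟨_, .const hk, by simp, rfl, fun r hr => by simp [hr.ne]⟩
  | v r =>
    intro s1 t hw ha hk ht
    have hr : r < t := lt_of_lt_of_le hk ht
    refine ⟨_, .seq (.const ((Nat.zero_le _).trans_lt (hw.1 0))) (.arith ?_), ?_, rfl, ?_⟩
    · simpa [ArithOp.eval, hr.ne] using hw.1 r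
    · simp [ArithOp.eval, hr.ne, ha.2 r hk]
    · intro r' h; simp [h.ne]
  | op o a b iha ihb =>
    intro s1 t hw ha hk ht
    have hka : a.Ok M s := by cases o <;> exact hk.1
    have hkb : b.Ok M s := by cases o <;> first | exact hk.2.1 | exact hk.2
    obtain ⟨s2, e2, v2, m2, f2⟩ := iha hw ha hka ht
    have ha2 : Agree s2 s := ⟨m2.trans ha.1, fun r hr => (f2 r (by omega)).trans (ha.2 r hr)⟩
    obtain ⟨s3, e3, v3, m3, f3⟩ := ihb (e2.wf hw) ha2 hkb (by omega : 100 ≤ t + 1)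
    have hv : s3.reg t = a.eval M s := (f3 t (by omega)).trans v2
    have w3 := e3.wf (e2.wf hw)
    refine ⟨_, .seq e2 (.seq e3 (.arith ?_)), ?_, ?_, ?_⟩
    · rw [hv, v3]
      have h1 : a.eval M s < M.W := v2 ▸ (e2.wf hw).1 t
      cases o
      · exact hk.2.2
      · exact (Nat.sub_le _ _).trans_lt h1
      · exact hk.2.2
      · exact (Nat.div_le_self _ _).trans_lt h1
    · simp [hv, v3, eval]
    · simp [m3, m2]
    · intro r hr
      simp [hr.ne, f3 r (by omega), f2 r hr]
  | ld a iha =>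
    intro s1 t hw ha hk ht
    obtain ⟨s2, e2, v2, m2, f2⟩ := iha hw ha hk.1 ht
    refine ⟨_, .seq e2 (.load (by rw [v2]; exact hk.2)), ?_, ?_, ?_⟩
    · simp [v2, m2, ha.1]
    · simp [m2]
    · intro r hr; simp [hr.ne, f2 r hr]
  | inp a iha =>
    intro s1 t hw ha hk ht
    obtain ⟨s2, e2, v2, m2, f2⟩ := iha hw ha hk.1 ht
    refine ⟨_, .seq e2 (.input (by rw [v2]; exact hk.2)), ?_, ?_, ?_⟩
    · simp [v2]
    · simp [m2]
    · intro r hr; simp [hr.ne, f2 r hr]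

end Ex

/-- Total correctness with time: started in a state that agrees with `s`, the program halts in a
state that agrees with some `s'`, after at most `t` steps, where `Q s' t`. -/
def Tot (M : Mach) (c : Cmd) (s : State) (Q : State → ℕ → Prop) : Prop :=
  ∀ s1, WF M.W s1 → Agree s1 s → ∃ s1' t1, Exec M.W M.S M.inp c s1 s1' t1 ∧
    ∃ s' t, Agree s1' s' ∧ t1 ≤ t ∧ Q s' t

/-- `reg r ← e`. -/
def asg (r : ℕ) (e : Ex) : Cmd :=
  .seq (e.comp 100) (.seq (.const 101 0) (.arith .add r 100 101))
/-- `mem[a] ← e`. -/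
def sto (a e : Ex) : Cmd := .seq (a.comp 100) (.seq (e.comp 101) (.store 100 101))
/-- Conditional: `c₁` if `e` is nonzero, and `c₂` otherwise. -/
def iff (e : Ex) (c₁ c₂ : Cmd) : Cmd := .seq (e.comp 100) (.ite 100 c₁ c₂)
/-- Loop: `c` is repeated while `e` is nonzero. -/
def whl (e : Ex) (c : Cmd) : Cmd := .seq (e.comp 100) (.loop 100 (.seq c (e.comp 100)))
/-- No effect outside the scratch registers. -/
def skip : Cmd := .const 100 0
/-- `for r := 0, …, e - 1 do c`. -/
def forUp (r : ℕ) (e : Ex) (c : Cmd) : Cmd :=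
  .seq (asg r (.c 0)) (whl (e - .v r) (.seq c (asg r (.v r + .c 1))))

infixr:60 " ;; " => Cmd.seq

section Rules
variable {M : Mach} {s : State} {Q : State → ℕ → Prop}

theorem Tot.mono {c : Cmd} {Q' : State → ℕ → Prop} (h : Tot M c s Q')
    (hq : ∀ s' t, Q' s' t → Q s' t) : Tot M c s Q := by
  intro s1 hw ha
  obtain ⟨s1', t1, e, s', t, h1, h2, h3⟩ := h s1 hw ha
  exact ⟨s1', t1, e, s', t, h1, h2, hq _ _ h3⟩

theorem tot_seq {c₁ c₂ : Cmd}
    (h : Tot M c₁ s fun s1 t1 => Tot M c₂ s1 fun s2 t2 => Q s2 (t1 + t2)) :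
    Tot M (c₁ ;; c₂) s Q := by
  intro s1 hw ha
  obtain ⟨s2, t1, e1, s', t, h1, h2, h3⟩ := h s1 hw ha
  obtain ⟨s3, t2, e2, s'', t', h4, h5, h6⟩ := h3 s2 (e1.wf hw) h1
  exact ⟨s3, _, .seq e1 e2, s'', t + t', h4, by omega, h6⟩

theorem tot_asg {r : ℕ} {e : Ex} (hr : r < 100) (ho : e.Ok M s)
    (hq : Q (s.setReg r (e.eval M s)) (e.cost + 2)) : Tot M (asg r e) s Q := by
  intro s1 hw ha
  obtain ⟨s2, e2, v2, m2, f2⟩ := e.comp_exec hw ha ho le_rfl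
  refine ⟨_, _, .seq e2 (.seq (.const ((Nat.zero_le _).trans_lt (hw.1 0))) (.arith ?_)),
    _, _, ⟨?_, ?_⟩, le_rfl, hq⟩
  · simpa [ArithOp.eval] using (e2.wf hw).1 100
  · simp [m2, ha.1]
  · intro r' hr'
    have : r' ≠ 101 := by omega
    simp [ArithOp.eval, v2, f2 r' hr', ha.2 r' hr', this]

theorem tot_sto {a e : Ex} (hoa : a.Ok M s) (ho : e.Ok M s) (hS : a.eval M s < M.S)
    (hq : Q (s.setMem (a.eval M s) (e.eval M s)) (a.cost + (e.cost + 1))) :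
    Tot M (sto a e) s Q := by
  intro s1 hw ha
  obtain ⟨s2, e2, v2, m2, f2⟩ := a.comp_exec hw ha hoa le_rfl
  have ha2 : Agree s2 s := ⟨m2.trans ha.1, fun r hr => (f2 r hr).trans (ha.2 r hr)⟩
  obtain ⟨s3, e3, v3, m3, f3⟩ := e.comp_exec (e2.wf hw) ha2 ho (by norm_num : 100 ≤ 101)
  have h100 : s3.reg 100 = a.eval M s := (f3 100 (by norm_num)).trans v2
  refine ⟨_, _, .seq e2 (.seq e3 (.store (by rw [h100]; exact hS))), _, _, ⟨?_, ?_⟩, le_rfl, hq⟩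
  · funext x; simp [h100, v3, m3, m2, ha.1]
  · intro r hr
    simp [f3 r (by omega), f2 r hr, ha.2 r hr]

theorem tot_skip (hW : 0 < M.W) (hq : Q s 1) : Tot M skip s Q := by
  intro s1 hw ha
  refine ⟨_, _, .const hW, s, 1, ⟨ha.1, fun r hr => ?_⟩, le_rfl, hq⟩
  have : r ≠ 100 := by omega
  simp [this, ha.2 r hr]

theorem tot_iff {e : Ex} {c₁ c₂ : Cmd} (ho : e.Ok M s)
    (h1 : e.eval M s ≠ 0 → Tot M c₁ s fun s' t => Q s' (t + e.cost + 1))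
    (h2 : e.eval M s = 0 → Tot M c₂ s fun s' t => Q s' (t + e.cost + 1)) :
    Tot M (iff e c₁ c₂) s Q := by
  intro s1 hw ha
  obtain ⟨s2, e2, v2, m2, f2⟩ := e.comp_exec hw ha ho le_rfl
  have ha2 : Agree s2 s := ⟨m2.trans ha.1, fun r hr => (f2 r hr).trans (ha.2 r hr)⟩
  by_cases h : e.eval M s = 0
  · obtain ⟨s3, t3, e3, s', t, a3, l3, q3⟩ := h2 h s2 (e2.wf hw) ha2
    exact ⟨s3, _, .seq e2 (.iteFalse (by rw [v2, h]) e3), s', _, a3, by omega, q3⟩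
  · obtain ⟨s3, t3, e3, s', t, a3, l3, q3⟩ := h1 h s2 (e2.wf hw) ha2
    exact ⟨s3, _, .seq e2 (.iteTrue (by rw [v2]; exact h) e3), s', _, a3, by omega, q3⟩

theorem tot_whl_done {e : Ex} {c : Cmd} (ho : e.Ok M s) (h0 : e.eval M s = 0)
    (hq : Q s (e.cost + 1)) : Tot M (whl e c) s Q := by
  intro s1 hw ha
  obtain ⟨s2, e2, v2, m2, f2⟩ := e.comp_exec hw ha ho le_rfl
  exact ⟨s2, _, .seq e2 (.loopDone (by rw [v2, h0])), s, _,
    ⟨m2.trans ha.1, fun r hr => (f2 r hr).trans (ha.2 r hr)⟩, le_rfl, hq⟩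

/-- Unrolling of the first iteration of a loop. -/
theorem tot_whl_step {e : Ex} {c : Cmd} (ho : e.Ok M s) (h0 : e.eval M s ≠ 0)
    (h : Tot M c s fun s1 t1 => Tot M (whl e c) s1 fun s2 t2 => Q s2 (e.cost + 1 + t1 + t2)) :
    Tot M (whl e c) s Q := by
  intro s1 hw ha
  obtain ⟨s2, e2, v2, m2, f2⟩ := e.comp_exec hw ha ho le_rfl
  have ha2 : Agree s2 s := ⟨m2.trans ha.1, fun r hr => (f2 r hr).trans (ha.2 r hr)⟩
  obtain ⟨s3, t3, e3, s', t, a3, l3, q3⟩ := h s2 (e2.wf hw) ha2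
  obtain ⟨s4, t4, e4, s'', t', a4, l4, q4⟩ := q3 s3 (e3.wf (e2.wf hw)) a3
  cases e4 with
  | seq e5 e6 =>
    exact ⟨s4, _, .seq e2 (.loopStep (by rw [v2]; exact h0) (.seq e3 e5) e6), s'', _, a4,
      by omega, q4⟩

/-- A loop whose running time is paid for by the potential `φ`. -/
theorem tot_whl {e : Ex} {c : Cmd} (J : State → ℕ → Prop) {φ₀ : ℕ} (h0 : J s φ₀)
    (hok : ∀ s φ, J s φ → e.Ok M s)
    (hstep : ∀ s φ, J s φ → e.eval M s ≠ 0 → Tot M c s fun s' t =>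
      ∃ φ', J s' φ' ∧ t + e.cost + 1 + φ' ≤ φ)
    (hq : ∀ s' t φ', J s' φ' → e.eval M s' = 0 → t + φ' ≤ φ₀ + e.cost + 1 → Q s' t) :
    Tot M (whl e c) s Q := by
  induction φ₀ using Nat.strong_induction_on generalizing s Q with
  | _ φ₀ ih =>
    by_cases hz : e.eval M s = 0
    · exact tot_whl_done (hok _ _ h0) hz (hq _ _ _ h0 hz (by omega))
    · refine tot_whl_step (hok _ _ h0) hz ((hstep _ _ h0 hz).mono ?_)
      rintro s' t ⟨φ', h1, h2⟩
      exact ih φ' (by omega) h1 fun s'' t' φ'' h3 h4 h5 => hq _ _ _ h3 h4 (by omega)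

theorem tot_forUp {r : ℕ} {e : Ex} {c : Cmd} {N : ℕ} (I : ℕ → State → Prop) (τ : ℕ)
    (hr : r < 100) (hN : N < M.W) (h0 : I 0 (s.setReg r 0))
    (hI : ∀ k s, k ≤ N → I k s → s.reg r = k ∧ e.Ok M s ∧ e.eval M s = N)
    (hc : ∀ k s, k < N → I k s → Tot M c s fun s' t =>
      t ≤ τ ∧ s'.reg r = k ∧ I (k + 1) (s'.setReg r (k + 1)))
    (hq : ∀ s' t, I N s' → t ≤ N * (τ + e.cost + 10) + e.cost + 10 → Q s' t) :
    Tot M (forUp r e c) s Q := by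
  refine tot_seq (tot_asg hr (by simpa using (Nat.zero_le _).trans_lt hN) ?_)
  refine tot_whl (fun s φ => ∃ k ≤ N, I k s ∧ φ = (N - k) * (τ + e.cost + 10))
    ⟨0, Nat.zero_le _, by simpa using h0, rfl⟩ ?_ ?_ ?_
  · rintro s φ ⟨k, hk, hi, -⟩
    exact ⟨(hI k s hk hi).2.1, hr⟩
  · rintro s φ ⟨k, hk, hi, rfl⟩ hne
    obtain ⟨h1, h2, h3⟩ := hI k s hk hi
    simp only [Ex.eval_sub, h3, Ex.eval_v, h1] at hne
    refine tot_seq ((hc k s (by omega) hi).mono ?_)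
    rintro s' t ⟨ht, hrk, hi'⟩
    refine tot_asg hr ?_ ?_
    · simp [hr, hrk]; omega
    · refine ⟨_, ⟨k + 1, by omega, by simpa [hrk] using hi', rfl⟩, ?_⟩
      obtain ⟨d, hd⟩ : ∃ d, N = k + 1 + d := ⟨N - (k + 1), by omega⟩
      have e1 : N - k = d + 1 := by omega
      have e2 : N - (k + 1) = d := by omega
      simp only [e1, e2, Ex.cost_add, Ex.cost_v, Ex.cost_c, Ex.cost_sub]
      rw [Nat.succ_mul]
      omega
  · rintro s' t φ' ⟨k, hk, hi, rfl⟩ h4 h5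
    obtain ⟨h1, h2, h3⟩ := hI k s' hk hi
    simp only [Ex.eval_sub, h3, Ex.eval_v, h1] at h4
    have : k = N := by omega
    subst this
    refine hq _ _ hi ?_
    simp only [Ex.cost_sub, Ex.cost_v, Nat.sub_self, Nat.zero_mul, Nat.sub_zero, Ex.cost_c] at h5 ⊢
    omega

end Rules

/-! ### Decremental maintenance of the counters -/

/-- Address of a fact: kind, row, column. -/
abbrev Trip := ℕ × ℕ × ℕ
/-- The values of all cells. Where the counters are maintained (`Core`), they are as follows. For a
fact of kind `0` to `5` the value `0` means that it is absent. A present fact of kind `2` to `5` has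
the value `1` plus the number of its witnesses; a present edge fact, of kind `0` or `1`, has the
value `2`. Hence the value `1` marks the present facts that have no support left: these are the
facts on the work list. The cells of kind `6` are plain numbers of witnesses, and those of kind `7`
hold the matrix. -/
abbrev Tab := Trip → ℕ
/-- The tables together with the work list of dead facts, which is a stack: its last entry is
processed first. -/
abbrev Cfg := Tab × List Trip

/-- The addresses that occur, for `m` nodes and vertices. -/
def Valid (m : ℕ) (t : Trip) : Prop := t.1 < 8 ∧ t.2.1 < m ∧ t.2.2 < m

/-- If partner `p` and head `h` are present, the head loses one witness; a head without witnesses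
left is put on the work list. -/
def decA (push : Bool) (p h : Trip) (c : Cfg) : Cfg :=
  if c.1 p ≠ 0 ∧ c.1 h ≠ 0 then
    (Function.update c.1 h (c.1 h - 1), if push = true ∧ c.1 h = 2 then c.2 ++ [h] else c.2)
  else c

/-- The decrements for the pairs of partner `P i` and head `H i` with `i < k`. -/
def sweepA (push : Bool) (P H : ℕ → Trip) : ℕ → Cfg → Cfg
  | 0, c => c
  | k + 1, c => decA push (P k) (H k) (sweepA push P H k c)

/-- Deletion of the dead fact `f`. The facts that `f` is a witness for are found by running, for each
rule in which `f` occurs, through the possible partners of `f`. With `s = 0` for the paths into the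
centre of the node and `s = 1` for the paths out of it, an edge fact contributes to the kinds `4 + s`
and `2 + s`, a fact on an older node to the kind `4 + s`, and a fact on a vertex to the kinds `4 + s`
and `3 - s` of younger nodes and to reachability. -/
def procA (m : ℕ) (f : Trip) (c : Cfg) : Cfg :=
  let s := f.1 % 2
  let a := f.2.1
  let b := f.2.2
  let c' := if f.1 / 2 = 0 then
      sweepA true (fun i => (5 - s, i, b)) (fun i => (2 + s, a, i)) m (decA true f (4 + s, a, b) c)
    else if f.1 / 2 = 1 then
      sweepA true (fun i => (4 + s, b, i)) (fun i => (4 + s, a, i)) m c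
    else
      sweepA false (fun i => (5 - s, a, i)) (fun i => (6, (1 - s) * b + i * s, s * b + i * (1 - s))) m
        (sweepA true (fun i => (1 - s, i, b)) (fun i => (3 - s, i, a)) m
          (sweepA true (fun i => (2 + s, i, a)) (fun i => (4 + s, i, b)) m c))
  (Function.update c'.1 f 0, c'.2)

/-- Passing from `c` to `c'` decrements exactly the present cells in `D`. -/
def Eff (D : Trip → Prop) (c c' : Cfg) : Prop :=
  (∀ t, (D t → c.1 t ≠ 0 → c'.1 t = c.1 t - 1) ∧ (¬ D t ∨ c.1 t = 0 → c'.1 t = c.1 t)) ∧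
  ∃ l, c'.2 = c.2 ++ l ∧ l.Nodup ∧ ∀ t, t ∈ l ↔ D t ∧ t.1 < 6 ∧ c.1 t = 2

theorem Eff.comp {D₁ D₂ : Trip → Prop} {c c' c'' : Cfg} (h1 : Eff D₁ c c') (h2 : Eff D₂ c' c'')
    (hd : ∀ t, D₁ t → ¬ D₂ t) :
    Eff (fun t => D₁ t ∨ D₂ t) c c'' := by
  obtain ⟨a1, l1, b1, n1, m1⟩ := h1
  obtain ⟨a2, l2, b2, n2, m2⟩ := h2
  have key : ∀ t, ¬ D₁ t → c'.1 t = c.1 t := fun t h => (a1 t).2 (Or.inl h)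
  refine ⟨fun t => ⟨?_, ?_⟩, l1 ++ l2, by simp [b1, b2], ?_, ?_⟩
  · rintro (h | h) h0
    · rw [(a2 t).2 (Or.inl (hd t h)), (a1 t).1 h h0]
    · have h3 := key t fun h' => hd t h' h
      rw [(a2 t).1 h (by rwa [h3]), h3]
  · intro h
    have h3 : c'.1 t = c.1 t := (a1 t).2 (h.imp_left fun h h' => h (Or.inl h'))
    rw [(a2 t).2 (h.imp (fun h h' => h (Or.inr h')) fun h => by rw [h3, h]), h3]
  · rw [List.nodup_append']
    refine ⟨n1, n2, fun t h1 h2 => hd t ((m1 t).1 h1).1 ((m2 t).1 h2).1⟩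
  · intro t
    rw [List.mem_append, m1, m2]
    by_cases h : D₁ t
    · simp [h, hd t h]
    · simp [h, key t h]

theorem Eff.congr {D₁ D₂ : Trip → Prop} {c c' : Cfg} (h1 : Eff D₁ c c')
    (hd : ∀ t, D₁ t ↔ D₂ t) : Eff D₂ c c' := by
  have : D₁ = D₂ := funext fun t => propext (hd t)
  rwa [← this]

theorem eff_decA {push : Bool} {p h : Trip} {c : Cfg} (hp : push = true ↔ h.1 < 6) :
    Eff (fun t => t = h ∧ c.1 p ≠ 0) c (decA push p h c) := by
  unfold decA
  split_ifs with h1 h2 h2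
  · refine ⟨fun t => ⟨?_, ?_⟩, [h], rfl, by simp, fun t => ?_⟩
    · rintro ⟨rfl, -⟩ _; simp
    · rintro (h3 | h3)
      · have : t ≠ h := fun h4 => h3 ⟨h4, h1.1⟩
        simp [this]
      · have : t ≠ h := fun h4 => h1.2 (h4 ▸ h3)
        simp [this]
    · simp only [List.mem_singleton]
      constructor
      · rintro rfl; exact ⟨⟨rfl, h1.1⟩, hp.1 h2.1, h2.2⟩
      · exact fun h => h.1.1
  · refine ⟨fun t => ⟨?_, ?_⟩, [], by simp, by simp, fun t => ?_⟩
    · rintro ⟨rfl, -⟩ _; simp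
    · rintro (h3 | h3)
      · have : t ≠ h := fun h4 => h3 ⟨h4, h1.1⟩
        simp [this]
      · have : t ≠ h := fun h4 => h1.2 (h4 ▸ h3)
        simp [this]
    · simp only [List.not_mem_nil, false_iff]
      rintro ⟨⟨rfl, -⟩, h3, h4⟩
      exact h2 ⟨hp.2 h3, h4⟩
  · refine ⟨fun t => ⟨?_, fun _ => rfl⟩, [], by simp, by simp, fun t => ?_⟩
    · rintro ⟨rfl, h3⟩ h4; exact absurd ⟨h3, h4⟩ h1
    · simp only [List.not_mem_nil, false_iff]
      rintro ⟨⟨rfl, h3⟩, -, h4⟩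
      exact h1 ⟨h3, by omega⟩

theorem eff_sweepA {push : Bool} {P H : ℕ → Trip} {c : Cfg} (hp : ∀ i, push = true ↔ (H i).1 < 6)
    (hinj : ∀ i j, H i = H j → i = j) (hPH : ∀ i j, P i ≠ H j) (k : ℕ) :
    Eff (fun t => ∃ i < k, t = H i ∧ c.1 (P i) ≠ 0) c (sweepA push P H k c) := by
  induction k with
  | zero => exact ⟨by simp [sweepA], [], by simp [sweepA], by simp, by simp⟩
  | succ k ih =>
    have hP : (sweepA push P H k c).1 (P k) = c.1 (P k) :=
      (ih.1 _).2 (Or.inl (by rintro ⟨i, -, h, -⟩; exact hPH _ _ h))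
    refine (ih.comp (eff_decA (hp k)) ?_).congr ?_
    · rintro t ⟨i, hi, rfl, -⟩ ⟨h, -⟩
      have := hinj _ _ h
      omega
    · intro t
      rw [hP]
      constructor
      · rintro (⟨i, hi, h⟩ | h)
        · exact ⟨i, by omega, h⟩
        · exact ⟨k, by omega, h⟩
      · rintro ⟨i, hi, h⟩
        rcases Nat.lt_succ_iff_lt_or_eq.1 hi with h' | rfl
        · exact Or.inl ⟨i, h', h⟩
        · exact Or.inr h

/-- Number of indices at which both facts are present. -/
def ip (m : ℕ) (g : Tab) (P Q : ℕ → Trip) : ℕ :=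
  ∑ c ∈ Finset.range m, if g (P c) ≠ 0 ∧ g (Q c) ≠ 0 then 1 else 0

/-- Number of witnesses of a fact. Kind `0, 1` are the edge facts of a node (into and out of its
centre), `2, 3` relate a node to an older one, `4, 5` relate a node to a vertex (which reaches the
centre, or is reached from it), `6` is reachability between vertices. -/
def cnt (m : ℕ) (g : Tab) (t : Trip) : ℕ :=
  if t.1 < 4 then ip m g (fun z => (t.1 - 2, t.2.1, z)) (fun z => (7 - t.1, t.2.2, z))
  else if t.1 < 6 then (if g (t.1 - 4, t.2.1, t.2.2) ≠ 0 then 1 else 0) +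
    ip m g (fun j => (t.1 - 2, t.2.1, j)) (fun j => (t.1, j, t.2.2))
  else ip m g (fun k => (4, k, t.2.1)) (fun k => (5, k, t.2.2))

/-- The counters are exact; `L` lists the present facts without witnesses. The function `rk` orders
the nodes by age. -/
structure Core (m : ℕ) (rk : ℕ → ℕ) (g : Tab) (L : List Trip) : Prop where
  nodup : L.Nodup
  mem : ∀ t, t ∈ L ↔ Valid m t ∧ t.1 < 6 ∧ g t = 1
  edge : ∀ t, Valid m t → t.1 < 2 → g t ≤ 2
  rank : ∀ t, Valid m t → 2 ≤ t.1 → t.1 < 4 → g t ≠ 0 → rk t.2.2 < rk t.2.1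
  pres : ∀ t, Valid m t → 2 ≤ t.1 → t.1 < 6 → g t ≠ 0 → g t = 1 + cnt m g t
  abs : ∀ t, Valid m t → 2 ≤ t.1 → t.1 < 6 → g t = 0 → (t.1 < 4 → rk t.2.2 < rk t.2.1) →
    cnt m g t = 0
  reach : ∀ t, Valid m t → t.1 = 6 → g t = cnt m g t

theorem ip_congr {m : ℕ} {g g' : Tab} {P Q : ℕ → Trip}
    (h : ∀ c < m, (g (P c) ≠ 0 ∧ g (Q c) ≠ 0 ↔ g' (P c) ≠ 0 ∧ g' (Q c) ≠ 0)) :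
    ip m g P Q = ip m g' P Q := by
  refine Finset.sum_congr rfl fun c hc => ?_
  simp only [h c (Finset.mem_range.1 hc)]

theorem ip_drop {m : ℕ} {g g' : Tab} {P Q : ℕ → Trip} {f : Trip} {b : ℕ} (hb : b < m)
    (hf : g f ≠ 0) (hP : P b = f) (hP' : ∀ c < m, c ≠ b → P c ≠ f) (hQ : ∀ c < m, Q c ≠ f)
    (hpP : ∀ c < m, g' (P c) ≠ 0 ↔ g (P c) ≠ 0 ∧ P c ≠ f)
    (hpQ : ∀ c < m, g' (Q c) ≠ 0 ↔ g (Q c) ≠ 0 ∧ Q c ≠ f) :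
    ip m g P Q = ip m g' P Q + if g (Q b) ≠ 0 then 1 else 0 := by
  have hbm := Finset.mem_range.2 hb
  unfold ip
  rw [← Finset.add_sum_erase _ _ hbm, ← Finset.add_sum_erase _ _ hbm]
  have h1 : ∀ c ∈ (Finset.range m).erase b, (if g (P c) ≠ 0 ∧ g (Q c) ≠ 0 then 1 else 0) =
      if g' (P c) ≠ 0 ∧ g' (Q c) ≠ 0 then 1 else 0 := by
    intro c hc
    rw [Finset.mem_erase, Finset.mem_range] at hc
    simp only [hpP c hc.2, hpQ c hc.2, hP' c hc.2 hc.1, hQ c hc.2, ne_eq, not_false_eq_true,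
      and_true]
  rw [Finset.sum_congr rfl h1]
  have h2 : ¬ g' (P b) ≠ 0 := by rw [hpP b hb]; simp [hP]
  rw [not_not] at h2
  simp only [hP, hf, h2 ▸ congrArg g' hP.symm, ne_eq, not_false_eq_true, true_and,
    not_true_eq_false, false_and, if_false]
  omega

theorem ip_comm {m : ℕ} {g : Tab} {P Q : ℕ → Trip} : ip m g P Q = ip m g Q P := by
  unfold ip; simp only [and_comm]

/-- `g'` arises from `g` by the deletion of `f`: the other facts stay present, and neither the edge
facts nor the matrix (kind `7`) change otherwise. -/
structure After (m : ℕ) (f : Trip) (g g' : Tab) : Prop where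
  pres : ∀ t, Valid m t → t.1 < 6 → (g' t ≠ 0 ↔ g t ≠ 0 ∧ t ≠ f)
  edge : ∀ t, t.1 < 2 → t ≠ f → g' t = g t
  mat : ∀ t, t.1 = 7 → g' t = g t

/-- One step of the work list preserves exactness of the counters, given which heads are decremented
(`D`) and that these are the heads that lose a witness. -/
theorem Core.step {m : ℕ} {rk : ℕ → ℕ} {g g' : Tab} {L L' : List Trip} {f : Trip}
    (hC : Core m rk g (L ++ [f])) {D : Trip → Prop} [DecidablePred D]
    (hE : Eff D (g, L) (g', L')) (hD : ∀ t, D t → 2 ≤ t.1 ∧ t.1 < 7 ∧ Valid m t)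
    (hdrop : ∀ g'' : Tab, (∀ t, Valid m t → t.1 < 6 → (g'' t ≠ 0 ↔ g t ≠ 0 ∧ t ≠ f)) →
      ∀ t, Valid m t → 2 ≤ t.1 → t.1 < 7 → cnt m g t = cnt m g'' t + if D t then 1 else 0) :
    Core m rk (Function.update g' f 0) L' ∧ After m f g (Function.update g' f 0) := by
  obtain ⟨hE1, l, hl, hln, hlm⟩ := hE
  simp only at hE1 hl hlm
  have hf : Valid m f ∧ f.1 < 6 ∧ g f = 1 := (hC.mem f).1 (by simp)
  have hnd := hC.nodup
  rw [List.nodup_append'] at hnd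
  have hfL : f ∉ L := fun h => hnd.2.2 h (by simp)
  have hL : ∀ t, t ∈ L ↔ Valid m t ∧ t.1 < 6 ∧ g t = 1 ∧ t ≠ f := by
    intro t
    constructor
    · intro h
      obtain ⟨h1, h2, h3⟩ := (hC.mem t).1 (List.mem_append_left _ h)
      exact ⟨h1, h2, h3, fun h4 => hfL (h4 ▸ h)⟩
    · rintro ⟨h1, h2, h3, h4⟩
      have := (hC.mem t).2 ⟨h1, h2, h3⟩
      simpa [h4] using this
  -- a decremented fact still has its lost witness on the books, so its cell was at least 2
  have hsplit : ∀ t, Valid m t → t.1 < 7 → 2 ≤ t.1 → D t → 1 ≤ cnt m g t := by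
    intro t hv h6 h2 hd
    have := hdrop (fun t => if t = f then 0 else g t)
      (by intro t _ _; by_cases h : t = f <;> simp [h]) t hv h2 h6
    simp only [hd, if_true] at this
    omega
  have hge : ∀ t, D t → t.1 < 6 → g t ≠ 0 → 2 ≤ g t := by
    intro t hd h6 h0
    obtain ⟨h2, h7, hv⟩ := hD t hd
    have := hC.pres t hv h2 h6 h0
    have := hsplit t hv h7 h2 hd
    omega
  set g'' := Function.update g' f 0 with hg''
  have hff : g'' f = 0 := by simp [hg'']
  have hne : ∀ t, t ≠ f → g'' t = g' t := fun t h => by simp [hg'', h]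
  have hp : ∀ t, Valid m t → t.1 < 6 → (g'' t ≠ 0 ↔ g t ≠ 0 ∧ t ≠ f) := by
    intro t hv h6
    by_cases h : t = f
    · subst h; simp [hff]
    · rw [hne t h]
      by_cases hd : D t ∧ g t ≠ 0
      · have := hge t hd.1 h6 hd.2
        rw [(hE1 t).1 hd.1 hd.2]
        simp only [h, ne_eq, not_false_eq_true, and_true]; omega
      · rw [(hE1 t).2 (by tauto)]; simp [h]
  have hdr := hdrop g'' hp
  refine ⟨⟨?_, ?_, ?_, ?_, ?_, ?_, ?_⟩, hp, fun t h2 h4 => ?_, fun t h7 => ?_⟩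
  · rw [hl, List.nodup_append']
    refine ⟨hnd.1, hln, fun t h1 h2 => ?_⟩
    have := ((hL t).1 h1).2.2.1
    have := ((hlm t).1 h2).2.2
    omega
  · intro t
    rw [hl, List.mem_append, hL, hlm]
    constructor
    · rintro (⟨h1, h2, h3, h4⟩ | ⟨h1, h2, h3⟩)
      · refine ⟨h1, h2, ?_⟩
        rw [hne t h4, (hE1 t).2 (Or.inl fun hd => ?_), h3]
        have := hge t hd h2 (by omega)
        omega
      · refine ⟨(hD t h1).2.2, h2, ?_⟩
        have h4 : t ≠ f := by rintro rfl; omega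
        rw [hne t h4, (hE1 t).1 h1 (by omega), h3]
    · rintro ⟨h1, h2, h3⟩
      have h4 : t ≠ f := by rintro rfl; omega
      rw [hne t h4] at h3
      by_cases hd : D t ∧ g t ≠ 0
      · rw [(hE1 t).1 hd.1 hd.2] at h3
        exact Or.inr ⟨hd.1, h2, by omega⟩
      · rw [(hE1 t).2 (by tauto)] at h3
        exact Or.inl ⟨h1, h2, h3, h4⟩
  · intro t hv h2
    by_cases h4 : t = f
    · subst h4; omega
    · rw [hne t h4, (hE1 t).2 (Or.inl fun hd => by have := (hD t hd).1; omega)]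
      exact hC.edge t hv h2
  · intro t hv h2 h4 h0
    exact hC.rank t hv h2 h4 ((hp t hv (by omega)).1 h0).1
  · intro t hv h2 h6 h0
    obtain ⟨h1, h3⟩ := (hp t hv h6).1 h0
    have e1 := hdr t hv h2 (by omega)
    have e2 := hC.pres t hv h2 h6 h1
    rw [hne t h3]
    by_cases hd : D t
    · rw [(hE1 t).1 hd h1]; simp only [hd, if_true] at e1; omega
    · rw [(hE1 t).2 (Or.inl hd)]; simp only [hd, if_false] at e1; omega
  · intro t hv h2 h6 h0 hr
    have e1 := hdr t hv h2 (by omega)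
    have : cnt m g t = 0 := by
      by_cases h3 : t = f
      · subst h3
        have := hC.pres t hv h2 h6 (by omega)
        omega
      · refine hC.abs t hv h2 h6 ?_ hr
        by_contra h
        exact (hp t hv h6).2 ⟨h, h3⟩ h0
    omega
  · intro t hv h6
    have e1 := hdr t hv (by omega) (by omega)
    have e2 := hC.reach t hv h6
    have h3 : t ≠ f := by rintro rfl; omega
    rw [hne t h3]
    by_cases hd : D t
    · simp only [hd, if_true] at e1
      rw [(hE1 t).1 hd (by omega)]; omega
    · rw [(hE1 t).2 (Or.inl hd)]; simp only [hd, if_false] at e1; omega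
  · rw [hne t h4, (hE1 t).2 (Or.inl fun hd => by have := (hD t hd).1; omega)]
  · have h4 : t ≠ f := by rintro rfl; omega
    rw [hne t h4, (hE1 t).2 (Or.inl fun hd => by have := (hD t hd).2.1; omega)]

/-! ### Deletion of a fact -/

theorem trip_ne {k a b k' a' b' : ℕ} (h : k ≠ k' ∨ a ≠ a' ∨ b ≠ b') :
    ((k, a, b) : Trip) ≠ (k', a', b') := by
  simp only [ne_eq, Prod.mk.injEq]; tauto

section Deletion
variable {m : ℕ} {rk : ℕ → ℕ} {g : Tab} {L : List Trip} {s a b : ℕ}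

theorem Core.proc_edge (hC : Core m rk g (L ++ [(s, a, b)])) (hs : s < 2) :
    Core m rk (procA m (s, a, b) (g, L)).1 (procA m (s, a, b) (g, L)).2 ∧
      After m (s, a, b) g (procA m (s, a, b) (g, L)).1 := by
  classical
  obtain ⟨⟨-, ha, hb⟩, -, hf1⟩ := (hC.mem (s, a, b)).1 (by simp)
  simp only at ha hb
  have hf0 : g (s, a, b) ≠ 0 := by omega
  have e1 : s % 2 = s := by omega
  have e2 : s / 2 = 0 := by omega
  set c1 := decA true (s, a, b) (4 + s, a, b) (g, L) with hc1
  have E1 : Eff _ (g, L) c1 := eff_decA (by simp; omega)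
  have E2 := eff_sweepA (push := true) (P := fun i => ((5 - s, i, b) : Trip))
    (H := fun i => ((2 + s, a, i) : Trip)) (c := c1) (by intro i; simp; omega)
    (by intro i j h; simpa using h) (by intro i j; exact trip_ne (by omega)) m
  have hg : ∀ i, c1.1 (5 - s, i, b) = g (5 - s, i, b) := fun i =>
    (E1.1 _).2 (Or.inl fun h => absurd h.1 (trip_ne (by omega)))
  have E := (E1.comp E2 (by
    rintro t ⟨rfl, -⟩ ⟨i, -, h, -⟩; exact absurd h (trip_ne (by omega)))).congr
    (D₂ := fun t => t = (4 + s, a, b) ∨ (t.1 = 2 + s ∧ t.2.1 = a ∧ t.2.2 < m ∧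
      g (5 - s, t.2.2, b) ≠ 0)) (by
    rintro ⟨k, x, y⟩
    simp only [hg, hf0, ne_eq, not_false_eq_true, and_true, Prod.mk.injEq]
    refine or_congr Iff.rfl ⟨?_, ?_⟩
    · rintro ⟨i, hi, ⟨rfl, rfl, rfl⟩, h⟩; exact ⟨rfl, rfl, hi, h⟩
    · rintro ⟨rfl, rfl, hi, h⟩; exact ⟨y, hi, ⟨rfl, rfl, rfl⟩, h⟩)
  have hpr : procA m (s, a, b) (g, L) = (Function.update (sweepA true (fun i => (5 - s, i, b))
      (fun i => (2 + s, a, i)) m c1).1 (s, a, b) 0, (sweepA true (fun i => (5 - s, i, b))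
      (fun i => (2 + s, a, i)) m c1).2) := by
    simp only [procA, e1, e2, if_true, hc1]
  rw [hpr]
  refine hC.step E ?_ ?_
  · rintro ⟨k, x, y⟩ (h | ⟨h1, h2, h3, -⟩)
    · obtain ⟨rfl, rfl, rfl⟩ := Prod.mk.injEq .. ▸ (Prod.mk.injEq .. ▸ h)
      exact ⟨by simp only; omega, by simp only; omega, by simp only; omega, ha, hb⟩
    · simp only at h1 h2 h3
      subst h1 h2
      exact ⟨by simp, by simp only; omega, by simp only; omega, ha, h3⟩
  · rintro g'' hp ⟨k, x, y⟩ ⟨-, hx, hy⟩ h2 h7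
    simp only at hx hy h2 h7
    have hp' : ∀ k x y, k < 6 → x < m → y < m →
        (g'' (k, x, y) ≠ 0 ↔ g (k, x, y) ≠ 0 ∧ (k, x, y) ≠ (s, a, b)) :=
      fun k x y h1 h2 h3 => hp (k, x, y) ⟨by simp only; omega, h2, h3⟩ h1
    have hp2 : ∀ k x y, k < 6 → x < m → y < m → (k ≠ s ∨ x ≠ a ∨ y ≠ b) →
        (g (k, x, y) ≠ 0 ↔ g'' (k, x, y) ≠ 0) := by
      intro k x y h1 h2 h3 h4
      rw [hp' k x y h1 h2 h3]
      simp [trip_ne h4]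
    by_cases hk : k = 2 + s
    · subst hk
      have hD : ((2 + s, x, y) : Trip) ≠ (4 + s, a, b) := trip_ne (by omega)
      have e3 : 2 + s < 4 := by omega
      simp only [cnt, hD, false_or, e3, if_true, show 2 + s - 2 = s by omega,
        show 7 - (2 + s) = 5 - s by omega, true_and, hy]
      by_cases hxa : x = a
      · subst hxa
        simp only [true_and]
        exact ip_drop hb hf0 rfl (fun c _ h => trip_ne (by omega))
          (fun c _ => trip_ne (by omega)) (fun c h => hp' _ _ _ (by omega) hx h)
          (fun c h => hp' _ _ _ (by omega) hy h)
      · simp only [hxa, false_and, if_false, add_zero]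
        exact ip_congr fun c h => and_congr (hp2 _ _ _ (by omega) hx h (by omega))
          (hp2 _ _ _ (by omega) hy h (by omega))
    · simp only [hk, false_and, or_false]
      by_cases h4 : k < 4
      · have hD : ((k, x, y) : Trip) ≠ (4 + s, a, b) := trip_ne (by omega)
        simp only [cnt, h4, if_true, hD, if_false, add_zero]
        exact ip_congr fun c h => and_congr (hp2 _ _ _ (by omega) hx h (by omega))
          (hp2 _ _ _ (by omega) hy h (by omega))
      · by_cases h6 : k < 6
        · simp only [cnt, h4, h6, if_true, if_false]
          rw [ip_congr (g' := g'') fun c h => and_congr (hp2 _ _ _ (by omega) hx h (by omega))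
            (hp2 _ _ _ (by omega) h hy (by omega))]
          by_cases hD : ((k, x, y) : Trip) = (4 + s, a, b)
          · simp only [Prod.mk.injEq] at hD
            obtain ⟨rfl, rfl, rfl⟩ := hD
            have := hp' s x y (by omega) hx hy
            simp only [ne_eq, not_true_eq_false, and_false, iff_false, not_not] at this
            simp only [show 4 + s - 4 = s by omega, this, hf0, ne_eq, not_false_eq_true, if_true,
              not_true_eq_false, if_false]
            omega
          · simp only [hD, if_false, add_zero]
            have : k - 4 ≠ s ∨ x ≠ a ∨ y ≠ b := by
              by_contra h
              exact hD (by simp only [Prod.mk.injEq]; omega)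
            simp only [hp2 (k - 4) x y (by omega) hx hy this]
        · have hD : ((k, x, y) : Trip) ≠ (4 + s, a, b) := trip_ne (by omega)
          simp only [cnt, h4, h6, if_false, hD, add_zero]
          exact ip_congr fun c h => and_congr (hp2 _ _ _ (by omega) h hx (by omega))
            (hp2 _ _ _ (by omega) h hy (by omega))

theorem Core.proc_older (hC : Core m rk g (L ++ [(2 + s, a, b)])) (hs : s < 2) :
    Core m rk (procA m (2 + s, a, b) (g, L)).1 (procA m (2 + s, a, b) (g, L)).2 ∧
      After m (2 + s, a, b) g (procA m (2 + s, a, b) (g, L)).1 := by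
  classical
  obtain ⟨hv, -, hf1⟩ := (hC.mem (2 + s, a, b)).1 (by simp)
  have hf0 : g (2 + s, a, b) ≠ 0 := by omega
  have hab : b ≠ a := by
    have := hC.rank _ hv (by simp) (by simp only; omega) hf0
    simp only at this
    rintro rfl; omega
  obtain ⟨-, ha, hb⟩ := hv
  simp only at ha hb
  have e1 : (2 + s) % 2 = s := by omega
  have e2 : (2 + s) / 2 = 1 := by omega
  have E := (eff_sweepA (push := true) (P := fun i => ((4 + s, b, i) : Trip))
    (H := fun i => ((4 + s, a, i) : Trip)) (c := (g, L)) (by intro i; simp; omega)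
    (by intro i j h; simpa using h) (by intro i j; exact trip_ne (by omega)) m).congr
    (D₂ := fun t => t.1 = 4 + s ∧ t.2.1 = a ∧ t.2.2 < m ∧ g (4 + s, b, t.2.2) ≠ 0) (by
    rintro ⟨k, x, y⟩
    simp only [Prod.mk.injEq]
    constructor
    · rintro ⟨i, hi, ⟨rfl, rfl, rfl⟩, h⟩; exact ⟨rfl, rfl, hi, h⟩
    · rintro ⟨rfl, rfl, hi, h⟩; exact ⟨y, hi, ⟨rfl, rfl, rfl⟩, h⟩)
  have hpr : procA m (2 + s, a, b) (g, L) = (Function.update (sweepA true (fun i => (4 + s, b, i))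
      (fun i => (4 + s, a, i)) m (g, L)).1 (2 + s, a, b) 0, (sweepA true (fun i => (4 + s, b, i))
      (fun i => (4 + s, a, i)) m (g, L)).2) := by
    simp only [procA, e1, e2, if_true, one_ne_zero, if_false]
  rw [hpr]
  refine hC.step E ?_ ?_
  · rintro ⟨k, x, y⟩ ⟨h1, h2, h3, -⟩
    simp only at h1 h2 h3
    subst h1 h2
    exact ⟨by simp only; omega, by simp only; omega, by simp only; omega, ha, h3⟩
  · rintro g'' hp ⟨k, x, y⟩ ⟨-, hx, hy⟩ h2 h7
    simp only at hx hy h2 h7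
    have hp' : ∀ k x y, k < 6 → x < m → y < m →
        (g'' (k, x, y) ≠ 0 ↔ g (k, x, y) ≠ 0 ∧ (k, x, y) ≠ (2 + s, a, b)) :=
      fun k x y h1 h2 h3 => hp (k, x, y) ⟨by simp only; omega, h2, h3⟩ h1
    have hp2 : ∀ k x y, k < 6 → x < m → y < m → (k ≠ 2 + s ∨ x ≠ a ∨ y ≠ b) →
        (g (k, x, y) ≠ 0 ↔ g'' (k, x, y) ≠ 0) := by
      intro k x y h1 h2 h3 h4
      rw [hp' k x y h1 h2 h3]
      simp [trip_ne h4]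
    by_cases h4 : k < 4
    · have : k ≠ 4 + s := by omega
      simp only [cnt, h4, if_true, this, false_and, if_false, add_zero]
      exact ip_congr fun c h => and_congr (hp2 _ _ _ (by omega) hx h (by omega))
        (hp2 _ _ _ (by omega) hy h (by omega))
    · by_cases h6 : k < 6
      · simp only [cnt, h4, h6, if_true, if_false, hy, true_and]
        simp only [hp2 (k - 4) x y (by omega) hx hy (by omega)]
        by_cases hk : k = 4 + s ∧ x = a
        · obtain ⟨rfl, rfl⟩ := hk
          simp only [true_and, show 4 + s - 2 = 2 + s by omega]
          rw [add_assoc, ip_drop (g' := g'') hb hf0 rfl (fun c _ h => trip_ne (by omega))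
            (fun c _ => trip_ne (by omega)) (fun c h => hp' _ _ _ (by omega) hx h)
            (fun c h => hp' _ _ _ (by omega) h hy)]
        · have : ¬ (k = 4 + s ∧ x = a ∧ g (4 + s, b, y) ≠ 0) := by tauto
          simp only [this, if_false, add_zero]
          rw [ip_congr (g' := g'') fun c h => and_congr (hp2 _ _ _ (by omega) hx h (by omega))
            (hp2 _ _ _ (by omega) h hy (by omega))]
      · have : k ≠ 4 + s := by omega
        simp only [cnt, h4, h6, if_false, this, false_and, add_zero]
        exact ip_congr fun c h => and_congr (hp2 _ _ _ (by omega) h hx (by omega))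
            (hp2 _ _ _ (by omega) h hy (by omega))

theorem Core.proc_vertex (hC : Core m rk g (L ++ [(4 + s, a, b)])) (hs : s < 2) :
    Core m rk (procA m (4 + s, a, b) (g, L)).1 (procA m (4 + s, a, b) (g, L)).2 ∧
      After m (4 + s, a, b) g (procA m (4 + s, a, b) (g, L)).1 := by
  classical
  obtain ⟨hv, -, hf1⟩ := (hC.mem (4 + s, a, b)).1 (by simp)
  have hf0 : g (4 + s, a, b) ≠ 0 := by omega
  obtain ⟨-, ha, hb⟩ := hv
  simp only at ha hb
  have e1 : (4 + s) % 2 = s := by omega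
  have e2 : (4 + s) / 2 = 2 := by omega
  set c1 := sweepA true (fun i => ((2 + s, i, a) : Trip)) (fun i => ((4 + s, i, b) : Trip)) m (g, L)
    with hc1
  set c2 := sweepA true (fun i => ((1 - s, i, b) : Trip)) (fun i => ((3 - s, i, a) : Trip)) m c1
    with hc2
  set c3 := sweepA false (fun i => ((5 - s, a, i) : Trip))
    (fun i => ((6, (1 - s) * b + i * s, s * b + i * (1 - s)) : Trip)) m c2 with hc3
  have E1 : Eff _ (g, L) c1 := eff_sweepA (by intro i; simp; omega)
    (by intro i j h; simpa using h) (by intro i j; exact trip_ne (by omega)) m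
  have E2 : Eff _ c1 c2 := eff_sweepA (by intro i; simp; omega)
    (by intro i j h; simpa using h) (by intro i j; exact trip_ne (by omega)) m
  have E3 : Eff _ c2 c3 := eff_sweepA (by intro i; simp)
    (by intro i j h; obtain rfl | rfl : s = 0 ∨ s = 1 := by omega
        all_goals simpa using h) (by intro i j; exact trip_ne (by omega)) m
  have hg1 : ∀ i, c1.1 (1 - s, i, b) = g (1 - s, i, b) := fun i =>
    (E1.1 _).2 (Or.inl (by rintro ⟨j, -, h, -⟩; exact absurd h (trip_ne (by omega))))
  have hg2 : ∀ i, c2.1 (5 - s, a, i) = g (5 - s, a, i) := fun i => by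
    rw [(E2.1 _).2 (Or.inl (by rintro ⟨j, -, h, -⟩; exact absurd h (trip_ne (by omega)))),
      (E1.1 _).2 (Or.inl (by rintro ⟨j, -, h, -⟩; exact absurd h (trip_ne (by omega))))]
  have E := ((E1.comp E2 (by
    rintro t ⟨i, -, rfl, -⟩ ⟨j, -, h, -⟩; exact absurd h (trip_ne (by omega)))).comp E3 (by
    rintro t (⟨i, -, rfl, -⟩ | ⟨i, -, rfl, -⟩) ⟨j, -, h, -⟩ <;>
    exact absurd h (trip_ne (by omega)))).congr
    (D₂ := fun t => (t.2.1 < m ∧ t.2.2 < m) ∧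
      ((t.1 = 4 + s ∧ t.2.2 = b ∧ g (2 + s, t.2.1, a) ≠ 0) ∨
      (t.1 = 3 - s ∧ t.2.2 = a ∧ g (1 - s, t.2.1, b) ≠ 0) ∨
      (t.1 = 6 ∧ (s = 0 ∧ t.2.1 = b ∧ g (5, a, t.2.2) ≠ 0 ∨
        s = 1 ∧ t.2.2 = b ∧ g (4, a, t.2.1) ≠ 0)))) (by
    rintro ⟨k, x, y⟩
    simp only [hg1, hg2, Prod.mk.injEq]
    constructor
    · rintro ((⟨i, hi, ⟨rfl, rfl, rfl⟩, h⟩ | ⟨i, hi, ⟨rfl, rfl, rfl⟩, h⟩) |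
        ⟨i, hi, ⟨rfl, rfl, rfl⟩, h⟩)
      · exact ⟨⟨hi, hb⟩, Or.inl ⟨rfl, rfl, h⟩⟩
      · exact ⟨⟨hi, ha⟩, Or.inr (Or.inl ⟨rfl, rfl, h⟩)⟩
      · obtain rfl | rfl : s = 0 ∨ s = 1 := by omega
        · exact ⟨by simp; omega, Or.inr (Or.inr ⟨rfl, Or.inl ⟨rfl, by simp, by simpa using h⟩⟩)⟩
        · exact ⟨by simp; omega, Or.inr (Or.inr ⟨rfl, Or.inr ⟨rfl, by simp, by simpa using h⟩⟩)⟩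
    · rintro ⟨⟨hx, hy⟩, ⟨rfl, rfl, h⟩ | ⟨rfl, rfl, h⟩ | ⟨rfl, ⟨rfl, rfl, h⟩ | ⟨rfl, rfl, h⟩⟩⟩
      · exact Or.inl (Or.inl ⟨x, hx, ⟨rfl, rfl, rfl⟩, h⟩)
      · exact Or.inl (Or.inr ⟨x, hx, ⟨rfl, rfl, rfl⟩, h⟩)
      · exact Or.inr ⟨y, hy, by simp, by simpa using h⟩
      · exact Or.inr ⟨x, hx, by simp, by simpa using h⟩)
  have hpr : procA m (4 + s, a, b) (g, L) = (Function.update c3.1 (4 + s, a, b) 0, c3.2) := by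
    simp only [procA, e1, e2, if_false, OfNat.ofNat_ne_zero, OfNat.ofNat_ne_one, hc1, hc2, hc3]
  rw [hpr]
  refine hC.step E ?_ ?_
  · rintro ⟨k, x, y⟩ ⟨⟨hx, hy⟩, h⟩
    simp only at hx hy h
    have : 2 ≤ k ∧ k < 7 := by omega
    exact ⟨this.1, this.2, by simp only; omega, hx, hy⟩
  · rintro g'' hp ⟨k, x, y⟩ ⟨-, hx, hy⟩ h2 h7
    simp only at hx hy h2 h7
    have hp' : ∀ k x y, k < 6 → x < m → y < m →
        (g'' (k, x, y) ≠ 0 ↔ g (k, x, y) ≠ 0 ∧ (k, x, y) ≠ (4 + s, a, b)) :=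
      fun k x y h1 h2 h3 => hp (k, x, y) ⟨by simp only; omega, h2, h3⟩ h1
    have hp2 : ∀ k x y, k < 6 → x < m → y < m → (k ≠ 4 + s ∨ x ≠ a ∨ y ≠ b) →
        (g (k, x, y) ≠ 0 ↔ g'' (k, x, y) ≠ 0) := by
      intro k x y h1 h2 h3 h4
      rw [hp' k x y h1 h2 h3]
      simp [trip_ne h4]
    simp only [hx, hy, true_and]
    by_cases h4 : k < 4
    · have hk1 : k ≠ 4 + s := by omega
      have hk2 : k ≠ 6 := by omega
      simp only [cnt, h4, if_true, hk1, hk2, false_and, or_false, false_or]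
      by_cases hk : k = 3 - s ∧ y = a
      · obtain ⟨rfl, rfl⟩ := hk
        simp only [true_and, show 3 - s - 2 = 1 - s by omega, show 7 - (3 - s) = 4 + s by omega]
        rw [ip_comm, ip_comm (g := g'')]
        exact ip_drop hb hf0 rfl (fun c _ h => trip_ne (by omega))
            (fun c _ => trip_ne (by omega)) (fun c h => hp' _ _ _ (by omega) hy h)
            (fun c h => hp' _ _ _ (by omega) hx h)
      · have : ¬ (k = 3 - s ∧ y = a ∧ g (1 - s, x, b) ≠ 0) := by tauto
        simp only [this, if_false, add_zero]
        exact ip_congr fun c h => and_congr (hp2 _ _ _ (by omega) hx h (by omega))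
          (hp2 _ _ _ (by omega) hy h (by omega))
    · by_cases h6 : k < 6
      · have hk1 : k ≠ 3 - s := by omega
        have hk2 : k ≠ 6 := by omega
        simp only [cnt, h4, h6, if_true, if_false, hk1, hk2, false_and, or_false]
        simp only [hp2 (k - 4) x y (by omega) hx hy (by omega)]
        by_cases hk : k = 4 + s ∧ y = b
        · obtain ⟨rfl, rfl⟩ := hk
          simp only [true_and, show 4 + s - 2 = 2 + s by omega]
          rw [add_assoc, ip_comm, ip_comm (g := g''),
            ip_drop (g' := g'') ha hf0 rfl (fun c _ h => trip_ne (by omega))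
            (fun c _ => trip_ne (by omega)) (fun c h => hp' _ _ _ (by omega) h hy)
            (fun c h => hp' _ _ _ (by omega) hx h)]
        · have : ¬ (k = 4 + s ∧ y = b ∧ g (2 + s, x, a) ≠ 0) := by tauto
          simp only [this, if_false, add_zero]
          rw [ip_congr (g' := g'') fun c h => and_congr (hp2 _ _ _ (by omega) hx h (by omega))
            (hp2 _ _ _ (by omega) h hy (by omega))]
      · obtain rfl : k = 6 := by omega
        have hk1 : 6 ≠ 4 + s := by omega
        have hk2 : 6 ≠ 3 - s := by omega
        simp only [cnt, h4, h6, if_false, hk1, hk2, false_and, false_or, true_and]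
        obtain rfl | rfl : s = 0 ∨ s = 1 := by omega
        · simp only [true_and, zero_ne_one, false_and, or_false]
          by_cases hk : x = b
          · subst hk
            simp only [true_and]
            exact ip_drop (g' := g'') ha hf0 rfl (fun c _ h => trip_ne (by omega))
              (fun c _ => trip_ne (by omega)) (fun c h => hp' _ _ _ (by omega) h hx)
              (fun c h => hp' _ _ _ (by omega) h hy)
          · simp only [hk, false_and, if_false, add_zero]
            exact ip_congr fun c h => and_congr (hp2 _ _ _ (by omega) h hx (by omega))
              (hp2 _ _ _ (by omega) h hy (by omega))
        · simp only [true_and, one_ne_zero, false_and, false_or]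
          by_cases hk : y = b
          · subst hk
            simp only [true_and]
            rw [ip_comm, ip_comm (g := g'')]
            exact ip_drop (g' := g'') ha hf0 rfl (fun c _ h => trip_ne (by omega))
              (fun c _ => trip_ne (by omega)) (fun c h => hp' _ _ _ (by omega) h hy)
              (fun c h => hp' _ _ _ (by omega) h hx)
          · simp only [hk, false_and, if_false, add_zero]
            exact ip_congr fun c h => and_congr (hp2 _ _ _ (by omega) h hx (by omega))
              (hp2 _ _ _ (by omega) h hy (by omega))

/-- The deletion of a dead fact decrements precisely the counters that lose a witness by it, so the
counters stay exact. -/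
theorem Core.proc {f : Trip} (hC : Core m rk g (L ++ [f])) :
    Core m rk (procA m f (g, L)).1 (procA m f (g, L)).2 ∧
      After m f g (procA m f (g, L)).1 := by
  obtain ⟨-, h6, -⟩ := (hC.mem f).1 (by simp)
  obtain ⟨k, a, b⟩ := f
  simp only at h6
  by_cases h2 : k < 2
  · exact hC.proc_edge h2
  by_cases h4 : k < 4
  · obtain ⟨s, rfl⟩ : ∃ s, k = 2 + s := ⟨k - 2, by omega⟩
    exact hC.proc_older (by omega)
  · obtain ⟨s, rfl⟩ : ∃ s, k = 4 + s := ⟨k - 4, by omega⟩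
    exact hC.proc_vertex (by omega)

end Deletion

/-- Marking the edge fact `t` for deletion. -/
def killA (t : Trip) (c : Cfg) : Cfg :=
  if 2 ≤ c.1 t then (Function.update c.1 t 1, c.2 ++ [t]) else c

section Kill
variable {m : ℕ} {rk : ℕ → ℕ} {g g' : Tab} {L : List Trip}

theorem cnt_congr (h : ∀ t, Valid m t → t.1 < 6 → (g t ≠ 0 ↔ g' t ≠ 0)) {t : Trip}
    (ht : Valid m t) (h2 : 2 ≤ t.1) (h6 : t.1 < 7) : cnt m g t = cnt m g' t := by
  obtain ⟨k, x, y⟩ := t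
  obtain ⟨-, hx, hy⟩ := ht
  simp only at h2 h6 hx hy
  have h' : ∀ k x y, k < 6 → x < m → y < m → (g (k, x, y) ≠ 0 ↔ g' (k, x, y) ≠ 0) :=
    fun k x y h1 h2 h3 => h (k, x, y) ⟨by simp only; omega, h2, h3⟩ h1
  unfold cnt
  simp only
  by_cases h4 : k < 4
  · simp only [h4, if_true]
    exact ip_congr fun c hc => and_congr (h' _ _ _ (by omega) hx hc) (h' _ _ _ (by omega) hy hc)
  by_cases h5 : k < 6
  · simp only [h4, h5, if_false, if_true, h' (k - 4) x y (by omega) hx hy]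
    rw [ip_congr (g' := g')
      fun c hc => and_congr (h' _ _ _ (by omega) hx hc) (h' _ _ _ (by omega) hc hy)]
  · simp only [h4, h5, if_false]
    exact ip_congr fun c hc => and_congr (h' _ _ _ (by omega) hc hx) (h' _ _ _ (by omega) hc hy)

theorem killA_fst (t t' : Trip) (c : Cfg) :
    (killA t c).1 t' = if t' = t ∧ 2 ≤ c.1 t then 1 else c.1 t' := by
  unfold killA
  by_cases h : 2 ≤ c.1 t
  · simp [h, Function.update_apply]
  · simp [h]

theorem killA_ne_zero (t t' : Trip) (c : Cfg) : (killA t c).1 t' ≠ 0 ↔ c.1 t' ≠ 0 := by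
  rw [killA_fst]
  split_ifs with h
  · obtain ⟨rfl, h⟩ := h; simp; omega
  · rfl

/-- Edge facts have no witnesses, so marking one puts it on the work list and changes nothing else. -/
theorem Core.kill (hC : Core m rk g L) {t : Trip} (ht : Valid m t) (h2 : t.1 < 2) :
    Core m rk (killA t (g, L)).1 (killA t (g, L)).2 := by
  have hp := fun t' => killA_ne_zero t t' (g, L)
  simp only at hp
  by_cases hg : 2 ≤ g t
  swap
  · have : killA t (g, L) = (g, L) := by simp [killA, hg]
    rwa [this]
  have hv : ∀ t', t' ≠ t → (killA t (g, L)).1 t' = g t' := fun t' h => by rw [killA_fst]; simp [h]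
  have hv' : (killA t (g, L)).1 t = 1 := by rw [killA_fst]; simp [hg]
  have hL : (killA t (g, L)).2 = L ++ [t] := by simp [killA, hg]
  have hcnt : ∀ t', Valid m t' → 2 ≤ t'.1 → t'.1 < 7 → cnt m (killA t (g, L)).1 t' = cnt m g t' :=
    fun t' h h3 h4 => cnt_congr (fun t' _ _ => hp t') h h3 h4
  have hne : ∀ t' : Trip, 2 ≤ t'.1 → t' ≠ t := by rintro t' h rfl; omega
  refine ⟨?_, ?_, ?_, ?_, ?_, ?_, ?_⟩
  · rw [hL, List.nodup_append']
    refine ⟨hC.nodup, by simp, fun a ha h => ?_⟩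
    obtain rfl := List.mem_singleton.1 h
    have := ((hC.mem _).1 ha).2.2
    omega
  · intro t'
    rw [hL, List.mem_append, hC.mem, List.mem_singleton]
    by_cases h : t' = t
    · subst h; simp [hv', ht]; omega
    · simp [h, hv t' h]
  · intro t' h3 h4
    by_cases h : t' = t
    · subst h; omega
    · rw [hv t' h]; exact hC.edge t' h3 h4
  · intro t' h3 h4 h5 h6; exact hC.rank t' h3 h4 h5 ((hp t').1 h6)
  · intro t' h3 h4 h5 h6
    rw [hv t' (hne t' h4), hcnt t' h3 h4 (by omega)]
    exact hC.pres t' h3 h4 h5 ((hp t').1 h6)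
  · intro t' h3 h4 h5 h6
    rw [hv t' (hne t' h4)] at h6
    rw [hcnt t' h3 h4 (by omega)]
    exact hC.abs t' h3 h4 h5 h6
  · intro t' h3 h4
    rw [hv t' (hne t' (by omega)), hcnt t' h3 (by omega) (by omega)]
    exact hC.reach t' h3 h4

end Kill

/-- Number of present facts in the rows `lo, …, hi - 1`. -/
def nPres (m lo hi : ℕ) (g : Tab) : ℕ :=
  ((Finset.range 6 ×ˢ (Finset.Ico lo hi ×ˢ Finset.range m)).filter fun t => g t ≠ 0).card

theorem nPres_mono {m lo hi : ℕ} {g g' : Tab} (hm : hi ≤ m)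
    (h : ∀ t, Valid m t → t.1 < 6 → lo ≤ t.2.1 → t.2.1 < hi → g' t ≠ 0 → g t ≠ 0) :
    nPres m lo hi g' ≤ nPres m lo hi g := by
  refine Finset.card_le_card fun t ht => ?_
  simp only [Finset.mem_filter, Finset.mem_product, Finset.mem_range, Finset.mem_Ico] at ht ⊢
  obtain ⟨⟨h1, ⟨h2, h3⟩, h4⟩, h5⟩ := ht
  exact ⟨⟨h1, ⟨h2, h3⟩, h4⟩, h t ⟨by omega, by omega, h4⟩ h1 h2 h3 h5⟩

/-- The number of present facts is the potential that pays for the deletions of facts. -/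
theorem nPres_lt {m : ℕ} {g g' : Tab} {f : Trip} (h : After m f g g') (hf : Valid m f)
    (h6 : f.1 < 6) (h0 : g f ≠ 0) : nPres m 0 m g' < nPres m 0 m g := by
  refine Finset.card_lt_card ⟨fun t ht => ?_, fun hs => ?_⟩
  · simp only [Finset.mem_filter, Finset.mem_product, Finset.mem_range, Finset.mem_Ico] at ht ⊢
    obtain ⟨⟨h1, ⟨h2, h3⟩, h4⟩, h5⟩ := ht
    exact ⟨⟨h1, ⟨h2, h3⟩, h4⟩, ((h.pres t ⟨by omega, by omega, h4⟩ h1).1 h5).1⟩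
  · have h1 : f ∈ (Finset.range 6 ×ˢ (Finset.Ico 0 m ×ˢ Finset.range m)).filter
        fun t => g t ≠ 0 := by
      simp only [Finset.mem_filter, Finset.mem_product, Finset.mem_range, Finset.mem_Ico]
      exact ⟨⟨h6, ⟨Nat.zero_le _, hf.2.1⟩, hf.2.2⟩, h0⟩
    have h2 := (Finset.mem_filter.1 (hs h1)).2
    exact ((h.pres f hf h6).1 h2).2 rfl

theorem nPres_split {m n : ℕ} (hn : n ≤ m) (g : Tab) :
    nPres m 0 m g = nPres m 0 n g + nPres m n m g := by
  unfold nPres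
  rw [← Finset.card_union_of_disjoint]
  · congr 1
    ext t
    simp only [Finset.mem_filter, Finset.mem_product, Finset.mem_range, Finset.mem_Ico,
      Finset.mem_union]
    constructor
    · rintro ⟨⟨h1, ⟨h2, h3⟩, h4⟩, h5⟩
      by_cases h : t.2.1 < n
      · exact Or.inl ⟨⟨h1, ⟨h2, h⟩, h4⟩, h5⟩
      · exact Or.inr ⟨⟨h1, ⟨by omega, h3⟩, h4⟩, h5⟩
    · rintro (⟨⟨h1, ⟨h2, h3⟩, h4⟩, h5⟩ | ⟨⟨h1, ⟨h2, h3⟩, h4⟩, h5⟩)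
      · exact ⟨⟨h1, ⟨h2, by omega⟩, h4⟩, h5⟩
      · exact ⟨⟨h1, ⟨by omega, h3⟩, h4⟩, h5⟩
  · rw [Finset.disjoint_left]
    intro t h1 h2
    simp only [Finset.mem_filter, Finset.mem_product, Finset.mem_range, Finset.mem_Ico] at h1 h2
    omega

theorem nPres_le {m lo hi : ℕ} (g : Tab) : nPres m lo hi g ≤ 6 * ((hi - lo) * m) := by
  refine (Finset.card_filter_le _ _).trans ?_
  simp

/-- What remains after the work list has been emptied. -/
structure Casc (m : ℕ) (g g' : Tab) : Prop where
  pres : ∀ t, Valid m t → t.1 < 6 → g' t ≠ 0 → g t ≠ 0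
  edge : ∀ t, Valid m t → t.1 < 2 → g t ≠ 1 → g' t = g t
  one : ∀ t, Valid m t → t.1 < 2 → g t = 1 → g' t ≤ 1
  mat : ∀ t, t.1 = 7 → g' t = g t

theorem Casc.refl (m : ℕ) (g : Tab) : Casc m g g :=
  ⟨fun _ _ _ h => h, fun _ _ _ _ => rfl, fun _ _ _ h => h.le, fun _ _ => rfl⟩

/-- Only marked edge facts are ever deleted among the edge facts. -/
theorem Casc.step {m : ℕ} {g g' g'' : Tab} {f : Trip} (h : Casc m g g') (h' : After m f g' g'')
    (hf : g' f = 1) : Casc m g g'' := by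
  refine ⟨fun t hv h6 h0 => h.pres t hv h6 ((h'.pres t hv h6).1 h0).1, fun t hv h2 h1 => ?_,
    fun t hv h2 h1 => ?_, fun t h7 => (h'.mat t h7).trans (h.mat t h7)⟩
  · have e := h.edge t hv h2 h1
    rw [h'.edge t h2 (by rintro rfl; omega), e]
  · by_cases hf : t = f
    · subst hf
      have := h'.pres t hv (by omega)
      simp only [ne_eq, not_true_eq_false, and_false, iff_false, not_not] at this
      omega
    · rw [h'.edge t h2 hf]
      exact h.one t hv h2 h1

/-! ### Insertion of a node -/

/-- Stored value of a fact with `x` witnesses. -/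
def up (x : ℕ) : ℕ := if x = 0 then 0 else x + 1

theorem up_ne_zero {x : ℕ} : up x ≠ 0 ↔ x ≠ 0 := by unfold up; split_ifs <;> simp_all

/-- Number of indices at which both functions are nonzero. -/
def ipp (m : ℕ) (p q : ℕ → ℕ) : ℕ := ∑ c ∈ Finset.range m, if p c ≠ 0 ∧ q c ≠ 0 then 1 else 0

/-- `z` is an in-neighbour (`s = 0`) or an out-neighbour (`s = 1`) of `v`, or `v` itself. -/
def Nbr (g : Tab) (s v z : ℕ) : Prop :=
  z = v ∨ (s = 0 ∧ g (7, z, v) ≠ 0) ∨ (s = 1 ∧ g (7, v, z) ≠ 0)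

/-- `g'` arises from `g` by (re)computing the row of node `k` with centre `v`. -/
structure AddSpec (m k v : ℕ) (g g' : Tab) : Prop where
  edge : ∀ s < 2, ∀ z < m, (Nbr g s v z → g' (s, k, z) = 2) ∧ (¬ Nbr g s v z → g' (s, k, z) = 0)
  older : ∀ s < 2, ∀ j < m, g' (2 + s, k, j) =
    up (ipp m (fun z => g' (s, k, z)) fun z => g (5 - s, j, z))
  vert : ∀ s < 2, ∀ x < m, g' (4 + s, k, x) = up ((if g' (s, k, x) ≠ 0 then 1 else 0) +
    ipp m (fun j => g' (2 + s, k, j)) fun j => g (4 + s, j, x))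
  reach : ∀ x < m, ∀ y < m, g' (6, x, y) =
    g (6, x, y) + if g' (4, k, x) ≠ 0 ∧ g' (5, k, y) ≠ 0 then 1 else 0
  rest : ∀ t, Valid m t → t.1 < 6 → t.2.1 ≠ k → g' t = g t
  mat : ∀ t, Valid m t → t.1 = 7 → g' t = g t

theorem ipp_congr {m : ℕ} {p q p' q' : ℕ → ℕ}
    (h : ∀ c < m, (p c ≠ 0 ∧ q c ≠ 0 ↔ p' c ≠ 0 ∧ q' c ≠ 0)) : ipp m p q = ipp m p' q' := by
  refine Finset.sum_congr rfl fun c hc => ?_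
  simp only [h c (Finset.mem_range.1 hc)]

theorem ipp_ne_zero {m : ℕ} {p q : ℕ → ℕ} : ipp m p q ≠ 0 ↔ ∃ c < m, p c ≠ 0 ∧ q c ≠ 0 := by
  unfold ipp
  rw [ne_eq, Finset.sum_eq_zero_iff]
  simp

theorem ip_eq {m : ℕ} {g : Tab} {P Q : ℕ → Trip} :
    ip m g P Q = ipp m (fun c => g (P c)) fun c => g (Q c) := rfl

theorem ipp_le {m : ℕ} {p q : ℕ → ℕ} : ipp m p q ≤ m := by
  unfold ipp
  refine (Finset.sum_le_sum (g := fun _ => 1) fun c _ => ?_).trans (by simp)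
  split_ifs <;> simp

/-- A new node, ranked above all others, has its counters computed from the older nodes, none of whose
facts refers to it. -/
theorem Core.add {m k v : ℕ} {rk : ℕ → ℕ} {g g' : Tab} (hC : Core m rk g []) (hk : k < m)
    (hA : AddSpec m k v g g') (h0 : ∀ t, Valid m t → t.1 < 6 → t.2.1 = k → g t = 0)
    {R : ℕ} (hR : ∀ j < m, rk j < R) : Core m (Function.update rk k R) g' [] := by
  have h0' : ∀ i y, i < 6 → y < m → g (i, k, y) = 0 := fun i y h1 h2 =>
    h0 (i, k, y) ⟨by simp only; omega, hk, h2⟩ h1 rfl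
  have hr : ∀ i x y, i < 6 → x < m → y < m → x ≠ k → g' (i, x, y) = g (i, x, y) :=
    fun i x y h1 h2 h3 h4 => hA.rest (i, x, y) ⟨by simp only; omega, h2, h3⟩ h1 h4
  have hrk : ∀ j, j ≠ k → Function.update rk k R j = rk j := fun j h => by simp [h]
  have hrkk : Function.update rk k R k = R := by simp
  -- nothing depends on the new node yet
  have hcol : ∀ s < 2, ∀ x < m, x ≠ k → g (2 + s, x, k) = 0 := by
    intro s hs x hx hxk
    by_contra h
    have hv : Valid m (2 + s, x, k) := ⟨by simp only; omega, hx, hk⟩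
    have h1 := hC.pres _ hv (by simp) (by simp only; omega) h
    have h2 : cnt m g (2 + s, x, k) = 0 := by
      simp only [cnt, show 2 + s < 4 by omega, if_true, show 7 - (2 + s) = 5 - s by omega]
      rw [ip_eq]
      by_contra h3
      obtain ⟨c, hc, -, h4⟩ := ipp_ne_zero.1 h3
      exact h4 (h0' _ _ (by omega) hc)
    have := (hC.mem (2 + s, x, k)).2 ⟨hv, by simp only; omega, by omega⟩
    simp at this
  have hdiag : ∀ s < 2, g' (2 + s, k, k) = 0 := by
    intro s hs
    rw [hA.older s hs k hk]
    by_contra h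
    obtain ⟨c, hc, -, h4⟩ := ipp_ne_zero.1 (up_ne_zero.1 h)
    exact h4 (h0' _ _ (by omega) hc)
  have holder : ∀ s < 2, ∀ j < m, j ≠ k → g' (2 + s, k, j) = up (cnt m g' (2 + s, k, j)) := by
    intro s hs j hj hjk
    rw [hA.older s hs j hj]
    simp only [cnt, show 2 + s < 4 by omega, if_true, show 7 - (2 + s) = 5 - s by omega,
      show 2 + s - 2 = s by omega, ip_eq]
    congr 1
    exact ipp_congr fun c hc => by rw [hr (5 - s) j c (by omega) hj hc hjk]
  have hvert : ∀ s < 2, ∀ x < m, g' (4 + s, k, x) = up (cnt m g' (4 + s, k, x)) := by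
    intro s hs x hx
    rw [hA.vert s hs x hx]
    simp only [cnt, show ¬ 4 + s < 4 by omega, show 4 + s < 6 by omega, if_true, if_false,
      show 4 + s - 4 = s by omega, show 4 + s - 2 = 2 + s by omega, ip_eq]
    congr 2
    refine ipp_congr fun c hc => ?_
    by_cases hck : c = k
    · subst hck; simp [hdiag s hs]
    · rw [hr (4 + s) c x (by omega) hc hx hck]
  have hother : ∀ i x y, 2 ≤ i → i < 6 → x < m → y < m → x ≠ k → (i < 4 → y ≠ k) →
      cnt m g' (i, x, y) = cnt m g (i, x, y) := by
    intro i x y h2 h6 hx hy hxk hyk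
    unfold cnt
    simp only
    by_cases h4 : i < 4
    · simp only [h4, if_true]
      refine ip_congr fun c hc => ?_
      rw [hr _ _ _ (by omega) hx hc hxk, hr _ _ _ (by omega) hy hc (hyk h4)]
    · simp only [h4, h6, if_false, if_true]
      rw [hr (i - 4) x y (by omega) hx hy hxk]
      congr 1
      refine ip_congr fun c hc => ?_
      rw [hr _ _ _ (by omega) hx hc hxk]
      by_cases hck : c = k
      · subst hck
        have := hcol (i - 4) (by omega) x hx hxk
        rw [show 2 + (i - 4) = i - 2 by omega] at this
        simp [this]
      · rw [hr _ _ _ (by omega) hc hy hck]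
  have hup1 : ∀ x, up x ≠ 1 := by intro x; unfold up; split_ifs <;> omega
  have hup : ∀ x, up x ≠ 0 → up x = 1 + x := by intro x h; unfold up at *; split_ifs at * <;> omega
  have hup0 : ∀ x, up x = 0 → x = 0 := by intro x h; unfold up at *; split_ifs at * <;> omega
  refine ⟨List.nodup_nil, ?_, ?_, ?_, ?_, ?_, ?_⟩
  · rintro ⟨i, x, y⟩
    simp only [List.not_mem_nil, false_iff]
    rintro ⟨⟨h8, hx, hy⟩, h6, h1⟩
    simp only at h8 hx hy h6
    by_cases hxk : x = k
    · subst hxk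
      by_cases h2 : i < 2
      · have := hA.edge i h2 y hy
        by_cases hn : Nbr g i v y
        · have := this.1 hn; omega
        · have := this.2 hn; omega
      · by_cases h4 : i < 4
        · have := hA.older (i - 2) (by omega) y hy
          rw [show 2 + (i - 2) = i by omega, h1] at this
          exact hup1 _ this.symm
        · have := hA.vert (i - 4) (by omega) y hy
          rw [show 4 + (i - 4) = i by omega, h1] at this
          exact hup1 _ this.symm
    · rw [hr i x y h6 hx hy hxk] at h1
      have := (hC.mem (i, x, y)).2 ⟨⟨h8, hx, hy⟩, h6, h1⟩
      simp at this
  · rintro ⟨i, x, y⟩ ⟨h8, hx, hy⟩ h2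
    simp only at hx hy h2
    by_cases hxk : x = k
    · subst hxk
      have := hA.edge i h2 y hy
      by_cases hn : Nbr g i v y
      · have := this.1 hn; omega
      · have := this.2 hn; omega
    · rw [hr i x y (by omega) hx hy hxk]
      exact hC.edge (i, x, y) ⟨h8, hx, hy⟩ h2
  · rintro ⟨i, x, y⟩ ⟨h8, hx, hy⟩ h2 h4 h
    simp only at hx hy h2 h4 ⊢
    obtain ⟨s, rfl⟩ : ∃ s, i = 2 + s := ⟨i - 2, by omega⟩
    by_cases hxk : x = k
    · subst hxk
      by_cases hyk : y = x
      · subst hyk; exact absurd (hdiag s (by omega)) h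
      · rw [hrkk, hrk y hyk]; exact hR y hy
    · rw [hr _ x y (by omega) hx hy hxk] at h
      by_cases hyk : y = k
      · subst hyk; exact absurd (hcol s (by omega) x hx hxk) h
      · rw [hrk x hxk, hrk y hyk]
        exact hC.rank (2 + s, x, y) ⟨h8, hx, hy⟩ (by simp) h4 h
  · rintro ⟨i, x, y⟩ ⟨h8, hx, hy⟩ h2 h6 h
    simp only at hx hy h2 h6
    by_cases hxk : x = k
    · subst hxk
      by_cases h4 : i < 4
      · obtain ⟨s, rfl⟩ : ∃ s, i = 2 + s := ⟨i - 2, by omega⟩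
        by_cases hyk : y = x
        · subst hyk; exact absurd (hdiag s (by omega)) h
        · have := holder s (by omega) y hy hyk
          rw [this] at h ⊢
          exact hup _ h
      · obtain ⟨s, rfl⟩ : ∃ s, i = 4 + s := ⟨i - 4, by omega⟩
        have := hvert s (by omega) y hy
        rw [this] at h ⊢
        exact hup _ h
    · rw [hr _ x y (by omega) hx hy hxk] at h ⊢
      rw [hother i x y h2 h6 hx hy hxk]
      · exact hC.pres (i, x, y) ⟨h8, hx, hy⟩ h2 h6 h
      · rintro h4 rfl
        have := hcol (i - 2) (by omega) x hx hxk
        rw [show 2 + (i - 2) = i by omega] at this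
        exact h this
  · rintro ⟨i, x, y⟩ ⟨h8, hx, hy⟩ h2 h6 h hrank
    simp only at hx hy h2 h6 hrank
    by_cases hxk : x = k
    · subst hxk
      by_cases h4 : i < 4
      · obtain ⟨s, rfl⟩ : ∃ s, i = 2 + s := ⟨i - 2, by omega⟩
        have hyk : y ≠ x := by rintro rfl; exact lt_irrefl _ (hrank h4)
        rw [holder s (by omega) y hy hyk] at h
        exact hup0 _ h
      · obtain ⟨s, rfl⟩ : ∃ s, i = 4 + s := ⟨i - 4, by omega⟩
        rw [hvert s (by omega) y hy] at h
        exact hup0 _ h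
    · have hyk : i < 4 → y ≠ k := by
        rintro h4 rfl
        have := hrank h4
        rw [hrkk, hrk x hxk] at this
        have := hR x hx
        omega
      rw [hr _ x y (by omega) hx hy hxk] at h
      rw [hother i x y h2 h6 hx hy hxk hyk]
      refine hC.abs (i, x, y) ⟨h8, hx, hy⟩ h2 h6 h fun h4 => ?_
      have := hrank h4
      rwa [hrk x hxk, hrk y (hyk h4)] at this
  · rintro ⟨i, x, y⟩ ⟨h8, hx, hy⟩ h6
    simp only at hx hy h6
    subst h6
    rw [hA.reach x hx y hy, hC.reach (6, x, y) ⟨h8, hx, hy⟩ rfl]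
    have hkm := Finset.mem_range.2 hk
    simp only [cnt, ip, show ¬ 6 < 4 by omega, show ¬ 6 < 6 by omega, if_false]
    rw [← Finset.add_sum_erase _ _ hkm, ← Finset.add_sum_erase _ _ hkm]
    simp only [h0' 4 x (by omega) hx, ne_eq, not_true_eq_false, false_and, if_false, zero_add]
    rw [add_comm]
    congr 1
    refine Finset.sum_congr rfl fun c hc => ?_
    rw [Finset.mem_erase, Finset.mem_range] at hc
    rw [hr 4 c x (by omega) hc.2 hx hc.1, hr 5 c y (by omega) hc.2 hy hc.1]

/-! ### The counters describe reachability -/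

open Relation (ReflTransGen)

/-- The edge facts of the nodes present edges of `X`, incident to the centres `vtx k` of the nodes;
every node in use has its centre as a trivial neighbour; every edge of `X` belongs to some node. -/
structure Nodes (m : ℕ) (vtx : ℕ → ℕ) (X : ℕ → ℕ → Prop) (g : Tab) : Prop where
  snd : ∀ s < 2, ∀ k < m, ∀ z < m, g (s, k, z) ≠ 0 →
    z = vtx k ∨ (s = 0 ∧ X z (vtx k)) ∨ (s = 1 ∧ X (vtx k) z)
  idn : ∀ s < 2, ∀ k < m, ∀ z < m, g (s, k, z) ≠ 0 → ∀ s' < 2, g (s', k, vtx k) ≠ 0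
  cov : ∀ x y, X x y → x ≠ y → ∃ k < m, (vtx k = y ∧ g (0, k, x) ≠ 0) ∨ (vtx k = x ∧ g (1, k, y) ≠ 0)
  vtx_lt : ∀ k < m, vtx k < m
  lt : ∀ x y, X x y → x < m ∧ y < m

section Closure
variable {m : ℕ} {rk : ℕ → ℕ} {g g' : Tab}

theorem Core.older_iff (hC : Core m rk g []) {s k j : ℕ} (hs : s < 2) (hk : k < m) (hj : j < m) :
    g (2 + s, k, j) ≠ 0 ↔ rk j < rk k ∧ ∃ z < m, g (s, k, z) ≠ 0 ∧ g (5 - s, j, z) ≠ 0 := by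
  have hv : Valid m (2 + s, k, j) := ⟨by simp only; omega, hk, hj⟩
  have hc : cnt m g (2 + s, k, j) = ipp m (fun z => g (s, k, z)) fun z => g (5 - s, j, z) := by
    simp only [cnt, show 2 + s < 4 by omega, if_true, show 7 - (2 + s) = 5 - s by omega,
      show 2 + s - 2 = s by omega, ip_eq]
  constructor
  · intro h
    refine ⟨hC.rank _ hv (by simp) (by simp only; omega) h, ?_⟩
    rw [← ipp_ne_zero, ← hc]
    intro h0
    have h1 := hC.pres _ hv (by simp) (by simp only; omega) h
    have := (hC.mem (2 + s, k, j)).2 ⟨hv, by simp only; omega, by omega⟩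
    simp at this
  · rintro ⟨h1, h2⟩ h0
    rw [← ipp_ne_zero, ← hc] at h2
    exact h2 (hC.abs _ hv (by simp) (by simp only; omega) h0 fun _ => h1)

theorem Core.vert_iff (hC : Core m rk g []) {s k x : ℕ} (hs : s < 2) (hk : k < m) (hx : x < m) :
    g (4 + s, k, x) ≠ 0 ↔
      g (s, k, x) ≠ 0 ∨ ∃ j < m, g (2 + s, k, j) ≠ 0 ∧ g (4 + s, j, x) ≠ 0 := by
  have hv : Valid m (4 + s, k, x) := ⟨by simp only; omega, hk, hx⟩
  have hc : cnt m g (4 + s, k, x) = (if g (s, k, x) ≠ 0 then 1 else 0) +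
      ipp m (fun j => g (2 + s, k, j)) fun j => g (4 + s, j, x) := by
    simp only [cnt, show ¬ 4 + s < 4 by omega, show 4 + s < 6 by omega, if_true, if_false,
      show 4 + s - 4 = s by omega, show 4 + s - 2 = 2 + s by omega, ip_eq]
  have hne : cnt m g (4 + s, k, x) ≠ 0 ↔
      g (s, k, x) ≠ 0 ∨ ∃ j < m, g (2 + s, k, j) ≠ 0 ∧ g (4 + s, j, x) ≠ 0 := by
    rw [← ipp_ne_zero, hc]
    by_cases h : g (s, k, x) = 0 <;> simp [h]
  rw [← hne]
  constructor
  · intro h h0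
    have h1 := hC.pres _ hv (by simp only; omega) (by simp only; omega) h
    have := (hC.mem (4 + s, k, x)).2 ⟨hv, by simp only; omega, by omega⟩
    simp at this
  · intro h2 h0
    exact h2 (hC.abs _ hv (by simp only; omega) (by simp only; omega) h0 fun h => by
      simp only at h; omega)

theorem Core.reach_iff (hC : Core m rk g []) {x y : ℕ} (hx : x < m) (hy : y < m) :
    g (6, x, y) ≠ 0 ↔ ∃ k < m, g (4, k, x) ≠ 0 ∧ g (5, k, y) ≠ 0 := by
  rw [hC.reach (6, x, y) ⟨by simp, hx, hy⟩ rfl]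
  simp only [cnt, show ¬ 6 < 4 by omega, show ¬ 6 < 6 by omega, if_false, ip_eq]
  exact ipp_ne_zero

/-- Reachability through nodes of rank below `r`. -/
def Through (m : ℕ) (rk : ℕ → ℕ) (g : Tab) (r x y : ℕ) : Prop :=
  x = y ∨ ∃ j < m, rk j < r ∧ g (4, j, x) ≠ 0 ∧ g (5, j, y) ≠ 0

theorem Core.in_iff (hC : Core m rk g []) {k x : ℕ} (hk : k < m) (hx : x < m) :
    g (4, k, x) ≠ 0 ↔ ∃ z < m, g (0, k, z) ≠ 0 ∧ Through m rk g (rk k) x z := by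
  rw [hC.vert_iff (s := 0) (by omega) hk hx]
  constructor
  · rintro (h | ⟨j, hj, h1, h2⟩)
    · exact ⟨x, hx, h, Or.inl rfl⟩
    · obtain ⟨hr, z, hz, h3, h4⟩ := (hC.older_iff (s := 0) (by omega) hk hj).1 h1
      exact ⟨z, hz, h3, Or.inr ⟨j, hj, hr, h2, h4⟩⟩
  · rintro ⟨z, hz, h, rfl | ⟨j, hj, hr, h2, h4⟩⟩
    · exact Or.inl h
    · exact Or.inr ⟨j, hj, (hC.older_iff (s := 0) (by omega) hk hj).2 ⟨hr, z, hz, h, h4⟩, h2⟩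

theorem Core.out_iff (hC : Core m rk g []) {k y : ℕ} (hk : k < m) (hy : y < m) :
    g (5, k, y) ≠ 0 ↔ ∃ z < m, g (1, k, z) ≠ 0 ∧ Through m rk g (rk k) z y := by
  rw [hC.vert_iff (s := 1) (by omega) hk hy]
  constructor
  · rintro (h | ⟨j, hj, h1, h2⟩)
    · exact ⟨y, hy, h, Or.inl rfl⟩
    · obtain ⟨hr, z, hz, h3, h4⟩ := (hC.older_iff (s := 1) (by omega) hk hj).1 h1
      exact ⟨z, hz, h3, Or.inr ⟨j, hj, hr, h4, h2⟩⟩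
  · rintro ⟨z, hz, h, rfl | ⟨j, hj, hr, h2, h4⟩⟩
    · exact Or.inl h
    · exact Or.inr ⟨j, hj, (hC.older_iff (s := 1) (by omega) hk hj).2 ⟨hr, z, hz, h, h2⟩, h4⟩

/-- Adding one node at a time keeps the relation transitive: a path that meets the centre of the
newest node can be cut there. -/
theorem Core.through_trans (hC : Core m rk g []) (hinj : ∀ i < m, ∀ j < m, rk i = rk j → i = j)
    (r : ℕ) : ∀ x < m, ∀ y < m, ∀ z < m, Through m rk g r x y → Through m rk g r y z →
      Through m rk g r x z := by
  induction r with
  | zero =>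
    rintro x - y - z - (rfl | ⟨j, -, h, -⟩) h2
    · exact h2
    · omega
  | succ r ih =>
    have mono : ∀ {x y}, Through m rk g r x y → Through m rk g (r + 1) x y := by
      rintro x y (h | ⟨j, hj, hr, h⟩)
      exacts [Or.inl h, Or.inr ⟨j, hj, by omega, h⟩]
    have split : ∀ {x y}, Through m rk g (r + 1) x y → Through m rk g r x y ∨
        ∃ j < m, rk j = r ∧ g (4, j, x) ≠ 0 ∧ g (5, j, y) ≠ 0 := by
      rintro x y (h | ⟨j, hj, hr, h⟩)
      · exact Or.inl (Or.inl h)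
      · rcases Nat.lt_succ_iff_lt_or_eq.1 hr with h' | h'
        exacts [Or.inl (Or.inr ⟨j, hj, h', h⟩), Or.inr ⟨j, hj, h', h⟩]
    intro x hx y hy z hz h1 h2
    rcases split h1 with h1 | ⟨j, hj, hr, h3, h4⟩ <;> rcases split h2 with h2 | ⟨k, hk, hr', h5, h6⟩
    · exact mono (ih x hx y hy z hz h1 h2)
    · refine Or.inr ⟨k, hk, by omega, ?_, h6⟩
      obtain ⟨w, hw, h7, h8⟩ := (hC.in_iff hk hy).1 h5
      exact (hC.in_iff hk hx).2 ⟨w, hw, h7, hr' ▸ ih x hx y hy w hw h1 (hr' ▸ h8)⟩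
    · refine Or.inr ⟨j, hj, by omega, h3, ?_⟩
      obtain ⟨w, hw, h7, h8⟩ := (hC.out_iff hj hy).1 h4
      exact (hC.out_iff hj hz).2 ⟨w, hw, h7, hr ▸ ih w hw y hy z hz (hr ▸ h8) h2⟩
    · obtain rfl := hinj j hj k hk (hr.trans hr'.symm)
      exact Or.inr ⟨j, hj, by omega, h3, h6⟩

/-- The vertices recorded for a node are connected to its centre, by induction on the rank. -/
theorem Core.sound (hC : Core m rk g []) {vtx : ℕ → ℕ} {X : ℕ → ℕ → Prop}
    (hN : Nodes m vtx X g) : ∀ r, ∀ k < m, rk k = r →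
      (∀ x < m, g (4, k, x) ≠ 0 → ReflTransGen X x (vtx k)) ∧
      (∀ y < m, g (5, k, y) ≠ 0 → ReflTransGen X (vtx k) y) := by
  intro r
  induction r using Nat.strong_induction_on with
  | _ r ih =>
    intro k hk hr
    have hT : ∀ x < m, ∀ y < m, Through m rk g (rk k) x y → ReflTransGen X x y := by
      rintro x hx y hy (rfl | ⟨j, hj, hjr, h1, h2⟩)
      · exact .refl
      · obtain ⟨i1, i2⟩ := ih (rk j) (by omega) j hj rfl
        exact (i1 x hx h1).trans (i2 y hy h2)
    constructor
    · intro x hx h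
      obtain ⟨z, hz, h1, h2⟩ := (hC.in_iff hk hx).1 h
      rcases hN.snd 0 (by omega) k hk z hz h1 with rfl | ⟨-, h3⟩ | ⟨h3, -⟩
      · exact hT _ hx _ hz h2
      · exact (hT _ hx _ hz h2).tail h3
      · omega
    · intro y hy h
      obtain ⟨z, hz, h1, h2⟩ := (hC.out_iff hk hy).1 h
      rcases hN.snd 1 (by omega) k hk z hz h1 with rfl | ⟨h3, -⟩ | ⟨-, h3⟩
      · exact hT _ hz _ hy h2
      · omega
      · exact .head h3 (hT _ hz _ hy h2)

/-- Once the work list is empty, the nonzero counters of kind `6` are the pairs of distinct vertices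
in the closure: the relation through all nodes is transitive and contains the edges. -/
theorem Core.closure_iff (hC : Core m rk g []) {vtx : ℕ → ℕ} {X : ℕ → ℕ → Prop}
    (hN : Nodes m vtx X g) (hinj : ∀ i < m, ∀ j < m, rk i = rk j → i = j) {x y : ℕ} (hx : x < m)
    (hy : y < m) (hxy : x ≠ y) : g (6, x, y) ≠ 0 ↔ ReflTransGen X x y := by
  rw [hC.reach_iff hx hy]
  constructor
  · rintro ⟨k, hk, h1, h2⟩
    obtain ⟨i1, i2⟩ := hC.sound hN _ k hk rfl
    exact (i1 x hx h1).trans (i2 y hy h2)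
  · intro h
    obtain ⟨r, hr⟩ : ∃ r, ∀ k < m, rk k < r :=
      ⟨(Finset.range m).sup rk + 1, fun k hk =>
        Nat.lt_succ_of_le (Finset.le_sup (Finset.mem_range.2 hk))⟩
    have hE : ∀ x y, X x y → Through m rk g r x y := by
      intro x y h
      obtain ⟨hx, hy⟩ := hN.lt x y h
      by_cases hxy : x = y
      · exact Or.inl hxy
      obtain ⟨k, hk, ⟨rfl, h1⟩ | ⟨rfl, h1⟩⟩ := hN.cov x y h hxy
      · have h2 := hN.idn 0 (by omega) k hk x hx h1 1 (by omega)
        exact Or.inr ⟨k, hk, hr k hk, (hC.in_iff hk hx).2 ⟨x, hx, h1, Or.inl rfl⟩,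
          (hC.out_iff hk hy).2 ⟨_, hy, h2, Or.inl rfl⟩⟩
      · have h2 := hN.idn 1 (by omega) k hk y hy h1 0 (by omega)
        exact Or.inr ⟨k, hk, hr k hk, (hC.in_iff hk hx).2 ⟨_, hx, h2, Or.inl rfl⟩,
          (hC.out_iff hk hy).2 ⟨y, hy, h1, Or.inl rfl⟩⟩
    have : y < m ∧ Through m rk g r x y := by
      clear hxy hy
      induction h with
      | refl => exact ⟨hx, Or.inl rfl⟩
      | tail _ h2 ih =>
        obtain ⟨h3, h4⟩ := hN.lt _ _ h2
        exact ⟨h4, hC.through_trans hinj r x hx _ h3 _ h4 ih.2 (hE _ _ h2)⟩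
    rcases this.2 with h | ⟨j, hj, -, h1, h2⟩
    · exact absurd h hxy
    · exact ⟨j, hj, h1, h2⟩

/-- Between an `Init*` and the next nonempty `Reset*` only the presence of facts matters: the nodes
are sound and every pair in the closure is witnessed by a node. -/
structure Lazy (m : ℕ) (vtx : ℕ → ℕ) (X : ℕ → ℕ → Prop) (g : Tab) : Prop where
  snd4 : ∀ k < m, ∀ x < m, g (4, k, x) ≠ 0 → ReflTransGen X x (vtx k)
  snd5 : ∀ k < m, ∀ y < m, g (5, k, y) ≠ 0 → ReflTransGen X (vtx k) y
  cmp : ∀ x < m, ∀ y < m, ReflTransGen X x y →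
    x = y ∨ ∃ k < m, g (4, k, x) ≠ 0 ∧ g (5, k, y) ≠ 0
  reach : ∀ x < m, ∀ y < m, x ≠ y → (g (6, x, y) ≠ 0 ↔ ReflTransGen X x y)
  vtx_lt : ∀ k < m, vtx k < m
  lt : ∀ x y, X x y → x < m ∧ y < m

/-- In the lazy mode one new node accounts for all paths that use the inserted edges, because they can
be cut at its centre. Rows that already exist need no update. -/
theorem Lazy.add {vtx : ℕ → ℕ} {X X' : ℕ → ℕ → Prop} {k : ℕ} (h : Lazy m vtx X g) (hk : k < m)
    (hA : AddSpec m k (vtx k) g g') (hX : ∀ x y, X x y → X' x y)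
    (hX' : ∀ x y, X' x y → X x y ∨ x = vtx k ∨ y = vtx k) (hlt : ∀ x y, X' x y → x < m ∧ y < m)
    (hg : ∀ x < m, ∀ y < m, g (7, x, y) ≠ 0 ↔ X' x y) : Lazy m vtx X' g' := by
  set v := vtx k with hv
  have hvm : v < m := h.vtx_lt k hk
  have mono : ∀ {x y}, ReflTransGen X x y → ReflTransGen X' x y :=
    fun h => ReflTransGen.mono (p := X') (fun _ _ => hX _ _) _ _ h
  have e0 : ∀ z < m, g' (0, k, z) ≠ 0 ↔ z = v ∨ X' z v := by
    intro z hz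
    obtain ⟨a1, a2⟩ := hA.edge 0 (by omega) z hz
    have : Nbr g 0 v z ↔ z = v ∨ X' z v := by simp [Nbr, ← hg z hz v hvm]
    rw [← this]
    by_cases hn : Nbr g 0 v z
    · simp [hn, a1 hn]
    · simp [hn, a2 hn]
  have e1 : ∀ z < m, g' (1, k, z) ≠ 0 ↔ z = v ∨ X' v z := by
    intro z hz
    obtain ⟨a1, a2⟩ := hA.edge 1 (by omega) z hz
    have : Nbr g 1 v z ↔ z = v ∨ X' v z := by simp [Nbr, ← hg v hvm z hz]
    rw [← this]
    by_cases hn : Nbr g 1 v z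
    · simp [hn, a1 hn]
    · simp [hn, a2 hn]
  have l0 : ∀ x < m, g' (4, k, x) ≠ 0 ↔ ∃ z < m, (z = v ∨ X' z v) ∧ ReflTransGen X x z := by
    intro x hx
    have h1 : g' (4, k, x) ≠ 0 ↔ g' (0, k, x) ≠ 0 ∨ ∃ j < m, (∃ z < m, g' (0, k, z) ≠ 0 ∧
        g (5, j, z) ≠ 0) ∧ g (4, j, x) ≠ 0 := by
      rw [hA.vert 0 (by omega) x hx, up_ne_zero]
      have : ∀ j < m, (∃ z < m, g' (0, k, z) ≠ 0 ∧ g (5, j, z) ≠ 0) ↔ g' (2 + 0, k, j) ≠ 0 := by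
        intro j hj
        rw [hA.older 0 (by omega) j hj, up_ne_zero, ipp_ne_zero]
      rw [show (∃ j < m, (∃ z < m, g' (0, k, z) ≠ 0 ∧ g (5, j, z) ≠ 0) ∧ g (4, j, x) ≠ 0) ↔
        ∃ j < m, g' (2 + 0, k, j) ≠ 0 ∧ g (4 + 0, j, x) ≠ 0 from
          exists_congr fun j => and_congr_right fun hj => by rw [this j hj], ← ipp_ne_zero]
      by_cases h : g' (0, k, x) = 0 <;> simp [h]
    rw [h1]
    constructor
    · rintro (h2 | ⟨j, hj, ⟨z, hz, h2, h3⟩, h4⟩)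
      · exact ⟨x, hx, (e0 x hx).1 h2, .refl⟩
      · exact ⟨z, hz, (e0 z hz).1 h2, (h.snd4 j hj x hx h4).trans (h.snd5 j hj z hz h3)⟩
    · rintro ⟨z, hz, h2, h3⟩
      rcases h.cmp x hx z hz h3 with rfl | ⟨j, hj, h4, h5⟩
      · exact Or.inl ((e0 x hx).2 h2)
      · exact Or.inr ⟨j, hj, ⟨z, hz, (e0 z hz).2 h2, h5⟩, h4⟩
  have l1 : ∀ y < m, g' (5, k, y) ≠ 0 ↔ ∃ z < m, (z = v ∨ X' v z) ∧ ReflTransGen X z y := by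
    intro y hy
    have h1 : g' (5, k, y) ≠ 0 ↔ g' (1, k, y) ≠ 0 ∨ ∃ j < m, (∃ z < m, g' (1, k, z) ≠ 0 ∧
        g (4, j, z) ≠ 0) ∧ g (5, j, y) ≠ 0 := by
      rw [hA.vert 1 (by omega) y hy, up_ne_zero]
      have : ∀ j < m, (∃ z < m, g' (1, k, z) ≠ 0 ∧ g (4, j, z) ≠ 0) ↔ g' (2 + 1, k, j) ≠ 0 := by
        intro j hj
        rw [hA.older 1 (by omega) j hj, up_ne_zero, ipp_ne_zero]
      rw [show (∃ j < m, (∃ z < m, g' (1, k, z) ≠ 0 ∧ g (4, j, z) ≠ 0) ∧ g (5, j, y) ≠ 0) ↔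
        ∃ j < m, g' (2 + 1, k, j) ≠ 0 ∧ g (4 + 1, j, y) ≠ 0 from
          exists_congr fun j => and_congr_right fun hj => by rw [this j hj], ← ipp_ne_zero]
      by_cases h : g' (1, k, y) = 0 <;> simp [h]
    rw [h1]
    constructor
    · rintro (h2 | ⟨j, hj, ⟨z, hz, h2, h3⟩, h4⟩)
      · exact ⟨y, hy, (e1 y hy).1 h2, .refl⟩
      · exact ⟨z, hz, (e1 z hz).1 h2, (h.snd4 j hj z hz h3).trans (h.snd5 j hj y hy h4)⟩
    · rintro ⟨z, hz, h2, h3⟩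
      rcases h.cmp z hz y hy h3 with rfl | ⟨j, hj, h4, h5⟩
      · exact Or.inl ((e1 z hz).2 h2)
      · exact Or.inr ⟨j, hj, ⟨z, hz, (e1 z hz).2 h2, h4⟩, h5⟩
  have s0 : ∀ x < m, g' (4, k, x) ≠ 0 → ReflTransGen X' x v := by
    intro x hx h1
    obtain ⟨z, -, rfl | h2, h3⟩ := (l0 x hx).1 h1
    exacts [mono h3, (mono h3).tail h2]
  have s1 : ∀ y < m, g' (5, k, y) ≠ 0 → ReflTransGen X' v y := by
    intro y hy h1
    obtain ⟨z, -, rfl | h2, h3⟩ := (l1 y hy).1 h1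
    exacts [mono h3, .head h2 (mono h3)]
  -- the first visit of `v` cuts a path into two pieces whose inner edges are old
  have cl : ∀ x < m, ∀ y, ReflTransGen X' x y → y < m ∧ (ReflTransGen X x y ∨
      (g' (4, k, x) ≠ 0 ∧ g' (5, k, y) ≠ 0)) := by
    intro x hx y hp
    induction hp with
    | refl => exact ⟨hx, Or.inl .refl⟩
    | @tail y z _ h2 ih =>
      obtain ⟨hy, hz⟩ := hlt _ _ h2
      refine ⟨hz, ?_⟩
      have e5 : g' (5, k, v) ≠ 0 := (l1 v hvm).2 ⟨v, hvm, Or.inl rfl, .refl⟩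
      rcases hX' _ _ h2 with h3 | rfl | rfl
      · rcases ih.2 with h4 | ⟨h4, h5⟩
        · exact Or.inl (h4.tail h3)
        · obtain ⟨w, hw, h6, h7⟩ := (l1 _ hy).1 h5
          exact Or.inr ⟨h4, (l1 _ hz).2 ⟨w, hw, h6, h7.tail h3⟩⟩
      · have h5 := (l1 z hz).2 ⟨z, hz, Or.inr h2, .refl⟩
        rcases ih.2 with h4 | ⟨h4, -⟩
        · exact Or.inr ⟨(l0 x hx).2 ⟨_, hy, Or.inl rfl, h4⟩, h5⟩
        · exact Or.inr ⟨h4, h5⟩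
      · rcases ih.2 with h4 | ⟨h4, -⟩
        · exact Or.inr ⟨(l0 x hx).2 ⟨_, hy, Or.inr h2, h4⟩, e5⟩
        · exact Or.inr ⟨h4, e5⟩
  have rst : ∀ i j x, i < 6 → j < m → x < m → j ≠ k → g' (i, j, x) = g (i, j, x) :=
    fun i j x h1 h2 h3 h4 => hA.rest (i, j, x) ⟨by simp only; omega, h2, h3⟩ h1 h4
  refine ⟨?_, ?_, ?_, ?_, h.vtx_lt, hlt⟩
  · intro j hj x hx h1
    by_cases hjk : j = k
    · subst hjk; exact s0 x hx h1
    · rw [rst 4 j x (by omega) hj hx hjk] at h1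
      exact mono (h.snd4 j hj x hx h1)
  · intro j hj x hx h1
    by_cases hjk : j = k
    · subst hjk; exact s1 x hx h1
    · rw [rst 5 j x (by omega) hj hx hjk] at h1
      exact mono (h.snd5 j hj x hx h1)
  · intro x hx y hy h1
    rcases (cl x hx y h1).2 with h2 | h2
    · rcases h.cmp x hx y hy h2 with h3 | ⟨j, hj, h3, h4⟩
      · exact Or.inl h3
      · by_cases hjk : j = k
        · subst hjk
          have h5 := (l0 x hx).2 ⟨v, hvm, Or.inl rfl, h.snd4 j hj x hx h3⟩
          have h6 := (l1 y hy).2 ⟨v, hvm, Or.inl rfl, h.snd5 j hj y hy h4⟩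
          exact Or.inr ⟨j, hj, h5, h6⟩
        · refine Or.inr ⟨j, hj, ?_, ?_⟩
          · rwa [rst 4 j x (by omega) hj hx hjk]
          · rwa [rst 5 j y (by omega) hj hy hjk]
    · exact Or.inr ⟨k, hk, h2⟩
  · intro x hx y hy hxy
    rw [hA.reach x hx y hy]
    constructor
    · intro h1
      by_cases h2 : g (6, x, y) = 0
      · rw [h2] at h1
        split_ifs at h1 with h3
        · exact (s0 x hx h3.1).trans (s1 y hy h3.2)
        · simp at h1
      · exact mono ((h.reach x hx y hy hxy).1 h2)
    · intro h1
      rcases (cl x hx y h1).2 with h2 | h2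
      · have := (h.reach x hx y hy hxy).2 h2
        omega
      · simp [h2]

end Closure

/-! ### Representation of the tables in memory -/

/-- The address of a cell: the tables are stored one after the other, each in row-major order. -/
def enc (m : ℕ) (t : Trip) : ℕ := (t.1 * m + t.2.1) * m + t.2.2

/-- The memory is divided into blocks of `m²` cells: blocks `0` to `7` hold the tables, `8` to `15`
the work list, `16` a flag, `17` to `19` the arguments of the multiplication program, and the blocks
from `20` on are its memory. -/
structure Ctx (M : Mach) (m : ℕ) : Prop where
  pos : 2 ≤ m
  le_S : 20 * (m * m) ≤ M.S
  le_W : M.S + 100 ≤ M.W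

theorem enc_lt {m : ℕ} {t : Trip} (h : Valid m t) : enc m t < 8 * (m * m) := by
  obtain ⟨h1, h2, h3⟩ := h
  unfold enc
  have e1 : t.1 * m + t.2.1 + 1 ≤ 8 * m := by
    have : t.1 * m ≤ 7 * m := Nat.mul_le_mul_right _ (by omega)
    omega
  have e2 := Nat.mul_le_mul_right m e1
  rw [Nat.add_mul, Nat.mul_assoc] at e2
  omega

theorem enc_inj {m : ℕ} {t t' : Trip} (h : Valid m t) (h' : Valid m t')
    (he : enc m t = enc m t') : t = t' := by
  obtain ⟨k, a, b⟩ := t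
  obtain ⟨k', a', b'⟩ := t'
  obtain ⟨-, ha, hb⟩ := h
  obtain ⟨-, ha', hb'⟩ := h'
  simp only [enc] at ha hb ha' hb' he
  have hm : 0 < m := by omega
  have e1 : b = b' := by
    have := congrArg (· % m) he
    simpa [Nat.add_mod, Nat.mod_eq_of_lt hb, Nat.mod_eq_of_lt hb'] using this
  have e2 : k * m + a = k' * m + a' := by
    subst e1
    exact Nat.eq_of_mul_eq_mul_right hm (Nat.add_right_cancel he)
  have e3 : a = a' := by
    have := congrArg (· % m) e2
    simpa [Nat.add_mod, Nat.mod_eq_of_lt ha, Nat.mod_eq_of_lt ha'] using this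
  have e4 : k = k' := by
    subst e3
    exact Nat.eq_of_mul_eq_mul_right hm (Nat.add_right_cancel e2)
  rw [e1, e3, e4]

/-- Address expression of a fact; register `2` holds `m`. -/
def FA (k a b : Ex) : Ex := (k * .v 2 + a) * .v 2 + b

theorem FA_eval {M : Mach} {s : State} {m : ℕ} {k a b : Ex} (h2 : s.reg 2 = m) :
    (FA k a b).eval M s = enc m (k.eval M s, a.eval M s, b.eval M s) := by
  simp [FA, enc, h2]

theorem FA_ok {M : Mach} {s : State} {m : ℕ} {k a b : Ex} (hM : Ctx M m) (h2 : s.reg 2 = m)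
    (hk : k.Ok M s) (ha : a.Ok M s) (hb : b.Ok M s)
    (hv : Valid m (k.eval M s, a.eval M s, b.eval M s)) : (FA k a b).Ok M s := by
  have h1 := enc_lt hv
  simp only [enc] at h1
  have h3 := hM.le_S
  have h4 := hM.le_W
  have hm := hM.pos
  have h5 : k.eval M s * m + a.eval M s ≤ (k.eval M s * m + a.eval M s) * m := Nat.le_mul_of_pos_right _ (by omega)
  simp only [FA, Ex.ok_add, Ex.ok_mul, Ex.ok_v, Ex.eval_add, Ex.eval_mul, Ex.eval_v, h2]
  refine ⟨⟨⟨⟨hk, by norm_num, ?_⟩, ha, ?_⟩, by norm_num, ?_⟩, hb, ?_⟩ <;> omega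

@[simp] theorem FA_cost (k a b : Ex) : (FA k a b).cost = k.cost + a.cost + b.cost + 8 := by
  simp [FA]; omega

/-- The tables `g`, the work list `L` and the flag `fl` are stored in the state `s`. -/
structure Rep (m : ℕ) (g : Tab) (L : List Trip) (fl : ℕ) (s : State) : Prop where
  reg2 : s.reg 2 = m
  reg5 : s.reg 5 = L.length
  tab : ∀ t, Valid m t → s.mem (enc m t) = g t
  stk : ∀ (i : ℕ) (h : i < L.length), s.mem (8 * (m * m) + i) = enc m L[i]
  flag : s.mem (16 * (m * m)) = fl
  nodup : L.Nodup
  good : ∀ t ∈ L, Valid m t ∧ g t ≤ 1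

/-- The registers below `k` are unchanged, except for register `5`, the length of the work list. -/
def Fr (k : ℕ) (s s' : State) : Prop := ∀ r < k, r ≠ 5 → s'.reg r = s.reg r

theorem Fr.refl (k : ℕ) (s : State) : Fr k s s := fun _ _ _ => rfl
theorem Fr.trans {k : ℕ} {s s' s'' : State} (h : Fr k s s') (h' : Fr k s' s'') : Fr k s s'' :=
  fun r h1 h2 => (h' r h1 h2).trans (h r h1 h2)
theorem Fr.mono {k k' : ℕ} {s s' : State} (h : Fr k s s') (hk : k' ≤ k) : Fr k' s s' :=
  fun r h1 h2 => h r (by omega) h2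

section Rep
variable {M : Mach} {m fl : ℕ} {g : Tab} {L : List Trip} {s : State}

theorem length_le (hn : L.Nodup) (hv : ∀ t ∈ L, Valid m t) : L.length ≤ 8 * (m * m) := by
  have h1 : (L.map (enc m)).Nodup := hn.map_on fun x hx y hy h => enc_inj (hv x hx) (hv y hy) h
  have h2 : (L.map (enc m)).toFinset ⊆ Finset.range (8 * (m * m)) := by
    intro x hx
    rw [List.mem_toFinset, List.mem_map] at hx
    obtain ⟨t, ht, rfl⟩ := hx
    exact Finset.mem_range.2 (enc_lt (hv t ht))
  have h3 := Finset.card_le_card h2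
  rwa [List.toFinset_card_of_nodup h1, List.length_map, Finset.card_range] at h3

theorem Rep.len (h : Rep m g L fl s) : L.length ≤ 8 * (m * m) :=
  length_le h.nodup fun t ht => (h.good t ht).1

theorem Rep.setReg (h : Rep m g L fl s) {r v : ℕ} (h2 : r ≠ 2) (h5 : r ≠ 5) :
    Rep m g L fl (s.setReg r v) := by
  refine ⟨?_, ?_, h.tab, h.stk, h.flag, h.nodup, h.good⟩
  · simp [h2.symm, h.reg2]
  · simp [h5.symm, h.reg5]

theorem Rep.set (h : Rep m g L fl s) (hm : 0 < m) {t : Trip} {v : ℕ} (ht : Valid m t)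
    (hL : t ∈ L → v ≤ 1) : Rep m (Function.update g t v) L fl (s.setMem (enc m t) v) := by
  have h1 := enc_lt ht
  have h3 := h.len
  have h4 : 0 < m * m := Nat.mul_pos hm hm
  refine ⟨h.reg2, h.reg5, ?_, ?_, ?_, h.nodup, ?_⟩
  · intro t' ht'
    by_cases he : t' = t
    · simp [he]
    · have : enc m t' ≠ enc m t := fun h => he (enc_inj ht' ht h)
      simp [he, this, h.tab t' ht']
  · intro i hi
    rw [State.setMem_mem, if_neg (by omega), h.stk i hi]
  · rw [State.setMem_mem, if_neg (by omega), h.flag]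
  · intro t' ht'
    refine ⟨(h.good t' ht').1, ?_⟩
    by_cases he : t' = t
    · subst he; simpa using hL ht'
    · simpa [he] using (h.good t' ht').2

theorem Rep.push (h : Rep m g L fl s) (hm : 0 < m) {t : Trip} (ht : Valid m t) (hL : t ∉ L)
    (hg : g t ≤ 1) : L.length < 8 * (m * m) ∧ Rep m g (L ++ [t]) fl
      ((s.setMem (8 * (m * m) + L.length) (enc m t)).setReg 5 (L.length + 1)) := by
  have hn : (L ++ [t]).Nodup := by
    rw [List.nodup_append']
    exact ⟨h.nodup, by simp, fun a ha h' => hL (List.mem_singleton.1 h' ▸ ha)⟩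
  have hgood : ∀ t' ∈ L ++ [t], Valid m t' ∧ g t' ≤ 1 := by
    intro t' ht'
    rcases List.mem_append.1 ht' with h' | h'
    · exact h.good t' h'
    · rw [List.mem_singleton.1 h']; exact ⟨ht, hg⟩
  have hl := length_le hn fun t' ht' => (hgood t' ht').1
  simp only [List.length_append, List.length_singleton] at hl
  have h4 : 0 < m * m := Nat.mul_pos hm hm
  refine ⟨by omega, by simp [h.reg2], by simp, ?_, ?_, ?_, hn, hgood⟩
  · intro t' ht'
    have := enc_lt ht'
    rw [State.setReg_mem, State.setMem_mem, if_neg (by omega), h.tab t' ht']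
  · intro i hi
    simp only [List.length_append, List.length_singleton] at hi
    rw [State.setReg_mem, State.setMem_mem]
    by_cases he : i = L.length
    · subst he; simp
    · rw [if_neg (by omega), h.stk i (by omega), List.getElem_append_left]
  · rw [State.setReg_mem, State.setMem_mem, if_neg (by omega), h.flag]

theorem Rep.lt_S (hM : Ctx M m) {t : Trip} (ht : Valid m t) : enc m t < M.S := by
  have := enc_lt ht
  have := hM.le_S
  omega

/-! ### Programs for the work list -/

/-- Push the address in register `26`. -/
def pushC : Cmd := sto (.c 8 * (.v 2 * .v 2) + .v 5) (.v 26) ;; asg 5 (.v 5 + .c 1)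

theorem tot_push (hM : Ctx M m) (h : Rep m g L fl s) {t : Trip} (ht : Valid m t) (hL : t ∉ L)
    (hg : g t ≤ 1) (h26 : s.reg 26 = enc m t) :
    Tot M pushC s fun s' τ => Rep m g (L ++ [t]) fl s' ∧ (∀ r, r ≠ 5 → s'.reg r = s.reg r) ∧
      τ ≤ 30 := by
  obtain ⟨h1, h2⟩ := h.push (by have := hM.pos; omega) ht hL hg
  have h3 := hM.le_S
  have h4 := hM.le_W
  have h5 : m * m < M.W := by omega
  refine tot_seq (tot_sto ?_ ?_ ?_ (tot_asg (by norm_num) ?_ ⟨?_, ?_, ?_⟩))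
  · simp [h.reg2, h.reg5]; omega
  · simp
  · simp [h.reg2, h.reg5]; omega
  · simp [h.reg5]; omega
  · simpa [h.reg2, h.reg5, h26] using h2
  · intro r hr; simp [hr]
  · simp

/-- Decrement the head at the address in register `26` if it and the partner at the address in
register `25` are present. -/
def decC (push : Bool) : Cmd :=
  iff (.ld (.v 25)) (iff (.ld (.v 26))
    (sto (.v 26) (.ld (.v 26) - .c 1) ;;
      (if push = true then iff (.ld (.v 26) - .c 1) skip (iff (.ld (.v 26)) pushC skip) else skip))
    skip) skip

theorem tot_dec (hM : Ctx M m) (h : Rep m g L fl s) {push : Bool} {p t : Trip} (hp : Valid m p)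
    (ht : Valid m t) (h25 : s.reg 25 = enc m p) (h26 : s.reg 26 = enc m t) :
    Tot M (decC push) s fun s' τ =>
      Rep m (decA push p t (g, L)).1 (decA push p t (g, L)).2 fl s' ∧
      (∀ r, r ≠ 5 → s'.reg r = s.reg r) ∧ τ ≤ 70 := by
  have hpS := Rep.lt_S hM hp
  have htS := Rep.lt_S hM ht
  have hm := hM.pos
  have hW : 0 < M.W := by have := hM.le_W; omega
  have hW1 : 1 < M.W := by have := hM.le_W; omega
  refine tot_iff (by simpa [h25]) (fun h1 => ?_) fun h1 => ?_
  swap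
  · have : decA push p t (g, L) = (g, L) := by
      have : g p = 0 := by simpa [h25, h.tab p hp] using h1
      simp [decA, this]
    rw [this]
    exact tot_skip hW ⟨h, fun _ _ => rfl, by simp⟩
  refine tot_iff (by simpa [h26]) (fun h2 => ?_) fun h2 => ?_
  swap
  · have : decA push p t (g, L) = (g, L) := by
      have : g t = 0 := by simpa [h26, h.tab t ht] using h2
      simp [decA, this]
    rw [this]
    exact tot_skip hW ⟨h, fun _ _ => rfl, by simp⟩
  have h1' : g p ≠ 0 := by simpa [h25, h.tab p hp] using h1
  have h2' : g t ≠ 0 := by simpa [h26, h.tab t ht] using h2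
  have hd : decA push p t (g, L) = (Function.update g t (g t - 1),
      if push = true ∧ g t = 2 then L ++ [t] else L) := by simp [decA, h1', h2']
  rw [hd]
  have hrep : Rep m (Function.update g t (g t - 1)) L fl (s.setMem (enc m t) (g t - 1)) :=
    h.set (by omega) ht fun hL => by have := (h.good t hL).2; omega
  refine tot_seq (tot_sto (by simp) ?_ (by simpa [h26]) ?_)
  · simp [h26, htS, hW1]
  simp only [Ex.eval_v, Ex.eval_sub, Ex.eval_ld, Ex.eval_c, h26, h.tab t ht]
  split_ifs with hpu h3 h3
  · refine tot_iff (by simp [h26, htS, hW1]) (fun h4 => ?_) fun h4 => ?_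
    · simp [h26, h3] at h4
    · refine tot_iff (by simp [h26, htS]) (fun h5 => ?_) fun h5 => ?_
      · refine (tot_push hM hrep ht (fun hL => ?_) (by simp [h3]) (by simpa using h26)).mono ?_
        · have := (h.good t hL).2; omega
        · rintro s' τ ⟨a, b, c⟩
          refine ⟨a, fun r hr => (b r hr).trans (by simp), ?_⟩
          simp; omega
      · simp [h26, h3] at h5
  · refine tot_iff (by simp [h26, htS, hW1]) (fun h4 => ?_) fun h4 => ?_
    · exact tot_skip hW ⟨hrep, fun _ _ => rfl, by simp⟩
    · refine tot_iff (by simp [h26, htS]) (fun h5 => ?_) fun h5 => ?_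
      · simp [h26] at h4 h5
        exact absurd ⟨hpu, by omega⟩ h3
      · exact tot_skip hW ⟨hrep, fun _ _ => rfl, by simp⟩
  · exact absurd h3.1 hpu
  · exact tot_skip hW ⟨hrep, fun _ _ => rfl, by simp⟩

/-- The decrements for the pairs at the addresses `p₀ + i p₁` and `h₀ + i h₁`, where `p₀`, `p₁`,
`h₀`, `h₁` are in the registers `20` to `23`. -/
def sweepC (push : Bool) : Cmd :=
  forUp 24 (.v 2) (asg 25 (.v 20 + .v 24 * .v 21) ;; asg 26 (.v 22 + .v 24 * .v 23) ;; decC push)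

theorem tot_sweep (hM : Ctx M m) (h : Rep m g L fl s) {push : Bool} {P H : ℕ → Trip}
    (hP : ∀ i < m, s.reg 20 + i * s.reg 21 = enc m (P i) ∧ Valid m (P i))
    (hH : ∀ i < m, s.reg 22 + i * s.reg 23 = enc m (H i) ∧ Valid m (H i)) :
    Tot M (sweepC push) s fun s' τ =>
      Rep m (sweepA push P H m (g, L)).1 (sweepA push P H m (g, L)).2 fl s' ∧
      Fr 20 s s' ∧ τ ≤ m * 110 + 12 := by
  have h1 := hM.le_S
  have h2 := hM.le_W
  have hmm : m ≤ m * m := Nat.le_mul_self m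
  refine tot_forUp (N := m) (fun k s' =>
    Rep m (sweepA push P H k (g, L)).1 (sweepA push P H k (g, L)).2 fl s' ∧
      Fr 24 s s' ∧ s'.reg 24 = k) 98 (by norm_num) (by omega) ⟨?_, ?_, by simp⟩ ?_ ?_ ?_
  · exact h.setReg (by norm_num) (by norm_num)
  · intro r hr h5
    have : r ≠ 24 := by omega
    simp [this]
  · rintro k s' hk ⟨a, b, c⟩
    exact ⟨c, by simp, by simp [a.reg2]⟩
  · rintro k s' hk ⟨a, b, c⟩
    have r20 := b 20 (by norm_num) (by norm_num)
    have r21 := b 21 (by norm_num) (by norm_num)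
    have r22 := b 22 (by norm_num) (by norm_num)
    have r23 := b 23 (by norm_num) (by norm_num)
    obtain ⟨p1, p2⟩ := hP k hk
    obtain ⟨q1, q2⟩ := hH k hk
    have l1 := enc_lt p2
    have l2 := enc_lt q2
    refine tot_seq (tot_asg (by norm_num) ?_ (tot_seq (tot_asg (by norm_num) ?_ ?_)))
    · simp [c, r20, r21]; omega
    · simp [c, r22, r23]; omega
    · refine (tot_dec hM (p := P k) (t := H k) ((a.setReg (by norm_num) (by norm_num)).setReg
        (by norm_num) (by norm_num)) p2 q2 ?_ ?_).mono ?_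
      · simp [c, r20, r21, p1]
      · simp [c, r22, r23, q1]
      · rintro s'' τ ⟨d, e, f⟩
        refine ⟨by simp; omega, by simp [e, c], d.setReg (by norm_num) (by norm_num), ?_, by simp⟩
        intro r hr h5
        have h24 : r ≠ 24 := by omega
        have h25 : r ≠ 25 := by omega
        have h26 : r ≠ 26 := by omega
        simp [h24, e r h5, h25, h26, b r hr h5]
  · rintro s' τ ⟨a, b, c⟩ hτ
    refine ⟨a, b.mono (by norm_num), ?_⟩
    simp at hτ; omega

end Rep

/-! ### A step of the work list on the machine -/

/-- Only registers below `n` occur. -/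
def Ex.Low (n : ℕ) : Ex → Prop
  | .c _ => True
  | .v r => r < n
  | .op _ a b => a.Low n ∧ b.Low n
  | .ld a => a.Low n
  | .inp a => a.Low n

namespace Ex
@[simp] theorem low_c (n k : ℕ) : (c k).Low n ↔ True := Iff.rfl
@[simp] theorem low_v (n r : ℕ) : (v r).Low n ↔ r < n := Iff.rfl
@[simp] theorem low_add (n : ℕ) (a b : Ex) : (a + b).Low n ↔ a.Low n ∧ b.Low n := Iff.rfl
@[simp] theorem low_sub (n : ℕ) (a b : Ex) : (a - b).Low n ↔ a.Low n ∧ b.Low n := Iff.rfl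
@[simp] theorem low_mul (n : ℕ) (a b : Ex) : (a * b).Low n ↔ a.Low n ∧ b.Low n := Iff.rfl
@[simp] theorem low_FA (n : ℕ) (k a b : Ex) : (FA k a b).Low n ↔
    (((k.Low n ∧ 2 < n) ∧ a.Low n) ∧ 2 < n) ∧ b.Low n := Iff.rfl

theorem eval_congr {M : Mach} {s s' : State} {n : ℕ} (hm : s'.mem = s.mem)
    (hr : ∀ r < n, s'.reg r = s.reg r) (e : Ex) (he : e.Low n) : e.eval M s' = e.eval M s := by
  induction e with
  | c k => rfl
  | v r => exact hr r he
  | op o a b iha ihb => simp only [eval, iha he.1, ihb he.2]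
  | ld a iha => simp only [eval, iha he, hm]
  | inp a iha => simp only [eval, iha he]

theorem ok_congr {M : Mach} {s s' : State} {n : ℕ} (hm : s'.mem = s.mem)
    (hr : ∀ r < n, s'.reg r = s.reg r) (e : Ex) (he : e.Low n) : e.Ok M s' ↔ e.Ok M s := by
  induction e with
  | c k => rfl
  | v r => rfl
  | op o a b iha ihb =>
    have h1 := eval_congr (M := M) hm hr a he.1
    have h2 := eval_congr (M := M) hm hr b he.2
    cases o <;> simp only [Ok, iha he.1, ihb he.2, h1, h2]
  | ld a iha => simp only [Ok, iha he, eval_congr hm hr a he]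
  | inp a iha => simp only [Ok, iha he, eval_congr hm hr a he]

end Ex

section Work
variable {M : Mach} {m fl : ℕ} {g : Tab} {L : List Trip} {s : State}

theorem Rep.congr {g' : Tab} (h : Rep m g L fl s) (hg : ∀ t, Valid m t → g t = g' t) :
    Rep m g' L fl s :=
  ⟨h.reg2, h.reg5, fun t ht => (h.tab t ht).trans (hg t ht), h.stk, h.flag, h.nodup,
    fun t ht => ⟨(h.good t ht).1, hg t (h.good t ht).1 ▸ (h.good t ht).2⟩⟩

theorem Rep.of_mem {s' : State} (h : Rep m g L fl s) (hm : s'.mem = s.mem)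
    (h2 : s'.reg 2 = s.reg 2) (h5 : s'.reg 5 = s.reg 5) : Rep m g L fl s' :=
  ⟨h2.trans h.reg2, h5.trans h.reg5, by rw [hm]; exact h.tab, by rw [hm]; exact h.stk,
    by rw [hm]; exact h.flag, h.nodup, h.good⟩

/-- The decrements for the pairs at the addresses `e₁ + i e₂` and `e₃ + i e₄`. -/
def sweepAt (push : Bool) (e₁ e₂ e₃ e₄ : Ex) : Cmd :=
  asg 20 e₁ ;; asg 21 e₂ ;; asg 22 e₃ ;; asg 23 e₄ ;; sweepC push

theorem tot_sweepAt (hM : Ctx M m) (h : Rep m g L fl s) {push : Bool} {P H : ℕ → Trip}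
    {e₁ e₂ e₃ e₄ : Ex} (l₁ : e₁.Low 20) (l₂ : e₂.Low 20) (l₃ : e₃.Low 20) (l₄ : e₄.Low 20)
    (o₁ : e₁.Ok M s) (o₂ : e₂.Ok M s) (o₃ : e₃.Ok M s) (o₄ : e₄.Ok M s)
    (hP : ∀ i < m, e₁.eval M s + i * e₂.eval M s = enc m (P i) ∧ Valid m (P i))
    (hH : ∀ i < m, e₃.eval M s + i * e₄.eval M s = enc m (H i) ∧ Valid m (H i)) :
    Tot M (sweepAt push e₁ e₂ e₃ e₄) s fun s' τ =>
      Rep m (sweepA push P H m (g, L)).1 (sweepA push P H m (g, L)).2 fl s' ∧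
      Fr 20 s s' ∧ τ ≤ m * 110 + 20 + (e₁.cost + e₂.cost + e₃.cost + e₄.cost) := by
  set s1 := s.setReg 20 (e₁.eval M s) with hs1
  have f1 : ∀ r < 20, s1.reg r = s.reg r := fun r hr => by
    have : r ≠ 20 := by omega
    simp [hs1, this]
  set s2 := s1.setReg 21 (e₂.eval M s1) with hs2
  have f2 : ∀ r < 20, s2.reg r = s.reg r := fun r hr => by
    have : r ≠ 21 := by omega
    simp [hs2, this, f1 r hr]
  set s3 := s2.setReg 22 (e₃.eval M s2) with hs3
  have f3 : ∀ r < 20, s3.reg r = s.reg r := fun r hr => by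
    have : r ≠ 22 := by omega
    simp [hs3, this, f2 r hr]
  have v2 := Ex.eval_congr (M := M) (s := s) (s' := s1) rfl f1 e₂ l₂
  have v3 := Ex.eval_congr (M := M) (s := s) (s' := s2) rfl f2 e₃ l₃
  have v4 := Ex.eval_congr (M := M) (s := s) (s' := s3) rfl f3 e₄ l₄
  refine tot_seq (tot_asg (by norm_num) o₁ (tot_seq (tot_asg (by norm_num)
    ((Ex.ok_congr (s := s) (s' := s1) rfl f1 _ l₂).2 o₂) (tot_seq (tot_asg (by norm_num)
    ((Ex.ok_congr (s := s) (s' := s2) rfl f2 _ l₃).2 o₃) (tot_seq (tot_asg (by norm_num)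
    ((Ex.ok_congr (s := s) (s' := s3) rfl f3 _ l₄).2 o₄) ?_)))))))
  refine (tot_sweep hM (s := s3.setReg 23 (e₄.eval M s3)) (P := P) (H := H)
    (h.of_mem rfl (by simp [f3]) (by simp [f3])) ?_ ?_).mono ?_
  · intro i hi
    have : s1.reg 20 = e₁.eval M s := by simp [hs1]
    simpa [hs3, hs2, this, v2] using hP i hi
  · intro i hi
    have h22 : s3.reg 22 = e₃.eval M s := by simp [hs3, v3]
    simpa [h22, v4] using hH i hi
  · rintro s' τ ⟨a, b, c⟩
    refine ⟨a, fun r hr h5 => ?_, by omega⟩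
    have : r ≠ 23 := by omega
    rw [b r hr h5]
    simp [this, f3 r hr]

/-- Process the dead fact at the address in register `11`. -/
def procC : Cmd :=
  asg 16 (.v 11 / .v 2) ;; asg 12 (.v 16 / .v 2) ;; asg 13 (.v 16 - .v 12 * .v 2) ;;
  asg 14 (.v 11 - .v 16 * .v 2) ;; asg 15 (.v 12 - (.v 12 / .c 2) * .c 2) ;;
  iff (.v 12 / .c 2)
    (iff (.v 12 / .c 2 - .c 1)
      (sweepAt true (FA (.c 2 + .v 15) (.c 0) (.v 13)) (.v 2) (FA (.c 4 + .v 15) (.c 0) (.v 14))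
        (.v 2) ;;
      sweepAt true (FA (.c 1 - .v 15) (.c 0) (.v 14)) (.v 2) (FA (.c 3 - .v 15) (.c 0) (.v 13))
        (.v 2) ;;
      sweepAt false (FA (.c 5 - .v 15) (.v 13) (.c 0)) (.c 1)
        (FA (.c 6) ((.c 1 - .v 15) * .v 14) (.v 15 * .v 14)) (.v 15 * .v 2 + (.c 1 - .v 15)))
      (sweepAt true (FA (.c 4 + .v 15) (.v 14) (.c 0)) (.c 1) (FA (.c 4 + .v 15) (.v 13) (.c 0))
        (.c 1)))
    (asg 25 (.v 11) ;; asg 26 (FA (.c 4 + .v 15) (.v 13) (.v 14)) ;; decC true ;;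
      sweepAt true (FA (.c 5 - .v 15) (.c 0) (.v 14)) (.v 2) (FA (.c 2 + .v 15) (.v 13) (.c 0))
        (.c 1)) ;;
  sto (.v 11) (.c 0)

theorem tot_proc_tail (hM : Ctx M m) (h : Rep m g L fl s) {f : Trip} (hf : Valid m f)
    (h11 : s.reg 11 = enc m f) : Tot M (sto (.v 11) (.c 0)) s fun s' τ =>
      Rep m (Function.update g f 0) L fl s' ∧ (∀ r, s'.reg r = s.reg r) ∧ τ ≤ 4 := by
  have hS := Rep.lt_S hM hf
  have := hM.le_W
  have := hM.pos
  refine tot_sto (by simp) (by simp; omega) (by simpa [h11]) ⟨?_, by simp, by simp⟩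
  simpa [h11] using h.set (by omega) hf (v := 0) (by simp)

/-- The program carries out `procA` in time linear in the number of nodes. -/
theorem tot_proc (hM : Ctx M m) (h : Rep m g L fl s) {f : Trip} (hf : Valid m f) (h6 : f.1 < 6)
    (h11 : s.reg 11 = enc m f) : Tot M procC s fun s' τ =>
      Rep m (procA m f (g, L)).1 (procA m f (g, L)).2 fl s' ∧ Fr 11 s s' ∧ τ ≤ 800 * m := by
  obtain ⟨k, a, b⟩ := f
  obtain ⟨-, ha, hb⟩ := id hf
  simp only at ha hb h6
  have hm := hM.pos
  have hS := hM.le_S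
  have hW := hM.le_W
  have hlt := enc_lt hf
  have hmm : m ≤ m * m := Nat.le_mul_self m
  have e1 : enc m (k, a, b) / m = k * m + a := by
    simp only [enc]
    rw [Nat.add_div_of_dvd_right (Dvd.intro_left _ rfl), Nat.mul_div_cancel _ (by omega),
      Nat.div_eq_of_lt hb, add_zero]
  have e2 : (k * m + a) / m = k := by
    rw [Nat.add_div_of_dvd_right (Dvd.intro_left _ rfl), Nat.mul_div_cancel _ (by omega),
      Nat.div_eq_of_lt ha, add_zero]
  have e3 : k * m + a - k * m = a := by omega
  have e4 : enc m (k, a, b) - (k * m + a) * m = b := by simp only [enc]; omega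
  have e5 : k - k / 2 * 2 = k % 2 := by omega
  have l1 : k * m + a ≤ (k * m + a) * m := Nat.le_mul_of_pos_right _ (by omega)
  have l2 : (k * m + a) * m ≤ enc m (k, a, b) := by simp only [enc]; omega
  unfold procC
  refine tot_seq (tot_asg (by norm_num) (by simp) (tot_seq (tot_asg (by norm_num) (by simp)
    (tot_seq (tot_asg (by norm_num) ?_ (tot_seq (tot_asg (by norm_num) ?_
    (tot_seq (tot_asg (by norm_num) ?_ (tot_seq ?_))))))))))
  · simp [h11, h.reg2, e1, e2]; omega
  · simp [h11, h.reg2, e1]; omega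
  · simp [h11, h.reg2, e1, e2]; omega
  simp only [Ex.eval_sub, Ex.eval_mul, Ex.eval_div, Ex.eval_v, Ex.eval_c, State.setReg_reg, h11,
    h.reg2, Nat.reduceEqDiff, if_true, if_false, e1, e2, e3, e4, e5, Ex.cost_sub, Ex.cost_v, Ex.cost_mul, Ex.cost_div, Ex.cost_c]
  set sg := k % 2 with hsg
  generalize hs1 : ((((s.setReg 16 (k * m + a)).setReg 12 k).setReg 13 a).setReg 14 b).setReg 15 sg
    = s1
  have hsg2 : sg < 2 := by omega
  have R1 : Rep m g L fl s1 := h.of_mem (by subst hs1; simp) (by subst hs1; simp)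
    (by subst hs1; simp)
  have r11 : s1.reg 11 = enc m (k, a, b) := by subst hs1; simp [h11]
  have r12 : s1.reg 12 = k := by subst hs1; simp
  have r13 : s1.reg 13 = a := by subst hs1; simp
  have r14 : s1.reg 14 = b := by subst hs1; simp
  have r15 : s1.reg 15 = sg := by subst hs1; simp
  have F1 : Fr 11 s s1 := by
    intro r hr _
    subst hs1
    have h1 : r ≠ 12 := by omega
    have h2 : r ≠ 13 := by omega
    have h3 : r ≠ 14 := by omega
    have h4 : r ≠ 15 := by omega
    have h5 : r ≠ 16 := by omega
    simp [h1, h2, h3, h4, h5]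
  have hc : ∀ x, x < 20 → x < M.W := fun x hx => by omega
  clear hs1 e1 e2 e3 e4 e5 l1 l2
  have tail : ∀ {c : Cfg} {s2 : State}, Rep m c.1 c.2 fl s2 → Fr 20 s1 s2 →
      Tot M (sto (.v 11) (.c 0)) s2 fun s' τ =>
      Rep m (Function.update c.1 (k, a, b) 0) c.2 fl s' ∧ Fr 11 s s' ∧ τ ≤ 4 := by
    intro c s2 hR hF
    refine (tot_proc_tail hM hR hf ((hF 11 (by norm_num) (by norm_num)).trans r11)).mono ?_
    rintro s' τ ⟨A, B, C⟩
    exact ⟨A, F1.trans (fun r hr h5 => (B r).trans (hF r (by omega) h5)), C⟩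
  refine tot_iff (by simp [hc]) (fun h1 => tot_iff (by simp [hc]) (fun h2 => ?_) fun h2 => ?_)
    fun h1 => ?_
  · simp only [Ex.eval_sub, Ex.eval_div, Ex.eval_v, Ex.eval_c, r12] at h1 h2
    have hk2 : k / 2 = 2 := by omega
    simp only [procA, ← hsg, hk2, OfNat.ofNat_ne_zero, OfNat.ofNat_ne_one, if_false]
    refine tot_seq ((tot_sweepAt hM R1 (P := fun i => (2 + sg, i, a)) (H := fun i => (4 + sg, i, b))
      (by simp) (by simp) (by simp) (by simp) (FA_ok hM R1.reg2 ?_ ?_ ?_ ?_) ?_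
      (FA_ok hM R1.reg2 ?_ ?_ ?_ ?_) ?_ ?_ ?_).mono ?_)
    any_goals simp [hc, r13, r14, r15, Valid, ha, hb]
    any_goals omega
    · intro i hi
      rw [FA_eval R1.reg2]
      simp [R1.reg2, r13, r15, enc, hi, ha]
      exact ⟨by ring, by omega⟩
    · intro i hi
      rw [FA_eval R1.reg2]
      simp [R1.reg2, r14, r15, enc, hi, hb]
      exact ⟨by ring, by omega⟩
    intro s2 t2 R2 F2 T2
    have q13 := (F2 13 (by norm_num) (by norm_num)).trans r13
    have q14 := (F2 14 (by norm_num) (by norm_num)).trans r14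
    have q15 := (F2 15 (by norm_num) (by norm_num)).trans r15
    refine tot_seq ((tot_sweepAt hM R2 (P := fun i => (1 - sg, i, b)) (H := fun i => (3 - sg, i, a))
      (by simp) (by simp) (by simp) (by simp) (FA_ok hM R2.reg2 ?_ ?_ ?_ ?_) ?_
      (FA_ok hM R2.reg2 ?_ ?_ ?_ ?_) ?_ ?_ ?_).mono ?_)
    any_goals simp [hc, q13, q14, q15, Valid, ha, hb]
    any_goals omega
    · intro i hi
      rw [FA_eval R2.reg2]
      simp [R2.reg2, q14, q15, enc, hi, hb]
      exact ⟨by ring, by omega⟩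
    · intro i hi
      rw [FA_eval R2.reg2]
      simp [R2.reg2, q13, q15, enc, hi, ha]
      exact ⟨by ring, by omega⟩
    intro s3 t3 R3 F3 T3
    have p13 := (F3 13 (by norm_num) (by norm_num)).trans q13
    have p14 := (F3 14 (by norm_num) (by norm_num)).trans q14
    have p15 := (F3 15 (by norm_num) (by norm_num)).trans q15
    have hsg' : sg = 0 ∨ sg = 1 := by omega
    refine (tot_sweepAt hM R3 (P := fun i => (5 - sg, a, i))
      (H := fun i => (6, (1 - sg) * b + i * sg, sg * b + i * (1 - sg)))
      (by simp) (by simp) (by simp) (by simp) (FA_ok hM R3.reg2 ?_ ?_ ?_ ?_) ?_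
      (FA_ok hM R3.reg2 ?_ ?_ ?_ ?_) ?_ ?_ ?_).mono ?_
    any_goals simp [hc, p13, p14, p15, Valid, ha, hb, R3.reg2]
    any_goals omega
    any_goals rcases hsg' with h0 | h0 <;> simp [h0, R3.reg2, hc] <;> omega
    · intro i hi
      rw [FA_eval R3.reg2]
      simp [p13, p15, enc, hi, ha]
      omega
    · intro i hi
      rw [FA_eval R3.reg2]
      rcases hsg' with h0 | h0 <;> simp [p14, p15, enc, hi, hb, h0] <;> ring
    intro s4 t4 R4 F4 T4
    refine (tail R4 ((F2.trans F3).trans F4)).mono ?_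
    rintro s' τ ⟨A, B, C⟩
    refine ⟨A, B, ?_⟩
    omega
  · simp only [Ex.eval_sub, Ex.eval_div, Ex.eval_v, Ex.eval_c, r12] at h1 h2
    have hk2 : k / 2 = 1 := by omega
    simp only [procA, ← hsg, hk2, one_ne_zero, if_true, if_false]
    refine (tot_sweepAt hM R1 (P := fun i => (4 + sg, b, i)) (H := fun i => (4 + sg, a, i))
      (by simp) (by simp) (by simp) (by simp) (FA_ok hM R1.reg2 ?_ ?_ ?_ ?_) ?_
      (FA_ok hM R1.reg2 ?_ ?_ ?_ ?_) ?_ ?_ ?_).mono ?_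
    any_goals simp [hc, r13, r14, r15, Valid, ha, hb]
    any_goals omega
    · intro i hi
      rw [FA_eval R1.reg2]
      simp [r14, r15, enc, hi, hb]
      omega
    · intro i hi
      rw [FA_eval R1.reg2]
      simp [r13, r15, enc, hi, ha]
      omega
    intro s2 t2 R2 F2 T2
    refine (tail R2 F2).mono ?_
    rintro s' τ ⟨A, B, C⟩
    refine ⟨A, B, ?_⟩
    omega
  · simp only [Ex.eval_div, Ex.eval_v, Ex.eval_c, r12] at h1
    simp only [procA, ← hsg, h1, if_true]
    refine tot_seq (tot_asg (by norm_num) (by simp) (tot_seq (tot_asg (by norm_num)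
      (FA_ok hM ?_ ?_ ?_ ?_ ?_) (tot_seq ((tot_dec hM (p := (k, a, b)) (t := (4 + sg, a, b))
      ((R1.setReg (by norm_num) (by norm_num)).setReg (by norm_num) (by norm_num)) hf
      ?_ ?_ ?_).mono ?_)))))
    any_goals simp [hc, r11, r13, r14, r15, Valid, ha, hb, R1.reg2]
    any_goals omega
    · rw [FA_eval (by simpa using R1.reg2)]; simp [r13, r14, r15]
    intro s2 t2 R2 F2 T2
    have q13 := (F2 13 (by norm_num)).trans (by simpa using r13)
    have q14 := (F2 14 (by norm_num)).trans (by simpa using r14)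
    have q15 := (F2 15 (by norm_num)).trans (by simpa using r15)
    refine (tot_sweepAt hM R2 (P := fun i => (5 - sg, i, b)) (H := fun i => (2 + sg, a, i))
      (by simp) (by simp) (by simp) (by simp) (FA_ok hM R2.reg2 ?_ ?_ ?_ ?_) ?_
      (FA_ok hM R2.reg2 ?_ ?_ ?_ ?_) ?_ ?_ ?_).mono ?_
    any_goals simp [hc, q13, q14, q15, Valid, ha, hb]
    any_goals omega
    · intro i hi
      rw [FA_eval R2.reg2]
      simp [R2.reg2, q14, q15, enc, hi, hb]
      exact ⟨by ring, by omega⟩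
    · intro i hi
      rw [FA_eval R2.reg2]
      simp [q13, q15, enc, hi, ha]
      omega
    intro s3 t3 R3 F3 T3
    refine (tail R3 ?_).mono ?_
    · intro r hr h5
      have h25 : r ≠ 25 := by omega
      have h26 : r ≠ 26 := by omega
      rw [F3 r hr h5, F2 r h5]
      simp [h25, h26]
    · rintro s' τ ⟨A, B, C⟩
      refine ⟨A, B, ?_⟩
      omega

end Work

section Cascade
variable {M : Mach} {m fl : ℕ} {g : Tab} {L : List Trip} {s : State}

theorem Rep.pop {f : Trip} (h : Rep m g (L ++ [f]) fl s) :
    Rep m g L fl (s.setReg 5 L.length) ∧ s.mem (8 * (m * m) + L.length) = enc m f := by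
  have hn := h.nodup
  rw [List.nodup_append'] at hn
  refine ⟨⟨by simp [h.reg2], by simp, h.tab, fun i hi => ?_, h.flag, hn.1,
    fun t ht => h.good t (List.mem_append_left _ ht)⟩, ?_⟩
  · rw [State.setReg_mem, h.stk i (by simp; omega), List.getElem_append_left hi]
  · rw [h.stk L.length (by simp)]; simp

/-- Empty the work list. -/
def cascadeC : Cmd :=
  whl (.v 5) (asg 5 (.v 5 - .c 1) ;; asg 11 (.ld (.c 8 * (.v 2 * .v 2) + .v 5)) ;; procC)

/-- The deletion of one fact takes `O(m)` steps, so the running time is paid for by the number of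
facts that disappear. -/
theorem tot_cascade (hM : Ctx M m) {rk : ℕ → ℕ} (h : Rep m g L fl s) (hC : Core m rk g L) :
    Tot M cascadeC s fun s' τ => ∃ g', Rep m g' [] fl s' ∧ Core m rk g' [] ∧ Casc m g g' ∧
      Fr 11 s s' ∧ τ + 900 * m * nPres m 0 m g' ≤ 900 * m * nPres m 0 m g + 10 := by
  have hm := hM.pos
  have hS := hM.le_S
  have hW := hM.le_W
  refine tot_whl (fun s' φ => ∃ g' L', Rep m g' L' fl s' ∧ Core m rk g' L' ∧ Casc m g g' ∧
      Fr 11 s s' ∧ φ = 900 * m * nPres m 0 m g')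
    ⟨g, L, h, hC, Casc.refl m g, Fr.refl _ _, rfl⟩ (by simp) ?_ ?_
  · rintro s1 φ ⟨g1, L1, hR, hC1, hc, hF, rfl⟩ hne
    simp only [Ex.eval_v, hR.reg5] at hne
    obtain ⟨L2, f, rfl⟩ : ∃ L2 f, L1 = L2 ++ [f] :=
      ⟨_, _, (List.dropLast_append_getLast (List.ne_nil_of_length_pos (by omega))).symm⟩
    obtain ⟨hv, h6, hf1⟩ := (hC1.mem f).1 (by simp)
    obtain ⟨hR2, hmem⟩ := hR.pop
    have hlen := hR.len
    simp only [List.length_append, List.length_singleton] at hlen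
    refine tot_seq (tot_asg (by norm_num) (by simp; omega) (tot_seq (tot_asg (by norm_num) ?_ ?_)))
    · simp [hR.reg2, hR.reg5]; omega
    have e1 : (Ex.v 5 - Ex.c 1).eval M s1 = L2.length := by simp [hR.reg5]
    rw [e1]
    refine (tot_proc hM (f := f) (hR2.setReg (by norm_num) (by norm_num)) hv h6 ?_).mono ?_
    · simp [hR.reg2, hmem]
    · rintro s2 τ ⟨hR3, hF3, hτ⟩
      obtain ⟨hC3, hA⟩ := hC1.proc
      refine ⟨_, ⟨_, _, hR3, hC3, hc.step hA hf1, hF.trans ?_, rfl⟩, ?_⟩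
      · intro r hr h5
        have : r ≠ 11 := by omega
        rw [hF3 r hr h5]; simp [h5, this]
      · have hlt := nPres_lt hA hv h6 (by omega)
        have := Nat.mul_le_mul_left (900 * m) hlt
        rw [Nat.mul_add_one] at this
        simp only [Ex.cost_sub, Ex.cost_v, Ex.cost_c, Ex.cost_ld, Ex.cost_add, Ex.cost_mul]
        omega
  · rintro s1 t φ ⟨g1, L1, hR, hC1, hc, hF, rfl⟩ h0 ht
    simp only [Ex.eval_v, hR.reg5] at h0
    obtain rfl := List.length_eq_zero_iff.1 h0
    refine ⟨g1, hR, hC1, hc, hF, ?_⟩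
    simp only [Ex.cost_v] at ht
    omega

/-- Mark the edge fact at the address in register `26` for deletion. -/
def killC : Cmd := iff (.ld (.v 26) - .c 1) (sto (.v 26) (.c 1) ;; pushC) skip

/-- The program carries out `killA` in constant time. -/
theorem tot_kill (hM : Ctx M m) (h : Rep m g L fl s) {t : Trip} (ht : Valid m t)
    (h26 : s.reg 26 = enc m t) : Tot M killC s fun s' τ =>
      Rep m (killA t (g, L)).1 (killA t (g, L)).2 fl s' ∧ (∀ r, r ≠ 5 → s'.reg r = s.reg r) ∧
      τ ≤ 50 := by
  have htS := Rep.lt_S hM ht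
  have hm := hM.pos
  have hW : 1 < M.W := by have := hM.le_W; omega
  refine tot_iff (by simp [h26, htS, hW]) (fun h1 => ?_) fun h1 => ?_
  · have h2 : 2 ≤ g t := by simp [h26, h.tab t ht] at h1; omega
    refine tot_seq (tot_sto (by simp) (by simpa) (by simpa [h26]) ?_)
    have hL : t ∉ L := fun hL => by have := (h.good t hL).2; omega
    have hk : killA t (g, L) = (Function.update g t 1, L ++ [t]) := by simp [killA, h2]
    rw [hk]
    refine (tot_push hM (t := t) (g := Function.update g t 1) (L := L) (fl := fl) ?_ ht hL
      (by simp) (by simpa using h26)).mono ?_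
    · simpa [h26] using h.set (by omega) ht (v := 1) (by simp)
    · rintro s' τ ⟨a, b, c⟩
      refine ⟨a, fun r hr => (b r hr).trans (by simp), ?_⟩
      simp; omega
  · have h2 : ¬ 2 ≤ g t := by simp [h26, h.tab t ht] at h1; omega
    have hk : killA t (g, L) = (g, L) := by simp [killA, h2]
    rw [hk]
    exact tot_skip (by omega) ⟨h, fun _ _ => rfl, by simp⟩

end Cascade

/-! ### Loops that fill tables -/

section Fill
variable {M : Mach} {m fl : ℕ} {g : Tab} {s : State}

/-- A loop whose `k`-th iteration turns the table `G k` into `G (k + 1)`. -/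
theorem tot_tabs {r : ℕ} {e : Ex} {c : Cmd} {N : ℕ} (G : ℕ → Tab) (τ : ℕ) (hr : r < 100)
    (h2 : r ≠ 2) (h5 : r ≠ 5) (hN : N < M.W) (h0 : Rep m (G 0) [] fl s)
    (he : ∀ s' : State, Fr r s s' → e.Ok M s' ∧ e.eval M s' = N)
    (hc : ∀ k s', k < N → Rep m (G k) [] fl s' → Fr r s s' → s'.reg r = k →
      Tot M c s' fun s'' t => Rep m (G (k + 1)) [] fl s'' ∧ Fr (r + 1) s' s'' ∧ t ≤ τ) :
    Tot M (forUp r e c) s fun s' t => Rep m (G N) [] fl s' ∧ Fr r s s' ∧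
      t ≤ N * (τ + e.cost + 10) + e.cost + 10 := by
  refine tot_forUp (N := N) (fun k s' => Rep m (G k) [] fl s' ∧ Fr r s s' ∧ s'.reg r = k) τ hr hN
    ⟨h0.setReg h2 h5, fun r' hr' _ => ?_, by simp⟩ ?_ ?_ ?_
  · have : r' ≠ r := by omega
    simp [this]
  · rintro k s' hk ⟨a, b, d⟩
    exact ⟨d, he s' b⟩
  · rintro k s' hk ⟨a, b, d⟩
    refine (hc k s' hk a b d).mono ?_
    rintro s'' t ⟨a', b', t'⟩
    refine ⟨t', (b' r (by omega) h5).trans d, a'.setReg h2 h5, ?_, by simp⟩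
    intro r' hr' h
    have : r' ≠ r := by omega
    simp [this, b' r' (by omega) h, b r' hr' h]
  · rintro s' t ⟨a, b, d⟩ ht
    exact ⟨a, b, ht⟩

end Fill

/-! ### Insertion of a node on the machine -/

section Add
variable {M : Mach} {m fl : ℕ} {g : Tab} {s : State}

theorem tot_sto_tab (hM : Ctx M m) (h : Rep m g [] fl s) {a e : Ex} {t : Trip} (ht : Valid m t)
    (hao : a.Ok M s) (ha : a.eval M s = enc m t) (he : e.Ok M s) :
    Tot M (sto a e) s fun s' τ => Rep m (Function.update g t (e.eval M s)) [] fl s' ∧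
      (∀ r, s'.reg r = s.reg r) ∧ τ ≤ a.cost + e.cost + 1 := by
  have hm := hM.pos
  refine tot_sto hao he (by rw [ha]; exact Rep.lt_S hM ht) ⟨?_, by simp, by omega⟩
  rw [ha]
  exact h.set (by omega) ht (by simp)

/-- Add to register `16` the number of `c` (register `15`) for which both cells are nonzero. -/
def ipC (e₁ e₂ : Ex) : Cmd :=
  forUp 15 (.v 2) (iff (.ld e₁) (iff (.ld e₂) (asg 16 (.v 16 + .c 1)) skip) skip)

theorem tot_ip (hM : Ctx M m) (h : Rep m g [] fl s) {e₁ e₂ : Ex} {P Q : ℕ → Trip}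
    (l₁ : e₁.Low 16) (l₂ : e₂.Low 16)
    (h₁ : ∀ c < m, e₁.Ok M (s.setReg 15 c) ∧ e₁.eval M (s.setReg 15 c) = enc m (P c) ∧
      Valid m (P c))
    (h₂ : ∀ c < m, e₂.Ok M (s.setReg 15 c) ∧ e₂.eval M (s.setReg 15 c) = enc m (Q c) ∧
      Valid m (Q c)) (h16 : s.reg 16 ≤ 1) :
    Tot M (ipC e₁ e₂) s fun s' t => s'.mem = s.mem ∧ (∀ r < 15, s'.reg r = s.reg r) ∧
      s'.reg 16 = s.reg 16 + ipp m (fun c => g (P c)) (fun c => g (Q c)) ∧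
      t ≤ m * (e₁.cost + e₂.cost + 30) + 12 := by
  have hm := hM.pos
  have hS := hM.le_S
  have hW := hM.le_W
  have hmm : m ≤ m * m := Nat.le_mul_self m
  refine tot_forUp (N := m) (fun k s' => s'.mem = s.mem ∧ (∀ r < 15, s'.reg r = s.reg r) ∧
    s'.reg 15 = k ∧ s'.reg 16 = s.reg 16 + ipp k (fun c => g (P c)) (fun c => g (Q c)))
    (e₁.cost + e₂.cost + 16) (by norm_num) (by omega) ⟨rfl, fun r hr => ?_, by simp, ?_⟩ ?_ ?_ ?_
  · have : r ≠ 15 := by omega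
    simp [this]
  · simp [ipp]
  · rintro k s' hk ⟨a, b, c, d⟩
    exact ⟨c, by simp, by simp [b, h.reg2]⟩
  · rintro k s' hk ⟨a, b, c, d⟩
    have hreg : ∀ r < 16, s'.reg r = (s.setReg 15 k).reg r := by
      intro r hr
      by_cases h15 : r = 15
      · simp [h15, c]
      · simp [h15, b r (by omega)]
    obtain ⟨o1, v1, w1⟩ := h₁ k hk
    obtain ⟨o2, v2, w2⟩ := h₂ k hk
    have hmem : s'.mem = (s.setReg 15 k).mem := by simp [a]
    have x1 := (Ex.eval_congr hmem hreg e₁ l₁).trans v1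
    have x2 := (Ex.eval_congr hmem hreg e₂ l₂).trans v2
    have y1 := (Ex.ok_congr hmem hreg e₁ l₁).2 o1
    have y2 := (Ex.ok_congr hmem hreg e₂ l₂).2 o2
    have z1 : s'.mem (enc m (P k)) = g (P k) := by rw [a, h.tab _ w1]
    have z2 : s'.mem (enc m (Q k)) = g (Q k) := by rw [a, h.tab _ w2]
    have hS1 := Rep.lt_S hM w1
    have hS2 := Rep.lt_S hM w2
    have hip : ipp k (fun c => g (P c)) (fun c => g (Q c)) ≤ k := ipp_le
    have fin : ∀ {s2 : State} {t : ℕ}, s2.mem = s'.mem → (∀ r, r ≠ 16 → s2.reg r = s'.reg r) →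
        (s2.reg 16 = s'.reg 16 + if g (P k) ≠ 0 ∧ g (Q k) ≠ 0 then 1 else 0) →
        t ≤ e₁.cost + e₂.cost + 16 → t ≤ e₁.cost + e₂.cost + 16 ∧ s2.reg 15 = k ∧
        (s2.setReg 15 (k + 1)).mem = s.mem ∧
        (∀ r < 15, (s2.setReg 15 (k + 1)).reg r = s.reg r) ∧
        (s2.setReg 15 (k + 1)).reg 15 = k + 1 ∧ (s2.setReg 15 (k + 1)).reg 16 =
        s.reg 16 + ipp (k + 1) (fun c => g (P c)) (fun c => g (Q c)) := by
      intro s2 t f1 f2 f3 f4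
      refine ⟨f4, by rw [f2 15 (by norm_num), c], by simp [f1, a], fun r hr => ?_, by simp, ?_⟩
      · have h1 : r ≠ 15 := by omega
        have h2 : r ≠ 16 := by omega
        simp [h1, f2 r h2, b r hr]
      · simp only [State.setReg_reg, Nat.reduceEqDiff, if_false, f3, d, ipp,
          Finset.sum_range_succ]
        omega
    refine tot_iff (by simp [x1, y1, hS1]) (fun n1 => tot_iff (by simp [x2, y2, hS2])
      (fun n2 => tot_asg (by norm_num) ?_ (fin rfl ?_ ?_ ?_)) fun n2 =>
      tot_skip (by omega) (fin rfl ?_ ?_ ?_)) fun n1 => tot_skip (by omega) (fin rfl ?_ ?_ ?_)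
    · simp [d]; omega
    · intro r hr; simp [hr]
    · simp only [Ex.eval_ld, x1, x2, z1, z2] at n1 n2
      simp [n1, n2]
    · simp; omega
    · simp
    · simp only [Ex.eval_ld, x1, x2, z1, z2] at n1 n2
      simp [n1, n2]
    · simp; omega
    · simp
    · simp only [Ex.eval_ld, x1, x2, z1, z2] at n1
      simp [n1]
    · simp; omega
  · rintro s' t ⟨a, b, c, d⟩ ht
    refine ⟨a, b, d, ?_⟩
    simp only [Ex.cost_v] at ht
    rw [show e₁.cost + e₂.cost + 16 + 2 + 10 = e₁.cost + e₂.cost + 28 by omega] at ht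
    have := Nat.mul_le_mul_left m (show e₁.cost + e₂.cost + 28 ≤ e₁.cost + e₂.cost + 30 by omega)
    omega

/-- Store `up` of register `16`. -/
def upC (a : Ex) : Cmd := iff (.v 16) (sto a (.v 16 + .c 1)) (sto a (.c 0))

theorem tot_up (hM : Ctx M m) (h : Rep m g [] fl s) {a : Ex} {t : Trip} (ht : Valid m t)
    (hao : a.Ok M s) (ha : a.eval M s = enc m t) (h16 : s.reg 16 ≤ m + 1) :
    Tot M (upC a) s fun s' τ => Rep m (Function.update g t (up (s.reg 16))) [] fl s' ∧
      (∀ r, s'.reg r = s.reg r) ∧ τ ≤ a.cost + 20 := by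
  have hm := hM.pos
  have hS := hM.le_S
  have hW := hM.le_W
  have hmm : m ≤ m * m := Nat.le_mul_self m
  refine tot_iff (by simp) (fun n1 => (tot_sto_tab hM h ht hao ha ?_).mono ?_) fun n1 =>
    (tot_sto_tab hM h ht hao ha ?_).mono ?_
  · simp; omega
  · rintro s' τ ⟨x, y, z⟩
    simp only [Ex.eval_v] at n1
    refine ⟨by simpa [up, n1] using x, y, ?_⟩
    simp at z ⊢; omega
  · simp; omega
  · rintro s' τ ⟨x, y, z⟩
    simp only [Ex.eval_v] at n1
    refine ⟨by simpa [up, n1] using x, y, ?_⟩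
    simp at z ⊢; omega

/-- The first `n` cells of row `k` of kind `i` are overwritten by `val`. -/
def rowG (i k : ℕ) (val : ℕ → ℕ) (g : Tab) (n : ℕ) : Tab :=
  fun t => if t.1 = i ∧ t.2.1 = k ∧ t.2.2 < n then val t.2.2 else g t

theorem rowG_zero (i k : ℕ) (val : ℕ → ℕ) (g : Tab) : rowG i k val g 0 = g := by
  funext t; simp [rowG]

theorem rowG_succ (i k : ℕ) (val : ℕ → ℕ) (g : Tab) (n : ℕ) :
    Function.update (rowG i k val g n) (i, k, n) (val n) = rowG i k val g (n + 1) := by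
  funext ⟨a, b, c⟩
  by_cases h : (a, b, c) = ((i, k, n) : Trip)
  · rw [h]; simp [rowG]
  · rw [Function.update_of_ne h]
    simp only [Prod.mk.injEq, not_and] at h
    simp only [rowG]
    by_cases h1 : a = i ∧ b = k
    · have : c ≠ n := h h1.1 h1.2
      have e : c < n ↔ c < n + 1 := by omega
      simp [h1, e]
    · have h2 : ∀ q : Prop, ¬ (a = i ∧ b = k ∧ q) := by tauto
      simp [h2]

theorem rowG_other {i k : ℕ} {val : ℕ → ℕ} {g : Tab} {n : ℕ} {a b c : ℕ}
    (h : a ≠ i ∨ b ≠ k ∨ n ≤ c) : rowG i k val g n (a, b, c) = g (a, b, c) := by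
  have : ¬ (a = i ∧ b = k ∧ c < n) := by omega
  simp [rowG, this]

theorem rowG_self {i k : ℕ} {val : ℕ → ℕ} {g : Tab} {n c : ℕ} (h : c < n) :
    rowG i k val g n (i, k, c) = val c := by
  simp [rowG, h]

open Classical in
/-- Edge fact of a node with centre `v`. -/
noncomputable def valE (g : Tab) (s v z : ℕ) : ℕ := if Nbr g s v z then 2 else 0

/-- Neighbourhood of the new node `k` (register `11`) with centre `v` (register `12`). -/
def eC (i : ℕ) : Cmd :=
  forUp 13 (.v 2) (iff (.ld (if i = 0 then FA (.c 7) (.v 13) (.v 12) else FA (.c 7) (.v 12) (.v 13)))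
    (sto (FA (.c i) (.v 11) (.v 13)) (.c 2))
    (iff ((.v 13 - .v 12) + (.v 12 - .v 13)) (sto (FA (.c i) (.v 11) (.v 13)) (.c 0))
      (sto (FA (.c i) (.v 11) (.v 13)) (.c 2))))

theorem tot_e (hM : Ctx M m) (h : Rep m g [] fl s) {i k v : ℕ} (hi : i < 2) (hk : k < m)
    (hv : v < m) (h11 : s.reg 11 = k) (h12 : s.reg 12 = v) :
    Tot M (eC i) s fun s' τ => Rep m (rowG i k (valE g i v) g m) [] fl s' ∧ Fr 13 s s' ∧
      τ ≤ m * 100 + 12 := by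
  have hm := hM.pos
  have hS := hM.le_S
  have hW := hM.le_W
  have hmm : m ≤ m * m := Nat.le_mul_self m
  have hc : ∀ x, x < 20 → x < M.W := fun x hx => by omega
  refine (tot_tabs (N := m) (rowG i k (valE g i v) g) 80 (by norm_num) (by norm_num)
    (by norm_num) (by omega) (by rwa [rowG_zero]) (fun s' h' => ⟨by simp, by
      simp [h' 2 (by norm_num) (by norm_num), h.reg2]⟩) ?_).mono ?_
  · intro z s' hz hR hF h13
    have r11 := (hF 11 (by norm_num) (by norm_num)).trans h11
    have r12 := (hF 12 (by norm_num) (by norm_num)).trans h12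
    have hv1 : Valid m (i, k, z) := ⟨by simp only; omega, hk, hz⟩
    have ao : (FA (.c i) (.v 11) (.v 13)).Ok M s' := FA_ok hM hR.reg2 (by simp [hc]; omega)
      (by simp) (by simp) (by simpa [r11, h13] using hv1)
    have av : (FA (.c i) (.v 11) (.v 13)).eval M s' = enc m (i, k, z) := by
      rw [FA_eval hR.reg2]; simp [r11, h13]
    have fin : ∀ (x : ℕ), x = valE g i v z → x < 20 → Tot M (sto (FA (.c i) (.v 11) (.v 13)) (.c x))
        s' fun s'' t => Rep m (rowG i k (valE g i v) g (z + 1)) [] fl s'' ∧ Fr 14 s' s'' ∧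
        t ≤ 20 := by
      intro x hx hx2
      refine (tot_sto_tab hM hR hv1 ao av (by simp [hc, hx2])).mono ?_
      rintro s'' t ⟨A, B, C⟩
      refine ⟨?_, fun r _ _ => B r, by simp at C; omega⟩
      rwa [Ex.eval_c, hx, rowG_succ] at A
    have X1 : Valid m (7, z, v) := ⟨by simp, hz, hv⟩
    have X2 : Valid m (7, v, z) := ⟨by simp, hv, hz⟩
    have g1 : rowG i k (valE g i v) g z (7, z, v) = g (7, z, v) := rowG_other (by omega)
    have g2 : rowG i k (valE g i v) g z (7, v, z) = g (7, v, z) := rowG_other (by omega)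
    set e : Ex := (if i = 0 then FA (.c 7) (.v 13) (.v 12) else FA (.c 7) (.v 12) (.v 13)) with he
    have hh : e.Ok M s' ∧ e.eval M s' < M.S ∧ e.cost = 13 ∧ (s'.mem (e.eval M s') ≠ 0 ↔
        (i = 0 ∧ g (7, z, v) ≠ 0) ∨ (i = 1 ∧ g (7, v, z) ≠ 0)) := by
      obtain rfl | rfl : i = 0 ∨ i = 1 := by omega
      · simp only [he, if_true]
        refine ⟨FA_ok hM hR.reg2 (by simp [hc]) (by simp) (by simp)
          (by simpa [r12, h13] using X1), ?_, by simp, ?_⟩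
        · rw [FA_eval hR.reg2]; simpa [r12, h13] using Rep.lt_S hM X1
        · rw [FA_eval hR.reg2]; simp [r12, h13, hR.tab _ X1, g1]
      · simp only [he, one_ne_zero, if_false]
        refine ⟨FA_ok hM hR.reg2 (by simp [hc]) (by simp) (by simp)
          (by simpa [r12, h13] using X2), ?_, by simp, ?_⟩
        · rw [FA_eval hR.reg2]; simpa [r12, h13] using Rep.lt_S hM X2
        · rw [FA_eval hR.reg2]; simp [r12, h13, hR.tab _ X2, g2]
    obtain ⟨o1, o2, o3, o4⟩ := hh
    refine tot_iff ⟨o1, o2⟩ (fun n1 => (fin 2 ?_ (by norm_num)).mono ?_) fun n1 => tot_iff ?_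
      (fun n2 => (fin 0 ?_ (by norm_num)).mono ?_) fun n2 => (fin 2 ?_ (by norm_num)).mono ?_
    · have : Nbr g i v z := Or.inr (o4.1 n1)
      simp [valE, this]
    · rintro s'' t ⟨A, B, C⟩
      exact ⟨A, B, by simp [o3]; omega⟩
    · simp [r12, h13]; omega
    · have : ¬ Nbr g i v z := by
        rintro (rfl | h')
        · simp [r12, h13] at n2
        · exact o4.2 h' n1
      simp [valE, this]
    · rintro s'' t ⟨A, B, C⟩
      exact ⟨A, B, by simp [o3]; omega⟩
    · have : Nbr g i v z := by
        refine Or.inl ?_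
        simp [r12, h13] at n2
        omega
      simp [valE, this]
    · rintro s'' t ⟨A, B, C⟩
      exact ⟨A, B, by simp [o3]; omega⟩
  · rintro s' t ⟨A, B, C⟩
    refine ⟨A, B, ?_⟩
    simp at C; omega

/-- Counter of the witnesses that node `k` and the older node `j` have in common. -/
def valV (m : ℕ) (g : Tab) (i k j : ℕ) : ℕ :=
  up (ipp m (fun z => g (i, k, z)) fun z => g (5 - i, j, z))

/-- Counters of the new node `k` (register `11`) and the older nodes. -/
def vC (i : ℕ) : Cmd :=
  forUp 13 (.v 2) (asg 16 (.c 0) ;; ipC (FA (.c i) (.v 11) (.v 15)) (FA (.c (5 - i)) (.v 13) (.v 15))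
    ;; upC (FA (.c (2 + i)) (.v 11) (.v 13)))

theorem tot_v (hM : Ctx M m) (h : Rep m g [] fl s) {i k : ℕ} (hi : i < 2) (hk : k < m)
    (h11 : s.reg 11 = k) :
    Tot M (vC i) s fun s' τ => Rep m (rowG (2 + i) k (valV m g i k) g m) [] fl s' ∧ Fr 13 s s' ∧
      τ ≤ m * (m * 60 + 80) + 12 := by
  have hm := hM.pos
  have hS := hM.le_S
  have hW := hM.le_W
  have hmm : m ≤ m * m := Nat.le_mul_self m
  have hc : ∀ x, x < 20 → x < M.W := fun x hx => by omega
  refine (tot_tabs (N := m) (rowG (2 + i) k (valV m g i k) g) (m * 60 + 60) (by norm_num)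
    (by norm_num) (by norm_num) (by omega) (by rwa [rowG_zero]) (fun s' h' => ⟨by simp, by
      simp [h' 2 (by norm_num) (by norm_num), h.reg2]⟩) ?_).mono ?_
  · intro j s' hj hR hF h13
    have r11 := (hF 11 (by norm_num) (by norm_num)).trans h11
    refine tot_seq (tot_asg (by norm_num) (by simp [hc]) (tot_seq ((tot_ip hM
      (hR.setReg (by norm_num) (by norm_num)) (P := fun z => (i, k, z)) (Q := fun z => (5 - i, j, z))
      (by simp) (by simp) ?_ ?_ (by simp)).mono ?_)))
    · intro c hcm
      have hv1 : Valid m (i, k, c) := ⟨by simp only; omega, hk, hcm⟩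
      refine ⟨FA_ok hM (by simp [hR.reg2]) (by simp [hc]; omega) (by simp) (by simp)
        (by simpa [r11] using hv1), ?_, hv1⟩
      rw [FA_eval (by simpa using hR.reg2)]; simp [r11]
    · intro c hcm
      have hv1 : Valid m (5 - i, j, c) := ⟨by simp only; omega, hj, hcm⟩
      refine ⟨FA_ok hM (by simp [hR.reg2]) (by simp [hc]; omega) (by simp) (by simp)
        (by simpa [h13] using hv1), ?_, hv1⟩
      rw [FA_eval (by simpa using hR.reg2)]; simp [h13]
    · rintro s1 t1 ⟨A, B, C, D⟩
      have hv1 : Valid m (2 + i, k, j) := ⟨by simp only; omega, hk, hj⟩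
      have R1 : Rep m (rowG (2 + i) k (valV m g i k) g j) [] fl s1 :=
        hR.of_mem (by simp [A]) (by simp [B]) (by simp [B])
      have q11 : s1.reg 11 = k := by simp [B, r11]
      have q13 : s1.reg 13 = j := by simp [B, h13]
      have e1 : s1.reg 16 = ipp m (fun z => g (i, k, z)) fun z => g (5 - i, j, z) := by
        rw [C]
        simp only [Ex.eval_c, State.setReg_reg, if_true, zero_add]
        refine ipp_congr fun c hcm => ?_
        rw [rowG_other (by omega), rowG_other (by omega)]
      have hle : s1.reg 16 ≤ m := e1 ▸ ipp_le
      refine (tot_up hM R1 hv1 (FA_ok hM R1.reg2 (by simp [hc]; omega) (by simp) (by simp)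
        (by simpa [q11, q13] using hv1)) ?_ (by omega)).mono ?_
      · rw [FA_eval R1.reg2]; simp [q11, q13]
      · rintro s2 t2 ⟨A', B', C'⟩
        refine ⟨?_, fun r hr h5 => ?_, ?_⟩
        · rw [e1] at A'
          rw [← rowG_succ]
          exact A'
        · have : r ≠ 16 := by omega
          rw [B', B r (by omega)]; simp [this]
        · simp at D C' ⊢; omega
  · rintro s' t ⟨A, B, C⟩
    refine ⟨A, B, ?_⟩
    simp only [Ex.cost_v] at C
    have := Nat.mul_le_mul_left m (show m * 60 + 60 + 2 + 10 ≤ m * 60 + 80 by omega)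
    omega

/-- Counter of the witnesses that node `k` and the vertex `x` are connected. -/
def valL (m : ℕ) (g : Tab) (i k x : ℕ) : ℕ :=
  up ((if g (i, k, x) ≠ 0 then 1 else 0) + ipp m (fun j => g (2 + i, k, j)) fun j => g (4 + i, j, x))

/-- Counters of the new node `k` (register `11`) and the vertices. -/
def lC (i : ℕ) : Cmd :=
  forUp 13 (.v 2) (iff (.ld (FA (.c i) (.v 11) (.v 13))) (asg 16 (.c 1)) (asg 16 (.c 0)) ;;
    ipC (FA (.c (2 + i)) (.v 11) (.v 15)) (FA (.c (4 + i)) (.v 15) (.v 13)) ;;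
    upC (FA (.c (4 + i)) (.v 11) (.v 13)))

theorem tot_l (hM : Ctx M m) (h : Rep m g [] fl s) {i k : ℕ} (hi : i < 2) (hk : k < m)
    (h11 : s.reg 11 = k) :
    Tot M (lC i) s fun s' τ => Rep m (rowG (4 + i) k (valL m g i k) g m) [] fl s' ∧ Fr 13 s s' ∧
      τ ≤ m * (m * 60 + 110) + 12 := by
  have hm := hM.pos
  have hS := hM.le_S
  have hW := hM.le_W
  have hmm : m ≤ m * m := Nat.le_mul_self m
  have hc : ∀ x, x < 20 → x < M.W := fun x hx => by omega
  refine (tot_tabs (N := m) (rowG (4 + i) k (valL m g i k) g) (m * 60 + 90) (by norm_num)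
    (by norm_num) (by norm_num) (by omega) (by rwa [rowG_zero]) (fun s' h' => ⟨by simp, by
      simp [h' 2 (by norm_num) (by norm_num), h.reg2]⟩) ?_).mono ?_
  · intro x s' hx hR hF h13
    have r11 := (hF 11 (by norm_num) (by norm_num)).trans h11
    have hv0 : Valid m (i, k, x) := ⟨by simp only; omega, hk, hx⟩
    have hv1 : Valid m (4 + i, k, x) := ⟨by simp only; omega, hk, hx⟩
    have e0 : (FA (.c i) (.v 11) (.v 13)).eval M s' = enc m (i, k, x) := by
      rw [FA_eval hR.reg2]; simp [r11, h13]
    have g0 : rowG (4 + i) k (valL m g i k) g x (i, k, x) = g (i, k, x) := rowG_other (by omega)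
    have o0 : (FA (.c i) (.v 11) (.v 13)).Ok M s' := FA_ok hM hR.reg2 (by simp [hc]; omega) (by simp)
      (by simp) (by simpa [r11, h13] using hv0)
    have key : ∀ t0 ≤ 30, Tot M (ipC (FA (.c (2 + i)) (.v 11) (.v 15)) (FA (.c (4 + i)) (.v 15) (.v 13)) ;;
        upC (FA (.c (4 + i)) (.v 11) (.v 13))) (s'.setReg 16 (if g (i, k, x) ≠ 0 then 1 else 0))
        fun s'' t => Rep m (rowG (4 + i) k (valL m g i k) g (x + 1)) [] fl s'' ∧ Fr (13 + 1) s' s'' ∧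
          t0 + t ≤ m * 60 + 90 := by
      intro t0 ht0
      refine tot_seq ((tot_ip hM
        (hR.setReg (by norm_num) (by norm_num)) (P := fun j => (2 + i, k, j))
        (Q := fun j => (4 + i, j, x)) (by simp) (by simp) ?_ ?_ ?_).mono ?_)
      · intro c hcm
        have hv1 : Valid m (2 + i, k, c) := ⟨by simp only; omega, hk, hcm⟩
        refine ⟨FA_ok hM (by simp [hR.reg2]) (by simp [hc]; omega) (by simp) (by simp)
          (by simpa [r11] using hv1), ?_, hv1⟩
        rw [FA_eval (by simpa using hR.reg2)]; simp [r11]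
      · intro c hcm
        have hv1 : Valid m (4 + i, c, x) := ⟨by simp only; omega, hcm, hx⟩
        refine ⟨FA_ok hM (by simp [hR.reg2]) (by simp [hc]; omega) (by simp) (by simp)
          (by simpa [h13] using hv1), ?_, hv1⟩
        rw [FA_eval (by simpa using hR.reg2)]; simp [h13]
      · rw [State.setReg_reg, if_pos rfl]; split_ifs <;> omega
      · rintro s1 t1 ⟨A, B, C, D⟩
        have R1 : Rep m (rowG (4 + i) k (valL m g i k) g x) [] fl s1 :=
          hR.of_mem (by simp [A]) (by simp [B]) (by simp [B])
        have q11 : s1.reg 11 = k := by simp [B, r11]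
        have q13 : s1.reg 13 = x := by simp [B, h13]
        have e1 : s1.reg 16 = (if g (i, k, x) ≠ 0 then 1 else 0) +
            ipp m (fun j => g (2 + i, k, j)) fun j => g (4 + i, j, x) := by
          rw [C, State.setReg_reg, if_pos rfl]
          congr 1
          refine ipp_congr fun c hcm => ?_
          rw [rowG_other (by omega), rowG_other (by omega)]
        have hle : s1.reg 16 ≤ m + 1 := by
          have : ipp m (fun j => g (2 + i, k, j)) (fun j => g (4 + i, j, x)) ≤ m := ipp_le
          rw [e1]; split_ifs <;> omega
        refine (tot_up hM R1 hv1 (FA_ok hM R1.reg2 (by simp [hc]; omega) (by simp) (by simp)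
          (by simpa [q11, q13] using hv1)) ?_ (by omega)).mono ?_
        · rw [FA_eval R1.reg2]; simp [q11, q13]
        · rintro s2 t2 ⟨A', B', C'⟩
          refine ⟨?_, fun r hr h5 => ?_, ?_⟩
          · rw [e1] at A'
            rw [← rowG_succ]
            exact A'
          · have : r ≠ 16 := by omega
            rw [B', B r (by omega)]; simp [this]
          · simp at D C' ⊢; omega
    have hS0 := Rep.lt_S hM hv0
    refine tot_seq (tot_iff ⟨o0, by rwa [e0]⟩ (fun n1 => tot_asg (by norm_num) (by simp [hc]) ?_)
      fun n1 => tot_asg (by norm_num) (by simp [hc]) ?_)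
    · rw [Ex.eval_ld, e0, hR.tab _ hv0, g0] at n1
      have := key (((Ex.c 1).cost + 2) + (Ex.ld (FA (.c i) (.v 11) (.v 13))).cost + 1)
        (by simp)
      simpa only [n1, ne_eq, not_false_eq_true, if_true, Ex.eval_c] using this
    · rw [Ex.eval_ld, e0, hR.tab _ hv0, g0] at n1
      have := key (((Ex.c 0).cost + 2) + (Ex.ld (FA (.c i) (.v 11) (.v 13))).cost + 1)
        (by simp)
      simpa only [n1, ne_eq, not_true_eq_false, if_false, Ex.eval_c] using this
  · rintro s' t ⟨A, B, C⟩
    refine ⟨A, B, ?_⟩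
    simp only [Ex.cost_v] at C
    have := Nat.mul_le_mul_left m (show m * 60 + 90 + 2 + 10 ≤ m * 60 + 110 by omega)
    omega

/-- Contribution of node `k` to the counters of reachability, for the pairs before `(a, b)`. -/
def reachG (k : ℕ) (g : Tab) (a b : ℕ) : Tab := fun t =>
  if t.1 = 6 ∧ (t.2.1 < a ∨ t.2.1 = a ∧ t.2.2 < b) then
    g t + if g (4, k, t.2.1) ≠ 0 ∧ g (5, k, t.2.2) ≠ 0 then 1 else 0
  else g t

/-- Contribution of the new node `k` (register `11`) to reachability. -/
def rC : Cmd :=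
  forUp 13 (.v 2) (forUp 14 (.v 2) (iff (.ld (FA (.c 4) (.v 11) (.v 13)))
    (iff (.ld (FA (.c 5) (.v 11) (.v 14)))
      (sto (FA (.c 6) (.v 13) (.v 14)) (.ld (FA (.c 6) (.v 13) (.v 14)) + .c 1)) skip) skip))

theorem tot_r (hM : Ctx M m) (h : Rep m g [] fl s) {k : ℕ} (hk : k < m)
    (h11 : s.reg 11 = k) (hB : ∀ t, Valid m t → t.1 = 6 → g t + 1 < M.W) :
    Tot M rC s fun s' τ => Rep m (reachG k g m 0) [] fl s' ∧ Fr 13 s s' ∧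
      τ ≤ m * (m * 100 + 24) + 12 := by
  have hm := hM.pos
  have hS := hM.le_S
  have hW := hM.le_W
  have hmm : m ≤ m * m := Nat.le_mul_self m
  have hc : ∀ x, x < 20 → x < M.W := fun x hx => by omega
  refine (tot_tabs (N := m) (fun a => reachG k g a 0) (m * 100 + 12) (by norm_num)
    (by norm_num) (by norm_num) (by omega) (h.congr fun t _ => by simp [reachG])
    (fun s' h' => ⟨by simp, by simp [h' 2 (by norm_num) (by norm_num), h.reg2]⟩) ?_).mono ?_
  · intro x s' hx hR hF h13
    have r11 := (hF 11 (by norm_num) (by norm_num)).trans h11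
    refine (tot_tabs (N := m) (fun b => reachG k g x b) 88 (by norm_num)
      (by norm_num) (by norm_num) (by omega) hR
      (fun s' h' => ⟨by simp, by simp [h' 2 (by norm_num) (by norm_num), hR.reg2]⟩) ?_).mono ?_
    · intro y s1 hy R1 F1 h14
      have q11 := (F1 11 (by norm_num) (by norm_num)).trans r11
      have q13 := (F1 13 (by norm_num) (by norm_num)).trans h13
      have w4 : Valid m (4, k, x) := ⟨by simp, hk, hx⟩
      have w5 : Valid m (5, k, y) := ⟨by simp, hk, hy⟩
      have w6 : Valid m (6, x, y) := ⟨by simp, hx, hy⟩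
      have e4 : (FA (.c 4) (.v 11) (.v 13)).eval M s1 = enc m (4, k, x) := by
        rw [FA_eval R1.reg2]; simp [q11, q13]
      have e5 : (FA (.c 5) (.v 11) (.v 14)).eval M s1 = enc m (5, k, y) := by
        rw [FA_eval R1.reg2]; simp [q11, h14]
      have e6 : (FA (.c 6) (.v 13) (.v 14)).eval M s1 = enc m (6, x, y) := by
        rw [FA_eval R1.reg2]; simp [q13, h14]
      have o4 : (FA (.c 4) (.v 11) (.v 13)).Ok M s1 := FA_ok hM R1.reg2 (by simp [hc]) (by simp)
        (by simp) (by simpa [q11, q13] using w4)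
      have o5 : (FA (.c 5) (.v 11) (.v 14)).Ok M s1 := FA_ok hM R1.reg2 (by simp [hc]) (by simp)
        (by simp) (by simpa [q11, h14] using w5)
      have o6 : (FA (.c 6) (.v 13) (.v 14)).Ok M s1 := FA_ok hM R1.reg2 (by simp [hc]) (by simp)
        (by simp) (by simpa [q13, h14] using w6)
      have g4 : s1.mem (enc m (4, k, x)) = g (4, k, x) := by rw [R1.tab _ w4]; simp [reachG]
      have g5 : s1.mem (enc m (5, k, y)) = g (5, k, y) := by rw [R1.tab _ w5]; simp [reachG]
      have g6 : s1.mem (enc m (6, x, y)) = g (6, x, y) := by rw [R1.tab _ w6]; simp [reachG]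
      have step : ∀ t : Trip, Function.update (reachG k g x y) (6, x, y)
          (g (6, x, y) + if g (4, k, x) ≠ 0 ∧ g (5, k, y) ≠ 0 then 1 else 0) t =
          reachG k g x (y + 1) t := by
        rintro ⟨a, b, c⟩
        by_cases ht : (a, b, c) = ((6, x, y) : Trip)
        · rw [ht]; simp [reachG]
        · rw [Function.update_of_ne ht]
          simp only [Prod.mk.injEq] at ht
          have : (a = 6 ∧ (b < x ∨ b = x ∧ c < y)) ↔ (a = 6 ∧ (b < x ∨ b = x ∧ c < y + 1)) := by
            omega
          simp only [reachG, this]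
      have step0 : ¬ (g (4, k, x) ≠ 0 ∧ g (5, k, y) ≠ 0) →
          ∀ t : Trip, reachG k g x y t = reachG k g x (y + 1) t := by
        intro hn t
        rw [← step t, if_neg hn, Function.update_apply]
        split_ifs with ht
        · rw [ht]; simp [reachG]
        · rfl
      refine tot_iff ⟨o4, by rw [e4]; exact Rep.lt_S hM w4⟩ (fun n1 => tot_iff
        ⟨o5, by rw [e5]; exact Rep.lt_S hM w5⟩ (fun n2 => (tot_sto_tab hM R1 w6 o6 e6 ?_).mono ?_)
        fun n2 => tot_skip (by omega) ⟨R1.congr fun t _ => step0 ?_ t, Fr.refl _ _, by simp⟩)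
        fun n1 => tot_skip (by omega) ⟨R1.congr fun t _ => step0 ?_ t, Fr.refl _ _, by simp⟩
      · have := hB _ w6 rfl
        refine ⟨⟨o6, by rw [e6]; exact Rep.lt_S hM w6⟩, by simp [hc], ?_⟩
        simp only [Ex.eval_ld, Ex.eval_c, e6, g6]
        exact this
      · rintro s2 t2 ⟨A, B, C⟩
        rw [Ex.eval_ld, e4, g4] at n1
        rw [Ex.eval_ld, e5, g5] at n2
        refine ⟨A.congr fun t _ => ?_, fun r _ _ => B r, by simp at C ⊢; omega⟩
        rw [← step t, if_pos ⟨n1, n2⟩]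
        simp [e6, g6]
      · rw [Ex.eval_ld, e5, g5] at n2; tauto
      · rw [Ex.eval_ld, e4, g4] at n1; tauto
    · rintro s1 t1 ⟨A, B, C⟩
      refine ⟨A.congr fun t ht => ?_, B, by simp at C; omega⟩
      obtain ⟨a, b, c⟩ := t
      have hcm : c < m := ht.2.2
      have : (a = 6 ∧ (b < x ∨ b = x ∧ c < m)) ↔ (a = 6 ∧ (b < x + 1 ∨ b = x + 1 ∧ c < 0)) := by
        omega
      simp only [reachG, this]
  · rintro s' t ⟨A, B, C⟩
    refine ⟨A, B, ?_⟩
    simp only [Ex.cost_v] at C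
    rw [show m * 100 + 12 + 2 + 10 = m * 100 + 24 by omega] at C
    omega

/-- Insert node `k` (register `11`) with centre `v` (register `12`) as the newest node. -/
def addC : Cmd := eC 0 ;; eC 1 ;; vC 0 ;; vC 1 ;; lC 0 ;; lC 1 ;; rC

/-- Each of the `O(m)` cells of the rows takes `O(m)` steps, and each of the `O(m²)` pairs takes `O(1)`
steps. -/
theorem tot_add (hM : Ctx M m) (h : Rep m g [] fl s) {k v : ℕ} (hk : k < m) (hv : v < m)
    (h11 : s.reg 11 = k) (h12 : s.reg 12 = v) (hB : ∀ t, Valid m t → t.1 = 6 → g t + 1 < M.W) :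
    Tot M addC s fun s' τ => ∃ g', Rep m g' [] fl s' ∧ AddSpec m k v g g' ∧ Fr 13 s s' ∧
      τ ≤ 1000 * (m * m) := by
  have hm := hM.pos
  refine tot_seq ((tot_e hM h (i := 0) (by omega) hk hv h11 h12).mono ?_)
  rintro s1 t1 ⟨R1, F1, T1⟩
  refine tot_seq ((tot_e hM R1 (i := 1) (by omega) hk hv ((F1 11 (by omega) (by omega)).trans h11)
    ((F1 12 (by omega) (by omega)).trans h12)).mono ?_)
  rintro s2 t2 ⟨R2, F2, T2⟩
  replace F2 := F1.trans F2
  refine tot_seq ((tot_v hM R2 (i := 0) (by omega) hk ((F2 11 (by omega) (by omega)).trans h11)).mono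
    ?_)
  rintro s3 t3 ⟨R3, F3, T3⟩
  replace F3 := F2.trans F3
  refine tot_seq ((tot_v hM R3 (i := 1) (by omega) hk ((F3 11 (by omega) (by omega)).trans h11)).mono
    ?_)
  rintro s4 t4 ⟨R4, F4, T4⟩
  replace F4 := F3.trans F4
  refine tot_seq ((tot_l hM R4 (i := 0) (by omega) hk ((F4 11 (by omega) (by omega)).trans h11)).mono
    ?_)
  rintro s5 t5 ⟨R5, F5, T5⟩
  replace F5 := F4.trans F5
  refine tot_seq ((tot_l hM R5 (i := 1) (by omega) hk ((F5 11 (by omega) (by omega)).trans h11)).mono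
    ?_)
  rintro s6 t6 ⟨R6, F6, T6⟩
  replace F6 := F5.trans F6
  set g1 := rowG 0 k (valE g 0 v) g m with hg1
  set g2 := rowG 1 k (valE g1 1 v) g1 m with hg2
  set g3 := rowG (2 + 0) k (valV m g2 0 k) g2 m with hg3
  set g4 := rowG (2 + 1) k (valV m g3 1 k) g3 m with hg4
  set g5 := rowG (4 + 0) k (valL m g4 0 k) g4 m with hg5
  set g6 := rowG (4 + 1) k (valL m g5 1 k) g5 m with hg6
  have d1 : ∀ {a b c}, a ≠ 0 ∨ b ≠ k → g1 (a, b, c) = g (a, b, c) :=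
    fun h => rowG_other (by omega)
  have d2 : ∀ {a b c}, a ≠ 1 ∨ b ≠ k → g2 (a, b, c) = g1 (a, b, c) :=
    fun h => rowG_other (by omega)
  have d3 : ∀ {a b c}, a ≠ 2 ∨ b ≠ k → g3 (a, b, c) = g2 (a, b, c) :=
    fun h => rowG_other (by omega)
  have d4 : ∀ {a b c}, a ≠ 3 ∨ b ≠ k → g4 (a, b, c) = g3 (a, b, c) :=
    fun h => rowG_other (by omega)
  have d5 : ∀ {a b c}, a ≠ 4 ∨ b ≠ k → g5 (a, b, c) = g4 (a, b, c) :=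
    fun h => rowG_other (by omega)
  have d6 : ∀ {a b c}, a ≠ 5 ∨ b ≠ k → g6 (a, b, c) = g5 (a, b, c) :=
    fun h => rowG_other (by omega)
  refine (tot_r hM R6 hk ((F6 11 (by omega) (by omega)).trans h11) ?_).mono ?_
  · rintro ⟨a, b, c⟩ ht h6
    simp only at h6
    subst h6
    rw [d6 (by omega), d5 (by omega), d4 (by omega), d3 (by omega), d2 (by omega), d1 (by omega)]
    exact hB _ ht rfl
  rintro s7 t7 ⟨R7, F7, T7⟩
  refine ⟨_, R7, ?_, F6.trans F7, ?_⟩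
  swap
  · simp only [Nat.mul_add, Nat.add_mul, ← Nat.mul_assoc] at T1 T2 T3 T4 T5 T6 T7 ⊢
    have h1 : 2 * m ≤ m * m := Nat.mul_le_mul_right _ hm
    have h2 : m * m * 60 = 60 * (m * m) := Nat.mul_comm _ _
    have h3 : m * m * 100 = 100 * (m * m) := Nat.mul_comm _ _
    have h4 : 1000 * m * m = 1000 * (m * m) := Nat.mul_assoc _ _ _
    omega
  have d7 : ∀ {a b c}, a ≠ 6 → reachG k g6 m 0 (a, b, c) = g6 (a, b, c) := by
    intro a b c ha; simp [reachG, ha]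
  have nb : ∀ z, Nbr g1 1 v z ↔ Nbr g 1 v z := by
    intro z; simp only [Nbr]; rw [d1 (by omega), d1 (by omega)]
  refine ⟨?_, ?_, ?_, ?_, ?_, ?_⟩
  · intro i hi z hz
    rw [d7 (by omega), d6 (by omega), d5 (by omega), d4 (by omega), d3 (by omega)]
    obtain rfl | rfl : i = 0 ∨ i = 1 := by omega
    · rw [d2 (by omega), hg1, rowG_self hz]
      simp +contextual [valE]
    · rw [hg2, rowG_self hz]
      simp +contextual [valE, nb]
  · intro i hi j hj
    rw [d7 (by omega), d6 (by omega), d5 (by omega)]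
    obtain rfl | rfl : i = 0 ∨ i = 1 := by omega
    · rw [d4 (by omega), hg3, rowG_self hj, valV]
      congr 1
    · rw [hg4, rowG_self hj, valV]
      congr 1
  · intro i hi x hx
    rw [d7 (by omega)]
    obtain rfl | rfl : i = 0 ∨ i = 1 := by omega
    · rw [d6 (by omega), hg5, rowG_self hx, valL]
      congr 2
    · rw [hg6, rowG_self hx, valL]
      congr 2
  · intro x hx y hy
    rw [d7 (a := 4) (by omega), d7 (a := 5) (by omega)]
    simp only [reachG, hx, true_or, and_true, if_true]
    rw [d6 (a := 6) (by omega), d5 (a := 6) (by omega), d4 (a := 6) (by omega),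
      d3 (a := 6) (by omega), d2 (a := 6) (by omega), d1 (a := 6) (by omega)]
  · rintro ⟨a, b, c⟩ ht h6 hne
    simp only at h6 hne
    rw [d7 (by omega), d6 (by omega), d5 (by omega), d4 (by omega), d3 (by omega), d2 (by omega),
      d1 (by omega)]
  · rintro ⟨a, b, c⟩ ht h6
    simp only at h6
    rw [d7 (by omega), d6 (by omega), d5 (by omega), d4 (by omega), d3 (by omega), d2 (by omega),
      d1 (by omega)]

end Add

/-! ### The tables of a graph with `n` vertices -/

open Relation (ReflTransGen)

theorem Core.congr {m : ℕ} {rk : ℕ → ℕ} {g g' : Tab} {L : List Trip} (hC : Core m rk g L)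
    (h : ∀ t, Valid m t → t.1 < 7 → g' t = g t) : Core m rk g' L := by
  have hcnt : ∀ t, Valid m t → 2 ≤ t.1 → t.1 < 7 → cnt m g' t = cnt m g t :=
    fun t h1 h2 h3 => cnt_congr (fun t' a b => by rw [h t' a (by omega)]) h1 h2 h3
  refine ⟨hC.nodup, fun t => ?_, fun t h1 h2 => ?_, fun t h1 h2 h3 => ?_, fun t h1 h2 h3 => ?_,
    fun t h1 h2 h3 => ?_, fun t h1 h2 => ?_⟩
  · rw [hC.mem]
    refine and_congr_right fun h1 => and_congr_right fun h2 => ?_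
    rw [h t h1 (by omega)]
  · rw [h t h1 (by omega)]; exact hC.edge t h1 h2
  · rw [h t h1 (by omega)]; exact hC.rank t h1 h2 h3
  · rw [h t h1 (by omega), hcnt t h1 h2 (by omega)]; exact hC.pres t h1 h2 h3
  · rw [h t h1 (by omega), hcnt t h1 h2 (by omega)]; exact hC.abs t h1 h2 h3
  · rw [h t h1 (by omega), hcnt t h1 (by omega) (by omega)]; exact hC.reach t h1 h2

/-- The facts in `T` are marked for deletion, and the matrix entries in `Z` are set to zero. -/
def Marks (T Z : Trip → Prop) (g₀ g : Tab) : Prop := ∀ t,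
  (t.1 < 7 → (T t ∧ 2 ≤ g₀ t → g t = 1) ∧ (¬ (T t ∧ 2 ≤ g₀ t) → g t = g₀ t)) ∧
  (t.1 = 7 → (Z t → g t = 0) ∧ (¬ Z t → g t = g₀ t))

section Marked
variable {m : ℕ} {rk : ℕ → ℕ} {g₀ g g' : Tab} {T Z : Trip → Prop}

theorem Marks.ne_zero (h : Marks T Z g₀ g) {t : Trip} (ht : t.1 < 7) : g t ≠ 0 ↔ g₀ t ≠ 0 := by
  by_cases h1 : T t ∧ 2 ≤ g₀ t
  · rw [((h t).1 ht).1 h1]; omega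
  · rw [((h t).1 ht).2 h1]

theorem Core.ne_one (hC : Core m rk g []) {t : Trip} (ht : Valid m t) (h6 : t.1 < 6) : g t ≠ 1 :=
  fun h => by simpa using (hC.mem t).2 ⟨ht, h6, h⟩

/-- After the work list has been emptied, exactly the edge facts in `T` are gone. -/
theorem edge_after (hC : Core m rk g₀ []) (hM : Marks T Z g₀ g) (hc : Casc m g g')
    (hC' : Core m rk g' []) {t : Trip} (ht : Valid m t) (h2 : t.1 < 2) :
    g' t ≠ 0 ↔ g₀ t ≠ 0 ∧ ¬ T t := by
  have h1 := hC.edge t ht h2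
  have h3 := hC.ne_one ht (by omega)
  have h4 := hC'.ne_one ht (by omega)
  by_cases hT : T t ∧ 2 ≤ g₀ t
  · have h5 := ((hM t).1 (by omega)).1 hT
    have h6 := hc.one t ht h2 h5
    have : g' t = 0 := by omega
    simp [this, hT.1]
  · have h5 := ((hM t).1 (by omega)).2 hT
    rw [hc.edge t ht h2 (by omega), h5]
    constructor
    · exact fun h => ⟨h, fun h' => hT ⟨h', by omega⟩⟩
    · exact fun h => h.1

theorem pres_after (hM : Marks T Z g₀ g) (hc : Casc m g g') {t : Trip} (ht : Valid m t)
    (h6 : t.1 < 6) (h0 : g' t ≠ 0) : g₀ t ≠ 0 :=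
  (hM.ne_zero (by omega)).1 (hc.pres t ht h6 h0)

theorem nPres_congr {lo hi : ℕ} (hm : hi ≤ m) (h : ∀ t, Valid m t → t.1 < 6 → lo ≤ t.2.1 →
    t.2.1 < hi → (g' t ≠ 0 ↔ g t ≠ 0)) : nPres m lo hi g' = nPres m lo hi g :=
  le_antisymm (nPres_mono hm fun t a b c d => (h t a b c d).1)
    (nPres_mono hm fun t a b c d => (h t a b c d).2)

/-- Rows of nodes that keep their edges and depend on such nodes only keep all their facts. -/
theorem Core.rigid (hC : Core m rk g []) (hC' : Core m rk g' []) {n : ℕ} (hn : n ≤ m)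
    (hb : ∀ s < 2, ∀ k < n, ∀ j < m, n ≤ j → g (2 + s, k, j) = 0)
    (he : ∀ s < 2, ∀ k < n, ∀ z < m, g' (s, k, z) ≠ 0 ↔ g (s, k, z) ≠ 0)
    (hp : ∀ t, Valid m t → t.1 < 6 → g' t ≠ 0 → g t ≠ 0) :
    ∀ r, ∀ k < n, rk k = r → ∀ i < 6, ∀ z < m, g' (i, k, z) ≠ 0 ↔ g (i, k, z) ≠ 0 := by
  intro r
  induction r using Nat.strong_induction_on with
  | _ r ih =>
  intro k hk hr
  have hkm : k < m := by omega
  have hV : ∀ s < 2, ∀ j < m, g' (2 + s, k, j) ≠ 0 ↔ g (2 + s, k, j) ≠ 0 := by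
    intro s hs j hj
    by_cases hjn : j < n
    · rw [hC'.older_iff hs hkm hj, hC.older_iff hs hkm hj]
      refine and_congr_right fun hlt => exists_congr fun z => and_congr_right fun hz => ?_
      rw [he s hs k hk z hz, ih (rk j) (by omega) j hjn rfl (5 - s) (by omega) z hz]
    · have h0 := hb s hs k hk j hj (by omega)
      refine ⟨hp _ ⟨by simp only; omega, hkm, hj⟩ (by simp only; omega), fun h => absurd h0 h⟩
  have hL : ∀ s < 2, ∀ x < m, g' (4 + s, k, x) ≠ 0 ↔ g (4 + s, k, x) ≠ 0 := by
    intro s hs x hx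
    rw [hC'.vert_iff hs hkm hx, hC.vert_iff hs hkm hx, he s hs k hk x hx]
    refine or_congr_right (exists_congr fun j => and_congr_right fun hj => ?_)
    rw [hV s hs j hj]
    refine and_congr_right fun h1 => ?_
    have hjn : j < n := by
      by_contra hjn
      exact h1 (hb s hs k hk j hj (by omega))
    have hlt := ((hC.older_iff hs hkm hj).1 h1).1
    exact ih (rk j) (by omega) j hjn rfl (4 + s) (by omega) x hx
  intro i hi z hz
  obtain rfl | rfl | rfl | rfl | rfl | rfl : i = 0 ∨ i = 1 ∨ i = 2 ∨ i = 3 ∨ i = 4 ∨ i = 5 := by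
    omega
  · exact he 0 (by omega) k hk z hz
  · exact he 1 (by omega) k hk z hz
  · exact hV 0 (by omega) z hz
  · exact hV 1 (by omega) z hz
  · exact hL 0 (by omega) z hz
  · exact hL 1 (by omega) z hz

/-- A node without edges has no facts at all. -/
theorem Core.row_zero (hC : Core m rk g []) {k : ℕ} (hk : k < m)
    (h : ∀ s < 2, ∀ z < m, g (s, k, z) = 0) : ∀ t, Valid m t → t.1 < 6 → t.2.1 = k → g t = 0 := by
  have hV : ∀ s < 2, ∀ j < m, g (2 + s, k, j) = 0 := by
    intro s hs j hj
    by_contra h1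
    obtain ⟨-, z, hz, h2, -⟩ := (hC.older_iff hs hk hj).1 h1
    exact h2 (h s hs z hz)
  have hL : ∀ s < 2, ∀ j < m, g (4 + s, k, j) = 0 := by
    intro s hs j hj
    by_contra h1
    rcases (hC.vert_iff hs hk hj).1 h1 with h2 | ⟨z, hz, h2, -⟩
    · exact h2 (h s hs j hj)
    · exact h2 (hV s hs z hz)
  rintro ⟨i, k', z⟩ ⟨-, -, hz⟩ hi rfl
  simp only at hi hz
  obtain rfl | rfl | rfl | rfl | rfl | rfl : i = 0 ∨ i = 1 ∨ i = 2 ∨ i = 3 ∨ i = 4 ∨ i = 5 := by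
    omega
  exacts [h 0 (by omega) z hz, h 1 (by omega) z hz, hV 0 (by omega) z hz, hV 1 (by omega) z hz,
    hL 0 (by omega) z hz, hL 1 (by omega) z hz]

theorem nPres_row {n k : ℕ} (hk : k < m) (hnk : n ≤ k)
    (h : ∀ t, Valid m t → t.1 < 6 → t.2.1 ≠ k → g' t = g t) :
    nPres m n m g' ≤ nPres m n m g + 6 * m := by
  unfold nPres
  have hs : ((Finset.range 6 ×ˢ (Finset.Ico n m ×ˢ Finset.range m)).filter fun t => g' t ≠ 0) ⊆
      ((Finset.range 6 ×ˢ (Finset.Ico n m ×ˢ Finset.range m)).filter fun t => g t ≠ 0) ∪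
        (Finset.range 6 ×ˢ ({k} ×ˢ Finset.range m)) := by
    intro t ht
    simp only [Finset.mem_filter, Finset.mem_product, Finset.mem_range, Finset.mem_Ico,
      Finset.mem_union, Finset.mem_singleton] at ht ⊢
    obtain ⟨⟨h1, ⟨h2, h3⟩, h4⟩, h5⟩ := ht
    by_cases hk' : t.2.1 = k
    · exact Or.inr ⟨h1, hk', h4⟩
    · refine Or.inl ⟨⟨h1, ⟨h2, h3⟩, h4⟩, ?_⟩
      rwa [h t ⟨by omega, h3, h4⟩ h1 hk'] at h5
  refine (Finset.card_le_card hs).trans ((Finset.card_union_le _ _).trans ?_)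
  simp

end Marked

/-- The centre of a node: every vertex is the centre of the base node with the same number and of
one top node. -/
def vtx (n k : ℕ) : ℕ := if k < n then k else k - n

theorem vtx_lt {n k : ℕ} (h : k < n + n) : vtx n k < n := by unfold vtx; split_ifs <;> omega

/-- The invariant with full counters. -/
structure Full (n : ℕ) (X : ℕ → ℕ → Prop) (rk : ℕ → ℕ) (g : Tab) : Prop where
  core : Core (n + n) rk g []
  inj : ∀ i < n + n, ∀ j < n + n, rk i = rk j → i = j
  nodes : Nodes (n + n) (vtx n) X g
  mat : ∀ x < n + n, ∀ y < n + n, g (7, x, y) ≠ 0 ↔ X x y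
  base : ∀ s < 2, ∀ k < n, ∀ j < n + n, n ≤ j → g (2 + s, k, j) = 0
  lt : ∀ x y, X x y → x < n ∧ y < n

section FullSec
variable {n : ℕ} {X X' : ℕ → ℕ → Prop} {rk : ℕ → ℕ} {g₀ g g' g₂ g₃ : Tab} {T Z : Trip → Prop}

/-- Deletion of the edges in `D`: the edge facts on them are removed from all nodes, apart from the
trivial ones. -/
theorem Full.delete (h : Full n X rk g₀) (hM : Marks T Z g₀ g) (hc : Casc (n + n) g g')
    (hC' : Core (n + n) rk g' []) {D : ℕ → ℕ → Prop}
    (hT : ∀ s < 2, ∀ k < n + n, ∀ z < n + n, T (s, k, z) ↔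
      ((s = 0 ∧ D z (vtx n k)) ∨ (s = 1 ∧ D (vtx n k) z)) ∧ z ≠ vtx n k)
    (hZ : ∀ x < n + n, ∀ y < n + n, Z (7, x, y) ↔ D x y) :
    Full n (fun x y => X x y ∧ ¬ D x y) rk g' := by
  have e : ∀ s < 2, ∀ k < n + n, ∀ z < n + n, g' (s, k, z) ≠ 0 ↔ g₀ (s, k, z) ≠ 0 ∧ ¬ T (s, k, z) :=
    fun s hs k hk z hz => edge_after h.core hM hc hC' ⟨by simp only; omega, hk, hz⟩ hs
  refine ⟨hC', h.inj, ⟨?_, ?_, ?_, h.nodes.vtx_lt, fun x y hxy => h.nodes.lt x y hxy.1⟩, ?_, ?_,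
    fun x y hxy => h.lt x y hxy.1⟩
  · intro s hs k hk z hz h0
    obtain ⟨h1, h2⟩ := (e s hs k hk z hz).1 h0
    rw [hT s hs k hk z hz] at h2
    rcases h.nodes.snd s hs k hk z hz h1 with h3 | ⟨h3, h4⟩ | ⟨h3, h4⟩ <;>
      by_cases h5 : z = vtx n k
    · exact Or.inl h5
    · exact Or.inl h3
    · exact Or.inl h5
    · exact Or.inr (Or.inl ⟨h3, h4, fun h6 => h2 ⟨Or.inl ⟨h3, h6⟩, h5⟩⟩)
    · exact Or.inl h5
    · exact Or.inr (Or.inr ⟨h3, h4, fun h6 => h2 ⟨Or.inr ⟨h3, h6⟩, h5⟩⟩)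
  · intro s hs k hk z hz h0 s' hs'
    have hv := h.nodes.vtx_lt k hk
    rw [e s' hs' k hk _ hv]
    refine ⟨h.nodes.idn s hs k hk z hz ((e s hs k hk z hz).1 h0).1 s' hs', fun h1 => ?_⟩
    exact ((hT s' hs' k hk _ hv).1 h1).2 rfl
  · rintro x y ⟨hxy, hD⟩ hne
    obtain ⟨hx, hy⟩ := h.nodes.lt x y hxy
    obtain ⟨k, hk, ⟨rfl, h1⟩ | ⟨rfl, h1⟩⟩ := h.nodes.cov x y hxy hne
    · refine ⟨k, hk, Or.inl ⟨rfl, (e 0 (by omega) k hk x hx).2 ⟨h1, fun h2 => ?_⟩⟩⟩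
      have := (hT 0 (by omega) k hk x hx).1 h2
      simp [hD] at this
    · refine ⟨k, hk, Or.inr ⟨rfl, (e 1 (by omega) k hk y hy).2 ⟨h1, fun h2 => ?_⟩⟩⟩
      have := (hT 1 (by omega) k hk y hy).1 h2
      simp [hD] at this
  · intro x hx y hy
    rw [hc.mat _ rfl, ← h.mat x hx y hy, ← hZ x hx y hy]
    obtain ⟨h1, h2⟩ := (hM (7, x, y)).2 rfl
    by_cases hz : Z (7, x, y)
    · simp [h1 hz, hz]
    · simp [h2 hz, hz]
  · intro s hs k hk j hj hnj
    by_contra h1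
    exact pres_after hM hc (t := (2 + s, k, j)) ⟨by simp only; omega, by simp only; omega, hj⟩
      (by simp only; omega) h1 (h.base s hs k hk j hj hnj)

/-- An insertion centred at `i`: the top node of `i` is emptied and built anew as the youngest node.
The edges it had covered are incident to `i`, hence covered again. -/
theorem Full.renew (h : Full n X rk g₀) {i : ℕ} (hi : i < n) (hM : Marks T Z g₀ g)
    (hc : Casc (n + n) g g') (hC' : Core (n + n) rk g' [])
    (hT : ∀ s < 2, ∀ k < n + n, ∀ z < n + n, T (s, k, z) ↔ k = n + i)
    (h₂ : ∀ t, Valid (n + n) t → t.1 < 7 → g₂ t = g' t)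
    (hm : ∀ x < n + n, ∀ y < n + n, g₂ (7, x, y) ≠ 0 ↔ X' x y)
    (hX : ∀ x y, X x y → X' x y) (hX' : ∀ x y, X' x y → X x y ∨ x = i ∨ y = i)
    (hlt : ∀ x y, X' x y → x < n ∧ y < n) (hA : AddSpec (n + n) (n + i) i g₂ g₃) :
    (∃ rk', Full n X' rk' g₃) ∧ nPres (n + n) 0 n g₃ = nPres (n + n) 0 n g₀ ∧
      nPres (n + n) 0 n g' = nPres (n + n) 0 n g₀ ∧
      nPres (n + n) n (n + n) g₃ ≤ nPres (n + n) n (n + n) g' + 6 * (n + n) := by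
  have hk : n + i < n + n := by omega
  have e : ∀ s < 2, ∀ k < n + n, ∀ z < n + n, g' (s, k, z) ≠ 0 ↔ g₀ (s, k, z) ≠ 0 ∧ k ≠ n + i :=
    fun s hs k hk z hz => by
      rw [edge_after h.core hM hc hC' ⟨by simp only; omega, hk, hz⟩ hs, hT s hs k hk z hz]
  have hp : ∀ t, Valid (n + n) t → t.1 < 6 → g' t ≠ 0 → g₀ t ≠ 0 :=
    fun t a b c => pres_after hM hc a b c
  have hrow : ∀ t, Valid (n + n) t → t.1 < 6 → t.2.1 = n + i → g₂ t = 0 := by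
    intro t ht h6 hti
    rw [h₂ t ht (by omega)]
    refine hC'.row_zero hk (fun s hs z hz => ?_) t ht h6 hti
    by_contra h1
    exact ((e s hs _ hk z hz).1 h1).2 rfl
  have hC2 : Core (n + n) rk g₂ [] := hC'.congr h₂
  have hrig := h.core.rigid hC' (by omega : n ≤ n + n) h.base
    (fun s hs k hk z hz => by
      rw [e s hs k (by omega) z hz]
      have : k ≠ n + i := by omega
      simp [this]) hp
  have e3 : ∀ t, Valid (n + n) t → t.1 < 6 → t.2.1 ≠ n + i → g₃ t = g' t :=
    fun t a b c => (hA.rest t a b c).trans (h₂ t a (by omega))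
  have hfin : ∃ R, ∀ j < n + n, rk j < R :=
    ⟨(Finset.range (n + n)).sup rk + 1, fun j hj => Nat.lt_succ_of_le
      (Finset.le_sup (f := rk) (Finset.mem_range.2 hj))⟩
  obtain ⟨R, hR⟩ := hfin
  have hvi : vtx n (n + i) = i := by simp [vtx]
  have nb : ∀ s < 2, ∀ z < n + n, g₃ (s, n + i, z) ≠ 0 ↔ Nbr g₂ s i z := by
    intro s hs z hz
    obtain ⟨a1, a2⟩ := hA.edge s hs z hz
    by_cases hn : Nbr g₂ s i z
    · simp [hn, a1 hn]
    · simp [hn, a2 hn]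
  refine ⟨⟨Function.update rk (n + i) R, hC2.add hk hA hrow hR, ?_, ⟨?_, ?_, ?_, h.nodes.vtx_lt,
    fun x y hxy => by have := hlt x y hxy; omega⟩, ?_, ?_, hlt⟩, ?_, ?_, ?_⟩
  · intro a ha b hb hab
    simp only [Function.update_apply] at hab
    have h1 := hR a ha
    have h2 := hR b hb
    split_ifs at hab with h3 h4 h4
    · omega
    · omega
    · omega
    · exact h.inj a ha b hb hab
  · intro s hs k hk' z hz h0
    by_cases hki : k = n + i
    · subst hki
      rw [hvi]
      rcases (nb s hs z hz).1 h0 with h1 | ⟨h1, h2⟩ | ⟨h1, h2⟩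
      · exact Or.inl h1
      · exact Or.inr (Or.inl ⟨h1, (hm z hz i (by omega)).1 h2⟩)
      · exact Or.inr (Or.inr ⟨h1, (hm i (by omega) z hz).1 h2⟩)
    · rw [e3 (s, k, z) ⟨by simp only; omega, hk', hz⟩ (by simp only; omega) hki,
        e s hs k hk' z hz] at h0
      rcases h.nodes.snd s hs k hk' z hz h0.1 with h1 | ⟨h1, h2⟩ | ⟨h1, h2⟩
      · exact Or.inl h1
      · exact Or.inr (Or.inl ⟨h1, hX _ _ h2⟩)
      · exact Or.inr (Or.inr ⟨h1, hX _ _ h2⟩)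
  · intro s hs k hk' z hz h0 s' hs'
    have hv := h.nodes.vtx_lt k hk'
    by_cases hki : k = n + i
    · subst hki
      rw [nb s' hs' _ hv, hvi]
      exact Or.inl rfl
    · rw [e3 (s', k, vtx n k) ⟨by simp only; omega, hk', hv⟩ (by simp only; omega) hki,
        e s' hs' k hk' _ hv]
      rw [e3 (s, k, z) ⟨by simp only; omega, hk', hz⟩ (by simp only; omega) hki,
        e s hs k hk' z hz] at h0
      exact ⟨h.nodes.idn s hs k hk' z hz h0.1 s' hs', hki⟩
  · intro x y hxy hne
    obtain ⟨hx, hy⟩ := hlt x y hxy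
    by_cases hyi : y = i
    · subst hyi
      exact ⟨n + y, hk, Or.inl ⟨hvi, (nb 0 (by omega) x (by omega)).2
        (Or.inr (Or.inl ⟨rfl, (hm x (by omega) y (by omega)).2 hxy⟩))⟩⟩
    by_cases hxi : x = i
    · subst hxi
      exact ⟨n + x, hk, Or.inr ⟨hvi, (nb 1 (by omega) y (by omega)).2
        (Or.inr (Or.inr ⟨rfl, (hm x (by omega) y (by omega)).2 hxy⟩))⟩⟩
    have hold : X x y := by rcases hX' x y hxy with h1 | h1 | h1 <;> [exact h1; omega; omega]
    obtain ⟨k, hk', hh⟩ := h.nodes.cov x y hold hne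
    have hki : k ≠ n + i := by
      rintro rfl
      rcases hh with hh | hh <;> rw [hvi] at hh <;> omega
    refine ⟨k, hk', hh.imp (fun h1 => ⟨h1.1, ?_⟩) fun h1 => ⟨h1.1, ?_⟩⟩
    · rw [e3 (0, k, x) ⟨by simp only; omega, hk', by simp only; omega⟩ (by simp only; omega) hki,
        e 0 (by omega) k hk' x (by omega)]
      exact ⟨h1.2, hki⟩
    · rw [e3 (1, k, y) ⟨by simp only; omega, hk', by simp only; omega⟩ (by simp only; omega) hki,
        e 1 (by omega) k hk' y (by omega)]
      exact ⟨h1.2, hki⟩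
  · intro x hx y hy
    rw [hA.mat (7, x, y) ⟨by simp, hx, hy⟩ rfl]
    exact hm x hx y hy
  · intro s hs k hk' j hj hnj
    rw [e3 (2 + s, k, j) ⟨by simp only; omega, by simp only; omega, hj⟩ (by simp only; omega)
      (by simp only; omega)]
    by_contra h1
    exact hp (2 + s, k, j) ⟨by simp only; omega, by simp only; omega, hj⟩ (by simp only; omega) h1
      (h.base s hs k hk' j hj hnj)
  · refine nPres_congr (by omega) fun t ht h6 _ h7 => ?_
    rw [e3 t ht h6 (by omega)]
    exact hrig _ t.2.1 h7 rfl t.1 h6 t.2.2 ht.2.2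
  · exact nPres_congr (by omega) fun t ht h6 _ h7 => hrig _ t.2.1 h7 rfl t.1 h6 t.2.2 ht.2.2
  · exact nPres_row hk (by omega) e3

/-- The invariant after all base nodes have been inserted into empty tables. -/
theorem Full.ofRows (hC : Core (n + n) rk g [])
    (hinj : ∀ i < n + n, ∀ j < n + n, rk i = rk j → i = j)
    (h0 : ∀ t, Valid (n + n) t → t.1 < 6 → n ≤ t.2.1 → g t = 0)
    (hE : ∀ s < 2, ∀ k < n, ∀ z < n + n, g (s, k, z) ≠ 0 ↔ Nbr g s k z)
    (hm : ∀ x < n + n, ∀ y < n + n, g (7, x, y) ≠ 0 ↔ X x y)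
    (hlt : ∀ x y, X x y → x < n ∧ y < n) : Full n X rk g := by
  have hv : ∀ k < n, vtx n k = k := fun k hk => by simp [vtx, hk]
  have hz : ∀ i k z, i < 6 → k < n + n → z < n + n → g (i, k, z) ≠ 0 → k < n := by
    intro i k z h1 h2 h3 h4
    by_contra h5
    exact h4 (h0 (i, k, z) ⟨by simp only; omega, h2, h3⟩ h1 (by simp only; omega))
  refine ⟨hC, hinj, ⟨?_, ?_, ?_, fun k hk => (vtx_lt hk).trans_le (by omega),
    fun x y hxy => by have := hlt x y hxy; omega⟩, hm, ?_, hlt⟩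
  · intro s hs k hk z hz' h1
    have hkn := hz s k z (by omega) hk hz' h1
    rw [hv k hkn]
    rcases (hE s hs k hkn z hz').1 h1 with h2 | ⟨h2, h3⟩ | ⟨h2, h3⟩
    · exact Or.inl h2
    · exact Or.inr (Or.inl ⟨h2, (hm z hz' k hk).1 h3⟩)
    · exact Or.inr (Or.inr ⟨h2, (hm k hk z hz').1 h3⟩)
  · intro s hs k hk z hz' h1 s' hs'
    have hkn := hz s k z (by omega) hk hz' h1
    rw [hv k hkn, hE s' hs' k hkn k hk]
    exact Or.inl rfl
  · intro x y hxy hne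
    obtain ⟨hx, hy⟩ := hlt x y hxy
    refine ⟨y, by omega, Or.inl ⟨hv y hy, (hE 0 (by omega) y hy x (by omega)).2 ?_⟩⟩
    exact Or.inr (Or.inl ⟨rfl, (hm x (by omega) y (by omega)).2 hxy⟩)
  · intro s hs k hk j hj hnj
    by_contra h1
    obtain ⟨-, z, hz', -, h2⟩ := (hC.older_iff hs (by omega) hj).1 h1
    have := hz (5 - s) j z (by omega) hj hz' h2
    omega

end FullSec

/-! ### Deletions on the machine -/

/-- Mark the edge fact at the address `e` for deletion. -/
def markC (e : Ex) : Cmd := asg 26 e ;; killC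

/-- The tables arise from `g₀` by marking the facts in `T` and erasing the entries in `Z`. -/
def Work (m : ℕ) (rk : ℕ → ℕ) (fl : ℕ) (g₀ : Tab) (T Z : Trip → Prop) (s : State) : Prop :=
  ∃ g L, Rep m g L fl s ∧ Core m rk g L ∧ Marks T Z g₀ g

section Delete
variable {M : Mach} {m fl n : ℕ} {g₀ g : Tab} {s : State} {rk : ℕ → ℕ} {T Z T' Z' : Trip → Prop}

theorem Work.congr (h : Work m rk fl g₀ T Z s) (hT : ∀ t, T t ↔ T' t) (hZ : ∀ t, Z t ↔ Z' t) :
    Work m rk fl g₀ T' Z' s := by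
  rwa [← (funext fun t => propext (hT t) : T = T'), ← (funext fun t => propext (hZ t) : Z = Z')]

theorem Work.reg2 (h : Work m rk fl g₀ T Z s) : s.reg 2 = m := by
  obtain ⟨g, L, h, -⟩ := h
  exact h.reg2

theorem Work.setReg (h : Work m rk fl g₀ T Z s) {r v : ℕ} (h2 : r ≠ 2) (h5 : r ≠ 5) :
    Work m rk fl g₀ T Z (s.setReg r v) := by
  obtain ⟨g, L, h, h'⟩ := h
  exact ⟨g, L, h.setReg h2 h5, h'⟩

theorem tot_mark (hM : Ctx M m) (h : Work m rk fl g₀ T Z s) {t : Trip} {e : Ex} (ht : Valid m t)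
    (h2 : t.1 < 2) (ho : e.Ok M s) (he : e.eval M s = enc m t) :
    Tot M (markC e) s fun s' τ => Work m rk fl g₀ (fun t' => T t' ∨ t' = t) Z s' ∧ Fr 26 s s' ∧
      τ ≤ e.cost + 60 := by
  obtain ⟨g, L, hR, hC, hW⟩ := h
  refine tot_seq (tot_asg (by norm_num) ho ((tot_kill hM (hR.setReg (by norm_num) (by norm_num)) ht
    (by simp [he])).mono ?_))
  rintro s' τ ⟨a, b, c⟩
  refine ⟨⟨_, _, a, hC.kill ht h2, fun t' => ⟨fun h7 => ?_, fun h7 => ?_⟩⟩, fun r hr h5 => ?_, ?_⟩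
  · obtain ⟨w1, w2⟩ := (hW t').1 h7
    rw [killA_fst]
    simp only
    by_cases e1 : t' = t
    · subst e1
      by_cases hT : T t' ∧ 2 ≤ g₀ t'
      · rw [w1 hT]; simp [hT.2]
      · rw [w2 hT]
        refine ⟨fun h => by simp [h.2], fun h => ?_⟩
        have : ¬ 2 ≤ g₀ t' := fun h' => h ⟨Or.inr rfl, h'⟩
        simp [this]
    · simp only [e1, false_and, if_false, or_false]
      exact ⟨w1, w2⟩
  · rw [killA_fst]
    have e1 : t' ≠ t := by rintro rfl; omega
    simp only [e1, false_and, if_false]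
    exact (hW t').2 h7
  · have : r ≠ 26 := by omega
    rw [b r h5]; simp [this]
  · omega

theorem Work.erase (hm : 0 < m) (h : Work m rk fl g₀ T Z s) {t : Trip} (ht : Valid m t)
    (h7 : t.1 = 7) : Work m rk fl g₀ T (fun t' => Z t' ∨ t' = t) (s.setMem (enc m t) 0) := by
  obtain ⟨g, L, hR, hC, hW⟩ := h
  refine ⟨_, L, hR.set hm ht (by simp), hC.congr fun t' _ h' => ?_, fun t' => ⟨fun h' => ?_, fun h' => ?_⟩⟩
  · have : t' ≠ t := by rintro rfl; omega
    simp [this]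
  · have : t' ≠ t := by rintro rfl; omega
    simp only [Function.update_of_ne this]
    exact (hW t').1 h'
  · by_cases e1 : t' = t
    · subst e1; simp
    · simp only [Function.update_of_ne e1, e1, or_false]
      exact (hW t').2 h'

/-- The edge facts that the deletion of the edges in `l` affects. -/
def TD (n : ℕ) (l : List (ℕ × ℕ)) (t : Trip) : Prop :=
  ∃ p ∈ l, p.1 ≠ p.2 ∧ (t = (0, p.2, p.1) ∨ t = (0, n + p.2, p.1) ∨ t = (1, p.1, p.2) ∨
    t = (1, n + p.1, p.2))

/-- The matrix entries that the deletion of the edges in `l` affects. -/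
def ZD (l : List (ℕ × ℕ)) (t : Trip) : Prop := ∃ p ∈ l, t = (7, p.1, p.2)

theorem TD_append (l : List (ℕ × ℕ)) (p : ℕ × ℕ) (t : Trip) : TD n (l ++ [p]) t ↔
    TD n l t ∨ (p.1 ≠ p.2 ∧ (t = (0, p.2, p.1) ∨ t = (0, n + p.2, p.1) ∨ t = (1, p.1, p.2) ∨
    t = (1, n + p.1, p.2))) := by
  simp only [TD, List.mem_append, List.mem_singleton, or_and_right, exists_or, exists_eq_left]

theorem ZD_append (l : List (ℕ × ℕ)) (p : ℕ × ℕ) (t : Trip) : ZD (l ++ [p]) t ↔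
    ZD l t ∨ t = (7, p.1, p.2) := by
  simp only [ZD, List.mem_append, List.mem_singleton, or_and_right, exists_or, exists_eq_left]

/-- Deletion of the edge at position `j` (register `6`) of the list; its end points are the arguments
`2 + 2j` and `3 + 2j`. Each end point is the centre of two nodes, hence the four facts. -/
def delBody : Cmd :=
  asg 7 (.inp (.c 2 + (.v 6 + .v 6))) ;; asg 8 (.inp (.c 3 + (.v 6 + .v 6))) ;;
  sto (FA (.c 7) (.v 7) (.v 8)) (.c 0) ;;
  iff ((.v 7 - .v 8) + (.v 8 - .v 7))
    (markC (FA (.c 0) (.v 8) (.v 7)) ;; markC (FA (.c 0) (.v 1 + .v 8) (.v 7)) ;;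
      markC (FA (.c 1) (.v 7) (.v 8)) ;; markC (FA (.c 1) (.v 1 + .v 7) (.v 8))) skip

theorem tot_delBody (hM : Ctx M (n + n)) (h : Work (n + n) rk fl g₀ T Z s) {x y j : ℕ} (hx : x < n)
    (hy : y < n) (h1 : s.reg 1 = n) (h6 : s.reg 6 = j) (hj : j + j + 3 < M.W)
    (i1 : M.inp (2 + (j + j)) = x) (i2 : M.inp (3 + (j + j)) = y) :
    Tot M delBody s fun s' τ => Work (n + n) rk fl g₀ (fun t => T t ∨ (x ≠ y ∧ (t = (0, y, x) ∨
      t = (0, n + y, x) ∨ t = (1, x, y) ∨ t = (1, n + x, y)))) (fun t => Z t ∨ t = (7, x, y)) s' ∧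
      Fr 7 s s' ∧ τ ≤ 400 := by
  have hm := hM.pos
  have hS := hM.le_S
  have hW := hM.le_W
  have hmm : n + n ≤ (n + n) * (n + n) := Nat.le_mul_self _
  have hc : ∀ x, x < 20 → x < M.W := fun x hx => by omega
  have hc1 : 1 < M.W := hc 1 (by norm_num)
  have hc0 : 0 < M.W := hc 0 (by norm_num)
  refine tot_seq (tot_asg (by norm_num) ?_ (tot_seq (tot_asg (by norm_num) ?_ ?_)))
  · simp [h6, i1, hc]; omega
  · simp [h6, i2, hc]; omega
  have e1 : (Ex.inp (.c 2 + (.v 6 + .v 6))).eval M s = x := by simp [h6, i1]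
  rw [e1]
  have e2 : (Ex.inp (.c 3 + (.v 6 + .v 6))).eval M (s.setReg 7 x) = y := by simp [h6, i2]
  rw [e2]
  generalize hs1 : (s.setReg 7 x).setReg 8 y = s1
  have W1 : Work (n + n) rk fl g₀ T Z s1 := by
    subst hs1; exact (h.setReg (by norm_num) (by norm_num)).setReg (by norm_num) (by norm_num)
  have r1 : s1.reg 1 = n := by subst hs1; simp [h1]
  have r7 : s1.reg 7 = x := by subst hs1; simp
  have r8 : s1.reg 8 = y := by subst hs1; simp
  have F1 : Fr 7 s s1 := by
    intro r hr _
    subst hs1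
    have a7 : r ≠ 7 := by omega
    have a8 : r ≠ 8 := by omega
    simp [a7, a8]
  clear hs1
  have v7 : Valid (n + n) (7, x, y) := ⟨by simp, by simp only; omega, by simp only; omega⟩
  have e7 : (FA (.c 7) (.v 7) (.v 8)).eval M s1 = enc (n + n) (7, x, y) := by
    rw [FA_eval W1.reg2]; simp [r7, r8]
  refine tot_seq (tot_sto (FA_ok hM W1.reg2 (by simp [hc]) (by simp) (by simp)
    (by simpa [r7, r8] using v7)) (by simp [hc0]) (by rw [e7]; exact Rep.lt_S hM v7) ?_)
  rw [e7, Ex.eval_c]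
  have W2 := W1.erase (by omega) v7 rfl
  generalize hs2 : s1.setMem (enc (n + n) (7, x, y)) 0 = s2 at W2 ⊢
  have f2 : ∀ r, s2.reg r = s1.reg r := by subst hs2; simp
  have q1 := (f2 1).trans r1
  have q7 := (f2 7).trans r7
  have q8 := (f2 8).trans r8
  refine tot_iff (by simp [q7, q8]; omega) (fun n1 => ?_) fun n1 => tot_skip hc0 ⟨?_, ?_, ?_⟩
  · have hxy : x ≠ y := by rintro rfl; simp [q7, q8] at n1
    refine tot_seq ((tot_mark hM W2 (t := (0, y, x)) ⟨by simp, by simp only; omega, by simp only; omega⟩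
      (by simp) (FA_ok hM W2.reg2 (by simp [hc0]) (by simp) (by simp) ?_) ?_).mono ?_)
    · simp [q7, q8, Valid]; omega
    · rw [FA_eval W2.reg2]; simp [q7, q8]
    rintro s3 t3 ⟨W3, F3, T3⟩
    have p1 := (F3 1 (by norm_num) (by norm_num)).trans q1
    have p7 := (F3 7 (by norm_num) (by norm_num)).trans q7
    have p8 := (F3 8 (by norm_num) (by norm_num)).trans q8
    refine tot_seq ((tot_mark hM W3 (t := (0, n + y, x)) ⟨by simp, by simp only; omega, by simp only; omega⟩
      (by simp) (FA_ok hM W3.reg2 (by simp [hc0]) (by simp [p1, p8]; omega) (by simp) ?_) ?_).mono ?_)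
    · simp [p1, p7, p8, Valid]; omega
    · rw [FA_eval W3.reg2]; simp [p1, p7, p8]
    rintro s4 t4 ⟨W4, F4, T4⟩
    have o1 := (F4 1 (by norm_num) (by norm_num)).trans p1
    have o7 := (F4 7 (by norm_num) (by norm_num)).trans p7
    have o8 := (F4 8 (by norm_num) (by norm_num)).trans p8
    refine tot_seq ((tot_mark hM W4 (t := (1, x, y)) ⟨by simp, by simp only; omega, by simp only; omega⟩
      (by simp) (FA_ok hM W4.reg2 (by simp [hc1]) (by simp) (by simp) ?_) ?_).mono ?_)
    · simp [o7, o8, Valid]; omega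
    · rw [FA_eval W4.reg2]; simp [o7, o8]
    rintro s5 t5 ⟨W5, F5, T5⟩
    have k1 := (F5 1 (by norm_num) (by norm_num)).trans o1
    have k7 := (F5 7 (by norm_num) (by norm_num)).trans o7
    have k8 := (F5 8 (by norm_num) (by norm_num)).trans o8
    refine (tot_mark hM W5 (t := (1, n + x, y)) ⟨by simp, by simp only; omega, by simp only; omega⟩
      (by simp) (FA_ok hM W5.reg2 (by simp [hc1]) (by simp [k1, k7]; omega) (by simp) ?_) ?_).mono ?_
    · simp [k1, k7, k8, Valid]; omega
    · rw [FA_eval W5.reg2]; simp [k1, k7, k8]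
    rintro s6 t6 ⟨W6, F6, T6⟩
    refine ⟨W6.congr (fun t => ?_) fun t => Iff.rfl, ?_, ?_⟩
    · simp only [or_assoc, ne_eq, hxy, not_false_eq_true, true_and]
    · have F2 : Fr 26 s1 s2 := fun r _ _ => f2 r
      exact F1.trans (((((F2.trans F3).trans F4).trans F5).trans F6).mono (by norm_num))
    · simp at T3 T4 T5 T6 ⊢; omega
  · refine W2.congr (fun t => ?_) fun t => Iff.rfl
    have hxy : x = y := by
      simp [q7, q8] at n1; omega
    simp [hxy]
  · exact F1.trans fun r _ _ => f2 r
  · simp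

/-- Deletion of the edges of the list, whose length is in register `3`. -/
def deleteC : Cmd := forUp 6 (.v 3) delBody ;; cascadeC

theorem TD_iff {l : List (ℕ × ℕ)} (hl : ∀ p ∈ l, p.1 < n ∧ p.2 < n) {s k z : ℕ} (hs : s < 2)
    (hk : k < n + n) : TD n l (s, k, z) ↔
      ((s = 0 ∧ (z, vtx n k) ∈ l) ∨ (s = 1 ∧ (vtx n k, z) ∈ l)) ∧ z ≠ vtx n k := by
  have hkv : k = vtx n k ∨ k = n + vtx n k := by unfold vtx; split_ifs <;> omega
  constructor
  · rintro ⟨⟨x, y⟩, hp, hne, h⟩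
    obtain ⟨hx, hy⟩ := hl _ hp
    simp only at hx hy hne
    rcases h with h | h | h | h <;> simp only [Prod.mk.injEq] at h <;> obtain ⟨rfl, rfl, rfl⟩ := h
    · have : vtx n k = k := by simp [vtx, hy]
      rw [this]; exact ⟨Or.inl ⟨rfl, hp⟩, hne⟩
    · have : vtx n (n + y) = y := by simp [vtx]
      rw [this]; exact ⟨Or.inl ⟨rfl, hp⟩, hne⟩
    · have : vtx n k = k := by simp [vtx, hx]
      rw [this]; exact ⟨Or.inr ⟨rfl, hp⟩, hne.symm⟩
    · have : vtx n (n + x) = x := by simp [vtx]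
      rw [this]; exact ⟨Or.inr ⟨rfl, hp⟩, hne.symm⟩
  · rintro ⟨⟨rfl, hp⟩ | ⟨rfl, hp⟩, hne⟩
    · refine ⟨_, hp, hne, ?_⟩
      rcases hkv with h | h
      · exact Or.inl (by rw [← h])
      · exact Or.inr (Or.inl (by rw [← h]))
    · refine ⟨_, hp, hne.symm, ?_⟩
      rcases hkv with h | h
      · exact Or.inr (Or.inr (Or.inl (by rw [← h])))
      · exact Or.inr (Or.inr (Or.inr (by rw [← h])))

theorem tot_delete (hM : Ctx M (n + n)) {X : ℕ → ℕ → Prop} (h : Rep (n + n) g₀ [] fl s)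
    (hF : Full n X rk g₀) {l : List (ℕ × ℕ)} (hl : ∀ p ∈ l, p.1 < n ∧ p.2 < n) (h1 : s.reg 1 = n)
    (h3 : s.reg 3 = l.length) (hlen : l.length + l.length + 3 < M.W)
    (hi : ∀ j (hj : j < l.length), M.inp (2 + (j + j)) = l[j].1 ∧ M.inp (3 + (j + j)) = l[j].2) :
    Tot M deleteC s fun s' τ => ∃ g', Rep (n + n) g' [] fl s' ∧
      Full n (fun x y => X x y ∧ (x, y) ∉ l) rk g' ∧
      (∀ lo hi, hi ≤ n + n → nPres (n + n) lo hi g' ≤ nPres (n + n) lo hi g₀) ∧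
      τ + 900 * (n + n) * nPres (n + n) 0 (n + n) g' ≤
        900 * (n + n) * nPres (n + n) 0 (n + n) g₀ + 420 * l.length + 30 := by
  refine tot_seq (tot_forUp (N := l.length) (fun j s' => Work (n + n) rk fl g₀ (TD n (l.take j))
    (ZD (l.take j)) s' ∧ Fr 6 s s' ∧ s'.reg 6 = j) 400 (by norm_num) (by omega)
    ⟨?_, ?_, by simp⟩ ?_ ?_ ?_)
  · refine ⟨g₀, [], h.setReg (by norm_num) (by norm_num), hF.core, fun t => ?_⟩
    simp [TD, ZD]
  · intro r hr _
    have : r ≠ 6 := by omega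
    simp [this]
  · rintro j s' hj ⟨a, b, c⟩
    exact ⟨c, by simp, by simp [b 3 (by norm_num) (by norm_num), h3]⟩
  · rintro j s' hj ⟨a, b, c⟩
    obtain ⟨i1, i2⟩ := hi j hj
    obtain ⟨l1, l2⟩ := hl l[j] (List.getElem_mem hj)
    refine (tot_delBody hM a l1 l2 ((b 1 (by norm_num) (by norm_num)).trans h1) c (by omega) i1
      i2).mono ?_
    rintro s2 t2 ⟨a', b', c'⟩
    refine ⟨c', (b' 6 (by norm_num) (by norm_num)).trans c,
      (a'.congr (fun t => ?_) fun t => ?_).setReg (by norm_num) (by norm_num), fun r hr h5 => ?_,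
      by simp⟩
    · rw [List.take_succ_eq_append_getElem hj, TD_append]
    · rw [List.take_succ_eq_append_getElem hj, ZD_append]
    · have : r ≠ 6 := by omega
      simp [this, b' r (by omega) h5, b r hr h5]
  · rintro s1 t1 ⟨⟨g, L, hR, hC, hMk⟩, b, c⟩ ht1
    rw [List.take_length] at hMk
    refine (tot_cascade hM hR hC).mono ?_
    rintro s2 t2 ⟨g', R', C', hc, F', hτ⟩
    refine ⟨g', R', hF.delete (D := fun x y => (x, y) ∈ l) hMk hc C'
      (fun s hs k hk z _ => TD_iff hl hs hk) (fun x _ y _ => ?_), fun lo hi hhi =>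
        nPres_mono hhi fun t ht h6 _ _ h0 => pres_after hMk hc ht h6 h0, ?_⟩
    · simp only [ZD, Prod.mk.injEq, true_and]
      constructor
      · rintro ⟨p, hp, rfl, rfl⟩; exact hp
      · exact fun h => ⟨_, h, rfl, rfl⟩
    · have : nPres (n + n) 0 (n + n) g = nPres (n + n) 0 (n + n) g₀ :=
        nPres_congr le_rfl fun t ht h6 _ _ => hMk.ne_zero (by omega)
      rw [this] at hτ
      simp only [Ex.cost_v] at ht1
      have e : l.length * (400 + 2 + 10) ≤ 420 * l.length := by omega
      omega

end Delete

/-! ### Construction of the counters from the matrix -/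

theorem enc_surj {m a : ℕ} (h : a < 8 * (m * m)) : ∃ t, Valid m t ∧ enc m t = a := by
  have hm : 0 < m := Nat.pos_of_ne_zero (by rintro rfl; simp at h)
  refine ⟨(a / m / m, a / m % m, a % m), ⟨?_, Nat.mod_lt _ hm, Nat.mod_lt _ hm⟩, ?_⟩
  · simp only
    rw [Nat.div_div_eq_div_mul]
    exact Nat.div_lt_of_lt_mul (by rwa [Nat.mul_comm])
  · simp only [enc]
    rw [Nat.div_add_mod', Nat.div_add_mod']

theorem enc_lt_kind {m k : ℕ} {t : Trip} (h : Valid m t) : enc m t < k * (m * m) ↔ t.1 < k := by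
  obtain ⟨i, a, b⟩ := t
  obtain ⟨h1, h2, h3⟩ := h
  simp only [enc] at *
  have e1 : a * m + b < m * m := by
    have := Nat.mul_le_mul_right m (show a + 1 ≤ m by omega)
    rw [Nat.add_mul] at this
    omega
  rw [Nat.add_mul, Nat.mul_assoc]
  constructor
  · intro h
    by_contra hc
    have := Nat.mul_le_mul_right (m * m) (show k ≤ i by omega)
    omega
  · intro h
    have := Nat.mul_le_mul_right (m * m) (show i + 1 ≤ k by omega)
    rw [Nat.add_mul] at this
    omega

section Build
variable {M : Mach} {m fl n : ℕ} {g₀ g : Tab} {s : State} {rk : ℕ → ℕ}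

/-- Set the tables of the kinds below `k` to zero. -/
def clearC (k : ℕ) : Cmd := forUp 6 (.c k * (.v 2 * .v 2)) (sto (.v 6) (.c 0))

theorem tot_clear (hM : Ctx M m) (h : Rep m g [] fl s) {k : ℕ} (hk : k ≤ 8) :
    Tot M (clearC k) s fun s' τ => Rep m (fun t => if t.1 < k then 0 else g t) [] fl s' ∧
      Fr 6 s s' ∧ τ ≤ 240 * (m * m) + 30 := by
  have hm := hM.pos
  have hS := hM.le_S
  have hW := hM.le_W
  have hkm : k * (m * m) ≤ 8 * (m * m) := Nat.mul_le_mul_right _ hk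
  refine (tot_tabs (N := k * (m * m)) (fun a t => if enc m t < a then 0 else g t) 4 (by norm_num)
    (by norm_num) (by norm_num) (by omega) (by simpa using h) (fun s' h' => ?_) ?_).mono ?_
  · have := (h' 2 (by norm_num) (by norm_num)).trans h.reg2
    have hk' : k ≤ 8 := hk
    simp [this]; omega
  · intro a s' ha hR hF h6
    obtain ⟨t, ht, rfl⟩ := enc_surj (show a < 8 * (m * m) by omega)
    refine (tot_sto_tab hM hR ht (by simp) (by simp [h6]) (by simp; omega)).mono ?_
    rintro s2 t2 ⟨A, B, C⟩
    refine ⟨A.congr fun t' ht' => ?_, fun r _ _ => B r, by simpa using C⟩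
    by_cases e : t' = t
    · subst e; simp
    · rw [Function.update_of_ne e]
      have : enc m t' ≠ enc m t := fun h => e (enc_inj ht' ht h)
      have e2 : enc m t' < enc m t ↔ enc m t' < enc m t + 1 := by omega
      simp only [e2]
  · rintro s' t ⟨A, B, C⟩
    refine ⟨A.congr fun t' ht' => ?_, B, ?_⟩
    · simp only [enc_lt_kind ht']
    · simp at C; omega

theorem core_zero (hg : ∀ t, Valid m t → t.1 < 7 → g t = 0) : Core m rk g [] := by
  have hcnt : ∀ t, Valid m t → 2 ≤ t.1 → t.1 < 7 → cnt m g t = 0 := by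
    intro t ht h2 h7
    have h := cnt_congr (g := g) (g' := fun _ => 0) (m := m)
      (fun t ht h6 => by simp [hg t ht (by omega)]) ht h2 h7
    rw [h]
    simp [cnt, ip]
  refine ⟨by simp, fun t => ?_, fun t h1 h2 => ?_, fun t h1 h2 h3 h4 => ?_, fun t h1 h2 h3 h4 => ?_,
    fun t h1 h2 h3 _ _ => hcnt t h1 h2 (by omega), fun t h1 h2 => ?_⟩
  · simp only [List.not_mem_nil, false_iff]
    rintro ⟨h1, h2, h3⟩
    rw [hg t h1 (by omega)] at h3
    omega
  · rw [hg t h1 (by omega)]; omega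
  · exact absurd (hg t h1 (by omega)) h4
  · exact absurd (hg t h1 (by omega)) h4
  · rw [hg t h1 (by omega), hcnt t h1 (by omega) (by omega)]

/-- Compute all counters anew from the matrix. -/
def rebuildC : Cmd :=
  clearC 7 ;; forUp 6 (.v 1) (asg 11 (.v 6) ;; asg 12 (.v 6) ;; addC) ;;
  sto (.c 16 * (.v 2 * .v 2)) (.c 0)

theorem Core.reach_le (hC : Core m rk g []) {t : Trip} (ht : Valid m t) (h6 : t.1 = 6) : g t ≤ m := by
  rw [hC.reach t ht h6]
  simp only [cnt, h6, show ¬ 6 < 4 by omega, show ¬ 6 < 6 by omega, if_false, ip_eq]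
  exact ipp_le

theorem Rep.setFlag (h : Rep m g [] fl s) (hm : 0 < m) (v : ℕ) :
    Rep m g [] v (s.setMem (16 * (m * m)) v) := by
  have h4 : 0 < m * m := Nat.mul_pos hm hm
  refine ⟨h.reg2, h.reg5, fun t ht => ?_, by simp, by simp, h.nodup, h.good⟩
  have := enc_lt ht
  rw [State.setMem_mem, if_neg (by omega), h.tab t ht]

/-- One base node is inserted for each vertex, at a cost of `O(n²)` each. -/
theorem tot_rebuild (hM : Ctx M (n + n)) {X : ℕ → ℕ → Prop} (h : Rep (n + n) g [] fl s)
    (h1 : s.reg 1 = n) (hX : ∀ x < n + n, ∀ y < n + n, g (7, x, y) ≠ 0 ↔ X x y)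
    (hlt : ∀ x y, X x y → x < n ∧ y < n) :
    Tot M rebuildC s fun s' τ => ∃ rk g', Rep (n + n) g' [] 0 s' ∧ Full n X rk g' ∧
      nPres (n + n) n (n + n) g' = 0 ∧ Fr 6 s s' ∧ τ ≤ 6000 * n ^ 3 := by
  have hm := hM.pos
  have hS := hM.le_S
  have hW := hM.le_W
  have hmm : n + n ≤ (n + n) * (n + n) := Nat.le_mul_self _
  have hn : 0 < n := by omega
  refine tot_seq ((tot_clear hM h (k := 7) (by norm_num)).mono ?_)
  rintro s1 t1 ⟨R1, F1, T1⟩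
  set g1 : Tab := fun t => if t.1 < 7 then 0 else g t with hg1
  have q1 := (F1 1 (by norm_num) (by norm_num)).trans h1
  refine tot_seq (tot_forUp (N := n) (fun k s' => ∃ rk g', Rep (n + n) g' [] fl s' ∧
    Core (n + n) rk g' [] ∧ (∀ i < n + n, ∀ j < n + n, rk i = rk j → i = j) ∧
    (∀ t, Valid (n + n) t → t.1 < 6 → k ≤ t.2.1 → g' t = 0) ∧
    (∀ s < 2, ∀ j < k, ∀ z < n + n, g' (s, j, z) ≠ 0 ↔ Nbr g' s j z) ∧
    (∀ t, Valid (n + n) t → t.1 = 7 → g' t = g t) ∧ Fr 6 s s' ∧ s'.reg 6 = k)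
    (1000 * ((n + n) * (n + n)) + 8) (by norm_num) (by omega) ?_ ?_ ?_ ?_)
  · refine ⟨id, g1, R1.setReg (by norm_num) (by norm_num), core_zero fun t _ h7 => by simp [hg1, h7],
      fun i _ j _ h => h, fun t _ h6 _ => by simp [hg1, show t.1 < 7 by omega], by simp,
      fun t _ h7 => by simp [hg1, h7], fun r hr h5 => ?_, by simp⟩
    have : r ≠ 6 := by omega
    simp [this, F1 r hr h5]
  · rintro k s' hk ⟨rk, g', hR, hC, hinj, h0, hE, h7, hF, h6⟩
    exact ⟨h6, by simp, by simp [hF 1 (by norm_num) (by norm_num), h1]⟩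
  · rintro k s' hk ⟨rk, g', hR, hC, hinj, h0, hE, h7, hF, h6⟩
    have hkm : k < n + n := by omega
    refine tot_seq (tot_asg (by norm_num) (by simp) (tot_seq (tot_asg (by norm_num) (by simp) ?_)))
    refine (tot_add hM (k := k) (v := k) ((hR.setReg (by norm_num) (by norm_num)).setReg
      (by norm_num) (by norm_num)) hkm hkm (by simp [h6]) (by simp [h6]) ?_).mono ?_
    · intro t ht h6
      have := hC.reach_le ht h6
      omega
    rintro s2 t2 ⟨g2, R2, A2, F2, T2⟩
    have hfin : ∃ R, ∀ j < n + n, rk j < R :=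
      ⟨(Finset.range (n + n)).sup rk + 1, fun j hj => Nat.lt_succ_of_le
        (Finset.le_sup (f := rk) (Finset.mem_range.2 hj))⟩
    obtain ⟨R, hRk⟩ := hfin
    have m2 : ∀ x < n + n, ∀ y < n + n, g2 (7, x, y) = g' (7, x, y) :=
      fun x hx y hy => A2.mat (7, x, y) ⟨by simp, hx, hy⟩ rfl
    have nbr : ∀ s < 2, ∀ j < n + n, ∀ z < n + n, Nbr g2 s j z ↔ Nbr g' s j z := by
      intro s _ j hj z hz
      simp only [Nbr, m2 z hz j hj, m2 j hj z hz]
    refine ⟨by simp; omega, ?_, Function.update rk k R, g2, R2.setReg (by norm_num) (by norm_num),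
      hC.add hkm A2 (fun t ht h6 hk' => h0 t ht h6 hk'.ge) hRk, ?_, ?_, ?_, ?_, ?_, by simp⟩
    · rw [F2 6 (by norm_num) (by norm_num)]; simp [h6]
    · intro a ha b hb hab
      simp only [Function.update_apply] at hab
      have l1 := hRk a ha
      have l2 := hRk b hb
      split_ifs at hab with h3 h4 h4
      · omega
      · omega
      · omega
      · exact hinj a ha b hb hab
    · intro t ht h6 hkt
      rw [A2.rest t ht h6 (by omega)]
      exact h0 t ht h6 (by omega)
    · intro i hi j hj z hz
      rw [nbr i hi j (by omega) z hz]
      by_cases hjk : j = k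
      · subst hjk
        obtain ⟨a1, a2⟩ := A2.edge i hi z hz
        by_cases hn : Nbr g' i j z
        · simp [hn, a1 hn]
        · simp [hn, a2 hn]
      · rw [A2.rest (i, j, z) ⟨by simp only; omega, by simp only; omega, hz⟩ (by simp only; omega) hjk]
        exact hE i hi j (by omega) z hz
    · intro t ht h7'
      rw [A2.mat t ht h7', h7 t ht h7']
    · intro r hr h5
      have b1 : r ≠ 6 := by omega
      have b2 : r ≠ 11 := by omega
      have b3 : r ≠ 12 := by omega
      simp [b1, F2 r (by omega) h5, b2, b3, hF r hr h5]
  · rintro s2 t2 ⟨rk, g', hR, hC, hinj, h0, hE, h7, hF, h6⟩ T2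
    have hreg2 := hR.reg2
    refine tot_sto ?_ (by simp; omega) (by simp [hreg2]; omega) ?_
    · simp [hreg2]; omega
    refine ⟨rk, g', ?_, Full.ofRows hC hinj h0 hE (fun x hx y hy => ?_) hlt, ?_, ?_, ?_⟩
    · have := hR.setFlag (by omega) 0
      simpa [hreg2] using this
    · rw [h7 (7, x, y) ⟨by simp, hx, hy⟩ rfl]; exact hX x hx y hy
    · rw [nPres, Finset.card_eq_zero, Finset.filter_eq_empty_iff]
      rintro ⟨a, b, c⟩ ht
      simp only [Finset.mem_product, Finset.mem_range, Finset.mem_Ico] at ht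
      simpa using h0 (a, b, c) ⟨by simp only; omega, by simp only; omega, by simp only; omega⟩
        (by simp only; omega) (by simp only; omega)
    · exact hF
    · simp only [Ex.cost_v] at T2
      simp only [Ex.cost_mul, Ex.cost_c, Ex.cost_v]
      have e1 : (n + n) * (n + n) = 4 * (n * n) := by ring
      rw [e1] at T1 T2
      have e2 : n * (1000 * (4 * (n * n)) + 8 + 2 + 10) = 4000 * n ^ 3 + 20 * n := by ring
      rw [e2] at T2
      have l1 : n * n ≤ n ^ 3 := by
        rw [show n ^ 3 = n * n * n by ring]; exact Nat.le_mul_of_pos_right _ hn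
      have l2 : n ≤ n * n := Nat.le_mul_self n
      have l3 : 1 ≤ n := hn
      omega

/-! ### Insertions on the machine -/

/-- Remove all edge facts of the top node of the vertex in register `3`, and what depends on them. -/
def clearNodeC : Cmd :=
  forUp 6 (.v 2) (markC (FA (.c 0) (.v 1 + .v 3) (.v 6)) ;; markC (FA (.c 1) (.v 1 + .v 3) (.v 6))) ;;
  cascadeC

theorem tot_clearNode (hM : Ctx M (n + n)) {i : ℕ} (hi : i < n) (h : Rep (n + n) g₀ [] fl s)
    (hC : Core (n + n) rk g₀ []) (h1 : s.reg 1 = n) (h3 : s.reg 3 = i) :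
    Tot M clearNodeC s fun s' τ => ∃ g g', Rep (n + n) g' [] fl s' ∧
      Marks (fun t => t.1 < 2 ∧ t.2.1 = n + i ∧ t.2.2 < n + n) (fun _ => False) g₀ g ∧
      Casc (n + n) g g' ∧ Core (n + n) rk g' [] ∧ Fr 6 s s' ∧
      τ + 900 * (n + n) * nPres (n + n) 0 (n + n) g' ≤
        900 * (n + n) * nPres (n + n) 0 (n + n) g₀ + 200 * (n + n) + 30 := by
  have hm := hM.pos
  have hS := hM.le_S
  have hW := hM.le_W
  have hmm : n + n ≤ (n + n) * (n + n) := Nat.le_mul_self _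
  have hc0 : 0 < M.W := by omega
  have hc1 : 1 < M.W := by omega
  refine tot_seq (tot_forUp (N := n + n) (fun k s' => Work (n + n) rk fl g₀
    (fun t => t.1 < 2 ∧ t.2.1 = n + i ∧ t.2.2 < k) (fun _ => False) s' ∧ Fr 6 s s' ∧ s'.reg 6 = k) 160
    (by norm_num) (by omega) ⟨?_, ?_, by simp⟩ ?_ ?_ ?_)
  · refine ⟨g₀, [], h.setReg (by norm_num) (by norm_num), hC, fun t => ?_⟩
    simp
  · intro r hr _
    have : r ≠ 6 := by omega
    simp [this]
  · rintro j s' hj ⟨a, b, c⟩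
    exact ⟨c, by simp, by simp [a.reg2]⟩
  · rintro k s1 hk ⟨W1, b, c⟩
    have r1 := (b 1 (by norm_num) (by norm_num)).trans h1
    have r3 := (b 3 (by norm_num) (by norm_num)).trans h3
    refine tot_seq ((tot_mark hM W1 (t := (0, n + i, k)) ⟨by simp, by simp only; omega, hk⟩ (by simp)
      (FA_ok hM W1.reg2 (by simp [hc0]) (by simp [r1, r3]; omega) (by simp) ?_) ?_).mono ?_)
    · simp [r1, r3, c, Valid]; omega
    · rw [FA_eval W1.reg2]; simp [r1, r3, c]
    rintro s2 t2 ⟨W2, F2, T2⟩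
    have p1 := (F2 1 (by norm_num) (by norm_num)).trans r1
    have p3 := (F2 3 (by norm_num) (by norm_num)).trans r3
    have p6 := (F2 6 (by norm_num) (by norm_num)).trans c
    refine (tot_mark hM W2 (t := (1, n + i, k)) ⟨by simp, by simp only; omega, hk⟩ (by simp)
      (FA_ok hM W2.reg2 (by simp [hc1]) (by simp [p1, p3]; omega) (by simp) ?_) ?_).mono ?_
    · simp [p1, p3, p6, Valid]; omega
    · rw [FA_eval W2.reg2]; simp [p1, p3, p6]
    rintro s3 t3 ⟨W3, F3, T3⟩
    refine ⟨by simp at T2 T3; omega, (F3 6 (by norm_num) (by norm_num)).trans p6,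
      (W3.congr ?_ fun _ => Iff.rfl).setReg (by norm_num) (by norm_num), fun r hr h5 => ?_, by simp⟩
    · rintro ⟨x, y, z⟩
      simp only [Prod.mk.injEq]
      omega
    · have : r ≠ 6 := by omega
      simp [this, F3 r (by omega) h5, F2 r (by omega) h5, b r hr h5]
  · rintro s1 t1 ⟨⟨g, L, hR, hC, hMk⟩, b, c⟩ ht1
    refine (tot_cascade hM hR hC).mono ?_
    rintro s2 t2 ⟨g', R', C', hc, F', hτ⟩
    refine ⟨g, g', R', hMk, hc, C', b.trans (F'.mono (by norm_num)), ?_⟩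
    have : nPres (n + n) 0 (n + n) g = nPres (n + n) 0 (n + n) g₀ :=
      nPres_congr le_rfl fun t ht h6 _ _ => hMk.ne_zero (by omega)
    rw [this] at hτ
    simp only [Ex.cost_v] at ht1
    omega

/-- If the argument at `a` is nonzero, the table entry at `e` becomes one. -/
def condC (a e : Ex) : Cmd := iff (.inp a) (sto e (.c 1)) skip

theorem tot_cond (hM : Ctx M m) (h : Rep m g [] fl s) {a e : Ex} {t : Trip} (ht : Valid m t)
    (hao : (Ex.inp a).Ok M s) (heo : e.Ok M s) (he : e.eval M s = enc m t) :
    Tot M (condC a e) s fun s' τ =>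
      Rep m (fun t' => if t' = t ∧ M.inp (a.eval M s) ≠ 0 then 1 else g t') [] fl s' ∧
      (∀ r, s'.reg r = s.reg r) ∧ τ ≤ a.cost + e.cost + 10 := by
  have hm := hM.pos
  have hW := hM.le_W
  refine tot_iff hao (fun n1 => (tot_sto_tab hM h ht heo he (by simp; omega)).mono ?_) fun n1 =>
    tot_skip (by omega) ⟨h.congr fun t' _ => ?_, fun _ => rfl, by simp; omega⟩
  · rintro s' τ ⟨A, B, C⟩
    refine ⟨A.congr fun t' _ => ?_, B, by simp at C ⊢; omega⟩
    have n1' : M.inp (a.eval M s) ≠ 0 := n1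
    simp [Function.update_apply, n1']
  · have n1' : M.inp (a.eval M s) = 0 := n1
    simp [n1']

/-- The matrix update of an insertion: the ones of `δ` in row and column `i` before position `k`. -/
def updG (i : ℕ) (δ : ℕ → ℕ → ℕ) (g : Tab) (k : ℕ) : Tab := fun t =>
  if t.1 = 7 ∧ ((t.2.1 = i ∧ t.2.2 < k ∧ δ i t.2.2 ≠ 0) ∨ (t.2.2 = i ∧ t.2.1 < k ∧ δ t.2.1 i ≠ 0))
  then 1 else g t

/-- Update of the matrix by an insertion centred at the vertex in register `3`. -/
def updC : Cmd :=
  forUp 6 (.v 1) (condC (.c 2 + (.v 3 * .v 1 + .v 6)) (FA (.c 7) (.v 3) (.v 6)) ;;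
    condC (.c 2 + (.v 6 * .v 1 + .v 3)) (FA (.c 7) (.v 6) (.v 3)))

theorem tot_upd (hM : Ctx M (n + n)) {i : ℕ} (hi : i < n) (h : Rep (n + n) g [] fl s)
    (h1 : s.reg 1 = n) (h3 : s.reg 3 = i) {δ : ℕ → ℕ → ℕ}
    (hδ : ∀ x < n, ∀ y < n, M.inp (2 + (x * n + y)) = δ x y ∧ δ x y ≤ 1) :
    Tot M updC s fun s' τ => Rep (n + n) (updG i δ g n) [] fl s' ∧ Fr 6 s s' ∧
      τ ≤ 120 * n + 20 := by
  have hm := hM.pos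
  have hS := hM.le_S
  have hW := hM.le_W
  have hmm : n + n ≤ (n + n) * (n + n) := Nat.le_mul_self _
  have hc : ∀ x, x < 20 → x < M.W := fun x hx => by omega
  have hc2 : 2 < M.W := hc 2 (by norm_num)
  have hc7 : 7 < M.W := hc 7 (by norm_num)
  have hidx : ∀ x < n, ∀ y < n, 2 + (x * n + y) < M.W ∧ x * n ≤ (n + n) * (n + n) := by
    intro x hx y hy
    have := Nat.mul_le_mul_right n (show x + 1 ≤ n by omega)
    have e : (n + n) * (n + n) = 4 * (n * n) := by ring
    rw [Nat.add_mul] at this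
    omega
  refine (tot_tabs (N := n) (updG i δ g) 100 (by norm_num) (by norm_num) (by norm_num) (by omega)
    (h.congr fun t _ => by simp [updG]) (fun s' h' => ⟨by simp, by
      simp [h' 1 (by norm_num) (by norm_num), h1]⟩) ?_).mono ?_
  · intro k s1 hk R1 F1 h6
    have r1 := (F1 1 (by norm_num) (by norm_num)).trans h1
    have r3 := (F1 3 (by norm_num) (by norm_num)).trans h3
    obtain ⟨d1, d2⟩ := hδ i hi k hk
    obtain ⟨d3, d4⟩ := hδ k hk i hi
    obtain ⟨x1, x2⟩ := hidx i hi k hk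
    obtain ⟨x3, x4⟩ := hidx k hk i hi
    have v1 : Valid (n + n) (7, i, k) := ⟨by simp, by simp only; omega, by simp only; omega⟩
    have v2 : Valid (n + n) (7, k, i) := ⟨by simp, by simp only; omega, by simp only; omega⟩
    refine tot_seq ((tot_cond hM R1 v1 ?_ (FA_ok hM R1.reg2 (by simp [hc7]) (by simp) (by simp)
      (by simpa [r3, h6] using v1)) (by rw [FA_eval R1.reg2]; simp [r3, h6])).mono ?_)
    · simp [r1, r3, h6, hc2, d1]; omega
    rintro s2 t2 ⟨R2, F2, T2⟩
    have p1 := (F2 1).trans r1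
    have p3 := (F2 3).trans r3
    have p6 := (F2 6).trans h6
    refine (tot_cond hM R2 v2 ?_ (FA_ok hM R2.reg2 (by simp [hc7]) (by simp) (by simp)
      (by simpa [p3, p6] using v2)) (by rw [FA_eval R2.reg2]; simp [p3, p6])).mono ?_
    · simp [p1, p3, p6, hc2, d3]; omega
    rintro s3 t3 ⟨R3, F3, T3⟩
    refine ⟨R3.congr ?_, fun r _ _ => (F3 r).trans (F2 r), by simp at T2 T3; omega⟩
    rintro ⟨a, b, c⟩ -
    have q1 : (Ex.c 2 + (Ex.v 3 * Ex.v 1 + Ex.v 6)).eval M s1 = 2 + (i * n + k) := by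
      simp [r1, r3, h6]
    have q2 : (Ex.c 2 + (Ex.v 6 * Ex.v 1 + Ex.v 3)).eval M s2 = 2 + (k * n + i) := by
      simp [p1, p3, p6]
    simp only [q1, q2, d1, d3, Prod.mk.injEq, updG]
    by_cases ha : a = 7
    swap
    · simp [ha]
    simp only [ha, true_and]
    by_cases hbi : b = i <;> by_cases hci : c = i <;> by_cases hbk : b = k <;> by_cases hck : c = k
    all_goals first | (subst hbi) | skip
    all_goals first | (subst hci) | skip
    all_goals first | (subst hbk) | skip
    all_goals first | (subst hck) | skip
    all_goals simp_all
    all_goals grind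
  · rintro s' t ⟨A, B, C⟩
    refine ⟨A, B, ?_⟩
    simp at C; omega

end Build

/-! ### The operations and their potentials -/

open Relation (ReflTransGen)

section Args
variable {n : ℕ}

theorem arr_cons_succ (a : ℕ) (l : List ℕ) (k : ℕ) : arr (a :: l) (k + 1) = arr l k := by
  simp [arr]

theorem arr_cons_zero (a : ℕ) (l : List ℕ) : arr (a :: l) 0 = a := by simp [arr]

theorem arr_entries (Y : BoolMat n) {x y : ℕ} (hx : x < n) (hy : y < n) :
    arr (entries Y) (x * n + y) = (Y ⟨x, hx⟩ ⟨y, hy⟩).toNat := by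
  have h : x * n + y < n * n := by
    have := Nat.mul_le_mul_right n (show x + 1 ≤ n by omega)
    rw [Nat.add_mul] at this
    omega
  have e1 : (x * n + y) / n = x := by
    rw [Nat.add_div_of_dvd_right (Dvd.intro_left _ rfl), Nat.mul_div_cancel _ (by omega),
      Nat.div_eq_of_lt hy, add_zero]
  have e2 : (x * n + y) % n = y := by simp [Nat.add_mod, Nat.mod_eq_of_lt hy]
  simp only [arr, entries]
  rw [List.getD_eq_getElem _ _ (by simpa using h)]
  simp [Fin.divNat, Fin.modNat, e1, e2]

theorem arr_pairs (D : List (Fin n × Fin n)) {j : ℕ} (hj : j < D.length) :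
    arr (D.flatMap fun p => [(p.1 : ℕ), (p.2 : ℕ)]) (j + j) = (D[j].1 : ℕ) ∧
    arr (D.flatMap fun p => [(p.1 : ℕ), (p.2 : ℕ)]) (j + j + 1) = (D[j].2 : ℕ) := by
  induction D generalizing j with
  | nil => simp at hj
  | cons p D ih =>
    cases j with
    | zero => simp [arr]
    | succ j =>
      have := ih (j := j) (by simpa using hj)
      rw [show j + 1 + (j + 1) = j + j + 1 + 1 by omega, List.flatMap_cons, List.cons_append,
        List.cons_append, List.nil_append, arr_cons_succ, arr_cons_succ, arr_cons_succ, arr_cons_succ]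
      exact this

end Args

/-- The edge relation of a matrix, on natural numbers. -/
def rel {n : ℕ} (X : BoolMat n) (x y : ℕ) : Prop :=
  ∃ (hx : x < n) (hy : y < n), X ⟨x, hx⟩ ⟨y, hy⟩ = true

theorem rel_iff {n : ℕ} (X : BoolMat n) (x y : Fin n) : rel X x y ↔ X x y = true :=
  ⟨fun ⟨_, _, h⟩ => h, fun h => ⟨x.2, y.2, h⟩⟩

theorem rel_lt {n : ℕ} {X : BoolMat n} {x y : ℕ} (h : rel X x y) : x < n ∧ y < n :=
  ⟨h.1, h.2.1⟩

theorem closure_iff_rel {n : ℕ} (X : BoolMat n) (x y : Fin n) :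
    KleeneClosure X x y ↔ ReflTransGen (rel X) x y := by
  constructor
  · intro h
    exact h.lift (fun v : Fin n => (v : ℕ)) fun a b hab => (rel_iff X a b).2 hab
  · intro h
    have : ∀ b : ℕ, ReflTransGen (rel X) x b → ∀ hb : b < n, KleeneClosure X x ⟨b, hb⟩ := by
      intro b hb
      induction hb with
      | refl => exact fun _ => .refl
      | tail _ hbc ih => exact fun hc => (ih hbc.1).tail hbc.2.2
    exact this y h y.2

/-- The positions of the ones. -/
def ones {n : ℕ} (X : BoolMat n) : Finset (Fin n × Fin n) := Finset.univ.filter fun p => X p.1 p.2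

/-- The invariant between the operations, for the memory contents `μ` after `T` operations. What the
deletions may still charge to the last initialization is `b`, and what they may charge to the
insertions since then is `t`; the ghost set `G` consists of the entries set by insertions. With the
flag `0` the counters are complete. With the flag `1` they have not been built since
the initialization. -/
def Inv {n : ℕ} (X : BoolMat n) (T b t : ℕ) (μ : ℕ → ℕ) : Prop :=
  ∃ (g : Tab) (G : Finset (Fin n × Fin n)), (∀ t, Valid (n + n) t → μ (enc (n + n) t) = g t) ∧
    G ⊆ ones X ∧
    ((μ (16 * ((n + n) * (n + n))) = 0 ∧ (∃ rk, Full n (rel X) rk g) ∧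
      b = 1800 * n * nPres (n + n) 0 n g + 1000 * (ones X \ G).card ∧
      t = 1800 * n * nPres (n + n) n (n + n) g + 1000 * G.card) ∨
    (μ (16 * ((n + n) * (n + n))) = 1 ∧ Lazy (n + n) (vtx n) (rel X) g ∧
      (∀ x < n + n, ∀ y < n + n, g (7, x, y) ≠ 0 ↔ rel X x y) ∧
      (∀ t, Valid (n + n) t → t.1 = 6 → g t ≤ T + 1) ∧ b = 40000 * n ^ 3 ∧ t = 1000 * G.card))

section Ops
variable {M : Mach} {n T b t : ℕ} {X : BoolMat n} {s : State}

/-- Common beginning of all operations. -/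
def proC : Cmd := asg 1 (.inp (.c 0)) ;; asg 2 (.v 1 + .v 1) ;; asg 5 (.c 0)

theorem tot_pro (hM : Ctx M (n + n)) (h0 : M.inp 0 = n) {c : Cmd} {Q : State → ℕ → Prop}
    (h : ∀ s' : State, s'.mem = s.mem → s'.reg 1 = n → s'.reg 2 = n + n → s'.reg 5 = 0 →
      Tot M c s' fun s'' τ => Q s'' (τ + 14)) : Tot M (proC ;; c) s Q := by
  have hm := hM.pos
  have hS := hM.le_S
  have hW := hM.le_W
  have hmm : n + n ≤ (n + n) * (n + n) := Nat.le_mul_self _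
  refine tot_seq (tot_seq (tot_asg (by norm_num) ?_ (tot_seq (tot_asg (by norm_num) ?_
    (tot_asg (by norm_num) ?_ ?_)))))
  · simp [h0]; omega
  · simp [h0]; omega
  · simp; omega
  · refine (h _ ?_ ?_ ?_ ?_).mono fun s'' τ hq => ?_
    · simp
    · simp [h0]
    · simp [h0]
    · simp
    · have e : (Ex.inp (Ex.c 0)).cost + 2 + ((Ex.v 1 + Ex.v 1).cost + 2 + ((Ex.c 0).cost + 2)) + τ
          = τ + 14 := by simp; omega
      rwa [e]

theorem rep_of {fl : ℕ} {g : Tab} {s' : State}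
    (h : ∀ t, Valid (n + n) t → s.mem (enc (n + n) t) = g t)
    (hf : s.mem (16 * ((n + n) * (n + n))) = fl) (hm : s'.mem = s.mem) (h2 : s'.reg 2 = n + n)
    (h5 : s'.reg 5 = 0) : Rep (n + n) g [] fl s' :=
  ⟨h2, by simpa using h5, by rw [hm]; exact h, by simp, by rw [hm]; exact hf, by simp, by simp⟩

/-- Program for `Lookup*(x, y)`: the diagonal is treated separately, since the counters only record
the paths through nodes. -/
def lookupC : Cmd :=
  proC ;; asg 3 (.inp (.c 1)) ;; asg 4 (.inp (.c 2)) ;;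
    iff ((.v 3 - .v 4) + (.v 4 - .v 3))
      (iff (.ld (FA (.c 6) (.v 3) (.v 4))) (asg 0 (.c 1)) (asg 0 (.c 0))) (asg 0 (.c 1))

theorem Inv.closure (h : Inv X T b t s.mem) {x y : ℕ} (hx : x < n + n) (hy : y < n + n)
    (hxy : x ≠ y) : s.mem (enc (n + n) (6, x, y)) ≠ 0 ↔ ReflTransGen (rel X) x y := by
  obtain ⟨g, G, hg, -, ⟨-, ⟨rk, hF⟩, -⟩ | ⟨-, hL, -⟩⟩ := h
  · rw [hg _ ⟨by simp, hx, hy⟩]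
    exact hF.core.closure_iff hF.nodes hF.inj hx hy hxy
  · rw [hg _ ⟨by simp, hx, hy⟩]
    exact hL.reach x hx y hy hxy

theorem Inv.succ {μ : ℕ → ℕ} (h : Inv X T b t μ) : Inv X (T + 1) b t μ := by
  obtain ⟨g, G, hg, hG, h1 | ⟨h1, h2, h3, h4, h5⟩⟩ := h
  · exact ⟨g, G, hg, hG, Or.inl h1⟩
  · exact ⟨g, G, hg, hG, Or.inr ⟨h1, h2, h3, fun t a b => (h4 t a b).trans (by omega), h5⟩⟩

theorem tot_lookup (hM : Ctx M (n + n)) (x y : Fin n)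
    (hi : M.inp = arr (Op.args (.lookup x y))) (h : Inv X T b t s.mem) :
    Tot M lookupC s fun s' τ => Inv X (T + 1) b t s'.mem ∧ τ ≤ 100 ∧
      (KleeneClosure X x y → s'.reg 0 = 1) ∧ (¬ KleeneClosure X x y → s'.reg 0 = 0) := by
  have hm := hM.pos
  have hS := hM.le_S
  have hW := hM.le_W
  have hmm : n + n ≤ (n + n) * (n + n) := Nat.le_mul_self _
  have hx := x.2
  have hy := y.2
  have i0 : M.inp 0 = n := by rw [hi]; simp [arr, Op.args]
  have i1 : M.inp 1 = x := by rw [hi]; simp [arr, Op.args]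
  have i2 : M.inp 2 = y := by rw [hi]; simp [arr, Op.args]
  have hc : ∀ x, x < 20 → x < M.W := fun x hx => by omega
  have hc0 := hc 0 (by norm_num)
  have hc1 := hc 1 (by norm_num)
  have hc2 := hc 2 (by norm_num)
  have hc6 := hc 6 (by norm_num)
  refine tot_pro hM i0 fun s1 m1 _ r2 _ => ?_
  refine tot_seq (tot_asg (by norm_num) ?_ (tot_seq (tot_asg (by norm_num) ?_ ?_)))
  · simp [i1, hc1]; omega
  · simp [i2, hc2]; omega
  have e1 : (Ex.inp (.c 1)).eval M s1 = x := by simp [i1]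
  rw [e1]
  have e2 : (Ex.inp (.c 2)).eval M (s1.setReg 3 x) = y := by simp [i2]
  rw [e2]
  generalize hs2 : (s1.setReg 3 x).setReg 4 y = s2
  have m2 : s2.mem = s.mem := by subst hs2; simp [m1]
  have q2 : s2.reg 2 = n + n := by subst hs2; simp [r2]
  have q3 : s2.reg 3 = x := by subst hs2; simp
  have q4 : s2.reg 4 = y := by subst hs2; simp
  clear hs2
  rw [closure_iff_rel]
  have v : Valid (n + n) (6, x, y) := ⟨by simp, by simp only; omega, by simp only; omega⟩
  have ev : (FA (.c 6) (.v 3) (.v 4)).eval M s2 = enc (n + n) (6, x, y) := by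
    rw [FA_eval q2]; simp [q3, q4]
  refine tot_iff (by simp [q3, q4]; omega) (fun n1 => tot_iff ⟨FA_ok hM q2 (by simp [hc6])
    (by simp) (by simp) (by simpa [q3, q4] using v), by rw [ev]; exact Rep.lt_S hM v⟩
    (fun n2 => tot_asg (by norm_num) (by simp [hc1]) ?_) fun n2 => tot_asg (by norm_num)
    (by simp [hc0]) ?_) fun n1 => tot_asg (by norm_num) (by simp [hc1]) ?_
  · have hne : (x : ℕ) ≠ y := by intro h; simp [q3, q4, h] at n1
    rw [Ex.eval_ld, ev, m2, h.closure v.2.1 v.2.2 hne] at n2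
    exact ⟨by simpa [m2] using h.succ, by simp, by simp, fun h' => absurd n2 h'⟩
  · have hne : (x : ℕ) ≠ y := by intro h; simp [q3, q4, h] at n1
    rw [Ex.eval_ld, ev, m2, ← not_ne_iff, h.closure v.2.1 v.2.2 hne] at n2
    exact ⟨by simpa [m2] using h.succ, by simp, fun h' => absurd h' n2, by simp⟩
  · have he : (x : ℕ) = y := by simp [q3, q4] at n1; omega
    refine ⟨by simpa [m2] using h.succ, by simp, by simp, fun h' => absurd ?_ h'⟩
    rw [he]

/-- Program for `Reset*`. If the counters have not been built since the last initialization, the first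
nonempty deletion builds them. -/
def resetC : Cmd :=
  proC ;; asg 3 (.inp (.c 1)) ;;
    iff (.v 3) (iff (.ld (.c 16 * (.v 2 * .v 2))) rebuildC skip ;; deleteC) skip

theorem rel_reset (D : List (Fin n × Fin n)) {x y : ℕ} :
    rel (Op.apply X (.reset D)) x y ↔
      rel X x y ∧ (x, y) ∉ D.map fun p => ((p.1 : ℕ), (p.2 : ℕ)) := by
  have key : ∀ (hx : x < n) (hy : y < n), (x, y) ∈ D.map (fun p => ((p.1 : ℕ), (p.2 : ℕ))) ↔
      ((⟨x, hx⟩, ⟨y, hy⟩) : Fin n × Fin n) ∈ D := by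
    intro hx hy
    rw [List.mem_map]
    constructor
    · rintro ⟨p, hp, he⟩
      rw [Prod.mk.injEq] at he
      have : p = ((⟨x, hx⟩, ⟨y, hy⟩) : Fin n × Fin n) := Prod.ext (Fin.ext he.1) (Fin.ext he.2)
      rwa [← this]
    · exact fun h => ⟨_, h, rfl⟩
  constructor
  · rintro ⟨hx, hy, h⟩
    simp only [Op.apply, Bool.and_eq_true, Bool.not_eq_true', decide_eq_false_iff_not] at h
    exact ⟨⟨hx, hy, h.1⟩, fun h' => h.2 ((key hx hy).1 h')⟩
  · rintro ⟨⟨hx, hy, h⟩, h'⟩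
    refine ⟨hx, hy, ?_⟩
    simp only [Op.apply, Bool.and_eq_true, Bool.not_eq_true', decide_eq_false_iff_not]
    exact ⟨h, fun h2 => h' ((key hx hy).2 h2)⟩

theorem ones_reset (D : List (Fin n × Fin n)) :
    ones (Op.apply X (.reset D)) = ones X \ D.toFinset := by
  ext p
  simp [ones, Op.apply]

theorem card_ones_le (X : BoolMat n) : (ones X).card ≤ n * n := by
  refine (Finset.card_filter_le _ _).trans ?_
  simp

/-- A deletion is paid for by the potentials. If it has to build the counters, then the cubic `b` left
by the initialization pays for this, and for the facts of the base nodes as well. -/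
theorem tot_reset (hM : Ctx M (n + n)) (D : List (Fin n × Fin n)) (hD : (Op.reset D).Admissible X)
    (hi : M.inp = arr (Op.args (.reset D))) (h : Inv X T b t s.mem) :
    Tot M resetC s fun s' τ => ∃ b' t', Inv (Op.apply X (.reset D)) (T + 1) b' t' s'.mem ∧ b' ≤ b ∧
      t' ≤ t ∧ τ + b' + t' ≤ b + t + if D = [] then 100 else 0 := by
  have hm := hM.pos
  have hS := hM.le_S
  have hW := hM.le_W
  have hmm : n + n ≤ (n + n) * (n + n) := Nat.le_mul_self _
  have hc : ∀ x, x < 20 → x < M.W := fun x hx => by omega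
  have hc0 := hc 0 (by norm_num)
  have hc1 := hc 1 (by norm_num)
  have hc16 := hc 16 (by norm_num)
  have i0 : M.inp 0 = n := by rw [hi]; simp [arr, Op.args]
  have i1 : M.inp 1 = D.length := by rw [hi]; simp [arr, Op.args]
  have hDsub : D.toFinset ⊆ ones X := by
    intro p hp
    simp only [ones, Finset.mem_filter, Finset.mem_univ, true_and]
    exact hD.2 p (List.mem_toFinset.1 hp)
  have hDc : D.toFinset.card = D.length := List.toFinset_card_of_nodup hD.1
  have hlen : D.length ≤ n * n := hDc ▸ (Finset.card_le_card hDsub).trans (card_ones_le X)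
  have e4 : (n + n) * (n + n) = 4 * (n * n) := by ring
  refine tot_pro hM i0 fun s1 m1 r1 r2 r5 => tot_seq (tot_asg (by norm_num) ?_ ?_)
  · simp [i1, hc1]; omega
  have e1 : (Ex.inp (.c 1)).eval M s1 = D.length := by simp [i1]
  rw [e1]
  generalize hs2 : s1.setReg 3 D.length = s2
  have m2 : s2.mem = s.mem := by subst hs2; simp [m1]
  have q1 : s2.reg 1 = n := by subst hs2; simp [r1]
  have q2 : s2.reg 2 = n + n := by subst hs2; simp [r2]
  have q3 : s2.reg 3 = D.length := by subst hs2; simp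
  have q5 : s2.reg 5 = 0 := by subst hs2; simp [r5]
  clear hs2
  refine tot_iff (by simp) (fun n1 => ?_) fun n1 => tot_skip hc0 ?_
  swap
  · have hnil : D = [] := by simpa [q3] using n1
    subst hnil
    have : Op.apply X (.reset []) = X := by funext x y; simp [Op.apply]
    rw [this]
    exact ⟨b, t, m2 ▸ h.succ, le_rfl, le_rfl, by simp; omega⟩
  have hne : D ≠ [] := by rintro rfl; simp [q3] at n1
  have hpos : 1 ≤ D.length := List.length_pos_iff.2 hne
  obtain ⟨g, G, hg, hG, hcase⟩ := h
  set l := D.map fun p => ((p.1 : ℕ), (p.2 : ℕ)) with hl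
  have hll : l.length = D.length := by simp [hl]
  set X' := Op.apply X (.reset D) with hX'
  have hrel : (fun x y => rel X x y ∧ (x, y) ∉ l) = rel X' := by
    funext x y; exact propext (rel_reset D).symm
  have hones : ones X' = ones X \ D.toFinset := ones_reset D
  -- the entries removed are paid for according to their membership in `G`
  have hsplit : (ones X' \ (G \ D.toFinset)).card + (G \ D.toFinset).card + D.length ≤
      (ones X \ G).card + G.card ∧ (ones X' \ (G \ D.toFinset)).card ≤ (ones X \ G).card ∧
      (G \ D.toFinset).card ≤ G.card ∧ G \ D.toFinset ⊆ ones X' := by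
    have hsub : G \ D.toFinset ⊆ ones X' := by
      rw [hones]; exact Finset.sdiff_subset_sdiff hG le_rfl
    have k1 := Finset.card_sdiff_add_card_eq_card hG
    have k2 := Finset.card_sdiff_add_card_eq_card hsub
    have k3 := Finset.card_sdiff_add_card_eq_card hDsub
    rw [← hones] at k3
    refine ⟨by omega, Finset.card_le_card ?_, Finset.card_le_card Finset.sdiff_subset, hsub⟩
    rw [hones]
    intro p
    simp only [Finset.mem_sdiff]
    tauto
  obtain ⟨c1, c2, c3, hsub⟩ := hsplit
  have del : ∀ (s3 : State) (g1 : Tab) (rk : ℕ → ℕ), Rep (n + n) g1 [] 0 s3 →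
      Full n (rel X) rk g1 → s3.reg 1 = n → s3.reg 3 = D.length →
      Tot M deleteC s3 fun s' τ => ∃ g', Inv X' (T + 1)
        (1800 * n * nPres (n + n) 0 n g' + 1000 * (ones X' \ (G \ D.toFinset)).card)
        (1800 * n * nPres (n + n) n (n + n) g' + 1000 * (G \ D.toFinset).card) s'.mem ∧
        nPres (n + n) 0 n g' ≤ nPres (n + n) 0 n g1 ∧
        nPres (n + n) n (n + n) g' ≤ nPres (n + n) n (n + n) g1 ∧
        τ + 1800 * n * nPres (n + n) 0 n g' + 1800 * n * nPres (n + n) n (n + n) g' ≤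
        1800 * n * nPres (n + n) 0 n g1 + 1800 * n * nPres (n + n) n (n + n) g1 +
          420 * D.length + 30 := by
    intro s3 g1 rk R3 F3 k1 k3
    refine (tot_delete hM R3 F3 (l := l) ?_ k1 (by rw [k3, hll]) (by rw [hll]; omega) ?_).mono ?_
    · intro p hp
      obtain ⟨q, -, rfl⟩ := List.mem_map.1 hp
      exact ⟨q.1.2, q.2.2⟩
    · intro j hj
      have hj' : j < D.length := by rwa [hll] at hj
      obtain ⟨a1, a2⟩ := arr_pairs D hj'
      have o1 : M.inp (2 + (j + j)) = arr (D.flatMap fun p => [(p.1 : ℕ), (p.2 : ℕ)]) (j + j) := by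
        rw [hi, Op.args, show 2 + (j + j) = j + j + 1 + 1 by omega, arr_cons_succ, arr_cons_succ]
      have o2 : M.inp (3 + (j + j)) = arr (D.flatMap fun p => [(p.1 : ℕ), (p.2 : ℕ)]) (j + j + 1) := by
        rw [hi, Op.args, show 3 + (j + j) = j + j + 1 + 1 + 1 by omega, arr_cons_succ, arr_cons_succ]
      rw [o1, o2, a1, a2]
      simp [hl]
    · rintro s4 τ ⟨g', R', F', hp, hτ⟩
      rw [hrel] at F'
      have w := nPres_split (m := n + n) (n := n) (by omega)
      have e : ∀ x, 900 * (n + n) * x = 1800 * n * x := fun x => by ring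
      rw [e, e, w g1, w g', Nat.mul_add, Nat.mul_add] at hτ
      refine ⟨g', ⟨g', _, R'.tab, hsub, Or.inl ⟨R'.flag, ⟨rk, F'⟩, rfl, rfl⟩⟩, hp 0 n (by omega),
        hp n (n + n) le_rfl, ?_⟩
      omega
  have hFo : (Ex.ld (.c 16 * (.v 2 * .v 2))).Ok M s2 := by
    simp [q2]; omega
  have hFe : (Ex.ld (.c 16 * (.v 2 * .v 2))).eval M s2 = s.mem (16 * ((n + n) * (n + n))) := by
    simp [q2, m2]
  rw [if_neg hne]
  rcases hcase with ⟨hfl, ⟨rk, hF⟩, rfl, rfl⟩ | ⟨hfl, hL, hmat, -, rfl, rfl⟩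
  · refine tot_seq (tot_iff hFo (fun n2 => by rw [hFe, hfl] at n2; omega) fun n2 => tot_skip hc0 ?_)
    refine (del s2 g rk (rep_of hg hfl m2 q2 q5) hF q1 q3).mono ?_
    rintro s' τ ⟨g', I', l1, l2, hτ⟩
    have l1' := Nat.mul_le_mul_left (1800 * n) l1
    have l2' := Nat.mul_le_mul_left (1800 * n) l2
    refine ⟨_, _, I', by omega, by omega, ?_⟩
    simp only [Ex.cost_ld, Ex.cost_mul, Ex.cost_c, Ex.cost_v, Ex.cost_inp]
    omega
  · refine tot_seq (tot_iff hFo (fun n2 => ?_) fun n2 => by rw [hFe, hfl] at n2; omega)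
    refine (tot_rebuild hM (rep_of hg hfl m2 q2 q5) q1 hmat fun x y h => rel_lt h).mono ?_
    rintro s3 t3 ⟨rk, g1, R3, F3, z3, Fr3, T3⟩
    refine (del s3 g1 rk R3 F3 ((Fr3 1 (by norm_num) (by norm_num)).trans q1)
      ((Fr3 3 (by norm_num) (by norm_num)).trans q3)).mono ?_
    rintro s' τ ⟨g', I', l1, l2, hτ⟩
    have l3 : nPres (n + n) 0 n g1 ≤ 6 * (n * (n + n)) := by
      simpa using nPres_le (m := n + n) (lo := 0) (hi := n) g1
    have l1' := Nat.mul_le_mul_left (1800 * n) (l1.trans l3)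
    have l3' := Nat.mul_le_mul_left (1800 * n) l3
    have e5 : 1800 * n * (6 * (n * (n + n))) = 21600 * n ^ 3 := by ring
    rw [e5] at l1' l3'
    have z : nPres (n + n) n (n + n) g' = 0 := by omega
    rw [z3, z] at hτ
    rw [z] at I'
    simp only [Nat.mul_zero, Nat.zero_add, Nat.add_zero] at hτ I'
    have l4 := card_ones_le X
    have l5 := Finset.card_le_card (Finset.sdiff_subset (s := ones X) (t := G))
    have l6 : n * n ≤ n ^ 3 := by
      rw [show n ^ 3 = n * n * n by ring]; exact Nat.le_mul_of_pos_right _ (by omega)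
    have l7 : 1 ≤ n * n := Nat.mul_pos (by omega) (by omega)
    refine ⟨_, _, I', by omega, by omega, ?_⟩
    simp only [Ex.cost_ld, Ex.cost_mul, Ex.cost_c, Ex.cost_v, Ex.cost_inp]
    omega

end Ops

/-! ### Insertions and their potential -/

section SetOp
variable {M : Mach} {n T b t : ℕ} {X : BoolMat n} {s : State}

/-- Program for `Set*`. The old top node of the centre is emptied first, unless the counters are not
in use. -/
def setC : Cmd :=
  proC ;; asg 3 (.inp (.c 1)) ;; iff (.ld (.c 16 * (.v 2 * .v 2))) skip clearNodeC ;; updC ;;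
    asg 11 (.v 1 + .v 3) ;; asg 12 (.v 3) ;; addC

theorem rel_set (i : Fin n) (Δ : BoolMat n) {x y : ℕ} :
    rel (Op.apply X (.set i Δ)) x y ↔ rel X x y ∨ ((x = i ∨ y = i) ∧ rel Δ x y) := by
  constructor
  · rintro ⟨hx, hy, h⟩
    simp only [Op.apply, Bool.or_eq_true, Bool.and_eq_true, decide_eq_true_eq] at h
    rcases h with h | ⟨h1, h2⟩
    · exact Or.inl ⟨hx, hy, h⟩
    · exact Or.inr ⟨h1.imp (fun h => by rw [← h]) fun h => by rw [← h], hx, hy, h2⟩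
  · rintro (⟨hx, hy, h⟩ | ⟨h1, hx, hy, h⟩)
    · exact ⟨hx, hy, by simp [Op.apply, h]⟩
    · refine ⟨hx, hy, ?_⟩
      simp only [Op.apply, Bool.or_eq_true, Bool.and_eq_true, decide_eq_true_eq]
      exact Or.inr ⟨h1.imp (fun h => Fin.ext h) fun h => Fin.ext h, h⟩

theorem Lazy.congr {m : ℕ} {v : ℕ → ℕ} {Y : ℕ → ℕ → Prop} {g g' : Tab} (h : Lazy m v Y g)
    (hg : ∀ t, t.1 < 7 → g' t = g t) : Lazy m v Y g' := by
  refine ⟨fun k hk x hx h0 => h.snd4 k hk x hx (by rwa [hg _ (by norm_num)] at h0),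
    fun k hk x hx h0 => h.snd5 k hk x hx (by rwa [hg _ (by norm_num)] at h0),
    fun x hx y hy h0 => (h.cmp x hx y hy h0).imp_right ?_,
    fun x hx y hy h0 => by rw [hg _ (by norm_num)]; exact h.reach x hx y hy h0, h.vtx_lt, h.lt⟩
  rintro ⟨k, hk, h1, h2⟩
  exact ⟨k, hk, by rwa [hg _ (by norm_num)], by rwa [hg _ (by norm_num)]⟩

/-- What the insertion centred at `i` adds to the ghost set has at most `2n` elements. -/
theorem ghost_set (i : Fin n) (Δ : BoolMat n) {G : Finset (Fin n × Fin n)} (hG : G ⊆ ones X) :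
    ∃ G' ⊆ ones (Op.apply X (.set i Δ)), G'.card ≤ G.card + 2 * n ∧
      (ones (Op.apply X (.set i Δ)) \ G').card ≤ (ones X \ G).card := by
  set X' := Op.apply X (.set i Δ) with hX'
  have hXX : ones X ⊆ ones X' := by
    intro p
    simp only [ones, Finset.mem_filter, Finset.mem_univ, true_and, hX', Op.apply]
    intro h; simp [h]
  refine ⟨G ∪ (ones X').filter (fun p => p.1 = i ∨ p.2 = i),
    Finset.union_subset (hG.trans hXX) (Finset.filter_subset _ _), ?_, Finset.card_le_card ?_⟩
  · refine (Finset.card_union_le _ _).trans (Nat.add_le_add_left ?_ _)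
    have : (ones X').filter (fun p => p.1 = i ∨ p.2 = i) ⊆
        (({i} : Finset (Fin n)) ×ˢ Finset.univ) ∪ (Finset.univ ×ˢ ({i} : Finset (Fin n))) := by
      intro p
      simp only [Finset.mem_filter, Finset.mem_union, Finset.mem_product, Finset.mem_singleton,
        Finset.mem_univ, and_true, true_and]
      exact fun h => h.2
    refine (Finset.card_le_card this).trans ((Finset.card_union_le _ _).trans ?_)
    simp; omega
  · intro p
    simp only [ones, Finset.mem_sdiff, Finset.mem_union, Finset.mem_filter, Finset.mem_univ,
      true_and, hX', Op.apply, Bool.or_eq_true, Bool.and_eq_true, decide_eq_true_eq, not_or, not_and]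
    rintro ⟨h1, h2, h3⟩
    refine ⟨?_, h2⟩
    rcases h1 with h1 | ⟨h4, h5⟩
    · exact h1
    · have := h3 (Or.inr ⟨h4, h5⟩)
      tauto

/-- An insertion raises the potential by at most a multiple of `n²`: the row of the new node holds
`O(n)` facts, which may later be deleted at a cost of `O(n)` each. -/
theorem tot_set (hM : Ctx M (n + n)) (i : Fin n) (Δ : BoolMat n)
    (hi : M.inp = arr (Op.args (.set i Δ))) (hT : T + 2 < M.W) (h : Inv X T b t s.mem) :
    Tot M setC s fun s' τ => ∃ b' t', Inv (Op.apply X (.set i Δ)) (T + 1) b' t' s'.mem ∧ b' ≤ b ∧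
      τ + t' ≤ t + 40000 * n ^ 2 := by
  have hm := hM.pos
  have hS := hM.le_S
  have hW := hM.le_W
  have hmm : n + n ≤ (n + n) * (n + n) := Nat.le_mul_self _
  have hc : ∀ x, x < 20 → x < M.W := fun x hx => by omega
  have hc0 := hc 0 (by norm_num)
  have hc1 := hc 1 (by norm_num)
  have hc16 := hc 16 (by norm_num)
  have hi' := i.2
  have i0 : M.inp 0 = n := by rw [hi]; simp [arr, Op.args]
  have i1 : M.inp 1 = i := by rw [hi]; simp [arr, Op.args]
  set δ : ℕ → ℕ → ℕ := fun x y => if h : x < n ∧ y < n then (Δ ⟨x, h.1⟩ ⟨y, h.2⟩).toNat else 0 with hδ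
  have hδin : ∀ x < n, ∀ y < n, M.inp (2 + (x * n + y)) = δ x y ∧ δ x y ≤ 1 := by
    intro x hx y hy
    have : δ x y = (Δ ⟨x, hx⟩ ⟨y, hy⟩).toNat := by simp [hδ, hx, hy]
    rw [this, hi, Op.args, show 2 + (x * n + y) = x * n + y + 1 + 1 by omega, arr_cons_succ,
      arr_cons_succ, arr_entries Δ hx hy]
    exact ⟨rfl, Bool.toNat_le _⟩
  have hδrel : ∀ x y, δ x y ≠ 0 ↔ rel Δ x y := by
    intro x y
    simp only [hδ, rel]
    by_cases hxy : x < n ∧ y < n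
    · rw [dif_pos hxy]
      simp [hxy.1, hxy.2]
    · rw [dif_neg hxy]
      simp only [ne_eq, not_true_eq_false, false_iff]
      rintro ⟨a, b, -⟩
      exact hxy ⟨a, b⟩
  set X' := Op.apply X (.set i Δ) with hX'
  have hr : ∀ x y, rel X' x y ↔ rel X x y ∨ ((x = i ∨ y = i) ∧ rel Δ x y) := fun x y => rel_set i Δ
  have hr1 : ∀ x y, rel X x y → rel X' x y := fun x y h => (hr x y).2 (Or.inl h)
  have hr2 : ∀ x y, rel X' x y → rel X x y ∨ x = i ∨ y = i := fun x y h =>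
    ((hr x y).1 h).imp_right fun h => h.1
  refine tot_pro hM i0 fun s1 m1 r1 r2 r5 => tot_seq (tot_asg (by norm_num) ?_ ?_)
  · simp [i1, hc1]; omega
  have e1 : (Ex.inp (.c 1)).eval M s1 = i := by simp [i1]
  rw [e1]
  generalize hs2 : s1.setReg 3 i = s2
  have m2 : s2.mem = s.mem := by subst hs2; simp [m1]
  have q1 : s2.reg 1 = n := by subst hs2; simp [r1]
  have q2 : s2.reg 2 = n + n := by subst hs2; simp [r2]
  have q3 : s2.reg 3 = i := by subst hs2; simp
  have q5 : s2.reg 5 = 0 := by subst hs2; simp [r5]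
  clear hs2
  obtain ⟨g, G, hg, hG, hcase⟩ := h
  obtain ⟨G', hG', c1, c2⟩ := ghost_set i Δ hG
  rw [← hX'] at hG' c2
  -- the part of the program after the old node has been removed
  have tail : ∀ {fl : ℕ} {s3 : State} {g1 : Tab}, Rep (n + n) g1 [] fl s3 → s3.reg 1 = n →
      s3.reg 3 = i → (∀ x < n + n, ∀ y < n + n, g1 (7, x, y) ≠ 0 ↔ rel X x y) →
      (∀ t, Valid (n + n) t → t.1 = 6 → g1 t + 1 < M.W) →
      Tot M (updC ;; asg 11 (.v 1 + .v 3) ;; asg 12 (.v 3) ;; addC) s3 fun s' τ => ∃ g2 g3,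
        Rep (n + n) g3 [] fl s' ∧ (∀ t, t.1 < 7 → g2 t = g1 t) ∧
        (∀ x < n + n, ∀ y < n + n, g2 (7, x, y) ≠ 0 ↔ rel X' x y) ∧
        AddSpec (n + n) (n + i) i g2 g3 ∧ τ ≤ 4200 * n ^ 2 := by
    intro fl s3 g1 R3 k1 k3 hmat hB
    refine tot_seq ((tot_upd hM hi' R3 k1 k3 hδin).mono ?_)
    rintro s4 t4 ⟨R4, F4, T4⟩
    have o1 := (F4 1 (by norm_num) (by norm_num)).trans k1
    have o3 := (F4 3 (by norm_num) (by norm_num)).trans k3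
    refine tot_seq (tot_asg (by norm_num) (by simp [o1, o3]; omega) (tot_seq (tot_asg (by norm_num)
      (by simp) ?_)))
    refine (tot_add hM (k := n + i) (v := i) ((R4.setReg (by norm_num) (by norm_num)).setReg
      (by norm_num) (by norm_num)) (by omega) (by omega) (by simp [o1, o3]) (by simp [o3]) ?_).mono ?_
    · intro t ht h6
      have : updG i δ g1 n t = g1 t := by simp [updG, h6]
      rw [this]
      exact hB t ht h6
    rintro s5 t5 ⟨g3, R5, A5, F5, T5⟩
    refine ⟨_, g3, R5, fun t ht => by simp [updG, show t.1 ≠ 7 by omega], fun x hx y hy => ?_, A5, ?_⟩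
    · rw [hr x y, ← hmat x hx y hy]
      unfold updG
      split_ifs with h1
      · simp only [ne_eq, one_ne_zero, not_false_eq_true, true_iff]
        rcases h1 with ⟨-, ⟨h2, -, h3⟩ | ⟨h2, -, h3⟩⟩
        · simp only at h2
          exact Or.inr ⟨Or.inl h2, h2 ▸ (hδrel _ _).1 h3⟩
        · simp only at h2
          exact Or.inr ⟨Or.inr h2, h2 ▸ (hδrel _ _).1 h3⟩
      · refine ⟨Or.inl, fun h2 => h2.elim id fun h3 => absurd ?_ h1⟩
        have h4 := rel_lt h3.2
        rcases h3 with ⟨h2 | h2, h3⟩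
        · exact ⟨rfl, Or.inl ⟨h2, h4.2, (hδrel _ _).2 (h2 ▸ h3)⟩⟩
        · exact ⟨rfl, Or.inr ⟨h2, h4.1, (hδrel _ _).2 (h2 ▸ h3)⟩⟩
    · simp only [Ex.cost_add, Ex.cost_v]
      have e4 : 1000 * ((n + n) * (n + n)) = 4000 * n ^ 2 := by ring
      have e5 : n ≤ n ^ 2 := by rw [pow_two]; exact Nat.le_mul_self n
      omega
  have hFo : (Ex.ld (.c 16 * (.v 2 * .v 2))).Ok M s2 := by
    simp [q2]; omega
  have hFe : (Ex.ld (.c 16 * (.v 2 * .v 2))).eval M s2 = s.mem (16 * ((n + n) * (n + n))) := by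
    simp [q2, m2]
  have e5 : n ≤ n ^ 2 := by rw [pow_two]; exact Nat.le_mul_self n
  have e6 : 1 ≤ n := by omega
  rcases hcase with ⟨hfl, ⟨rk, hF⟩, rfl, rfl⟩ | ⟨hfl, hL, hmat, hbd, rfl, rfl⟩
  · refine tot_seq (tot_iff hFo (fun n2 => by rw [hFe, hfl] at n2; omega) fun n2 =>
      (tot_clearNode hM hi' (rep_of hg hfl m2 q2 q5) hF.core q1 q3).mono ?_)
    rintro s3 t3 ⟨g1, g1', R3, hMk, hcs, hC3, F3, T3⟩
    refine (tail R3 ((F3 1 (by norm_num) (by norm_num)).trans q1)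
      ((F3 3 (by norm_num) (by norm_num)).trans q3) (fun x hx y hy => ?_) fun t ht h6 => ?_).mono ?_
    · rw [hcs.mat _ rfl, ((hMk (7, x, y)).2 rfl).2 (fun h => h)]
      exact hF.mat x hx y hy
    · have := hC3.reach_le ht h6
      omega
    rintro s4 t4 ⟨g2, g3, R4, h27, hm2, A4, T4⟩
    obtain ⟨hF4, w1, w2, w3⟩ := hF.renew hi' hMk hcs hC3
      (fun s hs k hk z hz => by simp [hs, hz]) (fun t _ h => h27 t h) hm2 hr1 hr2
      (fun x y h => rel_lt h) A4
    have w := nPres_split (m := n + n) (n := n) (by omega)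
    have e : ∀ x, 900 * (n + n) * x = 1800 * n * x := fun x => by ring
    rw [e, e, w g1', w g, Nat.mul_add, Nat.mul_add, w2] at T3
    refine ⟨_, _, ⟨g3, G', R4.tab, hG', Or.inl ⟨R4.flag, hF4, rfl, rfl⟩⟩, ?_, ?_⟩
    · rw [w1]; omega
    · have w3' := Nat.mul_le_mul_left (1800 * n) w3
      rw [Nat.mul_add, show 1800 * n * (6 * (n + n)) = 21600 * n ^ 2 by ring] at w3'
      simp only [Ex.cost_ld, Ex.cost_mul, Ex.cost_c, Ex.cost_v, Ex.cost_inp]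
      omega
  · refine tot_seq (tot_iff hFo (fun n2 => tot_skip hc0 ?_) fun n2 => by rw [hFe, hfl] at n2; omega)
    refine (tail (rep_of hg hfl m2 q2 q5) q1 q3 hmat fun t ht h6 => ?_).mono ?_
    · have := hbd t ht h6
      omega
    rintro s4 t4 ⟨g2, g3, R4, h27, hm2, A4, T4⟩
    have hvi : vtx n (n + i) = i := by simp [vtx]
    refine ⟨_, _, ⟨g3, G', R4.tab, hG', Or.inr ⟨R4.flag, ?_, fun x hx y hy => ?_, ?_, rfl, rfl⟩⟩,
      le_rfl, ?_⟩
    · refine (hL.congr h27).add (k := n + i) (by omega) (by rwa [hvi]) hr1 (by rwa [hvi])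
        (fun x y h => by have := rel_lt h; omega) hm2
    · rw [A4.mat (7, x, y) ⟨by simp, hx, hy⟩ rfl]; exact hm2 x hx y hy
    · rintro ⟨k, x, y⟩ ht h6
      simp only at h6
      subst h6
      have hb := hbd _ ht rfl
      rw [A4.reach x ht.2.1 y ht.2.2, h27 _ (by norm_num)]
      split_ifs <;> omega
    · simp only [Ex.cost_ld, Ex.cost_mul, Ex.cost_c, Ex.cost_v, Ex.cost_inp]
      omega

end SetOp

/-! ### The multiplication program as a subroutine -/

/-- All registers of the program are below `n`. -/
def Cmd.Low (n : ℕ) : Cmd → Prop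
  | .const r _ => r < n
  | .arith _ r a b => r < n ∧ a < n ∧ b < n
  | .input r a => r < n ∧ a < n
  | .load r a => r < n ∧ a < n
  | .store a b => a < n ∧ b < n
  | .seq c₁ c₂ => c₁.Low n ∧ c₂.Low n
  | .ite r c₁ c₂ => r < n ∧ c₁.Low n ∧ c₂.Low n
  | .loop r c => r < n ∧ c.Low n

theorem Cmd.Low.mono {c : Cmd} {n n' : ℕ} (h : c.Low n) (hn : n ≤ n') : c.Low n' := by
  induction c with
  | const r k => exact lt_of_lt_of_le h hn
  | arith op r a b => exact ⟨h.1.trans_le hn, h.2.1.trans_le hn, h.2.2.trans_le hn⟩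
  | input r a => exact ⟨h.1.trans_le hn, h.2.trans_le hn⟩
  | load r a => exact ⟨h.1.trans_le hn, h.2.trans_le hn⟩
  | store r a => exact ⟨h.1.trans_le hn, h.2.trans_le hn⟩
  | seq c₁ c₂ ih1 ih2 => exact ⟨ih1 h.1, ih2 h.2⟩
  | ite r c₁ c₂ ih1 ih2 => exact ⟨h.1.trans_le hn, ih1 h.2.1, ih2 h.2.2⟩
  | loop r c ih => exact ⟨h.1.trans_le hn, ih h.2⟩

theorem Cmd.exists_low (c : Cmd) : ∃ n, c.Low n := by
  induction c with
  | const r k => exact ⟨r + 1, Nat.lt_succ_self r⟩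
  | arith op r a b => exact ⟨r + a + b + 1, by simp only [Cmd.Low]; omega⟩
  | input r a => exact ⟨r + a + 1, by simp only [Cmd.Low]; omega⟩
  | load r a => exact ⟨r + a + 1, by simp only [Cmd.Low]; omega⟩
  | store r a => exact ⟨r + a + 1, by simp only [Cmd.Low]; omega⟩
  | seq c₁ c₂ ih1 ih2 =>
    obtain ⟨n1, h1⟩ := ih1
    obtain ⟨n2, h2⟩ := ih2
    exact ⟨n1 + n2, h1.mono (by omega), h2.mono (by omega)⟩
  | ite r c₁ c₂ ih1 ih2 =>
    obtain ⟨n1, h1⟩ := ih1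
    obtain ⟨n2, h2⟩ := ih2
    exact ⟨n1 + n2 + r + 1, by omega, h1.mono (by omega), h2.mono (by omega)⟩
  | loop r c ih =>
    obtain ⟨n1, h1⟩ := ih
    exact ⟨n1 + r + 1, by omega, h1.mono (by omega)⟩

/-- Translation of a program: its registers are moved to `200, 201, …`, its memory to the address in
register `111`, and its arguments are found in the memory at the address in register `112`, their
number in register `113`. -/
def Cmd.tr : Cmd → Cmd
  | .const r k => .const (200 + r) k
  | .arith op r a b => .arith op (200 + r) (200 + a) (200 + b)
  | .input r a => .arith .sub 110 113 (200 + a) ;;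
      .ite 110 (.arith .add 110 112 (200 + a) ;; .load (200 + r) 110) (.const (200 + r) 0)
  | .load r a => .arith .add 110 111 (200 + a) ;; .load (200 + r) 110
  | .store a b => .arith .add 110 111 (200 + a) ;; .store 110 (200 + b)
  | .seq c₁ c₂ => .seq c₁.tr c₂.tr
  | .ite r c₁ c₂ => .ite (200 + r) c₁.tr c₂.tr
  | .loop r c => .loop (200 + r) c.tr

/-- The state `σ` simulates the state `s` of the translated program. -/
structure Sim (k S₀ A B len : ℕ) (inp₀ ρ μ : ℕ → ℕ) (σ s : State) : Prop where
  reg : ∀ r < k, σ.reg (200 + r) = s.reg r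
  memBase : σ.reg 111 = B
  argBase : σ.reg 112 = A
  argLen : σ.reg 113 = len
  mem : ∀ a < S₀, σ.mem (B + a) = s.mem a
  arg : ∀ a < len, σ.mem (A + a) = inp₀ a
  low : ∀ r < 100, σ.reg r = ρ r
  rest : ∀ a, (a < B ∨ B + S₀ ≤ a) → σ.mem a = μ a

section Simulation
variable {k S₀ A B len : ℕ} {inp₀ ρ μ : ℕ → ℕ} {σ s : State}

theorem Sim.setReg (h : Sim k S₀ A B len inp₀ ρ μ σ s) (r v : ℕ) :
    Sim k S₀ A B len inp₀ ρ μ (σ.setReg (200 + r) v) (s.setReg r v) := by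
  refine ⟨fun r' hr' => ?_, ?_, ?_, ?_, h.mem, h.arg, fun r' hr' => ?_, h.rest⟩
  · simp [h.reg r' hr']
  · simp [h.memBase, show (111 : ℕ) ≠ 200 + r by omega]
  · simp [h.argBase, show (112 : ℕ) ≠ 200 + r by omega]
  · simp [h.argLen, show (113 : ℕ) ≠ 200 + r by omega]
  · simp [h.low r' hr', show r' ≠ 200 + r by omega]

theorem Sim.scratch (h : Sim k S₀ A B len inp₀ ρ μ σ s) (v : ℕ) :
    Sim k S₀ A B len inp₀ ρ μ (σ.setReg 110 v) s := by
  refine ⟨fun r' hr' => ?_, ?_, ?_, ?_, h.mem, h.arg, fun r' hr' => ?_, h.rest⟩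
  · simp [h.reg r' hr', show 200 + r' ≠ 110 by omega]
  · simp [h.memBase]
  · simp [h.argBase]
  · simp [h.argLen]
  · simp [h.low r' hr', show r' ≠ 110 by omega]

theorem Sim.setMem (h : Sim k S₀ A B len inp₀ ρ μ σ s) (hAB : A + len ≤ B) {a : ℕ} (ha : a < S₀)
    (v : ℕ) : Sim k S₀ A B len inp₀ ρ μ (σ.setMem (B + a) v) (s.setMem a v) := by
  refine ⟨h.reg, h.memBase, h.argBase, h.argLen, fun a' ha' => ?_, fun a' ha' => ?_, h.low,
    fun a' ha' => ?_⟩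
  · simp [h.mem a' ha']
  · rw [State.setMem_mem, if_neg (by omega), h.arg a' ha']
  · rw [State.setMem_mem, if_neg (by omega), h.rest a' ha']

/-- An instruction of the program becomes at most four instructions of its translation. -/
theorem Sim.exec {W₀ W S : ℕ} {inp : ℕ → ℕ} (hW : W₀ ≤ W) (hS : B + S₀ ≤ S) (hSW : S ≤ W)
    (hW0 : 0 < W) (hAB : A + len ≤ B) (hinp : ∀ a, len ≤ a → inp₀ a = 0) (hlen : len < W)
    {c : Cmd} {s' : State} {t : ℕ} (he : Exec W₀ S₀ inp₀ c s s' t) (hc : c.Low k)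
    (h : Sim k S₀ A B len inp₀ ρ μ σ s) :
    ∃ σ' t', Exec W S inp c.tr σ σ' t' ∧ Sim k S₀ A B len inp₀ ρ μ σ' s' ∧ t' ≤ 4 * t := by
  induction he generalizing σ with
  | const hk => exact ⟨_, _, .const (hk.trans_le hW), h.setReg _ _, by omega⟩
  | @arith op r a b s hk =>
    obtain ⟨hr, ha, hb⟩ := hc
    have e : op.eval (σ.reg (200 + a)) (σ.reg (200 + b)) = op.eval (s.reg a) (s.reg b) := by
      rw [h.reg a ha, h.reg b hb]
    refine ⟨_, _, .arith (by rw [e]; exact hk.trans_le hW), ?_, by omega⟩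
    rw [e]
    exact h.setReg _ _
  | @input r a s hk =>
    obtain ⟨hr, ha⟩ := hc
    have h1 := h.scratch (len - s.reg a)
    have x1 : Exec W S inp (.arith .sub 110 113 (200 + a)) σ (σ.setReg 110 (len - s.reg a)) 1 := by
      have := Exec.arith (W := W) (S := S) (inp := inp) (op := .sub) (r := 110) (a := 113)
        (b := 200 + a) (s := σ) (by simp only [ArithOp.eval, h.argLen]; omega)
      simpa only [ArithOp.eval, h.argLen, h.reg a ha] using this
    by_cases hl : s.reg a < len
    · have h2 := h1.scratch (A + s.reg a)
      have x2 : Exec W S inp (.arith .add 110 112 (200 + a)) (σ.setReg 110 (len - s.reg a))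
          ((σ.setReg 110 (len - s.reg a)).setReg 110 (A + s.reg a)) 1 := by
        have := Exec.arith (W := W) (S := S) (inp := inp) (op := .add) (r := 110) (a := 112)
          (b := 200 + a) (s := σ.setReg 110 (len - s.reg a))
          (by simp only [ArithOp.eval, h1.argBase, h1.reg a ha]; omega)
        simpa only [ArithOp.eval, h1.argBase, h1.reg a ha] using this
      refine ⟨_, _, .seq x1 (.iteTrue (by simp; omega) (.seq x2 (.load ?_))), ?_, ?_⟩
      · simp; omega
      · have e : ((σ.setReg 110 (len - s.reg a)).setReg 110 (A + s.reg a)).mem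
            (((σ.setReg 110 (len - s.reg a)).setReg 110 (A + s.reg a)).reg 110) = inp₀ (s.reg a) := by
          simp [h.arg _ hl]
        rw [e]
        exact h2.setReg _ _
      · omega
    · refine ⟨_, _, .seq x1 (.iteFalse (by simp; omega) (.const hW0)), ?_, ?_⟩
      · rw [hinp _ (by omega)]
        exact h1.setReg _ _
      · omega
  | @load r a s hk =>
    obtain ⟨hr, ha⟩ := hc
    have h1 := h.scratch (B + s.reg a)
    have x1 : Exec W S inp (.arith .add 110 111 (200 + a)) σ (σ.setReg 110 (B + s.reg a)) 1 := by
      have := Exec.arith (W := W) (S := S) (inp := inp) (op := .add) (r := 110) (a := 111)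
        (b := 200 + a) (s := σ) (by simp only [ArithOp.eval, h.memBase, h.reg a ha]; omega)
      simpa only [ArithOp.eval, h.memBase, h.reg a ha] using this
    refine ⟨_, _, .seq x1 (.load ?_), ?_, by omega⟩
    · simp; omega
    · have e : (σ.setReg 110 (B + s.reg a)).mem ((σ.setReg 110 (B + s.reg a)).reg 110) =
          s.mem (s.reg a) := by simp [h.mem _ hk]
      rw [e]
      exact h1.setReg _ _
  | @store a b s hk =>
    obtain ⟨ha, hb⟩ := hc
    have h1 := h.scratch (B + s.reg a)
    have x1 : Exec W S inp (.arith .add 110 111 (200 + a)) σ (σ.setReg 110 (B + s.reg a)) 1 := by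
      have := Exec.arith (W := W) (S := S) (inp := inp) (op := .add) (r := 110) (a := 111)
        (b := 200 + a) (s := σ) (by simp only [ArithOp.eval, h.memBase, h.reg a ha]; omega)
      simpa only [ArithOp.eval, h.memBase, h.reg a ha] using this
    refine ⟨_, _, .seq x1 (.store ?_), ?_, by omega⟩
    · simp; omega
    · have e1 : (σ.setReg 110 (B + s.reg a)).reg 110 = B + s.reg a := by simp
      rw [e1, h1.reg b hb]
      exact h1.setMem hAB hk _
  | seq _ _ ih1 ih2 =>
    obtain ⟨σ1, t1, x1, h1, l1⟩ := ih1 hc.1 h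
    obtain ⟨σ2, t2, x2, h2, l2⟩ := ih2 hc.2 h1
    exact ⟨σ2, _, .seq x1 x2, h2, by omega⟩
  | iteTrue hr _ ih =>
    obtain ⟨σ1, t1, x1, h1, l1⟩ := ih hc.2.1 h
    exact ⟨σ1, _, .iteTrue (by rwa [h.reg _ hc.1]) x1, h1, by omega⟩
  | iteFalse hr _ ih =>
    obtain ⟨σ1, t1, x1, h1, l1⟩ := ih hc.2.2 h
    exact ⟨σ1, _, .iteFalse (by rwa [h.reg _ hc.1]) x1, h1, by omega⟩
  | loopDone hr => exact ⟨σ, _, .loopDone (by rwa [h.reg _ hc.1]), h, by omega⟩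
  | loopStep hr _ _ ih1 ih2 =>
    obtain ⟨σ1, t1, x1, h1, l1⟩ := ih1 hc.2 h
    obtain ⟨σ2, t2, x2, h2, l2⟩ := ih2 hc h1
    exact ⟨σ2, _, .loopStep (by rwa [h.reg _ hc.1]) x1 x2, h2, by omega⟩

end Simulation

/-! ### The exponent is at least two -/

/-- A program that runs for `t` steps changes at most `t` cells. -/
theorem Exec.changed {W S inp c s s' t} (h : Exec W S inp c s s' t) :
    ∃ F : Finset ℕ, F.card ≤ t ∧ ∀ a ∉ F, s'.mem a = s.mem a := by
  induction h with
  | store _ =>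
    rename_i a b s _
    exact ⟨{s.reg a}, by simp, fun x hx => by
      rw [State.setMem_mem, if_neg (by simpa using hx)]⟩
  | seq _ _ ih1 ih2 =>
    obtain ⟨F1, c1, h1⟩ := ih1
    obtain ⟨F2, c2, h2⟩ := ih2
    refine ⟨F1 ∪ F2, (Finset.card_union_le _ _).trans (by omega), fun a ha => ?_⟩
    rw [Finset.mem_union, not_or] at ha
    rw [h2 a ha.2, h1 a ha.1]
  | iteTrue _ _ ih => obtain ⟨F, c, h⟩ := ih; exact ⟨F, by omega, h⟩
  | iteFalse _ _ ih => obtain ⟨F, c, h⟩ := ih; exact ⟨F, by omega, h⟩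
  | loopStep _ _ _ ih1 ih2 =>
    obtain ⟨F1, c1, h1⟩ := ih1
    obtain ⟨F2, c2, h2⟩ := ih2
    refine ⟨F1 ∪ F2, (Finset.card_union_le _ _).trans (by omega), fun a ha => ?_⟩
    rw [Finset.mem_union, not_or] at ha
    rw [h2 a ha.2, h1 a ha.1]
  | _ => exact ⟨∅, by simp, fun a _ => rfl⟩

/-- The product of two all-ones matrices has `n²` nonzero entries, all of which must be written. -/
theorem two_le_of_exponent {ω : ℝ} (h : MatMulExponent ω) : 2 ≤ ω := by
  obtain ⟨c, C, d, h⟩ := h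
  by_contra hω
  push Not at hω
  have key : ∀ n : ℕ, 1 ≤ n → (n : ℝ) ^ (2 - ω) ≤ C := by
    intro n hn
    obtain ⟨s, t, he, ht, hm⟩ := h n hn (fun _ _ => true) (fun _ _ => true)
    obtain ⟨F, hF, hF'⟩ := he.changed
    have hsub : Finset.range (n * n) ⊆ F := by
      intro a ha
      rw [Finset.mem_range] at ha
      by_contra hn'
      have e := hF' a hn'
      have := hm ⟨a / n, Nat.div_lt_of_lt_mul ha⟩ ⟨a % n, Nat.mod_lt _ (by omega)⟩
      simp only [Nat.div_add_mod', e] at this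
      simp [State.zero] at this
      omega
    have h1 : n * n ≤ t := by
      have := Finset.card_le_card hsub
      rw [Finset.card_range] at this
      omega
    have hn0 : (0 : ℝ) < n := by exact_mod_cast hn
    have h2 : (n : ℝ) ^ (2 : ℝ) ≤ C * (n : ℝ) ^ ω := by
      refine le_trans ?_ ht
      rw [Real.rpow_two, pow_two]
      exact_mod_cast h1
    rw [Real.rpow_sub hn0, div_le_iff₀ (Real.rpow_pos_of_pos hn0 ω)]
    exact h2
  have ht := tendsto_rpow_atTop (show 0 < 2 - ω by linarith)
  have ht' := ht.comp tendsto_natCast_atTop_atTop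
  obtain ⟨n, hn1, hn2⟩ := ((ht'.eventually_gt_atTop (C : ℝ)).and
    (Filter.eventually_ge_atTop 1)).exists
  exact absurd (key n hn2) (not_le.2 hn1)

/-! ### Multiplication of blocks -/

/-- `c`, with registers below `k`, multiplies `h × h` matrices in at most `β h` steps. -/
structure Multiplies (c : Cmd) (k C d : ℕ) (β : ℕ → ℕ) : Prop where
  low : c.Low k
  exec : ∀ h : ℕ, 1 ≤ h → ∀ A B : BoolMat h, ∃ (s : State) (t : ℕ),
    Exec ((h + 2) ^ d) (C * h ^ 2) (arr (h :: (entries A ++ entries B))) c State.zero s t ∧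
    t ≤ β h ∧ ∀ x y : Fin h, s.mem (x * h + y) = ∑ z : Fin h, (A x z).toNat * (B z y).toNat
  pos : 1 ≤ C

theorem MatMulExponent.multiplies {ω : ℝ} (h : MatMulExponent ω) :
    ∃ c k C d, Multiplies c k C d fun h => ⌊C * (h : ℝ) ^ ω⌋₊ := by
  obtain ⟨c, C, d, h⟩ := h
  obtain ⟨k, hk⟩ := c.exists_low
  refine ⟨c, k, C, d, hk, fun m hm A B => ?_, ?_⟩
  · obtain ⟨s, t, h1, h2, h3⟩ := h m hm A B
    exact ⟨s, t, h1, Nat.le_floor h2, h3⟩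
  · by_contra hC
    obtain rfl : C = 0 := by omega
    obtain ⟨s, t, h1, h2, h3⟩ := h 1 le_rfl (fun _ _ => true) (fun _ _ => true)
    obtain ⟨F, hF, hF'⟩ := h1.changed
    have ht : t = 0 := by
      have : (t : ℝ) ≤ 0 := by simpa using h2
      exact_mod_cast le_antisymm this (Nat.cast_nonneg t)
    have hFe : F = ∅ := Finset.card_eq_zero.1 (by omega)
    have := h3 0 0
    rw [hF' _ (by simp [hFe])] at this
    simp [State.zero] at this

/-- Set the `k` registers from `200` on to zero. -/
def zeroRegs : ℕ → Cmd
  | 0 => skip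
  | k + 1 => zeroRegs k ;; .const (200 + k) 0

theorem zeroRegs_exec {W S : ℕ} {inp : ℕ → ℕ} (hW : 0 < W) (s : State) (k : ℕ) :
    ∃ s', Exec W S inp (zeroRegs k) s s' (k + 1) ∧ s'.mem = s.mem ∧
      (∀ r < k, s'.reg (200 + r) = 0) ∧ ∀ r < 200, r ≠ 100 → s'.reg r = s.reg r := by
  induction k with
  | zero => exact ⟨_, .const hW, rfl, by simp, fun r _ hr => by simp [hr]⟩
  | succ k ih =>
    obtain ⟨s', h1, h2, h3, h4⟩ := ih
    refine ⟨_, .seq h1 (.const hW), by simp [h2], fun r hr => ?_, fun r hr hr' => ?_⟩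
    · by_cases e : r = k
      · simp [e]
      · simp [e, h3 r (by omega)]
    · have : r ≠ 200 + k := by omega
      simp [this, h4 r hr hr']

/-- Call of the multiplication program on matrices whose size is in register `31`. -/
def callC (c : Cmd) (k : ℕ) : Cmd :=
  (Ex.c 20 * (.v 2 * .v 2)).comp 111 ;; (Ex.c 17 * (.v 2 * .v 2)).comp 112 ;;
    (Ex.c 1 + (.v 31 * .v 31 + .v 31 * .v 31)).comp 113 ;; zeroRegs k ;; c.tr

section Call
variable {M : Mach} {m fl n : ℕ} {g : Tab} {s : State} {c : Cmd} {k C d : ℕ} {β : ℕ → ℕ}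

/-- The called program starts from zero registers and memory, as its specification requires, and what
lies outside its memory is unchanged. -/
theorem tot_call (hM : Ctx M m) (hc : Multiplies c k C d β) (hS : (20 + C) * (m * m) ≤ M.S)
    {h : ℕ} (hh : 1 ≤ h) (hhm : h ≤ m) (hd : (h + 2) ^ d ≤ M.W) (h2 : s.reg 2 = m)
    (h31 : s.reg 31 = h) (A B : BoolMat h)
    (harg : ∀ a < 1 + (h * h + h * h), s.mem (17 * (m * m) + a) =
      arr (h :: (entries A ++ entries B)) a)
    (hz : ∀ a < C * h ^ 2, s.mem (20 * (m * m) + a) = 0) :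
    Tot M (callC c k) s fun s' τ => s'.reg = s.reg ∧
      (∀ a < 20 * (m * m), s'.mem a = s.mem a) ∧
      (∀ x y : Fin h, s'.mem (20 * (m * m) + (x * h + y)) =
        ∑ z : Fin h, (A x z).toNat * (B z y).toNat) ∧ τ ≤ 4 * β h + k + 40 := by
  have hm := hM.pos
  have hW := hM.le_W
  have hhh : h * h ≤ m * m := Nat.mul_le_mul hhm hhm
  have hmm : m ≤ m * m := Nat.le_mul_self m
  have hCm : C * h ^ 2 ≤ C * (m * m) := by rw [pow_two]; exact Nat.mul_le_mul_left _ hhh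
  have hCh : h * h ≤ C * h ^ 2 := by
    rw [pow_two]; exact Nat.le_mul_of_pos_left _ hc.pos
  rw [Nat.add_mul] at hS
  have h1m : 1 ≤ m * m := Nat.mul_pos (by omega) (by omega)
  intro s1 hw ha
  obtain ⟨s2, x2, v2, m2, f2⟩ := Ex.comp_exec (M := M) (s := s) (Ex.c 20 * (.v 2 * .v 2)) (s1 := s1)
    (t := 111) hw ha (by simp [h2]; omega) (by norm_num)
  have a2 : Agree s2 s := ⟨m2.trans ha.1, fun r hr => (f2 r (by omega)).trans (ha.2 r hr)⟩
  obtain ⟨s3, x3, v3, m3, f3⟩ := Ex.comp_exec (M := M) (s := s) (Ex.c 17 * (.v 2 * .v 2)) (s1 := s2)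
    (t := 112) (x2.wf hw) a2 (by simp [h2]; omega) (by norm_num)
  have a3 : Agree s3 s := ⟨m3.trans a2.1, fun r hr => (f3 r (by omega)).trans (a2.2 r hr)⟩
  obtain ⟨s4, x4, v4, m4, f4⟩ := Ex.comp_exec (M := M) (s := s)
    (Ex.c 1 + (.v 31 * .v 31 + .v 31 * .v 31)) (s1 := s3)
    (t := 113) (x3.wf (x2.wf hw)) a3 (by simp [h31]; omega) (by norm_num)
  have a4 : Agree s4 s := ⟨m4.trans a3.1, fun r hr => (f4 r (by omega)).trans (a3.2 r hr)⟩
  obtain ⟨s5, x5, m5, z5, f5⟩ := zeroRegs_exec (W := M.W) (S := M.S) (inp := M.inp) (by omega) s4 k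
  have a5 : s5.mem = s.mem := m5.trans a4.1
  obtain ⟨r, t, hx, ht, hr⟩ := hc.exec h hh A B
  have hsim : Sim k (C * h ^ 2) (17 * (m * m)) (20 * (m * m)) (1 + (h * h + h * h))
      (arr (h :: (entries A ++ entries B))) s.reg s.mem s5 State.zero := by
    refine ⟨fun r hr => by simpa [State.zero] using z5 r hr, ?_, ?_, ?_, fun a ha => ?_, fun a ha => ?_,
      fun r hr => ?_, fun a _ => by rw [a5]⟩
    · rw [f5 111 (by norm_num) (by norm_num), f4 111 (by norm_num), f3 111 (by norm_num), v2]
      simp [h2]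
    · rw [f5 112 (by norm_num) (by norm_num), f4 112 (by norm_num), v3]
      simp [h2]
    · rw [f5 113 (by norm_num) (by norm_num), v4]
      simp [h31]
    · rw [a5, hz a ha]; simp [State.zero]
    · rw [a5, harg a ha]
    · rw [f5 r (by omega) (by omega), a4.2 r hr]
  have hl : (entries A ++ entries B).length = h * h + h * h := by simp [entries]
  have hz' : ∀ a, 1 + (h * h + h * h) ≤ a → arr (h :: (entries A ++ entries B)) a = 0 := by
    intro a ha
    rw [arr, List.getD_eq_default]
    simp only [List.length_cons, hl]
    omega
  obtain ⟨σ, t', hσ, hs', ht'⟩ := Sim.exec (W := M.W) (S := M.S) (inp := M.inp) hd (by omega) (by omega)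
    (by omega) (by omega) hz' (by omega) hx hc.low hsim
  refine ⟨σ, _, .seq x2 (.seq x3 (.seq x4 (.seq x5 hσ))), ⟨s.reg, σ.mem⟩,
    7 + (7 + (13 + (k + 1 + t'))), ⟨rfl, fun r hr => hs'.low r hr⟩, ?_, rfl, fun a ha => ?_,
    fun x y => ?_, by omega⟩
  · simp
  · exact hs'.rest a (Or.inl ha)
  · have hlt : (x : ℕ) * h + y < h * h := by
      have := Nat.mul_le_mul_right h (show (x : ℕ) + 1 ≤ h from x.2)
      rw [Nat.add_mul] at this
      have := y.2
      omega
    simp only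
    rw [hs'.mem _ (by omega), hr x y]

end Call

/-- Some `z` in the block `b, …, b + h - 1` of indices connects `x` to `y`: this is the entry `(x, y)`
of a Boolean product of blocks. -/
def Prod (b h : ℕ) (g : Tab) (x y : ℕ) : Prop := ∃ z < h, g (6, x, b + z) ≠ 0 ∧ g (6, b + z, y) ≠ 0

open Classical in
/-- The product of the blocks is added to the block with rows at `a` and columns at `d`, up to
position `p` in row-major order. -/
noncomputable def mulG (a b d h : ℕ) (g : Tab) (p : ℕ) : Tab := fun t =>
  if t.1 = 6 ∧ (a ≤ t.2.1 ∧ t.2.1 < a + h) ∧ (d ≤ t.2.2 ∧ t.2.2 < d + h) ∧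
    (t.2.1 - a) * h + (t.2.2 - d) < p ∧ Prod b h g t.2.1 t.2.2 then 1 else g t

/-- Write the size and the two blocks, as arguments of the multiplication program, into the memory.
The size is in register `31`, and the blocks of indices start at the registers `32`, `33`, `34`. -/
def argC : Cmd :=
  sto (.c 17 * (.v 2 * .v 2)) (.v 31) ;;
  forUp 35 (.v 31 * .v 31) (asg 36 (.v 35 / .v 31) ;; asg 37 (.v 35 - .v 36 * .v 31) ;;
    sto (.c 17 * (.v 2 * .v 2) + (.c 1 + .v 35)) (.ld (FA (.c 6) (.v 32 + .v 36) (.v 33 + .v 37))) ;;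
    sto (.c 17 * (.v 2 * .v 2) + (.c 1 + (.v 31 * .v 31 + .v 35)))
      (.ld (FA (.c 6) (.v 33 + .v 36) (.v 34 + .v 37))))

/-- Set the memory of the multiplication program to zero. -/
def wipeC (C : ℕ) : Cmd :=
  forUp 35 (.c C * (.v 31 * .v 31)) (sto (.c 20 * (.v 2 * .v 2) + .v 35) (.c 0))

/-- Add the result of the multiplication program to the table of kind `6`. -/
def accC : Cmd :=
  forUp 35 (.v 31 * .v 31) (asg 36 (.v 35 / .v 31) ;; asg 37 (.v 35 - .v 36 * .v 31) ;;
    iff (.ld (.c 20 * (.v 2 * .v 2) + .v 35))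
      (sto (FA (.c 6) (.v 32 + .v 36) (.v 34 + .v 37)) (.c 1)) skip)

section Mul
variable {M : Mach} {m fl n : ℕ} {g : Tab} {s : State} {c : Cmd} {k C dd : ℕ} {β : ℕ → ℕ}
  {a b d h : ℕ}

theorem Rep.setHigh (hr : Rep m g [] fl s) (hm : 0 < m) {p v : ℕ} (hp : 17 * (m * m) ≤ p) :
    Rep m g [] fl (s.setMem p v) := by
  have h4 : 0 < m * m := Nat.mul_pos hm hm
  refine ⟨hr.reg2, hr.reg5, fun t ht => ?_, by simp, ?_, hr.nodup, hr.good⟩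
  · have := enc_lt ht
    rw [State.setMem_mem, if_neg (by omega), hr.tab t ht]
  · rw [State.setMem_mem, if_neg (by omega), hr.flag]

theorem index_lt {p h : ℕ} (hp : p < h * h) : p / h < h ∧ p % h < h ∧ p - p / h * h = p % h := by
  have hh : 0 < h := Nat.pos_of_ne_zero (by rintro rfl; simp at hp)
  refine ⟨Nat.div_lt_of_lt_mul hp, Nat.mod_lt _ hh, ?_⟩
  have := Nat.div_add_mod' p h
  omega

theorem tot_arg (hM : Ctx M m) (hr : Rep m g [] fl s) (h31 : s.reg 31 = h) (h32 : s.reg 32 = a)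
    (h33 : s.reg 33 = b) (h34 : s.reg 34 = d) (ha : a + h ≤ m) (hb : b + h ≤ m) (hd : d + h ≤ m) :
    Tot M argC s fun s' τ => Rep m g [] fl s' ∧ Fr 35 s s' ∧ s'.mem (17 * (m * m)) = h ∧
      (∀ p < h * h, s'.mem (17 * (m * m) + (1 + p)) = g (6, a + p / h, b + p % h) ∧
        s'.mem (17 * (m * m) + (1 + (h * h + p))) = g (6, b + p / h, d + p % h)) ∧
      τ ≤ 120 * (h * h) + 40 := by
  have hm := hM.pos
  have hS := hM.le_S
  have hW := hM.le_W
  have hhh : h * h ≤ m * m := Nat.mul_le_mul (by omega) (by omega)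
  have hmm : m ≤ m * m := Nat.le_mul_self m
  have h1m : 2 ≤ m * m := by omega
  have hc : ∀ x, x < 20 → x < M.W := fun x hx => by omega
  have hc17 := hc 17 (by norm_num)
  have hc6 := hc 6 (by norm_num)
  have hc1 := hc 1 (by norm_num)
  have hh4 : 2 * (h * h) + 1 ≤ 3 * (m * m) := by omega
  refine tot_seq (tot_sto (by simp [hr.reg2]; omega) (by simp) (by simp [hr.reg2]; omega) ?_)
  have e0 : (Ex.c 17 * (Ex.v 2 * Ex.v 2)).eval M s = 17 * (m * m) := by simp [hr.reg2]
  rw [e0, Ex.eval_v, h31]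
  have R0 := hr.setHigh (v := h) (by omega) (le_refl (17 * (m * m)))
  refine tot_forUp (N := h * h) (fun q s' => Rep m g [] fl s' ∧ Fr 35 s s' ∧ s'.reg 35 = q ∧
    s'.mem (17 * (m * m)) = h ∧ ∀ p < q, s'.mem (17 * (m * m) + (1 + p)) = g (6, a + p / h, b + p % h) ∧
      s'.mem (17 * (m * m) + (1 + (h * h + p))) = g (6, b + p / h, d + p % h)) 100 (by norm_num)
    (by omega) ⟨R0.setReg (by norm_num) (by norm_num), ?_, by simp, by simp, by simp⟩ ?_ ?_ ?_
  · intro r hr _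
    have : r ≠ 35 := by omega
    simp [this]
  · rintro q s' hq ⟨R', F', e35, _, _⟩
    have := F' 31 (by norm_num) (by norm_num)
    refine ⟨e35, ?_, ?_⟩
    · simp [this, h31]; omega
    · simp [this, h31]
  · rintro q s' hq ⟨R', F', e35, hh0, hpr⟩
    have q31 := (F' 31 (by norm_num) (by norm_num)).trans h31
    have q32 := (F' 32 (by norm_num) (by norm_num)).trans h32
    have q33 := (F' 33 (by norm_num) (by norm_num)).trans h33
    have q34 := (F' 34 (by norm_num) (by norm_num)).trans h34
    obtain ⟨l1, l2, l3⟩ := index_lt hq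
    have l4 : q / h * h ≤ q := Nat.div_mul_le_self q h
    refine tot_seq (tot_asg (by norm_num) (by simp) (tot_seq (tot_asg (by norm_num) ?_ ?_)))
    · simp [e35, q31]; omega
    have e1 : (Ex.v 35 / Ex.v 31).eval M s' = q / h := by simp [e35, q31]
    rw [e1]
    have e2 : (Ex.v 35 - Ex.v 36 * Ex.v 31).eval M (s'.setReg 36 (q / h)) = q % h := by
      simp [e35, q31, l3]
    rw [e2]
    generalize hs2 : (s'.setReg 36 (q / h)).setReg 37 (q % h) = s2
    have R2 : Rep m g [] fl s2 := by
      subst hs2; exact (R'.setReg (by norm_num) (by norm_num)).setReg (by norm_num) (by norm_num)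
    have m2 : s2.mem = s'.mem := by subst hs2; rfl
    have f2 : ∀ r < 36, s2.reg r = s'.reg r := by
      intro r hr
      have a1 : r ≠ 36 := by omega
      have a2 : r ≠ 37 := by omega
      subst hs2; simp [a1, a2]
    have p36 : s2.reg 36 = q / h := by subst hs2; simp
    have p37 : s2.reg 37 = q % h := by subst hs2; simp
    have p31 := (f2 31 (by norm_num)).trans q31
    have p32 := (f2 32 (by norm_num)).trans q32
    have p33 := (f2 33 (by norm_num)).trans q33
    have p34 := (f2 34 (by norm_num)).trans q34
    have p35 := (f2 35 (by norm_num)).trans e35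
    clear hs2 e1 e2
    have v1 : Valid m (6, a + q / h, b + q % h) := ⟨by simp, by simp only; omega, by simp only; omega⟩
    have v2 : Valid m (6, b + q / h, d + q % h) := ⟨by simp, by simp only; omega, by simp only; omega⟩
    have E1 : (FA (.c 6) (.v 32 + .v 36) (.v 33 + .v 37)).eval M s2 =
        enc m (6, a + q / h, b + q % h) := by
      rw [FA_eval R2.reg2]; simp [p32, p36, p33, p37]
    refine tot_seq (tot_sto ?_ ⟨FA_ok hM R2.reg2 (by simp [hc6]) (by simp [p32, p36]; omega)
      (by simp [p33, p37]; omega) (by simpa [p32, p36, p33, p37] using v1), by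
        rw [E1]; exact Rep.lt_S hM v1⟩ ?_ ?_)
    · simp [R2.reg2, p35]; omega
    · simp [R2.reg2, p35]; omega
    have E2 : (Ex.c 17 * (Ex.v 2 * Ex.v 2) + (Ex.c 1 + Ex.v 35)).eval M s2 =
        17 * (m * m) + (1 + q) := by simp [R2.reg2, p35]
    rw [E2, Ex.eval_ld, E1, R2.tab _ v1]
    have R3 := R2.setHigh (v := g (6, a + q / h, b + q % h)) (by omega)
      (show 17 * (m * m) ≤ 17 * (m * m) + (1 + q) by omega)
    generalize hs3 : s2.setMem (17 * (m * m) + (1 + q)) (g (6, a + q / h, b + q % h)) = s3 at R3 ⊢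
    have f3 : ∀ r, s3.reg r = s2.reg r := by subst hs3; simp
    have E3 : (FA (.c 6) (.v 33 + .v 36) (.v 34 + .v 37)).eval M s3 =
        enc m (6, b + q / h, d + q % h) := by
      rw [FA_eval R3.reg2]; simp [f3, p33, p36, p34, p37]
    refine tot_sto ?_ ⟨FA_ok hM R3.reg2 (by simp [hc6]) (by simp [f3, p33, p36]; omega)
      (by simp [f3, p34, p37]; omega) (by simpa [f3, p34, p36, p33, p37] using v2), by
        rw [E3]; exact Rep.lt_S hM v2⟩ ?_ ?_
    · simp [R3.reg2, f3, p35, p31]; omega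
    · simp [R3.reg2, f3, p35, p31]; omega
    have E4 : (Ex.c 17 * (Ex.v 2 * Ex.v 2) + (Ex.c 1 + (Ex.v 31 * Ex.v 31 + Ex.v 35))).eval M s3 =
        17 * (m * m) + (1 + (h * h + q)) := by simp [R3.reg2, f3, p31, p35]
    rw [E4, Ex.eval_ld, E3, R3.tab _ v2]
    have R4 := R3.setHigh (v := g (6, b + q / h, d + q % h)) (by omega)
      (show 17 * (m * m) ≤ 17 * (m * m) + (1 + (h * h + q)) by omega)
    refine ⟨by simp, by simp [f3, p35], R4.setReg (by norm_num) (by norm_num), fun r hr' h5 => ?_,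
      by simp, ?_, fun p hp => ?_⟩
    · have : r ≠ 35 := by omega
      simp [this, f3, f2 r (by omega), F' r hr' h5]
    · simp only [State.setReg_mem, State.setMem_mem]
      rw [if_neg (by omega)]
      subst hs3
      rw [State.setMem_mem, if_neg (by omega), m2, hh0]
    · simp only [State.setReg_mem, State.setMem_mem]
      subst hs3
      simp only [State.setMem_mem, m2]
      by_cases hpq : p = q
      · subst hpq
        refine ⟨?_, ?_⟩
        · rw [if_neg (by omega), if_pos rfl]
        · rw [if_pos rfl]
      · obtain ⟨w1, w2⟩ := hpr p (by omega)
        refine ⟨?_, ?_⟩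
        · rw [if_neg (by omega), if_neg (by omega), w1]
        · rw [if_neg (by omega), if_neg (by omega), w2]
  · rintro s' t ⟨R', F', e35, hh0, hpr⟩ ht
    refine ⟨R', F', hh0, hpr, ?_⟩
    simp at ht ⊢
    omega

theorem tot_wipe (hM : Ctx M m) (hr : Rep m g [] fl s) (hS : (20 + C) * (m * m) ≤ M.S)
    (h31 : s.reg 31 = h) (hh : h ≤ m) :
    Tot M (wipeC C) s fun s' τ => Rep m g [] fl s' ∧ Fr 35 s s' ∧
      (∀ p < 20 * (m * m), s'.mem p = s.mem p) ∧ (∀ p < C * h ^ 2, s'.mem (20 * (m * m) + p) = 0) ∧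
      τ ≤ 40 * (C * h ^ 2) + 20 := by
  have hm := hM.pos
  have hW := hM.le_W
  have hhh : C * (h * h) ≤ C * (m * m) := Nat.mul_le_mul_left _ (Nat.mul_le_mul hh hh)
  have hhh' : h * h ≤ m * m := (Nat.mul_le_mul hh hh)
  have hCW : C ≤ C * (m * m) := Nat.le_mul_of_pos_right _ (Nat.mul_pos (by omega) (by omega))
  have hmm : m ≤ m * m := Nat.le_mul_self m
  rw [Nat.add_mul] at hS
  rw [pow_two]
  refine tot_forUp (N := C * (h * h)) (fun q s' => Rep m g [] fl s' ∧ Fr 35 s s' ∧ s'.reg 35 = q ∧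
    (∀ p < 20 * (m * m), s'.mem p = s.mem p) ∧ ∀ p < q, s'.mem (20 * (m * m) + p) = 0) 15
    (by norm_num) (by omega) ⟨hr.setReg (by norm_num) (by norm_num), ?_, by simp, by simp, by simp⟩
    ?_ ?_ ?_
  · intro r hr _
    have : r ≠ 35 := by omega
    simp [this]
  · rintro q s' hq ⟨R', F', e35, _, _⟩
    have := F' 31 (by norm_num) (by norm_num)
    refine ⟨e35, ?_, ?_⟩
    · simp [this, h31]; omega
    · simp [this, h31]
  · rintro q s' hq ⟨R', F', e35, hlo, hz⟩
    have e2 : (Ex.c 20 * (Ex.v 2 * Ex.v 2) + Ex.v 35).eval M s' = 20 * (m * m) + q := by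
      simp [R'.reg2, e35]
    refine tot_sto ?_ (by simp; omega) (by rw [e2]; omega) ?_
    · simp [R'.reg2, e35]; omega
    rw [e2, Ex.eval_c]
    refine ⟨by simp, by simp [e35], (R'.setHigh (by omega) (by omega)).setReg (by norm_num)
      (by norm_num), fun r hr h5 => ?_, by simp, fun p hp => ?_, fun p hp => ?_⟩
    · have : r ≠ 35 := by omega
      simp [this, F' r hr h5]
    · rw [State.setReg_mem, State.setMem_mem, if_neg (by omega), hlo p hp]
    · rw [State.setReg_mem, State.setMem_mem]
      split_ifs with h1
      · rfl
      · exact hz p (by omega)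
  · rintro s' t ⟨R', F', e35, hlo, hz⟩ ht
    refine ⟨R', F', hlo, hz, ?_⟩
    simp at ht ⊢
    omega

open Classical in
theorem tot_acc (hM : Ctx M m) (hr : Rep m g [] fl s) (h31 : s.reg 31 = h) (h32 : s.reg 32 = a)
    (h34 : s.reg 34 = d) (ha : a + h ≤ m) (hd : d + h ≤ m) (hS : (20 + 1) * (m * m) ≤ M.S)
    (hres : ∀ p < h * h, s.mem (20 * (m * m) + p) ≠ 0 ↔ Prod b h g (a + p / h) (d + p % h)) :
    Tot M accC s fun s' τ => Rep m (mulG a b d h g (h * h)) [] fl s' ∧ Fr 35 s s' ∧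
      τ ≤ 80 * (h * h) + 20 := by
  have hm := hM.pos
  have hW := hM.le_W
  have hhh : h * h ≤ m * m := Nat.mul_le_mul (by omega) (by omega)
  have hmm : m ≤ m * m := Nat.le_mul_self m
  refine tot_forUp (N := h * h) (fun q s' => Rep m (mulG a b d h g q) [] fl s' ∧ Fr 35 s s' ∧
    s'.reg 35 = q ∧ ∀ p < h * h, s'.mem (20 * (m * m) + p) = s.mem (20 * (m * m) + p)) 60
    (by norm_num) (by omega) ⟨?_, ?_, by simp, by simp⟩ ?_ ?_ ?_
  · exact (hr.setReg (by norm_num) (by norm_num)).congr fun t _ => by simp [mulG]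
  · intro r hr _
    have : r ≠ 35 := by omega
    simp [this]
  · rintro q s' hq ⟨R', F', e35, _⟩
    have := F' 31 (by norm_num) (by norm_num)
    refine ⟨e35, ?_, ?_⟩
    · simp [this, h31]; omega
    · simp [this, h31]
  · rintro q s' hq ⟨R', F', e35, hk⟩
    have q31 := (F' 31 (by norm_num) (by norm_num)).trans h31
    have q32 := (F' 32 (by norm_num) (by norm_num)).trans h32
    have q34 := (F' 34 (by norm_num) (by norm_num)).trans h34
    obtain ⟨l1, l2, l3⟩ := index_lt hq
    have l4 : q / h * h ≤ q := Nat.div_mul_le_self q h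
    refine tot_seq (tot_asg (by norm_num) (by simp) (tot_seq (tot_asg (by norm_num) ?_ ?_)))
    · simp [e35, q31]; omega
    have e1 : (Ex.v 35 / Ex.v 31).eval M s' = q / h := by simp [e35, q31]
    rw [e1]
    have e2 : (Ex.v 35 - Ex.v 36 * Ex.v 31).eval M (s'.setReg 36 (q / h)) = q % h := by
      simp [e35, q31, l3]
    rw [e2]
    generalize hs2 : (s'.setReg 36 (q / h)).setReg 37 (q % h) = s2
    have R2 : Rep m (mulG a b d h g q) [] fl s2 := by
      subst hs2; exact (R'.setReg (by norm_num) (by norm_num)).setReg (by norm_num) (by norm_num)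
    have m2 : s2.mem = s'.mem := by subst hs2; rfl
    have f2 : ∀ r < 36, s2.reg r = s'.reg r := by
      intro r hr
      have a1 : r ≠ 36 := by omega
      have a2 : r ≠ 37 := by omega
      subst hs2; simp [a1, a2]
    have p36 : s2.reg 36 = q / h := by subst hs2; simp
    have p37 : s2.reg 37 = q % h := by subst hs2; simp
    have p32 := (f2 32 (by norm_num)).trans q32
    have p34 := (f2 34 (by norm_num)).trans q34
    have p35 := (f2 35 (by norm_num)).trans e35
    clear hs2 e1 e2
    have v1 : Valid m (6, a + q / h, d + q % h) := ⟨by simp, by simp only; omega, by simp only; omega⟩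
    have E1 : (FA (.c 6) (.v 32 + .v 36) (.v 34 + .v 37)).eval M s2 =
        enc m (6, a + q / h, d + q % h) := by
      rw [FA_eval R2.reg2]; simp [p32, p36, p34, p37]
    have E2 : (Ex.ld (.c 20 * (.v 2 * .v 2) + .v 35)).eval M s2 = s.mem (20 * (m * m) + q) := by
      rw [Ex.eval_ld, m2]
      simp only [Ex.eval_add, Ex.eval_mul, Ex.eval_c, Ex.eval_v, R2.reg2, p35]
      exact hk q hq
    have hq' : q / h * h + q % h = q := Nat.div_add_mod' q h
    -- the position `q` is reached by one entry only
    have uniq : ∀ x y, (a ≤ x ∧ x < a + h) → (d ≤ y ∧ y < d + h) →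
        (x - a) * h + (y - d) = q → x = a + q / h ∧ y = d + q % h := by
      intro x y hx hy he
      have hh : 0 < h := by omega
      have e1 : q / h = x - a := by
        rw [← he, Nat.add_div_of_dvd_right (Dvd.intro_left _ rfl), Nat.mul_div_cancel _ hh,
          Nat.div_eq_of_lt (by omega), add_zero]
      have e2 : q % h = y - d := by
        rw [← he, Nat.add_comm, Nat.add_mul_mod_self_right, Nat.mod_eq_of_lt (by omega)]
      omega
    have step : ∀ t : Trip, Prod b h g (a + q / h) (d + q % h) →
        Function.update (mulG a b d h g q) (6, a + q / h, d + q % h) 1 t = mulG a b d h g (q + 1) t := by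
      rintro ⟨i, x, y⟩ hP
      by_cases ht : (i, x, y) = ((6, a + q / h, d + q % h) : Trip)
      · rw [ht]
        rw [Function.update_self]
        unfold mulG
        refine (if_pos ⟨rfl, ⟨by simp, by simp; omega⟩, ⟨by simp, by simp; omega⟩, ?_, hP⟩).symm
        simp only
        rw [Nat.add_sub_cancel_left, Nat.add_sub_cancel_left]
        omega
      · rw [Function.update_of_ne ht]
        simp only [mulG]
        refine if_congr (and_congr_right fun hi => and_congr_right fun hx => and_congr_right fun hy =>
          and_congr_left fun _ => ?_) rfl rfl
        have : (x - a) * h + (y - d) ≠ q := fun he => ht (by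
          obtain ⟨u1, u2⟩ := uniq x y hx hy he
          rw [hi, u1, u2])
        omega
    have step0 : ∀ t : Trip, ¬ Prod b h g (a + q / h) (d + q % h) →
        mulG a b d h g q t = mulG a b d h g (q + 1) t := by
      rintro ⟨i, x, y⟩ hP
      simp only [mulG]
      refine if_congr (and_congr_right fun hi => and_congr_right fun hx => and_congr_right fun hy => ?_)
        rfl rfl
      constructor
      · exact fun hh => ⟨by omega, hh.2⟩
      · rintro ⟨h1, h2⟩
        refine ⟨?_, h2⟩
        have : (x - a) * h + (y - d) ≠ q := fun he => hP (by
          obtain ⟨u1, u2⟩ := uniq x y hx hy he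
          rwa [← u1, ← u2])
        omega
    refine tot_iff ?_ (fun n1 => (tot_sto (FA_ok hM R2.reg2 (by simp; omega)
      (by simp [p32, p36]; omega) (by simp [p34, p37]; omega) (by simpa [p32, p36, p34, p37] using v1))
      (by simp; omega) (by rw [E1]; exact Rep.lt_S hM v1) ?_)) fun n1 => tot_skip (by omega) ?_
    · simp [R2.reg2, p35]; omega
    · rw [E2] at n1
      have hP := (hres q hq).1 n1
      rw [E1, Ex.eval_c]
      have R3 := R2.set (v := 1) (by omega) v1 (by simp)
      refine ⟨by simp, by simp [p35], (R3.congr fun t _ => step t hP).setReg (by norm_num)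
        (by norm_num), fun r hr h5 => ?_, by simp, fun p hp => ?_⟩
      · have : r ≠ 35 := by omega
        simp [this, f2 r (by omega), F' r hr h5]
      · have := enc_lt v1
        rw [State.setReg_mem, State.setMem_mem, if_neg (by omega), m2, hk p hp]
    · rw [E2] at n1
      have hP : ¬ Prod b h g (a + q / h) (d + q % h) := fun hP => (hres q hq).2 hP n1
      refine ⟨by simp, by simp [p35], (R2.congr fun t _ => step0 t hP).setReg (by norm_num)
        (by norm_num), fun r hr h5 => ?_, by simp, fun p hp => ?_⟩
      · have : r ≠ 35 := by omega
        simp [this, f2 r (by omega), F' r hr h5]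
      · rw [State.setReg_mem, m2, hk p hp]
  · rintro s' t ⟨R', F', e35, hk⟩ ht
    refine ⟨R', F', ?_⟩
    simp at ht ⊢
    omega

end Mul

/-! ### Accumulation of a product of blocks -/

section Mul
variable {M : Mach} {m fl n : ℕ} {g : Tab} {s : State} {c : Cmd} {k C dd : ℕ} {β : ℕ → ℕ}
  {a b d h : ℕ}

theorem arr_pair (x : ℕ) (l₁ l₂ : List ℕ) {p : ℕ} (hp : p < l₁.length) :
    arr (x :: (l₁ ++ l₂)) (1 + p) = arr l₁ p ∧
      arr (x :: (l₁ ++ l₂)) (1 + (l₁.length + p)) = arr l₂ p := by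
  rw [Nat.add_comm 1 p, Nat.add_comm 1, arr_cons_succ, arr_cons_succ, arr, arr, arr, arr]
  refine ⟨List.getD_append _ _ _ _ hp, ?_⟩
  rw [List.getD_append_right _ _ _ _ (by omega), Nat.add_sub_cancel_left]

/-- Addition of the product of the blocks `a × b` and `b × d` to the block `a × d`. -/
def mulC (c : Cmd) (k C : ℕ) : Cmd := argC ;; wipeC C ;; callC c k ;; accC

theorem tot_mulAcc (hM : Ctx M m) (hc : Multiplies c k C dd β) (hS : (20 + C) * (m * m) ≤ M.S)
    (hr : Rep m g [] fl s) (hg : ∀ x < m, ∀ y < m, g (6, x, y) ≤ 1) (hh : 1 ≤ h)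
    (hdd : (h + 2) ^ dd ≤ M.W) (h31 : s.reg 31 = h)
    (h32 : s.reg 32 = a) (h33 : s.reg 33 = b) (h34 : s.reg 34 = d) (ha : a + h ≤ m)
    (hb : b + h ≤ m) (hd : d + h ≤ m) :
    Tot M (mulC c k C) s fun s' τ => Rep m (mulG a b d h g (h * h)) [] fl s' ∧ Fr 35 s s' ∧
      τ ≤ 4 * β h + (k + 40 * C + 400) * (h * h) := by
  have hm := hM.pos
  have hhh : h * h ≤ m * m := Nat.mul_le_mul (by omega) (by omega)
  have hmm : m ≤ m * m := Nat.le_mul_self m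
  have h1 : 1 ≤ h * h := Nat.mul_pos hh hh
  refine tot_seq ((tot_arg hM hr h31 h32 h33 h34 ha hb hd).mono ?_)
  rintro s1 τ1 ⟨R1, F1, z1, p1, t1⟩
  have q31 := (F1 31 (by norm_num) (by norm_num)).trans h31
  refine tot_seq ((tot_wipe (C := C) hM R1 hS q31 (by omega)).mono ?_)
  rintro s2 τ2 ⟨R2, F2, k2, z2, t2⟩
  have r31 := (F2 31 (by norm_num) (by norm_num)).trans q31
  let A : BoolMat h := fun x y => decide (g (6, a + x, b + y) ≠ 0)
  let B : BoolMat h := fun x y => decide (g (6, b + x, d + y) ≠ 0)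
  have bit : ∀ x < m, ∀ y < m, (decide (g (6, x, y) ≠ 0)).toNat = g (6, x, y) := by
    intro x hx y hy
    have := hg x hx y hy
    interval_cases g (6, x, y) <;> rfl
  have lA : (entries A).length = h * h := by simp [entries]
  refine tot_seq ((tot_call (h := h) hM hc hS hh (by omega) hdd R2.reg2 r31 A B ?_ z2).mono ?_)
  · intro p hp
    rw [k2 _ (by omega)]
    rcases Nat.eq_zero_or_pos p with rfl | hp0
    · rw [arr_cons_zero, Nat.add_zero, z1]
    · obtain ⟨p, rfl⟩ : ∃ p', p = 1 + p' := ⟨p - 1, by omega⟩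
      by_cases hph : p < h * h
      · obtain ⟨l1, l2, -⟩ := index_lt hph
        rw [(p1 p hph).1, (arr_pair _ _ _ (by omega)).1]
        conv_rhs => rw [← Nat.div_add_mod' p h]
        rw [arr_entries A l1 l2]
        exact (bit _ (by omega) _ (by omega)).symm
      · obtain ⟨p, rfl⟩ : ∃ p', p = h * h + p' := ⟨p - h * h, by omega⟩
        have hph : p < h * h := by omega
        obtain ⟨l1, l2, -⟩ := index_lt hph
        have e := (arr_pair h (entries A) (entries B) (p := p) (by omega)).2
        rw [lA] at e
        rw [(p1 p hph).2, e]
        conv_rhs => rw [← Nat.div_add_mod' p h]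
        rw [arr_entries B l1 l2]
        exact (bit _ (by omega) _ (by omega)).symm
  rintro s3 τ3 ⟨rg3, k3, v3, t3⟩
  have R3 : Rep m g [] fl s3 := by
    refine ⟨by rw [rg3]; exact R2.reg2, by rw [rg3]; exact R2.reg5, fun t ht => ?_, by simp, ?_,
      R2.nodup, R2.good⟩
    · have := enc_lt ht
      rw [k3 _ (by omega), R2.tab t ht]
    · rw [k3 _ (by omega), R2.flag]
  have F : ∀ r < 35, r ≠ 5 → s3.reg r = s.reg r := fun r hr h5 => by
    rw [rg3, F2 r hr h5, F1 r hr h5]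
  have hCS : (20 + 1) * (m * m) ≤ M.S := (Nat.mul_le_mul_right _ (by have := hc.pos; omega)).trans hS
  refine (tot_acc (b := b) (h := h) hM R3 ((F 31 (by norm_num) (by norm_num)).trans h31)
    ((F 32 (by norm_num) (by norm_num)).trans h32) ((F 34 (by norm_num) (by norm_num)).trans h34) ha hd
    hCS ?_).mono ?_
  · intro p hp
    obtain ⟨l1, l2, -⟩ := index_lt hp
    have e := v3 ⟨p / h, l1⟩ ⟨p % h, l2⟩
    simp only [Nat.div_add_mod'] at e
    rw [e, ne_eq, Finset.sum_eq_zero_iff]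
    constructor
    · intro hne
      push Not at hne
      obtain ⟨z, -, hz⟩ := hne
      refine ⟨z, z.2, ?_, ?_⟩ <;> intro h0 <;> simp [A, B, h0] at hz
    · rintro ⟨z, hz, u1, u2⟩ h0
      have := h0 ⟨z, hz⟩ (Finset.mem_univ _)
      simp [A, B, u1, u2] at this
  · rintro s4 τ4 ⟨R4, F4, t4⟩
    refine ⟨R4, fun r hr h5 => (F4 r hr h5).trans (F r hr h5), ?_⟩
    have e1 : k ≤ k * (h * h) := Nat.le_mul_of_pos_right _ h1
    rw [pow_two] at t2
    have e2 : 40 * (C * (h * h)) = 40 * C * (h * h) := by ring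
    rw [Nat.add_mul, Nat.add_mul, ← e2]
    omega

end Mul

/-! ### Closure of a matrix by recursion on blocks -/

/-- The indices of the block of size `h` that starts at `a`. -/
def Blk (a h x : ℕ) : Prop := a ≤ x ∧ x < a + h

/-- On `P`, the relation `r` is reflexive and transitive. -/
structure Closed (P : ℕ → Prop) (r : ℕ → ℕ → Prop) : Prop where
  refl : ∀ x, P x → r x x
  trans : ∀ x y z, P x → P y → P z → r x y → r y z → r x z

/-- `r'` is `r` together with the product of its blocks `P × Q` and `Q × S`. -/
def AddProd (P Q S : ℕ → Prop) (r r' : ℕ → ℕ → Prop) : Prop :=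
  ∀ x y, r' x y ↔ r x y ∨ P x ∧ S y ∧ ∃ z, Q z ∧ r x z ∧ r z y

theorem mulG_ne_zero {a b d h : ℕ} {g : Tab} :
    AddProd (Blk a h) (Blk b h) (Blk d h) (fun x y => g (6, x, y) ≠ 0)
      fun x y => mulG a b d h g (h * h) (6, x, y) ≠ 0 := by
  intro x y
  have hP : Prod b h g x y ↔ ∃ z, Blk b h z ∧ g (6, x, z) ≠ 0 ∧ g (6, z, y) ≠ 0 := by
    constructor
    · rintro ⟨z, hz, h1⟩
      exact ⟨b + z, ⟨by omega, by omega⟩, h1⟩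
    · rintro ⟨z, ⟨h1, h2⟩, h3⟩
      refine ⟨z - b, by omega, ?_⟩
      rwa [show b + (z - b) = z by omega]
  simp only [mulG, ← hP]
  by_cases h0 : Blk a h x ∧ Blk d h y ∧ Prod b h g x y
  · obtain ⟨h1, h2, h3⟩ := h0
    have : (x - a) * h + (y - d) < h * h := by
      have := Nat.mul_le_mul_right h (show x - a + 1 ≤ h by have := h1.1; have := h1.2; omega)
      rw [Nat.add_mul] at this
      have := h2.1; have := h2.2
      omega
    rw [if_pos ⟨rfl, h1, h2, this, h3⟩]
    simp [h1, h2, h3]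
  · rw [if_neg fun hh => h0 ⟨hh.2.1, hh.2.2.1, hh.2.2.2.2⟩]
    simp [h0]

theorem addProd_mulG {a b d h : ℕ} {g g' : Tab} (hg : g' = mulG a b d h g (h * h)) :
    AddProd (Blk a h) (Blk b h) (Blk d h) (fun x y => g (6, x, y) ≠ 0)
      fun x y => g' (6, x, y) ≠ 0 := hg ▸ mulG_ne_zero

theorem mulG_of_ne {a b d h : ℕ} {g : Tab} {t : Trip} (ht : t.1 ≠ 6) :
    mulG a b d h g (h * h) t = g t := if_neg fun hh => ht hh.1

theorem mulG_le {a b d h m : ℕ} {g : Tab} (hg : ∀ x < m, ∀ y < m, g (6, x, y) ≤ 1) :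
    ∀ x < m, ∀ y < m, mulG a b d h g (h * h) (6, x, y) ≤ 1 := by
  intro x hx y hy
  rw [mulG]
  split_ifs
  exacts [le_rfl, hg x hx y hy]

/-- If the diagonal blocks `A` on `P` and, after the paths through `P` have been added, `D` on `Q`
are closed, then the paths through `Q` are all that is missing on the union of `P` and `Q`. -/
theorem closed_union {P Q : ℕ → Prop} (hPQ : ∀ x, P x → ¬ Q x)
    {r₀ r₁ r₂ r₃ r₄ r₅ r₆ r₇ : ℕ → ℕ → Prop} (h0 : Closed P r₀) (h1 : AddProd P P Q r₀ r₁)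
    (h2 : AddProd Q P P r₁ r₂) (h3 : AddProd Q P Q r₂ r₃) (h34 : ∀ x y, r₃ x y → r₄ x y)
    (h43 : ∀ x y, ¬ (Q x ∧ Q y) → r₄ x y → r₃ x y) (h4 : Closed Q r₄) (h5 : AddProd P Q Q r₄ r₅)
    (h6 : AddProd Q Q P r₅ r₆) (h7 : AddProd P Q P r₆ r₇) :
    Closed (fun x => P x ∨ Q x) r₇ := by
  have hQP : ∀ x, Q x → ¬ P x := fun x h h' => hPQ x h' h
  -- the four blocks after the third product
  have A4 : ∀ x y, P x → P y → (r₄ x y ↔ r₀ x y) := fun x y hx hy =>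
    ⟨fun h => by
      have := h43 x y (by grind) h
      grind [AddProd], fun h => h34 _ _ ((h3 _ _).2 (.inl ((h2 _ _).2 (.inl ((h1 _ _).2 (.inl h))))))⟩
  have B4 : ∀ x y z, P x → P y → Q z → r₀ x y → r₄ y z → r₄ x z := by
    intro x y z hx hy hz ha hb
    have hb3 := h43 y z (by grind) hb
    have hb1 : r₁ y z := by grind [AddProd]
    have : r₁ x z := by
      rcases (h1 _ _).1 hb1 with hb | ⟨-, -, w, hw, k1, k2⟩
      · exact (h1 _ _).2 (.inr ⟨hx, hz, y, hy, ha, hb⟩)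
      · exact (h1 _ _).2 (.inr ⟨hx, hz, w, hw, h0.trans _ _ _ hx hy hw ha k1, k2⟩)
    exact h34 _ _ ((h3 _ _).2 (.inl ((h2 _ _).2 (.inl this))))
  have C4 : ∀ x y z, Q x → P y → P z → r₄ x y → r₀ y z → r₄ x z := by
    intro x y z hx hy hz ha hb
    have ha3 := h43 x y (by grind) ha
    have ha2 : r₂ x y := by grind [AddProd]
    have hA : ∀ u v, P u → P v → (r₁ u v ↔ r₀ u v) := by grind [AddProd]
    have : r₂ x z := by
      rcases (h2 _ _).1 ha2 with ha | ⟨-, -, w, hw, k1, k2⟩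
      · exact (h2 _ _).2 (.inr ⟨hx, hz, y, hy, ha, (hA _ _ hy hz).2 hb⟩)
      · refine (h2 _ _).2 (.inr ⟨hx, hz, w, hw, k1, (hA _ _ hw hz).2 ?_⟩)
        exact h0.trans _ _ _ hw hy hz ((hA _ _ hw hy).1 k2) hb
    exact h34 _ _ ((h3 _ _).2 (.inl this))
  have D4 : ∀ x y z, Q x → P y → Q z → r₄ x y → r₄ y z → r₄ x z := by
    intro x y z hx hy hz ha hb
    have ha2 : r₂ x y := by have := h43 x y (by grind) ha; grind [AddProd]
    have hb2 : r₂ y z := by have := h43 y z (by grind) hb; grind [AddProd]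
    exact h34 _ _ ((h3 _ _).2 (.inr ⟨hx, hz, y, hy, ha2, hb2⟩))
  -- the blocks at the end
  have D7 : ∀ x y, Q x → Q y → (r₇ x y ↔ r₄ x y) := by grind [AddProd]
  have B7 : ∀ x y, P x → Q y → (r₇ x y ↔ ∃ z, Q z ∧ r₄ x z ∧ r₄ z y) := by
    intro x y hx hy
    have e : r₇ x y ↔ r₅ x y := by grind [AddProd]
    rw [e, h5 x y]
    exact ⟨fun h => h.elim (fun h => ⟨y, hy, h, h4.refl y hy⟩) fun h => h.2.2,
      fun h => .inr ⟨hx, hy, h⟩⟩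
  have e54 : ∀ z y, Q z → (r₅ z y ↔ r₄ z y) := by grind [AddProd]
  have C7 : ∀ x y, Q x → P y → (r₇ x y ↔ ∃ z, Q z ∧ r₄ x z ∧ r₄ z y) := by
    intro x y hx hy
    have e : r₇ x y ↔ r₆ x y := by grind [AddProd]
    rw [e, h6 x y, e54 x y hx]
    refine ⟨fun h => h.elim (fun h => ⟨x, hx, h4.refl x hx, h⟩) fun h => ?_,
      fun ⟨z, hz, k1, k2⟩ => .inr ⟨hx, hy, z, hz, (e54 _ _ hx).2 k1, (e54 _ _ hz).2 k2⟩⟩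
    obtain ⟨-, -, z, hz, k1, k2⟩ := h
    exact ⟨z, hz, (e54 _ _ hx).1 k1, (e54 _ _ hz).1 k2⟩
  have A7 : ∀ x y, P x → P y → (r₇ x y ↔ r₀ x y ∨ ∃ z, Q z ∧ r₇ x z ∧ r₇ z y) := by
    intro x y hx hy
    have e : r₆ x y ↔ r₀ x y := by rw [← A4 x y hx hy]; grind [AddProd]
    have e1 : ∀ z, Q z → (r₇ x z ↔ r₆ x z) := by grind [AddProd]
    have e2 : ∀ z, Q z → (r₇ z y ↔ r₆ z y) := by grind [AddProd]
    rw [h7 x y, e]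
    refine or_congr_right ⟨fun ⟨_, _, z, hz, k1, k2⟩ => ⟨z, hz, (e1 z hz).2 k1, (e2 z hz).2 k2⟩,
      fun ⟨z, hz, k1, k2⟩ => ⟨hx, hy, z, hz, (e1 z hz).1 k1, (e2 z hz).1 k2⟩⟩
  have DD : ∀ x y z, Q x → Q y → Q z → r₇ x y → r₇ y z → r₇ x z := by
    intro x y z hx hy hz
    rw [D7 x y hx hy, D7 y z hy hz, D7 x z hx hz]
    exact h4.trans x y z hx hy hz
  have BD : ∀ x y z, P x → Q y → Q z → r₇ x y → r₇ y z → r₇ x z := by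
    intro x y z hx hy hz
    rw [B7 x y hx hy, D7 y z hy hz, B7 x z hx hz]
    exact fun ⟨w, hw, k1, k2⟩ k3 => ⟨w, hw, k1, h4.trans _ _ _ hw hy hz k2 k3⟩
  have DC : ∀ x y z, Q x → Q y → P z → r₇ x y → r₇ y z → r₇ x z := by
    intro x y z hx hy hz
    rw [D7 x y hx hy, C7 y z hy hz, C7 x z hx hz]
    exact fun k3 ⟨w, hw, k1, k2⟩ => ⟨w, hw, h4.trans _ _ _ hx hy hw k3 k1, k2⟩
  have AB : ∀ x y z, P x → P y → Q z → r₀ x y → r₇ y z → r₇ x z := by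
    intro x y z hx hy hz
    rw [B7 y z hy hz, B7 x z hx hz]
    exact fun k3 ⟨w, hw, k1, k2⟩ => ⟨w, hw, B4 _ _ _ hx hy hw k3 k1, k2⟩
  have CA : ∀ x y z, Q x → P y → P z → r₇ x y → r₀ y z → r₇ x z := by
    intro x y z hx hy hz
    rw [C7 x y hx hy, C7 x z hx hz]
    exact fun ⟨w, hw, k1, k2⟩ k3 => ⟨w, hw, k1, C4 _ _ _ hw hy hz k2 k3⟩
  have CB : ∀ x y z, Q x → P y → Q z → r₇ x y → r₇ y z → r₇ x z := by
    intro x y z hx hy hz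
    rw [C7 x y hx hy, B7 y z hy hz, D7 x z hx hz]
    exact fun ⟨w, hw, k1, k2⟩ ⟨w', hw', k3, k4⟩ => h4.trans _ _ _ hx hw hz k1
      (h4.trans _ _ _ hw hw' hz (D4 _ _ _ hw hy hw' k2 k3) k4)
  refine ⟨fun x hx => hx.elim (fun hx => (A7 x x hx hx).2 (.inl (h0.refl x hx))) fun hx =>
    (D7 x x hx hx).2 (h4.refl x hx), ?_⟩
  rintro x y z (hx | hx) (hy | hy) (hz | hz) k1 k2
  · rcases (A7 x y hx hy).1 k1 with k1 | ⟨w, hw, k1, k1'⟩ <;>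
    rcases (A7 y z hy hz).1 k2 with k2 | ⟨u, hu, k2, k2'⟩
    · exact (A7 x z hx hz).2 (.inl (h0.trans _ _ _ hx hy hz k1 k2))
    · exact (A7 x z hx hz).2 (.inr ⟨u, hu, AB _ _ _ hx hy hu k1 k2, k2'⟩)
    · exact (A7 x z hx hz).2 (.inr ⟨w, hw, k1, CA _ _ _ hw hy hz k1' k2⟩)
    · exact (A7 x z hx hz).2 (.inr ⟨u, hu, BD _ _ _ hx hw hu k1 (CB _ _ _ hw hy hu k1' k2), k2'⟩)
  · rcases (A7 x y hx hy).1 k1 with k1 | ⟨w, hw, k1, k1'⟩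
    · exact AB _ _ _ hx hy hz k1 k2
    · exact BD _ _ _ hx hw hz k1 (CB _ _ _ hw hy hz k1' k2)
  · exact (A7 x z hx hz).2 (.inr ⟨y, hy, k1, k2⟩)
  · exact BD _ _ _ hx hy hz k1 k2
  · rcases (A7 y z hy hz).1 k2 with k2 | ⟨u, hu, k2, k2'⟩
    · exact CA _ _ _ hx hy hz k1 k2
    · exact DC _ _ _ hx hu hz (CB _ _ _ hx hy hu k1 k2) k2'
  · exact CB _ _ _ hx hy hz k1 k2
  · exact DC _ _ _ hx hy hz k1 k2
  · exact DD _ _ _ hx hy hz k1 k2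

/-- Time of the block recursion for a block of size `2 ^ s`, if one level costs `κ`. -/
def recTime (κ : ℕ → ℕ) : ℕ → ℕ
  | 0 => 0
  | s + 1 => 2 * recTime κ s + κ (2 ^ s)

/-- As the exponent is at least two, halving the size costs a factor of at least four, whereas there
are two halves; so the topmost level dominates. -/
theorem recTime_le {κ : ℕ → ℕ} {ω K : ℝ} (hω : 2 ≤ ω)
    (hκ : ∀ h, 1 ≤ h → (κ h : ℝ) ≤ K * (h : ℝ) ^ ω) (s : ℕ) :
    (recTime κ s : ℝ) ≤ K * ((2 ^ s : ℕ) : ℝ) ^ ω := by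
  have hK : 0 ≤ K := by simpa using (Nat.cast_nonneg (κ 1)).trans (hκ 1 le_rfl)
  induction s with
  | zero => simpa [recTime] using hK
  | succ s ih =>
    have h1 := hκ (2 ^ s) Nat.one_le_two_pow
    have h2 : (4 : ℝ) ≤ 2 ^ ω := by
      calc (4 : ℝ) = 2 ^ (2 : ℝ) := by norm_num
        _ ≤ 2 ^ ω := Real.rpow_le_rpow_of_exponent_le (by norm_num) hω
    have h3 : (((2 ^ (s + 1) : ℕ) : ℝ)) ^ ω = 2 ^ ω * ((2 ^ s : ℕ) : ℝ) ^ ω := by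
      rw [pow_succ, Nat.cast_mul, mul_comm, Real.mul_rpow (by norm_num) (by positivity)]
      norm_num
    have h4 : 0 ≤ K * ((2 ^ s : ℕ) : ℝ) ^ ω := by positivity
    rw [h3, recTime]
    push_cast at *
    nlinarith

/-! ### The block recursion on the machine -/

/-- `g'` arises from `g` by adding, inside the block of size `h` at `lo`, entries that are forced by
reflexivity and transitivity. -/
structure Ext (m lo h : ℕ) (g g' : Tab) : Prop where
  other : ∀ t, t.1 ≠ 6 → g' t = g t
  le : (∀ x < m, ∀ y < m, g (6, x, y) ≤ 1) → ∀ x < m, ∀ y < m, g' (6, x, y) ≤ 1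
  mono : ∀ x y, g (6, x, y) ≠ 0 → g' (6, x, y) ≠ 0
  outside : ∀ x y, ¬ (Blk lo h x ∧ Blk lo h y) → g' (6, x, y) ≠ 0 → g (6, x, y) ≠ 0
  sound : ∀ T : ℕ → ℕ → Prop, (∀ x, T x x) → (∀ x y z, T x y → T y z → T x z) →
    (∀ x y, g (6, x, y) ≠ 0 → T x y) → ∀ x y, g' (6, x, y) ≠ 0 → T x y

theorem Ext.refl (m lo h : ℕ) (g : Tab) : Ext m lo h g g :=
  ⟨fun _ _ => rfl, fun h => h, fun _ _ h => h, fun _ _ _ h => h, fun _ _ _ h => h⟩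

theorem Ext.trans {m lo h : ℕ} {g g' g'' : Tab} (e : Ext m lo h g g') (e' : Ext m lo h g' g'') :
    Ext m lo h g g'' :=
  ⟨fun t ht => (e'.other t ht).trans (e.other t ht), fun h => e'.le (e.le h),
    fun x y h => e'.mono x y (e.mono x y h), fun x y hb h => e.outside x y hb (e'.outside x y hb h),
    fun T h1 h2 h3 => e'.sound T h1 h2 (e.sound T h1 h2 h3)⟩

theorem Ext.widen {m lo h lo' h' : ℕ} {g g' : Tab} (e : Ext m lo h g g') (hl : lo' ≤ lo)
    (hh : lo + h ≤ lo' + h') : Ext m lo' h' g g' :=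
  ⟨e.other, e.le, e.mono, fun x y hb => e.outside x y fun h => hb
    ⟨⟨by have := h.1.1; omega, by have := h.1.2; omega⟩, ⟨by have := h.2.1; omega, by
      have := h.2.2; omega⟩⟩, e.sound⟩

theorem Ext.mulG {m lo H a b d h : ℕ} (g : Tab) (ha : lo ≤ a) (ha' : a + h ≤ lo + H) (hd : lo ≤ d)
    (hd' : d + h ≤ lo + H) : Ext m lo H g (mulG a b d h g (h * h)) := by
  refine ⟨fun t ht => mulG_of_ne ht, mulG_le, fun x y h => (mulG_ne_zero x y).2 (.inl h),
    fun x y hb h => ?_, fun T h1 h2 h3 x y h => ?_⟩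
  · rcases (mulG_ne_zero x y).1 h with h | ⟨u, v, -⟩
    · exact h
    · obtain ⟨u1, u2⟩ := u
      obtain ⟨v1, v2⟩ := v
      exact absurd ⟨⟨by omega, by omega⟩, ⟨by omega, by omega⟩⟩ hb
  · rcases (mulG_ne_zero x y).1 h with h | ⟨-, -, z, -, k1, k2⟩
    · exact h3 x y h
    · exact h2 x z y (h3 _ _ k1) (h3 _ _ k2)

theorem Ext.leaf {m lo h c : ℕ} (g : Tab) (hc : lo ≤ c) (hc' : c < lo + h) :
    Ext m lo h g (Function.update g (6, c, c) 1) := by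
  have key : ∀ x y, Function.update g (6, c, c) 1 (6, x, y) = if x = c ∧ y = c then 1 else g (6, x, y) := by
    intro x y
    simp [Function.update_apply]
  refine ⟨fun t ht => Function.update_of_ne (fun h => ht (by rw [h])) _ _, fun hg x hx y hy => ?_,
    fun x y h => ?_, fun x y hb h => ?_, fun T h1 h2 h3 x y h => ?_⟩ <;> rw [key] at *
  · split_ifs
    exacts [le_rfl, hg x hx y hy]
  · split_ifs
    exacts [one_ne_zero, h]
  · rw [if_neg] at h
    · exact h
    · rintro ⟨rfl, rfl⟩
      exact hb ⟨⟨hc, hc'⟩, ⟨hc, hc'⟩⟩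
  · split_ifs at h with e
    · rw [e.1, e.2]; exact h1 c
    · exact h3 x y h

/-- Every continuation of the loop `L` from the states in `P` is one from the state `s`. -/
def Reach (M : Mach) (L : Cmd) (s : State) (P : State → ℕ → Prop) : Prop :=
  ∀ Q : State → ℕ → Prop, (∀ s' τ, P s' τ → Tot M L s' fun s'' t => Q s'' (τ + t)) → Tot M L s Q

theorem Reach.trans {M : Mach} {L : Cmd} {s : State} {P P' : State → ℕ → Prop} (h : Reach M L s P)
    (h' : ∀ s' τ, P s' τ → Reach M L s' fun s'' t => P' s'' (τ + t)) : Reach M L s P' := by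
  intro Q hQ
  refine h Q fun s' τ hP => h' s' τ hP _ fun s'' t hP' => (hQ s'' _ hP').mono fun _ _ hq => ?_
  rwa [← Nat.add_assoc]

theorem Reach.step {M : Mach} {s : State} {P : State → ℕ → Prop} {e : Ex} {c : Cmd} (ho : e.Ok M s)
    (h0 : e.eval M s ≠ 0) (h : Tot M c s fun s' t => P s' (e.cost + 1 + t)) :
    Reach M (whl e c) s P :=
  fun Q hQ => tot_whl_step ho h0 (h.mono fun s' t hP => hQ s' _ hP)

/-- Product of the blocks that start at the values of three expressions. -/
def prodC (p : Cmd) (e₁ e₂ e₃ : Ex) : Cmd := asg 32 e₁ ;; asg 33 e₂ ;; asg 34 e₃ ;; p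

/-- One round of the block recursion. Register `30` holds the end of a finished block and register
`31` its size. After the left half of a larger block, the paths through it are added to the other
parts, and the right half is started with its first diagonal entry. After the right half, the larger
block is completed. -/
def roundC (p : Cmd) : Cmd :=
  iff (.v 30 / .v 31 - .v 30 / .v 31 / .c 2 * .c 2)
    (prodC p (.v 30 - .v 31) (.v 30 - .v 31) (.v 30) ;;
      prodC p (.v 30) (.v 30 - .v 31) (.v 30 - .v 31) ;; prodC p (.v 30) (.v 30 - .v 31) (.v 30) ;;
      sto (FA (.c 6) (.v 30) (.v 30)) (.c 1) ;; asg 30 (.v 30 + .c 1) ;; asg 31 (.c 1))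
    (prodC p (.v 30 - (.v 31 + .v 31)) (.v 30 - .v 31) (.v 30 - .v 31) ;;
      prodC p (.v 30 - .v 31) (.v 30 - .v 31) (.v 30 - (.v 31 + .v 31)) ;;
      prodC p (.v 30 - (.v 31 + .v 31)) (.v 30 - .v 31) (.v 30 - (.v 31 + .v 31)) ;;
      asg 31 (.v 31 + .v 31))

/-- A program that multiplies blocks of the table, in time `μ h`. -/
def BlockMul (M : Mach) (m fl : ℕ) (p : Cmd) (μ : ℕ → ℕ) : Prop :=
  ∀ (g : Tab) (s : State) (a b d h : ℕ), Rep m g [] fl s → (∀ x < m, ∀ y < m, g (6, x, y) ≤ 1) →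
    1 ≤ h → s.reg 31 = h → s.reg 32 = a → s.reg 33 = b → s.reg 34 = d → a + h ≤ m → b + h ≤ m →
    d + h ≤ m → Tot M p s fun s' τ => Rep m (mulG a b d h g (h * h)) [] fl s' ∧ Fr 35 s s' ∧ τ ≤ μ h

section Blocks
variable {M : Mach} {m fl n : ℕ} {g : Tab} {s : State} {p : Cmd} {μ : ℕ → ℕ}
  {a b d h : ℕ}

theorem tot_prod (hM : Ctx M m) (hp : BlockMul M m fl p μ) (hr : Rep m g [] fl s)
    (hg : ∀ x < m, ∀ y < m, g (6, x, y) ≤ 1) (hh : 1 ≤ h) (h31 : s.reg 31 = h) {e₁ e₂ e₃ : Ex}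
    (o₁ : e₁.Ok M s) (o₂ : ∀ v, e₂.Ok M (s.setReg 32 v))
    (o₃ : ∀ v w, e₃.Ok M ((s.setReg 32 v).setReg 33 w))
    (v₁ : e₁.eval M s = a) (v₂ : ∀ v, e₂.eval M (s.setReg 32 v) = b)
    (v₃ : ∀ v w, e₃.eval M ((s.setReg 32 v).setReg 33 w) = d) (c₁ : e₁.cost ≤ 8) (c₂ : e₂.cost ≤ 8)
    (c₃ : e₃.cost ≤ 8) (ha : a + h ≤ m) (hb : b + h ≤ m) (hd : d + h ≤ m) :
    Tot M (prodC p e₁ e₂ e₃) s fun s' τ => Rep m (mulG a b d h g (h * h)) [] fl s' ∧ Fr 32 s s' ∧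
      τ ≤ μ h + 30 := by
  refine tot_seq (tot_asg (by norm_num) o₁ (tot_seq (tot_asg (by norm_num) (o₂ _)
    (tot_seq (tot_asg (by norm_num) (o₃ _ _) ?_)))))
  rw [v₁, v₂, v₃]
  refine (hp g _ a b d h (((hr.setReg (by norm_num) (by norm_num)).setReg (by norm_num)
    (by norm_num)).setReg (by norm_num) (by norm_num)) hg hh ?_ ?_ ?_ ?_ ha hb hd).mono ?_
  · simp [h31]
  · simp
  · simp
  · simp
  · rintro s' τ ⟨R', F', ht⟩
    refine ⟨R', fun r hr' h5 => ?_, by omega⟩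
    rw [F' r (by omega) h5]
    have h1 : r ≠ 32 := by omega
    have h2 : r ≠ 33 := by omega
    have h3 : r ≠ 34 := by omega
    simp [h1, h2, h3]

/-- The rest of the round after the left half of a larger block. -/
theorem tot_left (hM : Ctx M m) (hp : BlockMul M m fl p μ) (hr : Rep m g [] fl s)
    (hg : ∀ x < m, ∀ y < m, g (6, x, y) ≤ 1) (hh : 1 ≤ h) {lo j : ℕ} (hlo : lo = j * (h + h))
    (h30 : s.reg 30 = lo + h) (h31 : s.reg 31 = h) (hm : lo + (h + h) ≤ m) :
    Tot M (roundC p) s fun s' τ => ∃ g₁ g₂ g₃ : Tab,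
      g₁ = mulG lo lo (lo + h) h g (h * h) ∧ g₂ = mulG (lo + h) lo lo h g₁ (h * h) ∧
      g₃ = mulG (lo + h) lo (lo + h) h g₂ (h * h) ∧
      Rep m (Function.update g₃ (6, lo + h, lo + h) 1) [] fl s' ∧ Fr 30 s s' ∧
      s'.reg 30 = lo + h + 1 ∧ s'.reg 31 = 1 ∧ τ ≤ 3 * μ h + 200 := by
  have hpos := hM.pos
  have hS := hM.le_S
  have hW := hM.le_W
  have hmm : m ≤ m * m := Nat.le_mul_self m
  have hc : ∀ x, x < 20 → x < M.W := fun x hx => by omega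
  have hc1 := hc 1 (by norm_num)
  have hc2 := hc 2 (by norm_num)
  have hc6 := hc 6 (by norm_num)
  have q : (lo + h) / h = 2 * j + 1 := by
    rw [hlo, show j * (h + h) + h = (2 * j + 1) * h by ring, Nat.mul_div_cancel _ hh]
  have hle : (lo + h) / h ≤ lo + h := Nat.div_le_self _ _
  refine tot_iff ?_ (fun _ => ?_) fun h0 => absurd h0 ?_
  · simp [h30, h31, hc2]
    have := Nat.div_mul_le_self ((lo + h) / h) 2
    omega
  swap
  · simp [h30, h31, q]; omega
  refine tot_seq ((tot_prod hM hp hr hg hh h31 (a := lo) (b := lo) (d := lo + h) (by simp) (by simp)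
    (by simp) (by simp [h30, h31]) (by simp [h30, h31]) (by simp [h30, h31]) (by simp) (by simp)
    (by simp) (by omega) (by omega) (by omega)).mono ?_)
  rintro s1 t1 ⟨R1, F1, l1⟩
  have a30 := (F1 30 (by norm_num) (by norm_num)).trans h30
  have a31 := (F1 31 (by norm_num) (by norm_num)).trans h31
  refine tot_seq ((tot_prod hM hp R1 (mulG_le hg) hh a31 (a := lo + h) (b := lo) (d := lo) (by simp)
    (by simp) (by simp) (by simp [a30, a31]) (by simp [a30, a31]) (by simp [a30, a31]) (by simp)
    (by simp) (by simp) (by omega) (by omega) (by omega)).mono ?_)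
  rintro s2 t2 ⟨R2, F2, l2⟩
  have b30 := (F2 30 (by norm_num) (by norm_num)).trans a30
  have b31 := (F2 31 (by norm_num) (by norm_num)).trans a31
  refine tot_seq ((tot_prod hM hp R2 (mulG_le (mulG_le hg)) hh b31 (a := lo + h) (b := lo)
    (d := lo + h) (by simp) (by simp) (by simp) (by simp [b30, b31]) (by simp [b30, b31])
    (by simp [b30, b31]) (by simp) (by simp) (by simp) (by omega) (by omega) (by omega)).mono ?_)
  rintro s3 t3 ⟨R3, F3, l3⟩
  have c30 := (F3 30 (by norm_num) (by norm_num)).trans b30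
  have v : Valid m (6, lo + h, lo + h) := ⟨by simp, by simp only; omega, by simp only; omega⟩
  have E : (FA (.c 6) (.v 30) (.v 30)).eval M s3 = enc m (6, lo + h, lo + h) := by
    rw [FA_eval R3.reg2]; simp [c30]
  refine tot_seq (tot_sto (FA_ok hM R3.reg2 (by simp [hc6]) (by simp) (by simp)
    (by simpa [c30] using v)) (by simp [hc1]) (by rw [E]; exact Rep.lt_S hM v) ?_)
  rw [E, Ex.eval_c]
  refine tot_seq (tot_asg (by norm_num) (by simp [c30, hc1]; omega) (tot_asg (by norm_num)
    (by simp [hc1]) ⟨_, _, _, rfl, rfl, rfl, ((R3.set (by omega) v (by simp)).setReg (by norm_num)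
      (by norm_num)).setReg (by norm_num) (by norm_num), fun r hr' h5 => ?_, ?_, ?_, ?_⟩))
  · have e1 : r ≠ 30 := by omega
    have e2 : r ≠ 31 := by omega
    simp [e1, e2, F3 r (by omega) h5, F2 r (by omega) h5, F1 r (by omega) h5]
  · simp [c30]
  · simp
  · simp [FA]
    omega

/-- The round after the right half of a larger block. -/
theorem tot_right (hM : Ctx M m) (hp : BlockMul M m fl p μ) (hr : Rep m g [] fl s)
    (hg : ∀ x < m, ∀ y < m, g (6, x, y) ≤ 1) (hh : 1 ≤ h) {lo j : ℕ} (hlo : lo = j * (h + h))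
    (h30 : s.reg 30 = lo + (h + h)) (h31 : s.reg 31 = h) (hm : lo + (h + h) ≤ m) :
    Tot M (roundC p) s fun s' τ => ∃ g₁ g₂ : Tab,
      g₁ = mulG lo (lo + h) (lo + h) h g (h * h) ∧ g₂ = mulG (lo + h) (lo + h) lo h g₁ (h * h) ∧
      Rep m (mulG lo (lo + h) lo h g₂ (h * h)) [] fl s' ∧ Fr 30 s s' ∧
      s'.reg 30 = lo + (h + h) ∧ s'.reg 31 = h + h ∧ τ ≤ 3 * μ h + 200 := by
  have hpos := hM.pos
  have hS := hM.le_S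
  have hW := hM.le_W
  have hmm : m ≤ m * m := Nat.le_mul_self m
  have hc : ∀ x, x < 20 → x < M.W := fun x hx => by omega
  have hc2 := hc 2 (by norm_num)
  have q : (lo + (h + h)) / h = 2 * j + 2 := by
    rw [hlo, show j * (h + h) + (h + h) = (2 * j + 2) * h by ring, Nat.mul_div_cancel _ hh]
  have hle : (lo + (h + h)) / h ≤ lo + (h + h) := Nat.div_le_self _ _
  have hhW : h + h < M.W := by omega
  have e1 : lo + (h + h) - h = lo + h := by omega
  refine tot_iff ?_ (fun h0 => absurd ?_ h0) fun _ => ?_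
  · simp [h30, h31, hc2]
    have := Nat.div_mul_le_self ((lo + (h + h)) / h) 2
    omega
  · simp [h30, h31, q]; omega
  refine tot_seq ((tot_prod hM hp hr hg hh h31 (a := lo) (b := lo + h) (d := lo + h)
    (by simp [h31, hhW]) (by simp) (by simp) (by simp [h30, h31]) (by simp [h30, h31, e1])
    (by simp [h30, h31, e1]) (by simp) (by simp) (by simp) (by omega) (by omega) (by omega)).mono ?_)
  rintro s1 t1 ⟨R1, F1, l1⟩
  have a30 := (F1 30 (by norm_num) (by norm_num)).trans h30
  have a31 := (F1 31 (by norm_num) (by norm_num)).trans h31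
  refine tot_seq ((tot_prod hM hp R1 (mulG_le hg) hh a31 (a := lo + h) (b := lo + h) (d := lo)
    (by simp) (by simp) (by simp [a31, hhW]) (by simp [a30, a31, e1]) (by simp [a30, a31, e1])
    (by simp [a30, a31]) (by simp) (by simp) (by simp) (by omega) (by omega) (by omega)).mono ?_)
  rintro s2 t2 ⟨R2, F2, l2⟩
  have b30 := (F2 30 (by norm_num) (by norm_num)).trans a30
  have b31 := (F2 31 (by norm_num) (by norm_num)).trans a31
  refine tot_seq ((tot_prod hM hp R2 (mulG_le (mulG_le hg)) hh b31 (a := lo) (b := lo + h)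
    (d := lo) (by simp [b31, hhW]) (by simp) (by simp [b31, hhW]) (by simp [b30, b31])
    (by simp [b30, b31, e1]) (by simp [b30, b31]) (by simp) (by simp) (by simp) (by omega) (by omega)
    (by omega)).mono ?_)
  rintro s3 t3 ⟨R3, F3, l3⟩
  have c30 := (F3 30 (by norm_num) (by norm_num)).trans b30
  have c31 := (F3 31 (by norm_num) (by norm_num)).trans b31
  refine tot_asg (by norm_num) (by simp [c31, hhW]) ⟨_, _, rfl, rfl, R3.setReg (by norm_num)
    (by norm_num), fun r hr' h5 => ?_, ?_, ?_, ?_⟩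
  · have e2 : r ≠ 31 := by omega
    simp [e2, F3 r (by omega) h5, F2 r (by omega) h5, F1 r (by omega) h5]
  · simp [c30]
  · simp [c31]
  · simp
    omega

/-- Closure of the table of kind `6`, whose size is in register `29`: the recursion on blocks is run
as a loop, because the binary digits of the end of a block tell which blocks are complete. -/
def blocksC (p : Cmd) : Cmd := whl (.v 29 - .v 31) (roundC p)

/-- Block recursion: started at the first index of a block, the loop arrives at the end of the block
and has closed it. -/
theorem reach_block (hM : Ctx M m) (hp : BlockMul M m fl p μ) {N : ℕ} (hN : N ≤ m) (q : ℕ) :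
    ∀ (lo j : ℕ) (g : Tab) (s : State), lo = j * 2 ^ q → lo + 2 ^ q ≤ N → Rep m g [] fl s →
      (∀ x < m, ∀ y < m, g (6, x, y) ≤ 1) → g (6, lo, lo) ≠ 0 → s.reg 29 = N → s.reg 30 = lo + 1 →
      s.reg 31 = 1 →
      Reach M (blocksC p) s fun s' τ => ∃ g', Rep m g' [] fl s' ∧ Fr 30 s s' ∧
        s'.reg 30 = lo + 2 ^ q ∧ s'.reg 31 = 2 ^ q ∧ Ext m lo (2 ^ q) g g' ∧
        Closed (Blk lo (2 ^ q)) (fun x y => g' (6, x, y) ≠ 0) ∧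
        τ ≤ recTime (fun h => 6 * μ h + 420) q := by
  induction q with
  | zero =>
    intro lo j g s hlo hle hr hg hd h29 h30 h31 Q hQ
    refine (hQ s 0 ⟨g, hr, Fr.refl _ _, by simpa using h30, by simpa using h31, Ext.refl _ _ _ _, ?_,
      by simp⟩).mono fun s' t hq => by simpa using hq
    have e : ∀ x, Blk lo (2 ^ 0) x → x = lo := fun x hx => by
      have := hx.1; have := hx.2; simp at this; omega
    refine ⟨fun x hx => by rw [e x hx]; exact hd, fun x y z hx hy hz h1 _ => ?_⟩
    rw [e x hx, e z hz]; exact hd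
  | succ q ih =>
    intro lo j g s hlo hle hr hg hd h29 h30 h31
    have h1 : 1 ≤ 2 ^ q := Nat.one_le_two_pow
    have e2 : 2 ^ (q + 1) = 2 ^ q + 2 ^ q := by ring
    rw [e2] at hlo hle ⊢
    have hlo2 : lo = (j + j) * 2 ^ q := by rw [hlo]; ring
    refine (ih lo (j + j) g s hlo2 (by omega) hr hg hd h29 h30 h31).trans ?_
    rintro s1 t1 ⟨g0, R0, F0, c0, d0, x0, k0, l0⟩
    have n0 := (F0 29 (by norm_num) (by norm_num)).trans h29
    refine Reach.trans (P := fun s2 t2 => ∃ g₁ g₂ g₃ : Tab,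
      g₁ = mulG lo lo (lo + 2 ^ q) (2 ^ q) g0 (2 ^ q * 2 ^ q) ∧
      g₂ = mulG (lo + 2 ^ q) lo lo (2 ^ q) g₁ (2 ^ q * 2 ^ q) ∧
      g₃ = mulG (lo + 2 ^ q) lo (lo + 2 ^ q) (2 ^ q) g₂ (2 ^ q * 2 ^ q) ∧
      Rep m (Function.update g₃ (6, lo + 2 ^ q, lo + 2 ^ q) 1) [] fl s2 ∧ Fr 30 s1 s2 ∧
      s2.reg 30 = lo + 2 ^ q + 1 ∧ s2.reg 31 = 1 ∧ t2 ≤ 3 * μ (2 ^ q) + 210) ?_ ?_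
    · refine Reach.step (by simp) (by simp [n0, d0]; omega) ((tot_left hM hp R0 (x0.le hg) h1 hlo c0 d0
        (by omega)).mono ?_)
      rintro s2 t2 ⟨g₁, g₂, g₃, w1, w2, w3, w4, w5, w6, w7, w8⟩
      exact ⟨g₁, g₂, g₃, w1, w2, w3, w4, w5, w6, w7, by simp; omega⟩
    rintro s2 t2 ⟨g₁, g₂, g₃, w1, w2, w3, R2, F2, w6, w7, w8⟩
    have xx1 : Ext m lo (2 ^ q + 2 ^ q) g0 g₁ := by rw [w1]; exact Ext.mulG _ (by omega) (by omega) (by omega) (by omega)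
    have xx2 : Ext m lo (2 ^ q + 2 ^ q) g₁ g₂ := by rw [w2]; exact Ext.mulG _ (by omega) (by omega) (by omega) (by omega)
    have xx3 : Ext m lo (2 ^ q + 2 ^ q) g₂ g₃ := by rw [w3]; exact Ext.mulG _ (by omega) (by omega) (by omega) (by omega)
    have xl : Ext m (lo + 2 ^ q) (2 ^ q) g₃ (Function.update g₃ (6, lo + 2 ^ q, lo + 2 ^ q) 1) :=
      Ext.leaf _ le_rfl (by omega)
    generalize hg4 : Function.update g₃ (6, lo + 2 ^ q, lo + 2 ^ q) 1 = g4 at R2 xl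
    have y4 : Ext m lo (2 ^ q + 2 ^ q) g g4 := (x0.widen le_rfl (by omega)).trans (xx1.trans (xx2.trans
      (xx3.trans (xl.widen (by omega) (by omega)))))
    have n2 := (F2 29 (by norm_num) (by norm_num)).trans n0
    refine (ih (lo + 2 ^ q) (j + j + 1) g4 s2 (by rw [hlo]; ring) (by omega) R2 (y4.le hg)
      (by rw [← hg4]; simp) n2 w6 w7).trans ?_
    rintro s3 t3 ⟨g5, R3, F3, c3, d3, x3, k3, l3⟩
    have n3 := (F3 29 (by norm_num) (by norm_num)).trans n2
    have y5 := y4.trans (x3.widen (by omega) (show lo + 2 ^ q + 2 ^ q ≤ lo + (2 ^ q + 2 ^ q) by omega))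
    refine Reach.step (by simp) (by simp [n3, d3]; omega) ((tot_right hM hp R3 (y5.le hg) h1 hlo
      (by omega) d3 (by omega)).mono ?_)
    rintro s4 t4 ⟨g₆, g₇, w9, w10, R4, F4, v1, v2, v3⟩
    have xx6 : Ext m lo (2 ^ q + 2 ^ q) g5 g₆ := by rw [w9]; exact Ext.mulG _ (by omega) (by omega) (by omega) (by omega)
    have xx7 : Ext m lo (2 ^ q + 2 ^ q) g₆ g₇ := by rw [w10]; exact Ext.mulG _ (by omega) (by omega) (by omega) (by omega)
    refine ⟨_, R4, F0.trans (F2.trans (F3.trans F4)), v1, v2, (y5.trans xx6).trans (xx7.trans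
      (Ext.mulG _ (by omega) (by omega) (by omega) (by omega))), ?_, ?_⟩
    · have u := closed_union (P := Blk lo (2 ^ q)) (Q := Blk (lo + 2 ^ q) (2 ^ q))
        (fun x hx hx' => by have := hx.2; have := hx'.1; omega) k0 (addProd_mulG w1)
        (addProd_mulG w2) (addProd_mulG w3)
        (fun x y hxy => x3.mono x y (xl.mono x y hxy))
        (fun x y hb hxy => xl.outside x y hb (x3.outside x y hb hxy)) k3
        (addProd_mulG w9) (addProd_mulG w10) mulG_ne_zero
      have e : ∀ x, Blk lo (2 ^ q + 2 ^ q) x → Blk lo (2 ^ q) x ∨ Blk (lo + 2 ^ q) (2 ^ q) x := by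
        intro x hx
        have := hx.1; have := hx.2
        rcases lt_or_ge x (lo + 2 ^ q) with h | h
        · exact .inl ⟨by omega, h⟩
        · exact .inr ⟨h, by omega⟩
      exact ⟨fun x hx => u.refl x (e x hx), fun x y z hx hy hz => u.trans x y z (e x hx) (e y hy)
        (e z hz)⟩
    · simp only [recTime, Ex.cost_sub, Ex.cost_v] at l0 l3 ⊢
      omega

end Blocks

open Relation

/-! ### Initialization -/

/-- The tables of kinds `k₁` and `k₂` after the first `p` entries of `f₁` and `f₂`, in row-major
order, have been written into them. -/
def fillG (n k₁ k₂ : ℕ) (f₁ f₂ : ℕ → ℕ → ℕ) (g : Tab) (p : ℕ) : Tab := fun t =>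
  if t.2.1 < n ∧ t.2.2 < n ∧ t.2.1 * n + t.2.2 < p then
    if t.1 = k₁ then f₁ t.2.1 t.2.2 else if t.1 = k₂ then f₂ t.2.1 t.2.2 else g t
  else g t

/-- Fill the tables of kinds `k₁` and `k₂` with the values of two expressions, in which the registers
`7` and `8` are row and column. -/
def fillC (k₁ k₂ : ℕ) (e₁ e₂ : Ex) : Cmd :=
  forUp 6 (.v 1 * .v 1) (asg 7 (.v 6 / .v 1) ;; asg 8 (.v 6 - .v 7 * .v 1) ;;
    sto (FA (.c k₁) (.v 7) (.v 8)) e₁ ;; sto (FA (.c k₂) (.v 7) (.v 8)) e₂)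

section Init
variable {M : Mach} {m fl n : ℕ} {g : Tab} {s : State} {p : Cmd} {μ : ℕ → ℕ}

theorem tot_fill (hM : Ctx M m) (hr : Rep m g [] fl s) {k₁ k₂ : ℕ} {e₁ e₂ : Ex} {f₁ f₂ : ℕ → ℕ → ℕ}
    (hk₁ : k₁ < 8) (hk₂ : k₂ < 8) (hk : k₁ ≠ k₂) (h1 : s.reg 1 = n) (hn : n ≤ m)
    (he : ∀ (x y : ℕ) (g' : Tab) (s' : State), x < n → y < n → Rep m g' [] fl s' → Fr 6 s s' →
      s'.reg 6 = x * n + y → s'.reg 7 = x → s'.reg 8 = y →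
      (∀ t, Valid m t → t.1 ≠ k₁ → t.1 ≠ k₂ → g' t = g t) → (e₁.Ok M s' ∧ e₁.eval M s' = f₁ x y) ∧
      e₂.Ok M s' ∧ e₂.eval M s' = f₂ x y) (c₁ : e₁.cost ≤ 20) (c₂ : e₂.cost ≤ 20) :
    Tot M (fillC k₁ k₂ e₁ e₂) s fun s' τ => Rep m (fillG n k₁ k₂ f₁ f₂ g (n * n)) [] fl s' ∧
      Fr 6 s s' ∧ τ ≤ 130 * (n * n) + 20 := by
  have hm := hM.pos
  have hS := hM.le_S
  have hW := hM.le_W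
  have hnn : n * n ≤ m * m := Nat.mul_le_mul hn hn
  have hmm : m ≤ m * m := Nat.le_mul_self m
  refine (tot_tabs (N := n * n) (fillG n k₁ k₂ f₁ f₂ g) 100 (by norm_num) (by norm_num) (by norm_num)
    (by omega) (hr.congr fun t _ => by simp [fillG]) (fun s' F' => ?_) ?_).mono ?_
  · simp [(F' 1 (by norm_num) (by norm_num)).trans h1]; omega
  swap
  · rintro s' t ⟨R, F, ht⟩
    refine ⟨R, F, ?_⟩
    simp at ht; omega
  intro q s' hq R' F' e6
  have q1 := (F' 1 (by norm_num) (by norm_num)).trans h1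
  obtain ⟨l1, l2, l3⟩ := index_lt hq
  have l4 : q / n * n ≤ q := Nat.div_mul_le_self q n
  have l5 := Nat.div_add_mod' q n
  refine tot_seq (tot_asg (by norm_num) (by simp) (tot_seq (tot_asg (by norm_num) ?_ ?_)))
  · simp [e6, q1]; omega
  have E1 : (Ex.v 6 / Ex.v 1).eval M s' = q / n := by simp [e6, q1]
  rw [E1]
  have E2 : (Ex.v 6 - Ex.v 7 * Ex.v 1).eval M (s'.setReg 7 (q / n)) = q % n := by
    simp [e6, q1, l3]
  rw [E2]
  generalize hs2 : (s'.setReg 7 (q / n)).setReg 8 (q % n) = s2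
  have R2 : Rep m (fillG n k₁ k₂ f₁ f₂ g q) [] fl s2 := by
    subst hs2; exact (R'.setReg (by norm_num) (by norm_num)).setReg (by norm_num) (by norm_num)
  have f2 : ∀ r < 7, s2.reg r = s'.reg r := by
    intro r hr
    have a1 : r ≠ 7 := by omega
    have a2 : r ≠ 8 := by omega
    subst hs2; simp [a1, a2]
  have p6 := (f2 6 (by norm_num)).trans e6
  have p7 : s2.reg 7 = q / n := by subst hs2; simp
  have p8 : s2.reg 8 = q % n := by subst hs2; simp
  have F2 : Fr 6 s s2 := fun r hr h5 => (f2 r (by omega)).trans (F' r hr h5)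
  clear hs2 E1 E2
  have v1 : Valid m (k₁, q / n, q % n) := ⟨hk₁, by simp only; omega, by simp only; omega⟩
  have v2 : Valid m (k₂, q / n, q % n) := ⟨hk₂, by simp only; omega, by simp only; omega⟩
  have hG : ∀ t, Valid m t → t.1 ≠ k₁ → t.1 ≠ k₂ → fillG n k₁ k₂ f₁ f₂ g q t = g t := by
    intro t _ a b
    simp [fillG, a, b]
  obtain ⟨⟨o1, w1⟩, -⟩ := he _ _ _ s2 l1 l2 R2 F2 (by omega) p7 p8 hG
  refine tot_seq ((tot_sto_tab hM R2 v1 (FA_ok hM R2.reg2 (by simp; omega) (by simp) (by simp)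
    (by simpa [p7, p8] using v1)) (by rw [FA_eval R2.reg2]; simp [p7, p8]) o1).mono ?_)
  rintro s3 t3 ⟨R3, F3, T3⟩
  rw [w1] at R3
  obtain ⟨-, o2, w2⟩ := he _ _ _ s3 l1 l2 R3 (fun r hr h5 => (F3 r).trans (F2 r hr h5))
    (by rw [F3]; omega) ((F3 7).trans p7) ((F3 8).trans p8) (fun t ht a b => by
      rw [Function.update_of_ne (fun h => a (by rw [h])), hG t ht a b])
  refine (tot_sto_tab hM R3 v2 (FA_ok hM R3.reg2 (by simp; omega) (by simp) (by simp)
    (by simpa [F3, p7, p8] using v2)) (by rw [FA_eval R3.reg2]; simp [F3, p7, p8]) o2).mono ?_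
  rintro s4 t4 ⟨R4, F4, T4⟩
  rw [w2] at R4
  refine ⟨R4.congr ?_, fun r hr h5 => ?_, ?_⟩
  · rintro ⟨i, x, y⟩ -
    have uniq : x < n → y < n → x * n + y = q → x = q / n ∧ y = q % n := by
      rintro hx hy rfl
      have hn0 : 0 < n := by omega
      refine ⟨?_, ?_⟩
      · rw [Nat.add_comm, Nat.add_mul_div_right _ _ hn0, Nat.div_eq_of_lt hy, zero_add]
      · rw [Nat.add_comm, Nat.add_mul_mod_self_right, Nat.mod_eq_of_lt hy]
    by_cases e : x = q / n ∧ y = q % n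
    · obtain ⟨rfl, rfl⟩ := e
      by_cases i2 : i = k₂
      · subst i2
        simp [fillG, l1, l2, l5, hk.symm]
      · by_cases i1 : i = k₁
        · subst i1
          simp [fillG, l1, l2, l5, i2]
        · simp [fillG, i1, i2]
    · have e1 : ∀ k, (i, x, y) ≠ ((k, q / n, q % n) : Trip) := by
        intro k hk
        simp only [Prod.mk.injEq] at hk
        exact e hk.2
      rw [Function.update_of_ne (e1 _), Function.update_of_ne (e1 _)]
      have : (x < n ∧ y < n ∧ x * n + y < q) ↔ (x < n ∧ y < n ∧ x * n + y < q + 1) := by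
        refine and_congr_right fun hx => and_congr_right fun hy => ?_
        have : x * n + y ≠ q := fun h => e (uniq hx hy h)
        omega
      simp only [fillG, this]
  · rw [F4, F3, f2 r (by omega)]
  · simp [FA] at T3 T4 ⊢
    omega

/-- Compute the least power of two that is at least `n` into register `29`. -/
def doubleC : Cmd := asg 29 (.c 1) ;; whl (.v 1 - .v 29) (asg 29 (.v 29 + .v 29))

/-- The matrix is written into the tables of kinds `6` and `7`; the former is closed, and the nodes
are read off from it. -/
def initC (p : Cmd) : Cmd :=
  proC ;; clearC 8 ;; fillC 7 6 (.inp (.c 1 + .v 6)) (.inp (.c 1 + .v 6)) ;;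
    doubleC ;;
    sto (FA (.c 6) (.c 0) (.c 0)) (.c 1) ;; asg 30 (.c 1) ;; asg 31 (.c 1) ;; blocksC p ;;
    fillC 4 5 (.ld (FA (.c 6) (.v 8) (.v 7))) (.ld (FA (.c 6) (.v 7) (.v 8))) ;;
    sto (.c 16 * (.v 2 * .v 2)) (.c 1)

theorem tot_double (hM : Ctx M (n + n)) (hn : 1 ≤ n) (h1 : s.reg 1 = n) (hr : Rep (n + n) g [] fl s) :
    Tot M doubleC s fun s' τ =>
      ∃ q, Rep (n + n) g [] fl s' ∧ Fr 29 s s' ∧ s'.reg 29 = 2 ^ q ∧ n ≤ 2 ^ q ∧ 2 ^ q < n + n ∧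
        τ ≤ 20 * n + 20 := by
  have hS := hM.le_S
  have hW := hM.le_W
  have hmm : n + n ≤ (n + n) * (n + n) := Nat.le_mul_self _
  refine tot_seq (tot_asg (by norm_num) (by simp; omega) ?_)
  refine tot_whl (fun s' φ => ∃ q, Rep (n + n) g [] fl s' ∧ Fr 29 s s' ∧ s'.reg 29 = 2 ^ q ∧
    2 ^ q < n + n ∧ φ = 20 * (n - 2 ^ q)) ⟨0, hr.setReg (by norm_num) (by norm_num), ?_, by simp,
      by simp; omega, rfl⟩ ?_ ?_ ?_
  · intro r hr _
    have : r ≠ 29 := by omega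
    simp [this]
  · rintro s' φ -
    simp
  · rintro s' φ ⟨q, R, F, h29, hq, rfl⟩ hne
    have q1 := (F 1 (by norm_num) (by norm_num)).trans h1
    simp only [Ex.eval_sub, Ex.eval_v, q1, h29] at hne
    have hp : 1 ≤ 2 ^ q := Nat.one_le_two_pow
    refine tot_asg (by norm_num) (by simp [h29]; omega) ⟨_, ⟨q + 1, R.setReg (by norm_num)
      (by norm_num), fun r hr h5 => ?_, by simp [h29]; ring, by rw [pow_succ]; omega, rfl⟩, ?_⟩
    · have : r ≠ 29 := by omega
      simp [this, F r hr h5]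
    · simp [pow_succ]
      omega
  · rintro s' t φ ⟨q, R, F, h29, hq, rfl⟩ h0 ht
    have q1 := (F 1 (by norm_num) (by norm_num)).trans h1
    simp only [Ex.eval_sub, Ex.eval_v, q1, h29] at h0
    refine ⟨q, R, F, h29, by omega, hq, ?_⟩
    simp at ht ⊢
    omega

/-- Only the closure is computed at this point. The potential `b` covers the cost of building the
counters later on. -/
theorem tot_init {Y : BoolMat n} {T : ℕ} (hM : Ctx M (n + n)) (hp : ∀ fl, BlockMul M (n + n) fl p μ)
    (hi : M.inp = arr (Op.args (.init Y))) :
    Tot M (initC p) s fun s' τ => Inv Y (T + 1) (40000 * n ^ 3) 0 s'.mem ∧ ∃ q, 2 ^ q < n + n ∧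
      τ ≤ recTime (fun h => 6 * μ h + 420) q + 2000 * (n * n) := by
  classical
  have hm := hM.pos
  have hS := hM.le_S
  have hW := hM.le_W
  have hmm : n + n ≤ (n + n) * (n + n) := Nat.le_mul_self _
  have hn : 1 ≤ n := by omega
  have hnn : n ≤ n * n := Nat.le_mul_self n
  have e4 : (n + n) * (n + n) = 4 * (n * n) := by ring
  have hc : ∀ x, x < 20 → x < M.W := fun x hx => by omega
  have hc0 := hc 0 (by norm_num)
  have hc1 := hc 1 (by norm_num)
  have hc6 := hc 6 (by norm_num)
  have i0 : M.inp 0 = n := by rw [hi]; simp [arr, Op.args]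
  have i1 : ∀ x y, x < n → y < n → M.inp (1 + (x * n + y)) = if rel Y x y then 1 else 0 := by
    intro x y hx hy
    rw [hi, Nat.add_comm, Op.args, arr_cons_succ, arr_entries Y hx hy]
    have : rel Y x y ↔ Y ⟨x, hx⟩ ⟨y, hy⟩ = true := rel_iff Y ⟨x, hx⟩ ⟨y, hy⟩
    simp only [this]
    cases Y ⟨x, hx⟩ ⟨y, hy⟩ <;> rfl
  refine tot_pro hM i0 fun s1 m1 r1 r2 r5 => ?_
  have R1 : Rep (n + n) (fun t => s1.mem (enc (n + n) t)) [] (s1.mem (16 * ((n + n) * (n + n)))) s1 :=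
    rep_of (s := s1) (fun _ _ => rfl) rfl rfl r2 r5
  generalize s1.mem (16 * ((n + n) * (n + n))) = fl at R1
  refine tot_seq ((tot_clear hM R1 (k := 8) le_rfl).mono ?_)
  rintro s2 t2 ⟨R2, F2, T2⟩
  replace R2 := R2.congr (g' := fun _ => 0) fun t ht => if_pos ht.1
  have a1 := (F2 1 (by norm_num) (by norm_num)).trans r1
  refine tot_seq ((tot_fill (f₁ := fun x y => M.inp (1 + (x * n + y)))
    (f₂ := fun x y => M.inp (1 + (x * n + y))) hM R2 (by norm_num) (by norm_num) (by norm_num) a1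
    (by omega) ?_ (by simp) (by simp)).mono ?_)
  · intro x y g' s' hx hy _ _ e6 _ _ _
    have : x * n + y < n * n := by
      have := Nat.mul_le_mul_right n (show x + 1 ≤ n by omega)
      rw [Nat.add_mul] at this
      omega
    have hv : M.inp (1 + (x * n + y)) < M.W := by rw [i1 x y hx hy]; split_ifs <;> omega
    have ho : (Ex.inp (.c 1 + .v 6)).Ok M s' := by
      simp [e6, hc1, hv]; omega
    exact ⟨⟨ho, by simp [e6]⟩, ho, by simp [e6]⟩
  rintro s3 t3 ⟨R3, F3, T3⟩
  have b1 := (F3 1 (by norm_num) (by norm_num)).trans a1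
  generalize hg3 : fillG n 7 6 _ _ _ _ = g3 at R3
  have v3 : ∀ x y k, (k = 6 ∨ k = 7) → g3 (k, x, y) = if rel Y x y then 1 else 0 := by
    intro x y k hk
    subst hg3
    by_cases hxy : x < n ∧ y < n
    · obtain ⟨hx, hy⟩ := hxy
      have : x * n + y < n * n := by
        have := Nat.mul_le_mul_right n (show x + 1 ≤ n by omega)
        rw [Nat.add_mul] at this
        omega
      rcases hk with rfl | rfl <;> simp [fillG, hx, hy, this, i1 x y hx hy]
    · have : ¬ rel Y x y := fun h => hxy (rel_lt h)
      rw [if_neg this]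
      exact if_neg fun h => hxy ⟨h.1, h.2.1⟩
  have z3 : ∀ t : Trip, t.1 ≠ 6 → t.1 ≠ 7 → g3 t = 0 := by
    intro t h6 h7
    subst hg3
    simp [fillG, h6, h7]
  refine tot_seq ((tot_double hM hn b1 R3).mono ?_)
  rintro s4 t4 ⟨q, R4, F4, n4, hq1, hq2, T4⟩
  have c1 := (F4 1 (by norm_num) (by norm_num)).trans b1
  have v0 : Valid (n + n) (6, 0, 0) := ⟨by simp, by simp only; omega, by simp only; omega⟩
  refine tot_seq ((tot_sto_tab hM R4 v0 (FA_ok hM R4.reg2 (by simp [hc6]) (by simp [hc0])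
    (by simp [hc0]) (by simpa using v0)) (by rw [FA_eval R4.reg2]; simp) (by simp [hc1])).mono ?_)
  rintro s5 t5 ⟨R5, F5, T5⟩
  rw [Ex.eval_c] at R5
  refine tot_seq (tot_asg (by norm_num) (by simp [hc1]) (tot_seq (tot_asg (by norm_num)
    (by simp [hc1]) ?_)))
  rw [Ex.eval_c, Ex.eval_c]
  have x5 : Ext (n + n) 0 (2 ^ q) g3 (Function.update g3 (6, 0, 0) 1) :=
    Ext.leaf _ le_rfl (by have := Nat.one_le_two_pow (n := q); omega)
  have g3le : ∀ x < n + n, ∀ y < n + n, g3 (6, x, y) ≤ 1 := by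
    intro x hx y hy
    rw [v3 x y 6 (Or.inl rfl)]
    split_ifs <;> simp
  have R6 : Rep (n + n) (Function.update g3 (6, 0, 0) 1) [] fl ((s5.setReg 30 1).setReg 31 1) :=
    (R5.setReg (by norm_num) (by norm_num)).setReg (by norm_num) (by norm_num)
  refine tot_seq (reach_block hM (hp fl) (N := 2 ^ q) (by omega) q 0 0 _ _ (by simp) (by simp) R6
    (x5.le g3le) (by simp) (by simp [F5, n4]) (by simp) (by simp) _ ?_)
  rintro s7 t7 ⟨g7, R7, F7, d30, d31, x7, k7, T7⟩
  have e1 := (F7 1 (by norm_num) (by norm_num)).trans (show _ = n by simp [F5, c1])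
  have e29 := (F7 29 (by norm_num) (by norm_num)).trans (show _ = 2 ^ q by simp [F5, n4])
  refine tot_whl_done (by simp) (by simp [e29, d31]) ?_
  refine tot_seq ((tot_fill (f₁ := fun x y => g7 (6, y, x)) (f₂ := fun x y => g7 (6, x, y)) hM R7
    (by norm_num) (by norm_num) (by norm_num) e1 (by omega) ?_ (by simp [FA]) (by simp [FA])).mono ?_)
  · intro x y g' s' hx hy R' F' _ e7 e8 hg'
    have w1 : Valid (n + n) (6, y, x) := ⟨by simp, by simp only; omega, by simp only; omega⟩
    have w2 : Valid (n + n) (6, x, y) := ⟨by simp, by simp only; omega, by simp only; omega⟩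
    have E1 : (FA (.c 6) (.v 8) (.v 7)).eval M s' = enc (n + n) (6, y, x) := by
      rw [FA_eval R'.reg2]; simp [e7, e8]
    have E2 : (FA (.c 6) (.v 7) (.v 8)).eval M s' = enc (n + n) (6, x, y) := by
      rw [FA_eval R'.reg2]; simp [e7, e8]
    refine ⟨⟨⟨FA_ok hM R'.reg2 (by simp [hc6]) (by simp) (by simp) (by simpa [e7, e8] using w1), by
      rw [E1]; exact Rep.lt_S hM w1⟩, ?_⟩, ⟨FA_ok hM R'.reg2 (by simp [hc6]) (by simp) (by simp)
      (by simpa [e7, e8] using w2), by rw [E2]; exact Rep.lt_S hM w2⟩, ?_⟩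
    · rw [Ex.eval_ld, E1, R'.tab _ w1, hg' _ w1 (by simp) (by simp)]
    · rw [Ex.eval_ld, E2, R'.tab _ w2, hg' _ w2 (by simp) (by simp)]
  rintro s8 t8 ⟨R8, F8, T8⟩
  generalize hg8 : fillG n 4 5 _ _ _ _ = g8 at R8
  refine tot_sto (by simp [R8.reg2]; omega) (by simp [hc1]) (by simp [R8.reg2]; omega) ?_
  have ev : (Ex.c 16 * (Ex.v 2 * Ex.v 2)).eval M s8 = 16 * ((n + n) * (n + n)) := by simp [R8.reg2]
  rw [ev, Ex.eval_c]
  have R9 := R8.setFlag (by omega) 1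
  have x75 := x5.trans x7
  have h67 : ∀ t : Trip, t.1 ≠ 4 → t.1 ≠ 5 → g8 t = g7 t := by
    intro t h4 h5
    subst hg8
    simp [fillG, h4, h5]
  -- the closed table is the closure of the matrix
  have h3 : ∀ x y, g3 (6, x, y) ≠ 0 ↔ rel Y x y := by
    intro x y
    rw [v3 x y 6 (Or.inl rfl)]
    simp
  have snd : ∀ x y, g7 (6, x, y) ≠ 0 → ReflTransGen (rel Y) x y :=
    x75.sound _ (fun _ => .refl) (fun _ _ _ => .trans) fun x y h => .single ((h3 x y).1 h)
  have blk : ∀ x, x < n → Blk 0 (2 ^ q) x := fun x hx => ⟨Nat.zero_le _, by omega⟩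
  have cmp : ∀ x < n, ∀ y, ReflTransGen (rel Y) x y → y < n ∧ g7 (6, x, y) ≠ 0 := by
    intro x hx y h
    induction h with
    | refl => exact ⟨hx, k7.refl x (blk x hx)⟩
    | @tail y z _ hyz ih =>
      have hz := (rel_lt hyz).2
      exact ⟨hz, k7.trans x y z (blk x hx) (blk y ih.1) (blk z hz) ih.2
        (x75.mono y z ((h3 y z).2 hyz))⟩
  have src : ∀ x y, ReflTransGen (rel Y) x y → x = y ∨ x < n := by
    intro x y h
    rcases h.cases_head with h | ⟨z, hz, -⟩
    · exact .inl h
    · exact .inr (rel_lt hz).1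
  have h4 : ∀ k x, g8 (4, k, x) = if k < n ∧ x < n then g7 (6, x, k) else 0 := by
    intro k x
    subst hg8
    by_cases hk : k < n ∧ x < n
    · obtain ⟨hk, hx⟩ := hk
      have : k * n + x < n * n := by
        have := Nat.mul_le_mul_right n (show k + 1 ≤ n by omega)
        rw [Nat.add_mul] at this
        omega
      simp [fillG, hk, hx, this]
    · rw [if_neg hk, fillG, if_neg fun h => hk ⟨h.1, h.2.1⟩, x75.other _ (by simp),
        z3 _ (by simp) (by simp)]
  have h5 : ∀ k x, g8 (5, k, x) = if k < n ∧ x < n then g7 (6, k, x) else 0 := by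
    intro k x
    subst hg8
    by_cases hk : k < n ∧ x < n
    · obtain ⟨hk, hx⟩ := hk
      have : k * n + x < n * n := by
        have := Nat.mul_le_mul_right n (show k + 1 ≤ n by omega)
        rw [Nat.add_mul] at this
        omega
      simp [fillG, hk, hx, this]
    · rw [if_neg hk, fillG, if_neg fun h => hk ⟨h.1, h.2.1⟩, x75.other _ (by simp),
        z3 _ (by simp) (by simp)]
  have hvtx : ∀ k < n, vtx n k = k := fun k hk => if_pos hk
  have hL : Lazy (n + n) (vtx n) (rel Y) g8 := by
    refine ⟨fun k _ x _ h => ?_, fun k _ y _ h => ?_, fun x _ y _ h => ?_, fun x _ y _ hxy => ?_,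
      fun k hk => (vtx_lt hk).trans_le (by omega), fun x y h => by have := rel_lt h; omega⟩
    · rw [h4] at h
      split_ifs at h with hk
      · rw [hvtx k hk.1]; exact snd x k h
      · exact absurd rfl h
    · rw [h5] at h
      split_ifs at h with hk
      · rw [hvtx k hk.1]; exact snd k y h
      · exact absurd rfl h
    · rcases src x y h with h1 | hx
      · exact .inl h1
      · obtain ⟨hy, hxy⟩ := cmp x hx y h
        refine .inr ⟨y, by omega, ?_, ?_⟩
        · rwa [h4, if_pos ⟨hy, hx⟩]
        · rw [h5, if_pos ⟨hy, hy⟩]; exact k7.refl y (blk y hy)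
    · rw [h67 _ (by simp) (by simp)]
      refine ⟨snd x y, fun h => ?_⟩
      rcases src x y h with h1 | hx
      · exact absurd h1 hxy
      · exact (cmp x hx y h).2
  refine ⟨⟨g8, ∅, R9.tab, by simp, Or.inr ⟨R9.flag, hL, fun x hx y hy => ?_, ?_, rfl, by simp⟩⟩, q,
    hq2, ?_⟩
  · rw [h67 _ (by simp) (by simp), x75.other _ (by simp), v3 x y 7 (Or.inr rfl)]
    simp
  · rintro ⟨i, x, y⟩ ht rfl
    have := x7.le (x5.le g3le) x ht.2.1 y ht.2.2
    rw [h67 _ (by simp) (by simp)]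
    omega
  · simp [FA] at T5 ⊢
    omega

end Init

/-! ### Charging the deletions -/

/-- `j` is the last time before `r` at which `P` holds. -/
def IsLast (P : ℕ → Prop) (j r : ℕ) : Prop := j < r ∧ P j ∧ ∀ i, j < i → i < r → ¬ P i

theorem IsLast.unique {P : ℕ → Prop} {j j' r : ℕ} (h : IsLast P j r) (h' : IsLast P j' r) : j = j' := by
  rcases lt_trichotomy j j' with h1 | h1 | h1
  · exact absurd h'.2.1 (h.2.2 j' h1 h'.1)
  · exact h1
  · exact absurd h.2.1 (h'.2.2 j h1 h.1)

theorem exists_isLast {P : ℕ → Prop} {x : ℕ → ℕ} (h0 : x 0 = 0) (h : ∀ j, ¬ P j → x (j + 1) ≤ x j)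
    {r : ℕ} (hr : x r ≠ 0) : ∃ j, IsLast P j r := by
  induction r with
  | zero => exact absurd h0 hr
  | succ r ih =>
    by_cases hP : P r
    · exact ⟨r, by omega, hP, fun i _ _ => by omega⟩
    · obtain ⟨j, h1, h2, h3⟩ := ih (by have := h r hP; omega)
      refine ⟨j, by omega, h2, fun i hi hi' => ?_⟩
      rcases Nat.lt_succ_iff_lt_or_eq.1 hi' with h4 | rfl
      exacts [h3 i hi h4, hP]

open Classical in
/-- A deletion charges the decrease of `b` to the last initialization and the decrease of `t` to the
last insertion. -/
noncomputable def chargeTo (I S R : ℕ → Prop) (b t : ℕ → ℕ) (r j : ℕ) : ℕ :=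
  if R r then (if IsLast I j r then b r - b (r + 1) else 0) +
    (if IsLast S j r then t r - t (r + 1) else 0) else 0

section Charge
variable {I S R : ℕ → Prop} {b t cost : ℕ → ℕ} {A B : ℕ}

theorem chargeTo_ne_zero {r j : ℕ} (h : chargeTo I S R b t r j ≠ 0) : j < r ∧ R r ∧ (I j ∨ S j) := by
  unfold chargeTo at h
  split_ifs at h with h1 h2 h3 h3
  · exact ⟨h2.1, h1, .inl h2.2.1⟩
  · exact ⟨h2.1, h1, .inl h2.2.1⟩
  · exact ⟨h3.1, h1, .inr h3.2.1⟩
  · exact absurd rfl h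
  · exact absurd rfl h

/-- The charges to an initialization telescope. -/
theorem sum_charge_init_le (hIS : ∀ j, I j → ¬ S j) (hb : ∀ j, ¬ I j → b (j + 1) ≤ b j) {j : ℕ}
    (hj : I j) (L : ℕ) : ∑ r ∈ Finset.range L, chargeTo I S R b t r j ≤ b (j + 1) := by
  classical
  have key : ∀ e, j + 1 ≤ e → (∑ r ∈ Finset.range e, chargeTo I S R b t r j) +
      (if IsLast I j e then b e else 0) ≤ b (j + 1) := by
    intro e he
    induction e, he using Nat.le_induction with
    | base =>
      rw [Finset.sum_eq_zero, zero_add]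
      · split_ifs <;> simp
      · intro r hr
        by_contra h
        have := (chargeTo_ne_zero h).1
        have := Finset.mem_range.1 hr
        omega
    | succ e he ih =>
      have hlast : IsLast I j (e + 1) → IsLast I j e ∧ ¬ I e := fun h =>
        ⟨⟨he, hj, fun i h1 h2 => h.2.2 i h1 (by omega)⟩, h.2.2 e he (by omega)⟩
      have hS : ¬ IsLast S j e := fun h => hIS j hj h.2.1
      have hc : chargeTo I S R b t e j ≤ if IsLast I j e then b e - b (e + 1) else 0 := by
        unfold chargeTo
        split_ifs <;> simp
      rw [Finset.sum_range_succ]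
      by_cases h1 : IsLast I j (e + 1)
      · obtain ⟨h2, h3⟩ := hlast h1
        have := hb e h3
        simp only [h1, h2, if_true] at hc ih ⊢
        omega
      · by_cases h2 : IsLast I j e <;> simp only [h1, h2, if_true, if_false] at hc ih ⊢ <;> omega
  rcases le_or_gt (j + 1) L with h | h
  · have := key L h
    omega
  · refine (Finset.sum_le_sum_of_subset (Finset.range_mono h.le)).trans ?_
    have := key (j + 1) le_rfl
    omega

theorem sum_last_le (P : ℕ → Prop) [∀ j r, Decidable (IsLast P j r)] (r v L : ℕ) :
    ∑ j ∈ Finset.range L, (if IsLast P j r then v else 0) ≤ v := by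
  by_cases h : ∃ j, IsLast P j r
  · obtain ⟨j, hj⟩ := h
    refine (Finset.sum_le_sum (g := fun i => if i = j then v else 0) fun i _ => ?_).trans ?_
    · by_cases hi : IsLast P i r
      · simp [hi.unique hj]
        simp [hj]
      · simp [hi]
    · rw [Finset.sum_ite_eq']
      split_ifs <;> simp
  · rw [Finset.sum_eq_zero]
    · simp
    · exact fun i _ => if_neg fun hi => h ⟨i, hi⟩

open Classical in
/-- The insertions pay for themselves and for all that is charged to them. -/
theorem sum_set_le (hIS : ∀ j, I j → ¬ S j) (hRI : ∀ j, R j → ¬ I j) (hRS : ∀ j, R j → ¬ S j)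
    (h0 : t 0 = 0) (hS : ∀ j, S j → cost j + t (j + 1) ≤ t j + A)
    (ht : ∀ j, ¬ S j → t (j + 1) ≤ t j) (L : ℕ) :
    ∑ j ∈ Finset.range L, (if S j then cost j + ∑ r ∈ Finset.range L, chargeTo I S R b t r j else 0) ≤
      ∑ j ∈ Finset.range L, if S j then A else 0 := by
  have h1 : ∀ L, (∑ j ∈ Finset.range L, if S j then cost j else 0) +
      (∑ r ∈ Finset.range L, if R r then t r - t (r + 1) else 0) + t L ≤
        ∑ j ∈ Finset.range L, if S j then A else 0 := by
    intro L
    induction L with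
    | zero => simp [h0]
    | succ L ih =>
      simp only [Finset.sum_range_succ]
      by_cases s : S L
      · have := hS L s
        have hR : ¬ R L := fun h => hRS L h s
        simp only [s, hR, if_true, if_false] at ih ⊢
        omega
      · have := ht L s
        by_cases r : R L <;> simp only [s, r, if_true, if_false] at ih ⊢ <;> omega
  have h2 : ∑ j ∈ Finset.range L, (if S j then ∑ r ∈ Finset.range L, chargeTo I S R b t r j else 0) ≤
      ∑ r ∈ Finset.range L, if R r then t r - t (r + 1) else 0 := by
    have e : ∀ j, (if S j then ∑ r ∈ Finset.range L, chargeTo I S R b t r j else 0) =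
        ∑ r ∈ Finset.range L, if S j then chargeTo I S R b t r j else 0 := by
      intro j
      split_ifs <;> simp
    simp only [e]
    rw [Finset.sum_comm]
    refine Finset.sum_le_sum fun r _ => ?_
    by_cases hr : R r
    · rw [if_pos hr]
      refine (Finset.sum_le_sum fun j _ => ?_).trans (sum_last_le S r (t r - t (r + 1)) L)
      unfold chargeTo
      by_cases hs : S j
      · have : ¬ IsLast I j r := fun h => hIS j h.2.1 hs
        simp [hs, hr, this]
      · simp [hs]
    · simp [chargeTo, hr]
  have h3 : ∀ j, (if S j then cost j + ∑ r ∈ Finset.range L, chargeTo I S R b t r j else 0) =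
      (if S j then cost j else 0) +
        if S j then ∑ r ∈ Finset.range L, chargeTo I S R b t r j else 0 := by
    intro j
    split_ifs <;> simp
  simp only [h3, Finset.sum_add_distrib]
  have := h1 L
  omega

/-- All decreases of the potentials are charged: while a potential is positive, an operation that may
increase it has taken place. -/
theorem le_sum_charge (hb0 : b 0 = 0) (ht0 : t 0 = 0) (hb : ∀ j, ¬ I j → b (j + 1) ≤ b j)
    (ht : ∀ j, ¬ S j → t (j + 1) ≤ t j) {r L : ℕ} (hr : R r) (hL : r < L) :
    (b r - b (r + 1)) + (t r - t (r + 1)) ≤ ∑ j ∈ Finset.range L, chargeTo I S R b t r j := by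
  classical
  have h : ∀ (P : ℕ → Prop) (x : ℕ → ℕ), x 0 = 0 → (∀ j, ¬ P j → x (j + 1) ≤ x j) →
      x r - x (r + 1) ≤ ∑ j ∈ Finset.range L, if IsLast P j r then x r - x (r + 1) else 0 := by
    intro P x h0 hx
    rcases Nat.eq_zero_or_pos (x r) with h1 | h1
    · simp [h1]
    · obtain ⟨j, hj⟩ := exists_isLast h0 hx h1.ne'
      have := Finset.single_le_sum (f := fun j => if IsLast P j r then x r - x (r + 1) else 0)
        (fun _ _ => Nat.zero_le _) (Finset.mem_range.2 (hj.1.trans hL))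
      simpa [hj] using this
  have h1 := h I b hb0 hb
  have h2 := h S t ht0 ht
  simp only [chargeTo, hr, if_true, Finset.sum_add_distrib]
  exact Nat.add_le_add h1 h2

end Charge

/-! ### Runs -/

/-- What one operation guarantees when it takes `τ` steps and changes the potentials from `b`, `t`
to `b'`, `t'`. -/
structure StepOk {n : ℕ} (C : ℕ) (ω : ℝ) (o : Op n) (τ b t b' t' : ℕ) : Prop where
  init : o.IsInit → (τ : ℝ) ≤ C * (n : ℝ) ^ ω ∧ b' ≤ C * n ^ 3 ∧ t' = 0
  not_init : ¬ o.IsInit → b' ≤ b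
  set : o.IsSet → τ + t' ≤ t + C * n ^ 2
  not_set : ¬ o.IsSet → t' ≤ t
  reset : ∀ D, o = .reset D → τ ≤ (b - b') + (t - t') + if D = [] then C else 0
  lookup : ∀ x y, o = .lookup x y → τ ≤ C

theorem Tot.exec {M : Mach} {c : Cmd} {s : State} {Q : State → ℕ → Prop} (h : Tot M c s Q)
    (hw : WF M.W s) : ∃ s₁ t₁, Exec M.W M.S M.inp c s s₁ t₁ ∧ ∃ s' t, s₁.mem = s'.mem ∧
      s₁.reg 0 = s'.reg 0 ∧ t₁ ≤ t ∧ Q s' t := by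
  obtain ⟨s₁, t₁, e, s', t, ha, ht, hq⟩ := h s hw ⟨rfl, fun _ _ => rfl⟩
  exact ⟨s₁, t₁, e, s', t, ha.1, ha.2 0 (by norm_num), ht, hq⟩

section Step
variable {n : ℕ} {c : Cmd} {k C₀ d₀ : ℕ} {β : ℕ → ℕ} {ω : ℝ}

/-- The data structure that uses the multiplication program `c`, with registers below `k` and `C n²`
cells of memory. -/
def closureDS (c : Cmd) (k C : ℕ) : ClosureDS := ⟨initC (mulC c k C), setC, resetC, lookupC⟩

/-- A bound for the constant factor of the initialization. -/
noncomputable def initConst (k C₀ : ℕ) (ω : ℝ) : ℕ :=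
  ⌈(24 * C₀ + 6 * (k + 40 * C₀ + 400) + 420 : ℝ) * 2 ^ ω⌉₊ + 2000

theorem init_time_le (hω : 2 ≤ ω) {q τ : ℕ} (hn : 1 ≤ n) (hq : 2 ^ q < n + n)
    (hτ : τ ≤ recTime (fun h => 6 * (4 * ⌊C₀ * (h : ℝ) ^ ω⌋₊ + (k + 40 * C₀ + 400) * (h * h)) + 420) q +
      2000 * (n * n)) : (τ : ℝ) ≤ initConst k C₀ ω * (n : ℝ) ^ ω := by
  have sq_le : ∀ h : ℕ, 1 ≤ h → (h : ℝ) * h ≤ (h : ℝ) ^ ω := by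
    intro h hh
    have : (h : ℝ) ^ (2 : ℝ) ≤ (h : ℝ) ^ ω :=
      Real.rpow_le_rpow_of_exponent_le (by exact_mod_cast hh) hω
    rwa [Real.rpow_two, pow_two] at this
  have h1 := recTime_le (κ := fun h => 6 * (4 * ⌊C₀ * (h : ℝ) ^ ω⌋₊ + (k + 40 * C₀ + 400) * (h * h)) + 420)
    (K := 24 * C₀ + 6 * (k + 40 * C₀ + 400) + 420) hω (fun h hh => ?_) q
  swap
  · have e1 : ((⌊C₀ * (h : ℝ) ^ ω⌋₊ : ℕ) : ℝ) ≤ C₀ * (h : ℝ) ^ ω := Nat.floor_le (by positivity)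
    have e2 := sq_le h hh
    have e3 : (1 : ℝ) ≤ (h : ℝ) ^ ω := Real.one_le_rpow (by exact_mod_cast hh) (by linarith)
    have e4 : (k + 40 * C₀ + 400 : ℝ) * ((h : ℝ) * h) ≤ (k + 40 * C₀ + 400) * (h : ℝ) ^ ω :=
      mul_le_mul_of_nonneg_left e2 (by positivity)
    push_cast
    linarith
  have h2 : (((2 ^ q : ℕ) : ℝ)) ^ ω ≤ 2 ^ ω * (n : ℝ) ^ ω := by
    rw [← Real.mul_rpow (by norm_num) (by positivity)]
    refine Real.rpow_le_rpow (by positivity) ?_ (by linarith)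
    have : ((2 ^ q : ℕ) : ℝ) ≤ ((n + n : ℕ) : ℝ) := by exact_mod_cast hq.le
    push_cast at this ⊢
    linarith
  generalize recTime _ q = ρ at hτ h1
  have h3 : (τ : ℝ) ≤ ((ρ + 2000 * (n * n) : ℕ) : ℝ) := by exact_mod_cast hτ
  have h4 := Nat.le_ceil ((24 * C₀ + 6 * (k + 40 * C₀ + 400) + 420 : ℝ) * 2 ^ ω)
  have h5 := sq_le n hn
  have h6 : (0 : ℝ) ≤ (n : ℝ) ^ ω := by positivity
  have h7 := mul_le_mul_of_nonneg_left h2 (show (0 : ℝ) ≤ 24 * C₀ + 6 * (k + 40 * C₀ + 400) + 420 by positivity)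
  have h8 := mul_le_mul_of_nonneg_right h4 h6
  rw [initConst]
  push_cast at h3 ⊢
  rw [add_mul]
  linarith

theorem exists_step {W S C T b t : ℕ} {X : BoolMat n} {s : State} (hω : 2 ≤ ω)
    (hc : Multiplies c k C₀ d₀ fun h => ⌊C₀ * (h : ℝ) ^ ω⌋₊) (hn : 1 ≤ n)
    (hS : (20 + C₀) * ((n + n) * (n + n)) ≤ S) (hSW : S + 100 ≤ W)
    (hd : (n + n + 2) ^ d₀ ≤ W) (hT : T + 2 < W) (hC : initConst k C₀ ω + 40000 ≤ C) (o : Op n)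
    (ho : o.Admissible X) (hw : WF W s) (hI : Inv X T b t s.mem) :
    ∃ s' τ b' t', Exec W S (arr o.args) ((closureDS c k C₀).prog o) s s' τ ∧
      Inv (o.apply X) (T + 1) b' t' s'.mem ∧ StepOk C ω o τ b t b' t' ∧
      ∀ x y, o = .lookup x y →
        (KleeneClosure X x y → s'.reg 0 = 1) ∧ (¬ KleeneClosure X x y → s'.reg 0 = 0) := by
  have hM : Ctx ⟨W, S, arr o.args⟩ (n + n) :=
    ⟨by omega, (Nat.mul_le_mul_right _ (by omega)).trans hS, hSW⟩
  have hCω : ((initConst k C₀ ω : ℕ) : ℝ) ≤ C := by exact_mod_cast (by omega : initConst k C₀ ω ≤ C)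
  have hω0 : (0 : ℝ) ≤ (n : ℝ) ^ ω := by positivity
  cases o with
  | init Y =>
    have hp : ∀ fl, BlockMul ⟨W, S, arr (Op.args (.init Y))⟩ (n + n) fl (mulC c k C₀)
        fun h => 4 * ⌊C₀ * (h : ℝ) ^ ω⌋₊ + (k + 40 * C₀ + 400) * (h * h) := by
      intro fl g s a b d h hr hg hh h31 h32 h33 h34 ha hb hd'
      exact tot_mulAcc hM hc hS hr hg hh ((Nat.pow_le_pow_left (by omega) _).trans hd) h31 h32 h33 h34
        ha hb hd'
    obtain ⟨s', τ, he, s2, τ2, hm, -, hτ, hI', q, hq, ht⟩ :=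
      (tot_init (T := T) (s := s) hM hp rfl).exec hw
    refine ⟨s', τ, _, _, he, hm ▸ hI', ⟨fun _ => ⟨?_, ?_, rfl⟩, fun h => (h trivial).elim,
      fun h => h.elim, fun _ => Nat.zero_le _, fun D h => by simp at h, fun x y h => by simp at h⟩,
      fun x y h => by simp at h⟩
    · exact (init_time_le hω hn hq (hτ.trans ht)).trans (mul_le_mul_of_nonneg_right hCω hω0)
    · exact Nat.mul_le_mul_right _ (by omega)
  | set i Δ =>
    obtain ⟨s', τ, he, s2, τ2, hm, -, hτ, b', t', hI', hb, ht⟩ := (tot_set hM i Δ rfl hT hI).exec hw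
    have : 40000 * n ^ 2 ≤ C * n ^ 2 := Nat.mul_le_mul_right _ (by omega)
    exact ⟨s', τ, _, _, he, hm ▸ hI', ⟨fun h => h.elim, fun _ => hb, fun _ => by omega,
      fun h => (h trivial).elim, fun D h => by simp at h, fun x y h => by simp at h⟩,
      fun x y h => by simp at h⟩
  | reset D =>
    obtain ⟨s', τ, he, s2, τ2, hm, -, hτ, b', t', hI', hb, ht, hsum⟩ := (tot_reset hM D ho rfl hI).exec hw
    refine ⟨s', τ, _, _, he, hm ▸ hI', ⟨fun h => h.elim, fun _ => hb, fun h => h.elim,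
      fun _ => ht, fun D' h => ?_, fun x y h => by simp at h⟩, fun x y h => by simp at h⟩
    obtain rfl : D = D' := by simpa using h
    split_ifs at hsum ⊢ <;> omega
  | lookup x y =>
    obtain ⟨s', τ, he, s2, τ2, hm, h0, hτ, hI', ht, ha⟩ := (tot_lookup hM x y rfl hI).exec hw
    refine ⟨s', τ, _, _, he, hm ▸ hI', ⟨fun h => h.elim, fun _ => le_rfl, fun h => h.elim,
      fun _ => le_rfl, fun D h => by simp at h, fun _ _ _ => by omega⟩, fun x' y' h => ?_⟩
    obtain ⟨rfl, rfl⟩ : x = x' ∧ y = y' := by simpa using h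
    rwa [h0]

end Step

theorem inv_zero {n : ℕ} : Inv (n := n) (fun _ _ => false) 0 0 0 State.zero.mem := by
  have hr : ∀ x y, ¬ rel (n := n) (fun _ _ => false) x y := by
    rintro x y ⟨_, _, h⟩
    simp at h
  have ho : ones (n := n) (fun _ _ => false) = ∅ := by simp [ones]
  have hN : ∀ lo hi, nPres (n + n) lo hi (fun _ => 0) = 0 := by simp [nPres]
  refine ⟨fun _ => 0, ∅, fun _ _ => rfl, by simp, Or.inl ⟨rfl, ⟨id, core_zero fun _ _ _ => rfl,
    fun i _ j _ h => h, ⟨by simp, by simp, fun x y h => (hr x y h).elim, fun k hk => ?_,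
      fun x y h => (hr x y h).elim⟩, fun x _ y _ => by simpa using hr x y, by simp,
      fun x y h => (hr x y h).elim⟩, by simp [hN, ho], by simp [hN]⟩⟩
  have := vtx_lt hk
  omega

theorem matAfter_take_succ {n : ℕ} (σ : List (Op n)) {j : ℕ} (hj : j < σ.length) :
    matAfter (σ.take (j + 1)) = (σ.get ⟨j, hj⟩).apply (matAfter (σ.take j)) := by
  rw [matAfter, List.take_succ_eq_append_getElem hj]
  exact List.foldl_append

/-- The run of a data structure, with the potentials along the way. -/
theorem exists_run {n : ℕ} {c : Cmd} {k C₀ d₀ : ℕ} {ω : ℝ} {W S C : ℕ} (hω : 2 ≤ ω)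
    (hc : Multiplies c k C₀ d₀ fun h => ⌊C₀ * (h : ℝ) ^ ω⌋₊) (hn : 1 ≤ n)
    (hS : (20 + C₀) * ((n + n) * (n + n)) ≤ S) (hSW : S + 100 ≤ W)
    (hd : (n + n + 2) ^ d₀ ≤ W) (hC : initConst k C₀ ω + 40000 ≤ C) (σ : List (Op n))
    (hσ : ValidSeq σ) (hT : σ.length + 2 < W) :
    ∃ (st : ℕ → State) (cost b t : ℕ → ℕ), st 0 = State.zero ∧ b 0 = 0 ∧ t 0 = 0 ∧
      ∀ j (hj : j < σ.length),
        Exec W S (arr (σ.get ⟨j, hj⟩).args) ((closureDS c k C₀).prog (σ.get ⟨j, hj⟩)) (st j)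
          (st (j + 1)) (cost j) ∧
        StepOk C ω (σ.get ⟨j, hj⟩) (cost j) (b j) (t j) (b (j + 1)) (t (j + 1)) ∧
        ∀ x y, σ.get ⟨j, hj⟩ = .lookup x y →
          (KleeneClosure (matAfter (σ.take j)) x y → (st (j + 1)).reg 0 = 1) ∧
          (¬ KleeneClosure (matAfter (σ.take j)) x y → (st (j + 1)).reg 0 = 0) := by
  let Good : ℕ → State × ℕ × ℕ → Prop := fun j x => j ≤ σ.length →
    WF W x.1 ∧ Inv (matAfter (σ.take j)) j x.2.1 x.2.2 x.1.mem
  let Next : ℕ → State × ℕ × ℕ → State × ℕ × ℕ → ℕ → Prop := fun j x y τ => ∀ hj : j < σ.length,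
    Exec W S (arr (σ.get ⟨j, hj⟩).args) ((closureDS c k C₀).prog (σ.get ⟨j, hj⟩)) x.1 y.1 τ ∧
    StepOk C ω (σ.get ⟨j, hj⟩) τ x.2.1 x.2.2 y.2.1 y.2.2 ∧
    ∀ u v, σ.get ⟨j, hj⟩ = .lookup u v →
      (KleeneClosure (matAfter (σ.take j)) u v → y.1.reg 0 = 1) ∧
      (¬ KleeneClosure (matAfter (σ.take j)) u v → y.1.reg 0 = 0)
  have step : ∀ j x, Good j x → ∃ y, Good (j + 1) y ∧ ∃ τ, Next j x y τ := by
    intro j x hx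
    by_cases hj : j < σ.length
    · obtain ⟨hw, hI⟩ := hx hj.le
      obtain ⟨s', τ, b', t', h1, h2, h3, h4⟩ := exists_step hω hc hn hS hSW hd (by omega) hC
        (σ.get ⟨j, hj⟩) (hσ ⟨j, hj⟩) hw hI
      refine ⟨(s', b', t'), fun _ => ⟨h1.wf hw, ?_⟩, τ, fun _ => ⟨h1, h3, h4⟩⟩
      rw [matAfter_take_succ σ hj]
      exact h2
    · exact ⟨x, fun h => by omega, 0, fun h => absurd h hj⟩
  choose! nxt hnxt τ hτ using step
  let f : ℕ → State × ℕ × ℕ := fun j => Nat.rec (State.zero, 0, 0) nxt j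
  have hf : ∀ j, Good j (f j) := by
    intro j
    induction j with
    | zero =>
      exact fun _ => ⟨⟨fun _ => show 0 < W by omega, fun _ => show 0 < W by omega⟩, inv_zero⟩
    | succ j ih => exact hnxt j (f j) ih
  exact ⟨fun j => (f j).1, fun j => τ j (f j), fun j => (f j).2.1, fun j => (f j).2.2, rfl, rfl, rfl,
    fun j hj => hτ j (f j) (hf j) hj⟩

/-! ### Time bounds and the data structure -/

open Classical in
/-- The bound per update when the only initialization comes first. -/
theorem TimeBounds.updates_le {n : ℕ} {σ : List (Op n)} {cost : Fin σ.length → ℕ}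
    {charge : Fin σ.length → Fin σ.length → ℕ} {C : ℕ} {ω : ℝ} (h : TimeBounds σ cost charge C ω)
    (hn : 1 ≤ n) (hσ : OnlyInitialInit σ) {κ : ℝ} (hκ : 0 < κ) (hu : κ * n ≤ (updates σ).card) :
    (∑ j ∈ updates σ, cost j : ℝ) ≤ C * (1 + 1 / κ) * (n : ℝ) ^ 2 * (updates σ).card := by
  obtain ⟨h1, h2, h3, h4, -⟩ := h
  have hC : C ≤ C * n ^ 2 := Nat.le_mul_of_pos_right _ (by positivity)
  -- the charges, sorted by the operations that pay
  have a1 : ∑ j ∈ updates σ, cost j ≤ ∑ j, (if (σ.get j).IsSet then cost j else 0) +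
      ∑ r, (∑ j, charge r j + if (σ.get r).IsReset then C else 0) := by
    rw [updates, Finset.sum_filter, ← Finset.sum_add_distrib]
    refine Finset.sum_le_sum fun j _ => ?_
    rcases hj : σ.get j with Y | ⟨i, Δ⟩ | D | ⟨x, y⟩
    · simp [Op.IsSet, Op.IsReset]
    · simp [Op.IsSet, Op.IsReset]
    · have := h4 j D hj
      rw [if_pos (Or.inr (show (Op.reset D).IsReset from trivial)),
        if_neg (show ¬ (Op.reset D).IsSet from id), if_pos (show (Op.reset D).IsReset from trivial)]
      refine this.trans ?_
      split_ifs <;> omega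
    · simp [Op.IsSet, Op.IsReset]
  have a2 : ∑ r, ∑ j, charge r j ≤ ∑ j, (if (σ.get j).IsSet then ∑ r, charge r j else 0) +
      ∑ j, (if (σ.get j).IsInit then ∑ r, charge r j else 0) := by
    rw [Finset.sum_comm, ← Finset.sum_add_distrib]
    refine Finset.sum_le_sum fun j _ => ?_
    by_cases hs : (σ.get j).IsSet
    · rw [if_pos hs]
      exact Nat.le_add_right _ _
    by_cases hi : (σ.get j).IsInit
    · rw [if_pos hi]
      exact Nat.le_add_left _ _
    · rw [Finset.sum_eq_zero]
      · simp
      · intro r _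
        by_contra h0
        exact (h1 r j h0).2.2.elim hi hs
  have a3 : ∑ j, (if (σ.get j).IsInit then ∑ r, charge r j else 0) ≤ C * n ^ 3 := by
    have e : ∀ j : Fin σ.length, (if (σ.get j).IsInit then ∑ r, charge r j else 0) ≤
        if j = ⟨0, hσ.1⟩ then C * n ^ 3 else 0 := by
      intro j
      by_cases hi : (σ.get j).IsInit
      · have : j = ⟨0, hσ.1⟩ := Fin.ext ((hσ.2 j).1 hi)
        rw [if_pos hi, if_pos this]
        exact (h2 j hi).2
      · rw [if_neg hi]
        exact Nat.zero_le _
    refine (Finset.sum_le_sum fun j _ => e j).trans ?_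
    rw [Finset.sum_ite_eq']
    simp
  have a4 : ∑ r : Fin σ.length, (if (σ.get r).IsReset then C else 0) =
      C * (Finset.univ.filter fun j => (σ.get j).IsReset).card := by
    rw [← Finset.sum_filter, Finset.sum_const, smul_eq_mul, mul_comm]
  have a5 : (updates σ).card = (Finset.univ.filter fun j => (σ.get j).IsSet).card +
      (Finset.univ.filter fun j => (σ.get j).IsReset).card := by
    rw [updates, Finset.filter_or, Finset.card_union_of_disjoint]
    rw [Finset.disjoint_filter]
    intro j _ hj
    rcases hj' : σ.get j with Y | ⟨i, Δ⟩ | D | ⟨x, y⟩ <;> simp_all [Op.IsSet, Op.IsReset]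
  rw [Finset.sum_filter] at h3
  have a6 : ∑ j, (if (σ.get j).IsSet then cost j + ∑ r, charge r j else 0) =
      ∑ j, (if (σ.get j).IsSet then cost j else 0) +
        ∑ j, (if (σ.get j).IsSet then ∑ r, charge r j else 0) := by
    rw [← Finset.sum_add_distrib]
    refine Finset.sum_congr rfl fun j _ => ?_
    split_ifs <;> simp
  rw [Finset.sum_add_distrib, a4] at a1
  have a7 : ∑ j ∈ updates σ, cost j ≤ C * n ^ 3 + C * n ^ 2 * (updates σ).card := by
    have := Nat.mul_le_mul_right (Finset.univ.filter fun j => (σ.get j).IsReset).card hC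
    rw [a5, Nat.mul_add]
    omega
  have a8 : (∑ j ∈ updates σ, cost j : ℝ) ≤ C * (n : ℝ) ^ 3 + C * (n : ℝ) ^ 2 * (updates σ).card := by
    exact_mod_cast a7
  have a9 : (n : ℝ) ≤ 1 / κ * (updates σ).card := by
    rw [one_div, ← div_eq_inv_mul, le_div_iff₀ hκ, mul_comm]
    exact hu
  have a10 : (C : ℝ) * (n : ℝ) ^ 2 * n ≤ C * (n : ℝ) ^ 2 * (1 / κ * (updates σ).card) :=
    mul_le_mul_of_nonneg_left a9 (by positivity)
  refine a8.trans ?_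
  have e1 : (C : ℝ) * (n : ℝ) ^ 3 = C * (n : ℝ) ^ 2 * n := by ring
  rw [e1]
  linarith

/-- The potentials along a run yield the charges. -/
theorem TimeBounds.of_potentials {n : ℕ} {σ : List (Op n)} {C : ℕ} {ω : ℝ} {cost b t : ℕ → ℕ}
    (hb0 : b 0 = 0) (ht0 : t 0 = 0) (h : ∀ j (hj : j < σ.length),
      StepOk C ω (σ.get ⟨j, hj⟩) (cost j) (b j) (t j) (b (j + 1)) (t (j + 1))) :
    ∃ charge, TimeBounds σ (fun j => cost j) charge C ω := by
  classical
  -- beyond the end of the sequence the potentials stay constant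
  let b' : ℕ → ℕ := fun j => b (min j σ.length)
  let t' : ℕ → ℕ := fun j => t (min j σ.length)
  have eb : ∀ j ≤ σ.length, b' j = b j := fun j hj => by simp [b', hj]
  have et : ∀ j ≤ σ.length, t' j = t j := fun j hj => by simp [t', hj]
  have out : ∀ j, ¬ j < σ.length → b' (j + 1) ≤ b' j ∧ t' (j + 1) ≤ t' j := by
    intro j hj
    have e1 : min (j + 1) σ.length = σ.length := by omega
    have e2 : min j σ.length = σ.length := by omega
    simp [b', t', e1, e2]
  let I : ℕ → Prop := fun j => ∃ hj : j < σ.length, (σ.get ⟨j, hj⟩).IsInit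
  let S : ℕ → Prop := fun j => ∃ hj : j < σ.length, (σ.get ⟨j, hj⟩).IsSet
  let R : ℕ → Prop := fun j => ∃ hj : j < σ.length, (σ.get ⟨j, hj⟩).IsReset
  have hI : ∀ j : Fin σ.length, I j ↔ (σ.get j).IsInit := fun j => ⟨fun h => h.2, fun h => ⟨j.2, h⟩⟩
  have hS : ∀ j : Fin σ.length, S j ↔ (σ.get j).IsSet := fun j => ⟨fun h => h.2, fun h => ⟨j.2, h⟩⟩
  have hR : ∀ j : Fin σ.length, R j ↔ (σ.get j).IsReset := fun j => ⟨fun h => h.2, fun h => ⟨j.2, h⟩⟩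
  have hIS : ∀ j, I j → ¬ S j := by
    rintro j ⟨hj, h1⟩ ⟨_, h2⟩
    rcases e : σ.get ⟨j, hj⟩ with Y | ⟨i, Δ⟩ | D | ⟨x, y⟩ <;> rw [e] at h1 h2
    exacts [h2, h1, h1, h1]
  have hRI : ∀ j, R j → ¬ I j := by
    rintro j ⟨hj, h1⟩ ⟨_, h2⟩
    rcases e : σ.get ⟨j, hj⟩ with Y | ⟨i, Δ⟩ | D | ⟨x, y⟩ <;> rw [e] at h1 h2
    exacts [h1, h1, h2, h1]
  have hRS : ∀ j, R j → ¬ S j := by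
    rintro j ⟨hj, h1⟩ ⟨_, h2⟩
    rcases e : σ.get ⟨j, hj⟩ with Y | ⟨i, Δ⟩ | D | ⟨x, y⟩ <;> rw [e] at h1 h2
    exacts [h1, h1, h2, h1]
  have hb : ∀ j, ¬ I j → b' (j + 1) ≤ b' j := by
    intro j hj
    by_cases hl : j < σ.length
    · rw [eb _ hl, eb _ hl.le]
      exact (h j hl).not_init fun h => hj ⟨hl, h⟩
    · exact (out j hl).1
  have ht : ∀ j, ¬ S j → t' (j + 1) ≤ t' j := by
    intro j hj
    by_cases hl : j < σ.length
    · rw [et _ hl, et _ hl.le]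
      exact (h j hl).not_set fun h => hj ⟨hl, h⟩
    · exact (out j hl).2
  have hset : ∀ j, S j → cost j + t' (j + 1) ≤ t' j + C * n ^ 2 := by
    rintro j ⟨hl, hj⟩
    rw [et _ hl, et _ hl.le]
    exact (h j hl).set hj
  have hb0' : b' 0 = 0 := by simp [b', hb0]
  have ht0' : t' 0 = 0 := by simp [t', ht0]
  refine ⟨fun r j => chargeTo I S R b' t' r j, fun r j hne => ?_, fun j hj => ⟨?_, ?_⟩, ?_,
    fun r D hr => ?_, fun j x y hj => (h j j.2).lookup x y hj⟩
  · obtain ⟨u1, u2, u3⟩ := chargeTo_ne_zero hne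
    rw [hR, hI, hS] at *
    exact ⟨u1, u2, u3⟩
  · exact ((h j j.2).init hj).1
  · rw [Fin.sum_univ_eq_sum_range (fun r => chargeTo I S R b' t' r j)]
    refine (sum_charge_init_le hIS hb ((hI j).2 hj) _).trans ?_
    rw [eb _ j.2]
    exact ((h j j.2).init hj).2.1
  · have := sum_set_le (b := b') hIS hRI hRS ht0' hset ht σ.length
    rw [← Fin.sum_univ_eq_sum_range, ← Fin.sum_univ_eq_sum_range] at this
    simp only [hS] at this
    rw [← Finset.sum_filter, ← Finset.sum_filter, Finset.sum_const, smul_eq_mul, mul_comm _ (C * n ^ 2)] at this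
    refine le_trans (le_of_eq (Finset.sum_congr rfl fun j _ => ?_)) this
    rw [Fin.sum_univ_eq_sum_range (fun r => chargeTo I S R b' t' r j)]
  · have h1 := (h r r.2).reset D hr
    have h2 := le_sum_charge (L := σ.length) hb0' ht0' hb ht ((hR r).2 (by rw [hr]; trivial)) r.2
    rw [eb _ r.2, eb _ r.2.le, et _ r.2, et _ r.2.le] at h2
    rw [Fin.sum_univ_eq_sum_range (fun j => chargeTo I S R b' t' r j)]
    exact h1.trans (Nat.add_le_add_right h2 _)

/-- The word length suffices for all addresses, for the multiplication program and for the counters. -/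
theorem word_bounds {n l C d₀ : ℕ} (hn : 1 ≤ n) :
    C * n ^ 2 + 100 ≤ (n + l + 2) ^ (C + 102 + 2 * d₀) ∧
      (n + n + 2) ^ d₀ ≤ (n + l + 2) ^ (C + 102 + 2 * d₀) ∧
      l + 2 < (n + l + 2) ^ (C + 102 + 2 * d₀) := by
  set B := n + l + 2 with hB
  have hB1 : 1 ≤ B := by omega
  have hB2 : 1 < B := by omega
  have h1 : C + 100 ≤ B ^ (C + 100) := (Nat.lt_pow_self hB2).le
  refine ⟨?_, ?_, ?_⟩
  · calc C * n ^ 2 + 100 ≤ (C + 100) * n ^ 2 := by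
          rw [Nat.add_mul]
          exact Nat.add_le_add_left (Nat.le_mul_of_pos_right _ (by positivity)) _
      _ ≤ B ^ (C + 100) * B ^ 2 := Nat.mul_le_mul h1 (Nat.pow_le_pow_left (by omega) _)
      _ = B ^ (C + 102) := by rw [← pow_add]
      _ ≤ _ := Nat.pow_le_pow_right hB1 (by omega)
  · calc (n + n + 2) ^ d₀ ≤ (B ^ 2) ^ d₀ := Nat.pow_le_pow_left (by nlinarith) _
      _ = B ^ (2 * d₀) := by rw [← pow_mul]
      _ ≤ _ := Nat.pow_le_pow_right hB1 (by omega)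
  · calc l + 2 < B ^ 1 := by rw [pow_one]; omega
      _ ≤ _ := Nat.pow_le_pow_right hB1 (by omega)

end DynClosure
open DynClosure
/-- Fully dynamic Boolean matrix closure (fully dynamic transitive closure of a digraph with
adjacency matrix `X`): a deterministic data structure, with words of `O(log (n + k))` bits for a
sequence of `k` operations, `O(n²)` memory cells, and the stated time bounds. -/
theorem mainTheorem2 (ω : ℝ) (hω : MatMulExponent ω) :
    ∃ (P : ClosureDS) (C d : ℕ), ∀ n : ℕ, 1 ≤ n → ∀ σ : List (Op n), ValidSeq σ →
      ∃ (st : ℕ → State) (cost : Fin σ.length → ℕ) (charge : Fin σ.length → Fin σ.length → ℕ),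
        P.IsRun ((n + σ.length + 2) ^ d) (C * n ^ 2) σ st cost ∧
        AnswersCorrect σ st ∧
        TimeBounds σ cost charge C ω ∧
        (OnlyInitialInit σ → ∀ κ : ℝ, 0 < κ → κ * n ≤ (updates σ).card →
          (∑ j ∈ updates σ, cost j : ℝ) ≤ C * (1 + 1 / κ) * (n : ℝ) ^ 2 * (updates σ).card) := by
  obtain ⟨c, k, C₀, d₀, hc⟩ := hω.multiplies
  obtain ⟨C, hC1, hC2⟩ : ∃ C, initConst k C₀ ω + 40000 ≤ C ∧ (20 + C₀) * 4 ≤ C :=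
    ⟨initConst k C₀ ω + 40000 + (20 + C₀) * 4, by omega, by omega⟩
  refine ⟨closureDS c k C₀, C, C + 102 + 2 * d₀, fun n hn σ hσ => ?_⟩
  obtain ⟨w1, w2, w3⟩ := word_bounds (l := σ.length) (C := C) (d₀ := d₀) hn
  have hS : (20 + C₀) * ((n + n) * (n + n)) ≤ C * n ^ 2 := by
    calc (20 + C₀) * ((n + n) * (n + n)) = (20 + C₀) * 4 * n ^ 2 := by ring
      _ ≤ _ := Nat.mul_le_mul_right _ hC2
  obtain ⟨st, cost, b, t, h0, hb0, ht0, h⟩ := exists_run (two_le_of_exponent hω) hc hn hS w1 w2 hC1 σ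
    hσ w3
  obtain ⟨charge, hch⟩ := TimeBounds.of_potentials hb0 ht0 fun j hj => (h j hj).2.1
  exact ⟨st, fun j => cost j, charge, ⟨h0, fun j => (h j j.2).1⟩,
    fun j x y hj => (h j j.2).2.2 x y hj, hch, fun hi κ hκ hu => hch.updates_le hn hi hκ hu⟩
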